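/- **Setting.** Let $\bigwedge_\infty=\bigwedge_\infty^0\oplus\bigwedge_\infty^1$ be the complex Grassmann algebra on generators $\zeta_1,\zeta_2,\dots$ (finite linear combinations of monomials), $a=a_B+a_S$ the decomposition into body $a_B\in\mathbb C$ and soul; $(\bigwedge_\infty^0)^\times$ is the set of invertible even elements, i.e. those with $a_B\neq0$. Limits and absolute convergence in $\bigwedge_\infty$ are coefficientwise in the monomials, with the limit or sum lying in $\bigwedge_\infty$. Superspace $\bigwedge_\infty^0\oplus(\bigwedge_\infty^1)^2$, with points $(z,\theta^+,\theta^-)$, carries the DeWitt topology (open sets are preimages of open sets under $(z,\theta^+,\theta^-)\mapsto z_B\in\mathbb C$). A function $G$ on a DeWitt open set $U$ with body $U_B$ is superanalytic if $G=f(z)+\theta^+\xi^+(z)+\theta^-\xi^-(z)+\theta^+\theta^-t(z)$, where each component is of the form $\sum_{(k)}f_{(k)}(z)\zeta_{k_1}\cdots\zeta_{k_s}$ with $f_{(k)}$ analytic on $U_B$, the sum being finite at each body point, and $f_{(k)}(z_B+z_S)=\sum_l\frac{z_S^l}{l!}f_{(k)}^{(l)}(z_B)$. With $D^\pm=\frac{\partial}{\partial\theta^\pm}+\theta^\mp\frac{\partial}{\partial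 z}$, a map $(z,\theta^+,\theta^-)\mapsto(\tilde z,\tilde\theta^+,\tilde\theta^-)$ on $U$ is $N=2$ superconformal if $\tilde z$ is even superanalytic, $\tilde\theta^\pm$ are odd superanalytic, $D^\pm\tilde\theta^\mp=0$, $D^\pm\tilde z=\tilde\theta^\mp D^\pm\tilde\theta^\pm$, and $D^+\tilde\theta^+$, $D^-\tilde\theta^-$ are not identically zero. The super-Riemann sphere $S^2\hat{\mathbb C}$ is glued from two copies of superspace, with charts $\sigma$ (southern) and $\nu$ (northern), by $\sigma\circ\nu^{-1}=I$, $I(w,\rho^+,\rho^-)=(\frac1w,\frac{i\rho^+}w,\frac{i\rho^-}w)$ for $w\in(\bigwedge_\infty^0)^\times$. For $n\ge0$, an $N=2$ super-Riemann sphere with $1+n$ tubes is $S^2\hat{\mathbb C}$ with ordered punctures $p_0$ (outgoing) and $p_1,\dots,p_n$ (incoming) having distinct bodies, and superconformal charts $(U_j,\Omega_j)$ with $p_j\in U_j$ and $\Omega_j(p_j)=0$. Two such, with data $(p_j,\Omega_j)$ and $(q_j,\Xi_j)$, are superconformally equivalent if there is a bijection $F$ of $S^2\hat{\mathbb C}$,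 superconformal together with its inverse, with $F(p_j)=q_j$ and $\Omega_j=\Xi_j\circ F$ near $p_j$ for all $j$. This is an equivalence relation, and the moduli space of spheres with $1+n$ tubes is the set of its classes. Canonical superspheres: write $H_j=\Omega_j\circ\sigma^{-1}$ and $H_0=(\tilde w,\tilde\rho^+,\tilde\rho^-)$. * For $n\ge1$, a sphere with $1+n$ tubes is canonical if $p_0=\nu^{-1}(0)$, $p_j=\sigma^{-1}(z_j,\theta_j^+,\theta_j^-)$ with $z_j\in(\bigwedge_\infty^0)^\times$ for $1\le j\le n-1$, $p_n=\sigma^{-1}(0)$, each $U_j$ is the set of points whose body lies in a disc (in the coordinate $\nu$ for $j=0$, $\sigma$ for $j\ge1$) centred at the body of $p_j$, for $1\le j\le n$ (with $(z_n,\theta_n^+,\theta_n^-)=0$) the function $H_j$ vanishes at $(z_j,\theta_j^+,\theta_j^-)$ and $\lim_{w\to z_j}H_j(w,\theta_j^+,\theta_j^-)/(w-z_j)$ exists in $(\bigwedge_\infty^0)^\times\oplus(\bigwedge_\infty^1)^2$, and $$\lim_{w\to\infty}H_0(w,0,0)=0,\qquad \lim_{w\to\infty}\frac{\partial}{\partial\rho^\pm}\,w\tilde\rho^\pm=i.\qquad(1)$$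 * For $n=0$, it is canonical if $p_0=\nu^{-1}(0)$, $U_0$ is a disc in the same sense, (1) holds, and $\lim_{w\to\infty}w^2(\tilde w(w,0,0)-w^{-1})=\lim_{w\to\infty}w\tilde\rho^\pm(w,0,0)=0$. Canonical superspheres with the same punctures and the same germs of local coordinates at the punctures (so differing only in the radii of the discs) are identified. Power series: given $a_j^\pm\in\bigwedge_\infty^0$ and $m_{j+1/2}^\pm\in\bigwedge_\infty^1$ $(j\ge0)$ with $a_0^\pm$ invertible, put $g^\pm(z)=\sum_{j\ge0}a_j^\pm z^j$, $\psi^\pm(z)=\sum_{j\ge0}m^\pm_{j+1/2}z^{j+1}$, and let $f$ be the power series with $f(0)=0$, $f'=(\psi^+)'\psi^--\psi^+(\psi^-)'+g^+g^-$. The superconformal power series $K=(\tilde z,\tilde\theta^+,\tilde\theta^-)$ with these coefficients is $$\tilde z=f+\theta^+g^+\psi^-+\theta^-g^-\psi^++\theta^+\theta^-(\psi^+\psi^-)',\qquad \tilde\theta^\pm=\psi^\pm+\theta^\pm g^\pm\pm\theta^+\theta^-(\psi^\pm)'.$$ It is called convergent if $g^\pm$ and $\psi^\pm$ converge absolutely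 for all $z\in\bigwedge_\infty^0$ with $|z_B|$ small. **Theorem.** 1. For every $n\ge0$, sending a canonical supersphere with $1+n$ tubes to its superconformal equivalence class is a bijection from the set of canonical superspheres with $1+n$ tubes onto the moduli space of $N=2$ super-Riemann spheres with $1+n$ tubes. 2. For $n\ge1$, the moduli space of $N=2$ super-Riemann spheres with $1+n$ tubes is in bijection with the set of all tuples $((z_1,\theta_1^+,\theta_1^-),\dots,(z_{n-1},\theta_{n-1}^+,\theta_{n-1}^-);H_0,\dots,H_n)$, where $(z_j,\theta_j^+,\theta_j^-)\in(\bigwedge_\infty^0)^\times\oplus(\bigwedge_\infty^1)^2$, $(z_j)_B\ne(z_k)_B$ for $j\ne k$, $H_0=K_0\circ I$ with $K_0$ a convergent superconformal power series with $a_0^\pm=1$, so that $$\rho^\mp H_0^\pm=\rho^\mp\Bigl(\sum_{j\ge1}m^\pm_{j-1/2}w^{-j}+\rho^\pm\Bigl(\frac iw+\sum_{j\ge1}i\,a_j^\pm w^{-j-1}\Bigr)\Bigr),$$ and, for $1\le k\le n$ and with $(z_n,\theta_n^+,\theta_n^-)=0$, $H_k=K_k\circ s_k$ with $K_k$ a convergent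 superconformal power series and $s_k(w,\rho^+,\rho^-)=(w-z_k-\rho^+\theta_k^--\rho^-\theta_k^+,\ \rho^+-\theta_k^+,\ \rho^--\theta_k^-)$. Every canonical supersphere has exactly one such tuple, given by its punctures and the expansions of its local coordinates there in the coordinate $\sigma$; every tuple arises in this way; and the bijection sends a tuple to the class of any canonical supersphere that has it. 3. In the same way, the moduli space of $N=2$ super-Riemann spheres with one tube is in bijection with the set of all series $H_0=K_0\circ I$ with $K_0$ a convergent superconformal power series such that $a_0^\pm=1$, $a_1^+=-a_1^-$ and $m_{1/2}^\pm=0$. -/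

import Mathlib

namespace NTwo

noncomputable section

open scoped Topology
open Filter

/-! ## The infinite Grassmann algebra -/

/-- The infinite Grassmann algebra: the exterior algebra on a complex vector space with
basis `ζ_0, ζ_1, ζ_2, …`. Its elements are finite linear combinations of monomials. -/
abbrev Gr : Type := ExteriorAlgebra ℂ (ℕ →₀ ℂ)

/-- The basis of monomials `ζ_{k_1} ⋯ ζ_{k_s}`, `k_1 < ⋯ < k_s`, indexed by finite sets. -/
def grBasis : Module.Basis (Finset ℕ) ℂ Gr :=
  (Finsupp.basisSingleOne : Module.Basis ℕ ℂ (ℕ →₀ ℂ)).ExteriorAlgebra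

/-- The coefficient of the monomial with index set `k`. -/
def coord (k : Finset ℕ) : Gr →ₗ[ℂ] ℂ := grBasis.coord k

/-- The body map (coefficient of `1`). -/
def body : Gr →ₐ[ℂ] ℂ := ExteriorAlgebra.algebraMapInv

/-- The soul of an element. -/
def soul (a : Gr) : Gr := a - algebraMap ℂ Gr (body a)

/-- The even part of the Grassmann algebra. -/
def evenPart : Submodule ℂ Gr := CliffordAlgebra.evenOdd (0 : QuadraticForm ℂ (ℕ →₀ ℂ)) 0

/-- The odd part of the Grassmann algebra. -/
def oddPart : Submodule ℂ Gr := CliffordAlgebra.evenOdd (0 : QuadraticForm ℂ (ℕ →₀ ℂ)) 1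

theorem even_mul_even {a b : Gr} (ha : a ∈ evenPart) (hb : b ∈ evenPart) : a * b ∈ evenPart := by
  have h := CliffordAlgebra.evenOdd_mul_le (0 : QuadraticForm ℂ (ℕ →₀ ℂ)) 0 0
    (Submodule.mul_mem_mul ha hb)
  simpa [evenPart] using h

theorem odd_mul_even {a b : Gr} (ha : a ∈ oddPart) (hb : b ∈ evenPart) : a * b ∈ oddPart := by
  have h := CliffordAlgebra.evenOdd_mul_le (0 : QuadraticForm ℂ (ℕ →₀ ℂ)) 1 0
    (Submodule.mul_mem_mul ha hb)
  simpa [oddPart] using h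

theorem even_mul_odd {a b : Gr} (ha : a ∈ evenPart) (hb : b ∈ oddPart) : a * b ∈ oddPart := by
  have h := CliffordAlgebra.evenOdd_mul_le (0 : QuadraticForm ℂ (ℕ →₀ ℂ)) 0 1
    (Submodule.mul_mem_mul ha hb)
  simpa [oddPart] using h

theorem odd_mul_odd {a b : Gr} (ha : a ∈ oddPart) (hb : b ∈ oddPart) : a * b ∈ evenPart := by
  have h := CliffordAlgebra.evenOdd_mul_le (0 : QuadraticForm ℂ (ℕ →₀ ℂ)) 1 1
    (Submodule.mul_mem_mul ha hb)
  have e : (1 : ZMod 2) + 1 = 0 := by decide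
  rw [e] at h
  exact h

theorem algebraMap_mem_even (c : ℂ) : algebraMap ℂ Gr c ∈ evenPart :=
  SetLike.algebraMap_mem_graded
    (CliffordAlgebra.evenOdd (0 : QuadraticForm ℂ (ℕ →₀ ℂ))) c

theorem one_mem_even : (1 : Gr) ∈ evenPart := by
  simpa using algebraMap_mem_even 1

theorem inverse_mem_even {a : Gr} (ha : a ∈ evenPart) : Ring.inverse a ∈ evenPart := by
  by_cases hu : IsUnit a
  · have hc := CliffordAlgebra.evenOdd_isCompl (0 : QuadraticForm ℂ (ℕ →₀ ℂ))
    have ht : Ring.inverse a ∈ evenPart ⊔ oddPart := by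
      have : evenPart ⊔ oddPart = ⊤ := hc.sup_eq_top
      rw [this]; trivial
    obtain ⟨u, hu0, v, hv1, huv⟩ := Submodule.mem_sup.1 ht
    have h1 : a * u + a * v = 1 := by
      rw [← mul_add, huv, Ring.mul_inverse_cancel a hu]
    have h2 : a * v ∈ evenPart := by
      have : a * v = 1 - a * u := by rw [← h1]; abel
      rw [this]
      exact Submodule.sub_mem _ one_mem_even (even_mul_even ha hu0)
    have h3 : a * v = 0 :=
      Submodule.disjoint_def.1 hc.disjoint _ h2 (even_mul_odd ha hv1)
    have h4 : v = 0 := by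
      have : Ring.inverse a * (a * v) = v := by
        rw [← mul_assoc, Ring.inverse_mul_cancel a hu, one_mul]
      rw [← this, h3, mul_zero]
    rw [← huv, h4, add_zero]
    exact hu0
  · rw [Ring.inverse_non_unit _ hu]
    exact Submodule.zero_mem _

theorem even_commute {a : Gr} (ha : a ∈ evenPart) (b : Gr) : Commute a b := by
  induction a, ha using CliffordAlgebra.even_induction with
  | algebraMap r => exact Algebra.commutes r b
  | add x y hx hy h1 h2 => exact h1.add_left h2
  | ι_mul_ι_mul m₁ m₂ x hx h =>
    refine Commute.mul_left ?_ h
    clear h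
    induction b using ExteriorAlgebra.induction with
    | algebraMap r => exact (Algebra.commutes r _).symm
    | ι y =>
      have s := fun u v : ℕ →₀ ℂ =>
        eq_neg_of_add_eq_zero_left (ExteriorAlgebra.ι_add_mul_swap (R := ℂ) u v)
      change ExteriorAlgebra.ι ℂ m₁ * ExteriorAlgebra.ι ℂ m₂ * ExteriorAlgebra.ι ℂ y =
        ExteriorAlgebra.ι ℂ y * (ExteriorAlgebra.ι ℂ m₁ * ExteriorAlgebra.ι ℂ m₂)
      rw [mul_assoc, s m₂ y, mul_neg, ← mul_assoc, s m₁ y, neg_mul, neg_neg, mul_assoc]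
    | mul u v h1 h2 => exact h1.mul_right h2
    | add u v h1 h2 => exact h1.add_right h2

theorem soul_nilpotent {a : Gr} (ha : a ∈ evenPart) : IsNilpotent (soul a) := by
  induction a, ha using CliffordAlgebra.even_induction with
  | algebraMap r =>
    have : body (algebraMap ℂ Gr r) = r := by simp
    refine ⟨1, ?_⟩
    rw [pow_one]
    change algebraMap ℂ Gr r - algebraMap ℂ Gr (body (algebraMap ℂ Gr r)) = 0
    rw [this, sub_self]
  | add x y hx hy h1 h2 =>
    have e : soul (x + y) = soul x + soul y := by
      simp only [soul, map_add]; abel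
    rw [e]
    have hc : Commute (soul x) (soul y) :=
      even_commute (Submodule.sub_mem _ hx (algebraMap_mem_even _)) _
    exact hc.isNilpotent_add h1 h2
  | ι_mul_ι_mul m₁ m₂ x hx h =>
    have hm : ExteriorAlgebra.ι ℂ m₁ * ExteriorAlgebra.ι ℂ m₂ ∈ evenPart :=
      CliffordAlgebra.ι_mul_ι_mem_evenOdd_zero (0 : QuadraticForm ℂ (ℕ →₀ ℂ)) m₁ m₂
    have hb : body (ExteriorAlgebra.ι ℂ m₁ * ExteriorAlgebra.ι ℂ m₂ * x) = 0 := by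
      simp [body, ExteriorAlgebra.algebraMapInv]
    refine ⟨2, ?_⟩
    change soul (ExteriorAlgebra.ι ℂ m₁ * ExteriorAlgebra.ι ℂ m₂ * x) ^ 2 = 0
    rw [soul, hb, map_zero, sub_zero, (even_commute hm x).mul_pow, pow_two, ← mul_assoc,
      (even_commute hm (ExteriorAlgebra.ι ℂ m₁)).eq, ← mul_assoc, ExteriorAlgebra.ι_sq_zero]
    simp

theorem isUnit_iff_body {a : Gr} (ha : a ∈ evenPart) : IsUnit a ↔ body a ≠ 0 := by
  constructor
  · intro h
    exact (h.map body).ne_zero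
  · intro h
    have e : a = algebraMap ℂ Gr (body a) + soul a := by simp [soul]
    rw [e]
    have hu : IsUnit (algebraMap ℂ Gr (body a)) := (isUnit_iff_ne_zero.2 h).map _
    exact (soul_nilpotent ha).isUnit_add_left_of_commute hu
      (Algebra.commutes (body a) (soul a)).symm

/-! ## Points of superspace and the DeWitt topology -/

/-- A point `(z, θ⁺, θ⁻)` with one even and two odd coordinates. -/
@[ext] structure Pt where
  z : Gr
  tp : Gr
  tm : Gr
  z_even : z ∈ evenPart
  tp_odd : tp ∈ oddPart
  tm_odd : tm ∈ oddPart

instance : Zero Pt :=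
  ⟨⟨0, 0, 0, Submodule.zero_mem _, Submodule.zero_mem _, Submodule.zero_mem _⟩⟩

/-- Projection of a point onto its body. -/
def Pt.body (p : Pt) : ℂ := NTwo.body p.z

/-- The DeWitt topology: open sets are the preimages of open sets of the body. -/
instance : TopologicalSpace Pt := TopologicalSpace.induced Pt.body inferInstance

/-- The point `(w, 0, 0)` for a complex number `w`. -/
def Pt.ofComplex (w : ℂ) : Pt :=
  ⟨algebraMap ℂ Gr w, 0, 0, algebraMap_mem_even w, Submodule.zero_mem _, Submodule.zero_mem _⟩

/-- The point `(z + t, θ⁺, θ⁻)` for a complex number `t`. -/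
def Pt.addComplex (p : Pt) (t : ℂ) : Pt :=
  ⟨p.z + algebraMap ℂ Gr t, p.tp, p.tm,
    Submodule.add_mem _ p.z_even (algebraMap_mem_even t), p.tp_odd, p.tm_odd⟩

/-- The DeWitt ball about a point; it depends only on the body of the centre. -/
def ball (x : Pt) (r : ℝ) : Set Pt := {p | ‖p.body - x.body‖ < r}

/-- `(z, θ⁺, θ⁻) ↦ (1/z, c θ⁺/z, c θ⁻/z)`; only used where `z` is invertible. -/
def recip (c : ℂ) (p : Pt) : Pt :=
  ⟨Ring.inverse p.z, c • (p.tp * Ring.inverse p.z), c • (p.tm * Ring.inverse p.z),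
    inverse_mem_even p.z_even,
    Submodule.smul_mem _ _ (odd_mul_even p.tp_odd (inverse_mem_even p.z_even)),
    Submodule.smul_mem _ _ (odd_mul_even p.tm_odd (inverse_mem_even p.z_even))⟩

/-- The map `I(w, ρ⁺, ρ⁻) = (1/w, iρ⁺/w, iρ⁻/w)`. -/
def invI (p : Pt) : Pt := recip Complex.I p

/-- The superconformal shift
`(w, ρ⁺, ρ⁻) ↦ (w - z - ρ⁺θ⁻ - ρ⁻θ⁺, ρ⁺ - θ⁺, ρ⁻ - θ⁻)` taking `x = (z, θ⁺, θ⁻)` to `0`. -/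
def shift (x p : Pt) : Pt :=
  ⟨p.z - x.z - p.tp * x.tm - p.tm * x.tp, p.tp - x.tp, p.tm - x.tm,
    Submodule.sub_mem _ (Submodule.sub_mem _ (Submodule.sub_mem _ p.z_even x.z_even)
      (odd_mul_odd p.tp_odd x.tm_odd)) (odd_mul_odd p.tm_odd x.tp_odd),
    Submodule.sub_mem _ p.tp_odd x.tp_odd, Submodule.sub_mem _ p.tm_odd x.tm_odd⟩

/-! ## Superanalytic and superconformal functions -/

/-- A family of complex functions `f_k`, one for each monomial `ζ_k`, standing for the
superfunction `Σ_k f_k(z) ζ_k` of one even variable. -/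
abbrev CoeffFamily : Type := Finset ℕ → ℂ → ℂ

/-- The family is analytic on `V` and `Σ_k f_k(w) ζ_k` is a finite sum, that is an element of the
Grassmann algebra, for every `w` in `V`. -/
def CoeffFamily.AnalyticOn (c : CoeffFamily) (V : Set ℂ) : Prop :=
  (∀ k, AnalyticOnNhd ℂ (c k) V) ∧ ∀ w ∈ V, {k | c k w ≠ 0}.Finite

/-- The value `Σ_k f_k(z) ζ_k`, where `f_k(z_B + z_S) = Σ_l (z_S ^ l / l!) f_k^{(l)}(z_B)`.
Both sums are finite when `c` is analytic on an open set that contains the body of `z`. -/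
def CoeffFamily.eval (c : CoeffFamily) (z : Gr) : Gr :=
  ∑ᶠ k : Finset ℕ, ∑ᶠ l : ℕ,
    (iteratedDeriv l (c k) (body z) / (Nat.factorial l : ℂ)) • (soul z ^ l * grBasis k)

/-- The derivative with respect to the even variable. -/
def CoeffFamily.diff (c : CoeffFamily) : CoeffFamily := fun k => deriv (c k)

/-- The component functions of a superfunction `f + θ⁺ ξ⁺ + θ⁻ ξ⁻ + θ⁺ θ⁻ t`
in one even and two odd variables. -/
structure SuperFn where
  f : CoeffFamily
  xp : CoeffFamily
  xm : CoeffFamily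
  t : CoeffFamily

/-- The value of the superfunction at a point. -/
def SuperFn.eval (F : SuperFn) (p : Pt) : Gr :=
  F.f.eval p.z + p.tp * F.xp.eval p.z + p.tm * F.xm.eval p.z + p.tp * p.tm * F.t.eval p.z

/-- Superanalyticity over the open set `V` of bodies. -/
def SuperFn.AnalyticOn (F : SuperFn) (V : Set ℂ) : Prop :=
  F.f.AnalyticOn V ∧ F.xp.AnalyticOn V ∧ F.xm.AnalyticOn V ∧ F.t.AnalyticOn V

/-- The superfunction is even over `V`. -/
def SuperFn.IsEvenOn (F : SuperFn) (V : Set ℂ) : Prop :=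
  (∀ k : Finset ℕ, Odd k.card → ∀ w ∈ V, F.f k w = 0 ∧ F.t k w = 0) ∧
  (∀ k : Finset ℕ, Even k.card → ∀ w ∈ V, F.xp k w = 0 ∧ F.xm k w = 0)

/-- The superfunction is odd over `V`. -/
def SuperFn.IsOddOn (F : SuperFn) (V : Set ℂ) : Prop :=
  (∀ k : Finset ℕ, Even k.card → ∀ w ∈ V, F.f k w = 0 ∧ F.t k w = 0) ∧
  (∀ k : Finset ℕ, Odd k.card → ∀ w ∈ V, F.xp k w = 0 ∧ F.xm k w = 0)

/-- The superderivation `D⁺ = ∂/∂θ⁺ + θ⁻ ∂/∂z`: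
`D⁺(f + θ⁺ξ⁺ + θ⁻ξ⁻ + θ⁺θ⁻t) = ξ⁺ + θ⁻(t + f') - θ⁺θ⁻(ξ⁺)'`. -/
def SuperFn.dPlus (F : SuperFn) : SuperFn where
  f := F.xp
  xp := 0
  xm := F.t + F.f.diff
  t := -F.xp.diff

/-- The superderivation `D⁻ = ∂/∂θ⁻ + θ⁺ ∂/∂z`:
`D⁻(f + θ⁺ξ⁺ + θ⁻ξ⁻ + θ⁺θ⁻t) = ξ⁻ + θ⁺(f' - t) + θ⁺θ⁻(ξ⁻)'`. -/
def SuperFn.dMinus (F : SuperFn) : SuperFn where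
  f := F.xm
  xp := F.f.diff - F.t
  xm := 0
  t := F.xm.diff

/-- `H` restricted to `U` is an `N = 2` superconformal function: `U` is DeWitt open, the three
components of `H` are superanalytic on `U`, the first even and the others odd, and `H` transforms
`D⁺`, `D⁻` homogeneously of degree one, by factors `D⁺θ̃⁺`, `D⁻θ̃⁻` that do not vanish
identically. -/
def SuperconformalOn (H : Pt → Pt) (U : Set Pt) : Prop :=
  ∃ V : Set ℂ, IsOpen V ∧ U = Pt.body ⁻¹' V ∧
    ∃ Z P M : SuperFn,
      Z.AnalyticOn V ∧ Z.IsEvenOn V ∧ P.AnalyticOn V ∧ P.IsOddOn V ∧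
      M.AnalyticOn V ∧ M.IsOddOn V ∧
      (∀ p ∈ U, (H p).z = Z.eval p ∧ (H p).tp = P.eval p ∧ (H p).tm = M.eval p) ∧
      (∀ p ∈ U, M.dPlus.eval p = 0) ∧
      (∀ p ∈ U, P.dMinus.eval p = 0) ∧
      (∀ p ∈ U, Z.dPlus.eval p - M.eval p * P.dPlus.eval p = 0) ∧
      (∀ p ∈ U, Z.dMinus.eval p - P.eval p * M.dMinus.eval p = 0) ∧
      (∃ p ∈ U, P.dPlus.eval p ≠ 0) ∧ (∃ p ∈ U, M.dMinus.eval p ≠ 0)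

/-! ## The super-Riemann sphere -/

/-- The super-Riemann sphere: the points of the southern coordinate neighborhood, and the points
of the northern one that are not in the southern one. The gluing is by `invI`, see `south_north`
below. -/
inductive Sphere : Type
  | fin (p : Pt) : Sphere
  | inf (q : Pt) (h : q.body = 0) : Sphere

open Classical in
/-- The inverse of the northern coordinate map. -/
def northInv (q : Pt) : Sphere :=
  if h : q.body = 0 then Sphere.inf q h else Sphere.fin (invI q)

/-- The topology of the sphere, glued from the DeWitt topologies of the two neighborhoods. -/
instance : TopologicalSpace Sphere where
  IsOpen U := IsOpen (Sphere.fin ⁻¹' U) ∧ IsOpen (northInv ⁻¹' U)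
  isOpen_univ := ⟨isOpen_univ, isOpen_univ⟩
  isOpen_inter _ _ h h' := ⟨h.1.inter h'.1, h.2.inter h'.2⟩
  isOpen_sUnion s h := by
    simp only [Set.preimage_sUnion]
    exact ⟨isOpen_biUnion fun t ht => (h t ht).1, isOpen_biUnion fun t ht => (h t ht).2⟩

theorem isOpen_sphere {U : Set Sphere} :
    IsOpen U ↔ IsOpen (Sphere.fin ⁻¹' U) ∧ IsOpen (northInv ⁻¹' U) := Iff.rfl

theorem continuous_ptBody : Continuous Pt.body := continuous_induced_dom

theorem continuous_to_pt {X : Type*} [TopologicalSpace X] {g : X → Pt} :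
    Continuous g ↔ Continuous (Pt.body ∘ g) := continuous_induced_rng

/-- The southern coordinate map. -/
def southFun : Sphere → Pt
  | Sphere.fin p => p
  | Sphere.inf _ _ => 0

/-- The northern coordinate map. -/
def northFun : Sphere → Pt
  | Sphere.fin p => recip (-Complex.I) p
  | Sphere.inf q _ => q

theorem body_recip (c : ℂ) (p : Pt) : (recip c p).body = p.body⁻¹ := by
  by_cases h : IsUnit p.z
  · have h1 : body (Ring.inverse p.z) * body p.z = 1 := by
      rw [← map_mul, Ring.inverse_mul_cancel _ h, map_one]
    exact eq_inv_of_mul_eq_one_left h1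
  · have h0 : body p.z = 0 := by
      by_contra h0
      exact h ((isUnit_iff_body p.z_even).2 h0)
    change body (Ring.inverse p.z) = (body p.z)⁻¹
    rw [Ring.inverse_non_unit _ h, h0, map_zero, inv_zero]

theorem recip_recip {c d : ℂ} (hcd : c * d = 1) {p : Pt} (hp : p.body ≠ 0) :
    recip c (recip d p) = p := by
  have hu : IsUnit p.z := (isUnit_iff_body p.z_even).2 hp
  obtain ⟨u, hu⟩ := hu
  have e : Ring.inverse p.z = ↑u⁻¹ := by rw [← hu, Ring.inverse_unit]
  have e2 : Ring.inverse (Ring.inverse p.z) = p.z := by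
    rw [e, Ring.inverse_unit, inv_inv, hu]
  have e3 : Ring.inverse p.z * p.z = 1 := by rw [e, ← hu, Units.inv_mul]
  ext1
  · exact e2
  · change c • (d • (p.tp * Ring.inverse p.z) * Ring.inverse (Ring.inverse p.z)) = p.tp
    rw [e2, smul_mul_assoc, mul_assoc, e3, smul_smul, hcd, one_smul, mul_one]
  · change c • (d • (p.tm * Ring.inverse p.z) * Ring.inverse (Ring.inverse p.z)) = p.tm
    rw [e2, smul_mul_assoc, mul_assoc, e3, smul_smul, hcd, one_smul, mul_one]

theorem northInv_northFun {x : Sphere} (hx : x ∈ Set.range northInv) :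
    northInv (northFun x) = x := by
  obtain ⟨q, rfl⟩ := hx
  by_cases h : q.body = 0
  · simp [northInv, northFun, h]
  · have h2 : northFun (northInv q) = q := by
      simp only [northInv, h, dif_neg, not_false_eq_true, northFun, invI]
      exact recip_recip (by simp) h
    rw [h2]

theorem northFun_northInv (q : Pt) : northFun (northInv q) = q := by
  by_cases h : q.body = 0
  · simp [northInv, northFun, h]
  · simp only [northInv, h, dif_neg, not_false_eq_true, northFun, invI]
    exact recip_recip (by simp) h

theorem isOpen_body_ne : IsOpen {p : Pt | p.body ≠ 0} :=
  isOpen_ne.preimage continuous_ptBody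

theorem isOpen_range_fin : IsOpen (Set.range Sphere.fin) := by
  refine isOpen_sphere.2 ⟨by simp, ?_⟩
  convert isOpen_body_ne using 1
  ext q
  by_cases h : q.body = 0 <;> simp [northInv, h]

theorem mem_range_northInv (p : Pt) : Sphere.fin p ∈ Set.range northInv ↔ p.body ≠ 0 := by
  constructor
  · rintro ⟨q, hq⟩
    by_cases h : q.body = 0
    · simp [northInv, h] at hq
    · simp only [northInv, h, dif_neg, not_false_eq_true, Sphere.fin.injEq] at hq
      rw [← hq, invI, body_recip]
      exact inv_ne_zero h
  · intro h
    refine ⟨recip (-Complex.I) p, ?_⟩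
    have hb : (recip (-Complex.I) p).body ≠ 0 := by
      rw [body_recip]; exact inv_ne_zero h
    simp only [northInv, hb, dif_neg, not_false_eq_true, Sphere.fin.injEq, invI]
    exact recip_recip (by simp) h

theorem isOpen_range_northInv : IsOpen (Set.range northInv) := by
  refine isOpen_sphere.2 ⟨?_, by simp⟩
  convert isOpen_body_ne using 1
  ext p
  exact mem_range_northInv p

theorem continuous_fin : Continuous Sphere.fin := ⟨fun _ h => h.1⟩

theorem continuous_northInv : Continuous northInv := ⟨fun _ h => h.2⟩

theorem isOpenMap_fin : IsOpenMap Sphere.fin := by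
  intro U hU
  refine isOpen_sphere.2 ⟨?_, ?_⟩
  · convert hU using 1
    ext p
    simp
  · obtain ⟨V, hV, rfl⟩ := isOpen_induced_iff.1 hU
    have h1 : IsOpen ({w : ℂ | w ≠ 0} ∩ (fun w : ℂ => w⁻¹) ⁻¹' V) :=
      (continuousOn_inv₀ (G₀ := ℂ)).isOpen_inter_preimage isOpen_ne hV
    convert h1.preimage continuous_ptBody using 1
    ext q
    by_cases h : q.body = 0
    · simp [northInv, h]
    · simp [northInv, h, invI, body_recip]

theorem isOpenMap_northInv : IsOpenMap northInv := by
  intro U hU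
  refine isOpen_sphere.2 ⟨?_, ?_⟩
  · obtain ⟨V, hV, rfl⟩ := isOpen_induced_iff.1 hU
    have h1 : IsOpen ({w : ℂ | w ≠ 0} ∩ (fun w : ℂ => w⁻¹) ⁻¹' V) :=
      (continuousOn_inv₀ (G₀ := ℂ)).isOpen_inter_preimage isOpen_ne hV
    convert h1.preimage continuous_ptBody using 1
    ext p
    constructor
    · rintro ⟨q, hq, hqp⟩
      have hp : p.body ≠ 0 := (mem_range_northInv p).1 ⟨q, hqp⟩
      refine ⟨hp, ?_⟩
      have e := northFun_northInv q
      rw [hqp] at e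
      have e2 : (recip (-Complex.I) p).body = q.body := congrArg Pt.body e
      rw [body_recip] at e2
      change p.body⁻¹ ∈ V
      rw [e2]
      exact hq
    · rintro ⟨hp, hV⟩
      refine ⟨recip (-Complex.I) p, ?_, ?_⟩
      · change (recip (-Complex.I) p).body ∈ V
        rw [body_recip]
        exact hV
      · exact northInv_northFun (x := Sphere.fin p) ((mem_range_northInv p).2 hp)
  · convert hU using 1
    ext q
    constructor
    · rintro ⟨q', hq', e⟩
      have := congrArg northFun e
      rw [northFun_northInv, northFun_northInv] at this
      exact this ▸ hq'
    · intro hq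
      exact ⟨q, hq, rfl⟩

/-- The southern chart, a homeomorphism of `U_south` onto superspace. -/
def south : OpenPartialHomeomorph Sphere Pt where
  toFun := southFun
  invFun := Sphere.fin
  source := Set.range Sphere.fin
  target := Set.univ
  map_source' _ _ := trivial
  map_target' p _ := ⟨p, rfl⟩
  left_inv' := by rintro _ ⟨p, rfl⟩; rfl
  right_inv' _ _ := rfl
  open_source := isOpen_range_fin
  open_target := isOpen_univ
  continuousOn_toFun := by
    rw [continuousOn_iff']
    intro U hU
    refine ⟨Sphere.fin '' U, isOpenMap_fin U hU, ?_⟩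
    ext x
    cases x <;> simp [southFun]
  continuousOn_invFun := continuous_fin.continuousOn

/-- The northern chart, a homeomorphism of `U_north` onto superspace. -/
def north : OpenPartialHomeomorph Sphere Pt where
  toFun := northFun
  invFun := northInv
  source := Set.range northInv
  target := Set.univ
  map_source' _ _ := trivial
  map_target' p _ := ⟨p, rfl⟩
  left_inv' _ hx := northInv_northFun hx
  right_inv' q _ := northFun_northInv q
  open_source := isOpen_range_northInv
  open_target := isOpen_univ
  continuousOn_toFun := by
    rw [continuousOn_iff']
    intro U hU
    refine ⟨northInv '' U, isOpenMap_northInv U hU, ?_⟩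
    ext x
    constructor
    · rintro ⟨h1, h2⟩
      exact ⟨⟨northFun x, h1, northInv_northFun h2⟩, h2⟩
    · rintro ⟨⟨q, hq, rfl⟩, h2⟩
      exact ⟨by change northFun (northInv q) ∈ U; rwa [northFun_northInv], h2⟩
  continuousOn_invFun := continuous_northInv.continuousOn

/-- The coordinate transition is `south ∘ north⁻¹ = I` on the points with invertible even
coordinate. -/
theorem south_north :
    (north.symm.trans south).source = {q : Pt | IsUnit q.z} ∧
      ∀ q : Pt, IsUnit q.z → south (north.symm q) = invI q := by
  constructor
  · ext q
    rw [Set.mem_ofPred_eq, isUnit_iff_body q.z_even, OpenPartialHomeomorph.trans_source]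
    change q ∈ Set.univ ∩ northInv ⁻¹' Set.range Sphere.fin ↔ q.body ≠ 0
    by_cases h : q.body = 0 <;> simp [northInv, h]
  · intro q hq
    have h : q.body ≠ 0 := (isUnit_iff_body q.z_even).1 hq
    change southFun (northInv q) = invI q
    simp [northInv, h, southFun]

/-- The two coordinate maps that give the superconformal structure of the sphere. -/
def atlas : Set (OpenPartialHomeomorph Sphere Pt) := {south, north}

/-- A superconformal coordinate chart of the sphere: a homeomorphism of an open set onto a DeWitt
open set, whose transition functions with the charts of the atlas are superconformal wherever the
domains overlap. -/
def IsSuperconformalChart (Ω : OpenPartialHomeomorph Sphere Pt) : Prop :=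
  ∀ φ ∈ atlas,
    ((φ.symm.trans Ω).source.Nonempty →
      SuperconformalOn (φ.symm.trans Ω) (φ.symm.trans Ω).source) ∧
    ((Ω.symm.trans φ).source.Nonempty →
      SuperconformalOn (Ω.symm.trans φ) (Ω.symm.trans φ).source)

/-- A superconformal map of the sphere to itself: its coordinate expressions are superconformal
on their natural domains. -/
def IsSuperconformalMap (F : Sphere → Sphere) : Prop :=
  ∀ φ ∈ atlas, ∀ ψ ∈ atlas,
    (φ.target ∩ φ.symm ⁻¹' (F ⁻¹' ψ.source)).Nonempty →
      SuperconformalOn (fun p => ψ (F (φ.symm p))) (φ.target ∩ φ.symm ⁻¹' (F ⁻¹' ψ.source))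

/-- Two points of the sphere have the same body. -/
def SameBody (x y : Sphere) : Prop :=
  ∃ φ ∈ atlas, x ∈ φ.source ∧ y ∈ φ.source ∧ (φ x).body = (φ y).body

/-! ## Tubes, superconformal equivalence, the moduli space -/

/-- A super-Riemann sphere with `1 + n` tubes: punctures `p_0` (negatively oriented) and
`p_1, …, p_n` (positively oriented) with distinct bodies, and local superconformal coordinates
vanishing at the punctures. -/
structure Tubed (n : ℕ) where
  pt : Fin (n + 1) → Sphere
  distinct : ∀ j k, j ≠ k → ¬ SameBody (pt j) (pt k)
  chart : Fin (n + 1) → OpenPartialHomeomorph Sphere Pt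
  superconformal : ∀ j, IsSuperconformalChart (chart j)
  mem_source : ∀ j, pt j ∈ (chart j).source
  vanish : ∀ j, chart j (pt j) = 0

/-- Superconformal equivalence: a superconformal isomorphism that respects the punctures, and the
local coordinates near the punctures. -/
def SuperconformallyEquivalent (n : ℕ) (T T' : Tubed n) : Prop :=
  ∃ F : Sphere ≃ Sphere, IsSuperconformalMap F ∧ IsSuperconformalMap F.symm ∧
    ∀ j, F (T.pt j) = T'.pt j ∧
      ∃ W : Set Sphere, IsOpen W ∧ T.pt j ∈ W ∧ W ⊆ (T.chart j).source ∧
        W ⊆ F ⁻¹' (T'.chart j).source ∧ ∀ x ∈ W, T.chart j x = T'.chart j (F x)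

/-- The moduli space of super-Riemann spheres with `1 + n` tubes. -/
def Moduli (n : ℕ) : Type := Quot (SuperconformallyEquivalent n)

/-- The class of a super-Riemann sphere with tubes in the moduli space. -/
def Tubed.toModuli {n : ℕ} (T : Tubed n) : Moduli n := Quot.mk _ T

/-! ## Canonical superspheres with tubes -/

/-- Convergence of Grassmann algebra elements, coefficient by coefficient. -/
def CoordTendsto {α : Type} (x : α → Gr) (l : Filter α) (a : Gr) : Prop :=
  ∀ k, Tendsto (fun i => coord k (x i)) l (𝓝 (coord k a))

/-- `d` is the left partial derivative of `G` with respect to `θ⁺` at `p`. -/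
def IsThetaPlusDeriv (G : Pt → Gr) (p : Pt) (d : Gr) : Prop :=
  ∀ p' : Pt, p'.z = p.z → p'.tm = p.tm → (p'.tp - p.tp) * d = G p' - G p

/-- `d` is the left partial derivative of `G` with respect to `θ⁻` at `p`. -/
def IsThetaMinusDeriv (G : Pt → Gr) (p : Pt) (d : Gr) : Prop :=
  ∀ p' : Pt, p'.z = p.z → p'.tp = p.tp → (p'.tm - p.tm) * d = G p' - G p

/-- The normalization at infinity of `H(w, ρ⁺, ρ⁻) = (w̃, ρ̃⁺, ρ̃⁻)`: `H(w, 0, 0) → 0` and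
`∂(w ρ̃⁺)/∂ρ⁺ → i`, `∂(w ρ̃⁻)/∂ρ⁻ → i` as `w → ∞`. -/
def NormalizedAtInfinity (H : Pt → Pt) : Prop :=
  CoordTendsto (fun w : ℂ => (H (Pt.ofComplex w)).z) (cocompact ℂ) 0 ∧
  CoordTendsto (fun w : ℂ => (H (Pt.ofComplex w)).tp) (cocompact ℂ) 0 ∧
  CoordTendsto (fun w : ℂ => (H (Pt.ofComplex w)).tm) (cocompact ℂ) 0 ∧
  ∃ dp dm : ℂ → Gr,
    (∀ᶠ w in cocompact ℂ,
      IsThetaPlusDeriv (fun p => p.z * (H p).tp) (Pt.ofComplex w) (dp w)) ∧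
    (∀ᶠ w in cocompact ℂ,
      IsThetaMinusDeriv (fun p => p.z * (H p).tm) (Pt.ofComplex w) (dm w)) ∧
    CoordTendsto dp (cocompact ℂ) (algebraMap ℂ Gr Complex.I) ∧
    CoordTendsto dm (cocompact ℂ) (algebraMap ℂ Gr Complex.I)

/-- The further normalization at infinity used for a single tube: `w² (w̃(w, 0, 0) - 1/w) → 0`
and `w ρ̃⁺(w, 0, 0) → 0`, `w ρ̃⁻(w, 0, 0) → 0` as `w → ∞`. -/
def OneTubeNormalized (H : Pt → Pt) : Prop :=
  CoordTendsto (fun w : ℂ => w ^ 2 • ((H (Pt.ofComplex w)).z - algebraMap ℂ Gr w⁻¹))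
    (cocompact ℂ) 0 ∧
  CoordTendsto (fun w : ℂ => w • (H (Pt.ofComplex w)).tp) (cocompact ℂ) 0 ∧
  CoordTendsto (fun w : ℂ => w • (H (Pt.ofComplex w)).tm) (cocompact ℂ) 0

/-- `H` vanishes at `x = (z, θ⁺, θ⁻)`, and `H(w, θ⁺, θ⁻)/(w - z)` tends, as `w → z`, to a point
whose even coordinate is invertible. -/
def VanishesWithInvertibleLimit (H : Pt → Pt) (x : Pt) : Prop :=
  H x = 0 ∧ ∃ c : Pt, IsUnit c.z ∧
    CoordTendsto (fun t : ℂ => t⁻¹ • (H (x.addComplex t)).z) (𝓝[≠] 0) c.z ∧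
    CoordTendsto (fun t : ℂ => t⁻¹ • (H (x.addComplex t)).tp) (𝓝[≠] 0) c.tp ∧
    CoordTendsto (fun t : ℂ => t⁻¹ • (H (x.addComplex t)).tm) (𝓝[≠] 0) c.tm

/-- The southern coordinates of the positively oriented punctures of a canonical supersphere: the
given ones, and finally `0`. -/
def positions {m : ℕ} (x : Fin m → Pt) : Fin (m + 1) → Pt := Fin.snoc (α := fun _ => Pt) x 0

/-- The local coordinate expressed in the southern coordinate. -/
def inSouth (Ω : OpenPartialHomeomorph Sphere Pt) (p : Pt) : Pt := Ω (south.symm p)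

/-- Canonical superspheres with tubes. With one tube, the puncture is at infinity, and the local
coordinate is defined on a disc and normalized by `NormalizedAtInfinity` and `OneTubeNormalized`.
With `1 + (m + 1)` tubes, the outgoing puncture is at infinity, the last puncture is at zero, the
others are at points with invertible even coordinate, and the local coordinates are defined on
discs, the one at infinity being normalized by `NormalizedAtInfinity`. -/
def IsCanonical : {n : ℕ} → Tubed n → Prop
  | 0, T => T.pt 0 = north.symm 0 ∧
      (∃ r : ℝ, 0 < r ∧ (T.chart 0).source = north.symm '' ball 0 r) ∧
      NormalizedAtInfinity (inSouth (T.chart 0)) ∧ OneTubeNormalized (inSouth (T.chart 0))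
  | m + 1, T => ∃ (x : Fin m → Pt) (r : Fin (m + 2) → ℝ),
      (∀ j, IsUnit (x j).z) ∧ (∀ j k, j ≠ k → (x j).body ≠ (x k).body) ∧ (∀ k, 0 < r k) ∧
      T.pt 0 = north.symm 0 ∧
      (∀ j : Fin (m + 1), T.pt j.succ = south.symm (positions x j)) ∧
      (T.chart 0).source = north.symm '' ball 0 (r 0) ∧
      (∀ j : Fin (m + 1),
        (T.chart j.succ).source = south.symm '' ball (positions x j) (r j.succ)) ∧
      NormalizedAtInfinity (inSouth (T.chart 0)) ∧
      ∀ j : Fin (m + 1),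
        VanishesWithInvertibleLimit (inSouth (T.chart j.succ)) (positions x j)

/-- Two spheres with tubes have the same punctures, and local coordinates with the same germs at
the punctures. Canonical superspheres related in this way differ only in the radii of the discs
to which the local coordinates are restricted. -/
def SameGerms {n : ℕ} (T T' : Tubed n) : Prop :=
  ∀ j, T.pt j = T'.pt j ∧
    ∃ W : Set Sphere, IsOpen W ∧ T.pt j ∈ W ∧ W ⊆ (T.chart j).source ∧
      W ⊆ (T'.chart j).source ∧ ∀ x ∈ W, T.chart j x = T'.chart j x

theorem sameGerms_equivalence (n : ℕ) : Equivalence (SameGerms (n := n)) where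
  refl T j := ⟨rfl, (T.chart j).source, (T.chart j).open_source, T.mem_source j,
    subset_rfl, subset_rfl, fun _ _ => rfl⟩
  symm h j := by
    obtain ⟨e, W, h1, h2, h3, h4, h5⟩ := h j
    exact ⟨e.symm, W, h1, e ▸ h2, h4, h3, fun x hx => (h5 x hx).symm⟩
  trans h h' j := by
    obtain ⟨e, W, h1, h2, h3, h4, h5⟩ := h j
    obtain ⟨e', W', h1', h2', h3', h4', h5'⟩ := h' j
    exact ⟨e.trans e', W ∩ W', h1.inter h1', ⟨h2, e ▸ h2'⟩, fun x hx => h3 hx.1,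
      fun x hx => h4' hx.2, fun x hx => (h5 x hx.1).trans (h5' x hx.2)⟩

/-- The canonical superspheres with `1 + n` tubes, up to `SameGerms`. -/
def canonicalSetoid (n : ℕ) : Setoid {T : Tubed n // IsCanonical T} where
  r T T' := SameGerms T.1 T'.1
  iseqv := ⟨fun T => (sameGerms_equivalence n).refl T.1,
    fun h => (sameGerms_equivalence n).symm h, fun h h' => (sameGerms_equivalence n).trans h h'⟩

/-- The set of canonical superspheres with `1 + n` tubes. -/
def CanonicalSphere (n : ℕ) : Type := Quotient (canonicalSetoid n)

/-! ## Superconformal power series -/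

/-- The data of an invertible superconformal power series vanishing at zero:
`g^±(w) = Σ_j a^±_j w^j` and `ψ^±(w) = Σ_j m^±_{j+1/2} w^{j+1}`. Here `mp j`, `mm j` stand for
`m^±_{j+1/2}`. The series itself is given by `evenTerm`, `plusTerm`, `minusTerm`. -/
@[ext] structure LocalSeries where
  ap : ℕ → Gr
  am : ℕ → Gr
  mp : ℕ → Gr
  mm : ℕ → Gr
  ap_even : ∀ j, ap j ∈ evenPart
  am_even : ∀ j, am j ∈ evenPart
  mp_odd : ∀ j, mp j ∈ oddPart
  mm_odd : ∀ j, mm j ∈ oddPart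
  ap_unit : IsUnit (ap 0)
  am_unit : IsUnit (am 0)

/-- The family `x` is absolutely summable with sum `s`, coefficient by coefficient. (For families
of complex numbers `HasSum` is absolute summability.) -/
def AbsHasSum {ι : Type} (x : ι → Gr) (s : Gr) : Prop :=
  ∀ k, HasSum (fun i => coord k (x i)) (coord k s)

/-- The terms of the double series for the even coordinate `z̃`, that is of
`f(z) + θ⁺ g⁺(z) ψ⁻(z) + θ⁻ g⁻(z) ψ⁺(z) + θ⁺ θ⁻ (ψ⁺ ψ⁻)'(z)`, where
`f' = (ψ⁺)' ψ⁻ - ψ⁺ (ψ⁻)' + g⁺ g⁻` and `f(0) = 0`. -/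
def LocalSeries.evenTerm (K : LocalSeries) (p : Pt) (i : ℕ × ℕ) : Gr :=
  ((1 : ℂ) / (i.1 + i.2 + 1)) • (K.ap i.1 * K.am i.2 * p.z ^ (i.1 + i.2 + 1)) +
  (((i.1 : ℂ) - i.2) / (i.1 + i.2 + 2)) • (K.mp i.1 * K.mm i.2 * p.z ^ (i.1 + i.2 + 2)) +
  p.tp * K.ap i.1 * K.mm i.2 * p.z ^ (i.1 + i.2 + 1) +
  p.tm * K.am i.1 * K.mp i.2 * p.z ^ (i.1 + i.2 + 1) +
  ((i.1 : ℂ) + i.2 + 2) • (p.tp * p.tm * K.mp i.1 * K.mm i.2 * p.z ^ (i.1 + i.2 + 1))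

/-- The terms of the series `θ̃⁺ = ψ⁺(z) + θ⁺ g⁺(z) + θ⁺ θ⁻ (ψ⁺)'(z)`. -/
def LocalSeries.plusTerm (K : LocalSeries) (p : Pt) (j : ℕ) : Gr :=
  K.mp j * p.z ^ (j + 1) + p.tp * K.ap j * p.z ^ j +
    ((j : ℂ) + 1) • (p.tp * p.tm * K.mp j * p.z ^ j)

/-- The terms of the series `θ̃⁻ = ψ⁻(z) + θ⁻ g⁻(z) - θ⁺ θ⁻ (ψ⁻)'(z)`. -/
def LocalSeries.minusTerm (K : LocalSeries) (p : Pt) (j : ℕ) : Gr :=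
  K.mm j * p.z ^ (j + 1) + p.tm * K.am j * p.z ^ j -
    ((j : ℂ) + 1) • (p.tp * p.tm * K.mm j * p.z ^ j)

/-- The superconformal power series converges absolutely at `p`, and its value there is `y`. -/
def LocalSeries.EvalsTo (K : LocalSeries) (p y : Pt) : Prop :=
  AbsHasSum (K.evenTerm p) y.z ∧ AbsHasSum (K.plusTerm p) y.tp ∧ AbsHasSum (K.minusTerm p) y.tm

/-- The series `g^±` and `ψ^±` converge absolutely, with sums in the Grassmann algebra, in a
DeWitt neighborhood of zero. -/
def LocalSeries.Converges (K : LocalSeries) : Prop :=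
  ∃ r : ℝ, 0 < r ∧ ∀ z ∈ evenPart, ‖body z‖ < r →
    (∃ s, AbsHasSum (fun j => K.ap j * z ^ j) s) ∧
    (∃ s, AbsHasSum (fun j => K.am j * z ^ j) s) ∧
    (∃ s, AbsHasSum (fun j => K.mp j * z ^ (j + 1)) s) ∧
    (∃ s, AbsHasSum (fun j => K.mm j * z ^ (j + 1)) s)

/-- The local coordinate `Ω` is, in the southern coordinate, the sum of the series `K` at the
shifted argument, near the point with coordinate `x`. -/
def ExpandsAt (Ω : OpenPartialHomeomorph Sphere Pt) (x : Pt) (K : LocalSeries) : Prop :=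
  ∃ r : ℝ, 0 < r ∧ ∀ p ∈ ball x r,
    south.symm p ∈ Ω.source ∧ K.EvalsTo (shift x p) (inSouth Ω p)

/-- The local coordinate `Ω` is, in the southern coordinate `(w, ρ⁺, ρ⁻)`, the sum of the series
`K` at `(1/w, iρ⁺/w, iρ⁻/w)`, near infinity. -/
def ExpandsAtInfinity (Ω : OpenPartialHomeomorph Sphere Pt) (K : LocalSeries) : Prop :=
  ∃ R : ℝ, 0 < R ∧ ∀ p : Pt, R < ‖p.body‖ →
    south.symm p ∈ Ω.source ∧ K.EvalsTo (invI p) (inSouth Ω p)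

/-- The tuples `((z_1, θ_1⁺, θ_1⁻), …, (z_m, θ_m⁺, θ_m⁻); H_0, …, H_{m+1})` that describe the
spheres with `1 + (m + 1)` tubes. The series `H_0` at infinity is `H 0` composed with `invI`; its
normalization says that the coefficient of `ρ^± w⁻¹` in `H_0^±` is `i`. The series at the `j`-th
positively oriented puncture is `H j.succ` composed with the shift of that puncture to zero. -/
@[ext] structure ModuliData (m : ℕ) where
  x : Fin m → Pt
  unit : ∀ j, IsUnit (x j).z
  distinct : ∀ j k, j ≠ k → (x j).body ≠ (x k).body
  H : Fin (m + 2) → LocalSeries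
  converges : ∀ k, (H k).Converges
  normalized_plus : (H 0).ap 0 = 1
  normalized_minus : (H 0).am 0 = 1

/-- The series that describe the spheres with one tube: normalized series `H_0` at infinity, with
`a_1⁺ = -a_1⁻` and `m_{1/2}^± = 0`. As above `H_0` is `K` composed with `invI`. -/
@[ext] structure OneTubeData where
  K : LocalSeries
  converges : K.Converges
  normalized_plus : K.ap 0 = 1
  normalized_minus : K.am 0 = 1
  a_one : K.ap 1 = -K.am 1
  mp_zero : K.mp 0 = 0
  mm_zero : K.mm 0 = 0

/-- The canonical supersphere `T` has the data `d`. -/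
def HasData {m : ℕ} (T : Tubed (m + 1)) (d : ModuliData m) : Prop :=
  IsCanonical T ∧
  (∀ j : Fin (m + 1), T.pt j.succ = south.symm (positions d.x j)) ∧
  ExpandsAtInfinity (T.chart 0) (d.H 0) ∧
  ∀ j : Fin (m + 1), ExpandsAt (T.chart j.succ) (positions d.x j) (d.H j.succ)

/-- The canonical supersphere `T` with one tube has the data `d`. -/
def HasOneTubeData (T : Tubed 0) (d : OneTubeData) : Prop :=
  IsCanonical T ∧ ExpandsAtInfinity (T.chart 0) d.K

end

end NTwo

/-!
# Canonical `N = 2` super-Riemann spheres with tubes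

The two parts of the theorem are a uniqueness and existence statement for canonical
representatives, and the identification of germs of superconformal coordinates with convergent
superconformal power series. Both are reduced to statements about functions of one complex
variable by testing identities on odd elements: a Grassmann element that is killed by all odd
elements vanishes (`cancel_odd`), since it involves only finitely many generators.

*Superconformality.* The superderivations `D^±` generate the odd translations
`(z + εθ⁻, θ⁺ + ε, θ⁻)` and `(z + εθ⁺, θ⁺, θ⁻ + ε)`. A superanalytic map is superconformal exactly
when it carries each translation by `ε` into a translation by `ε` times an even factor, `D⁺θ̃⁺` or
`D⁻θ̃⁻` (`IsDP`, `IsDM`, `preLSC_of_superFn`, `superconformalOn_of_lsc`). This formulation needs no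
chain rule and is evidently stable under composition and inversion (`LSC.comp`, `lsc_inverse`).
Here superanalytic germs are spanned by the products of odd variables, continued analytic
functions and constants (`SA`), and composition is possible because an even superanalytic function
is an analytic one plus finitely many functions of square zero (`SA.even_decomp`, `SA.hat_comp`).

*Germs and power series.* Solving the superconformality equations component by component gives the
normal form in terms of `f`, `g^±`, `ψ^±` (`exists_scForm`), and conversely the normal form is
superconformal (`SCForm.lsc`). Expanding the components in Taylor series, which converge absolutely
in the Grassmann algebra, and integrating the double series for `f'` termwise identifies the
superconformal germs that vanish at zero with the convergent superconformal power series
(`exists_hasSeries`, `LocalSeries.Converges.exists_hasSeries`, `HasSeries.evalsTo`,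
`LocalSeries.unique`). Such a germ is invertible on a disc (`SCForm.exists_chart`): up to
the body parts it is a contraction for the filtration by powers of a finitely generated nilpotent
ideal, so a fixed finite number of iterations solves `H x = y` exactly (`exists_inverse`).

*Automorphisms.* The inversion, the scalings `(abz, aθ⁺, bθ⁻)` and the shifts that move a given
finite point to zero are automorphisms of the super-Riemann sphere (`exists_inversion`,
`exists_scaling`, `exists_shift`). They move `p_0` to infinity and `p_n` to zero, and scale
`a_0^±` to one; with a single tube a shift is left, which removes `m_{1/2}^±` and `a_1⁺ + a_1⁻`
(`exists_canonical`). The limits in the definition of a canonical supersphere are these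
coefficients (`normalizedAtInfinity_iff`, `oneTubeNormalized_iff`), and the condition at the other
punctures holds for every superconformal coordinate (`vanishesWithInvertibleLimit`).
Conversely, an automorphism that preserves the normalization fixes infinity to first order, and
moreover zero, or infinity to second order. By Liouville's theorem its components are
polynomials of degree at most one, and it is the identity (`IsSCHomeo.rigid`,
`eq_id_of_normalized`). Hence equivalent canonical superspheres have the same germs
(`sameGerms_of_equivalent`), and these are recorded by the punctures and the power series
(`hasData_iff`, `sameGerms_iff_data`, `exists_tubed_hasData`).
-/

namespace NTwo

noncomputable section

open scoped Topology
open Filter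

/-! ### The Grassmann algebra: signs, cancellation, nilpotents -/

/-- The homogeneous part of the Grassmann algebra of parity `d`. -/
abbrev gr (d : ZMod 2) : Submodule ℂ Gr :=
  CliffordAlgebra.evenOdd (0 : QuadraticForm ℂ (ℕ →₀ ℂ)) d

/-- The sign with which elements of parities `d` and `e` commute. -/
def sgn (d e : ZMod 2) : ℂ := if d = 1 ∧ e = 1 then -1 else 1

/-- The generator `ζ_n`. -/
def zeta (n : ℕ) : Gr := ExteriorAlgebra.ι ℂ (Finsupp.single n 1)

theorem iota_odd (v : ℕ →₀ ℂ) : ExteriorAlgebra.ι ℂ v ∈ oddPart :=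
  CliffordAlgebra.ι_mem_evenOdd_one _ v

theorem zeta_odd (n : ℕ) : zeta n ∈ oddPart := iota_odd _

theorem gr_mul {d e : ZMod 2} {a b : Gr} (ha : a ∈ gr d) (hb : b ∈ gr e) : a * b ∈ gr (d + e) :=
  CliffordAlgebra.evenOdd_mul_le (0 : QuadraticForm ℂ (ℕ →₀ ℂ)) d e (Submodule.mul_mem_mul ha hb)

theorem gr_pow {d : ZMod 2} {a : Gr} (ha : a ∈ gr d) (n : ℕ) : a ^ n ∈ gr (n * d) := by
  induction n with
  | zero => rw [pow_zero, Nat.cast_zero, zero_mul]; exact one_mem_even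
  | succ n ih =>
    have := gr_mul ih ha
    rw [pow_succ]
    convert this using 2
    push_cast; ring

theorem even_or_odd (d : ZMod 2) : d = 0 ∨ d = 1 := by
  revert d; decide

theorem odd_anticomm {a b : Gr} (ha : a ∈ oddPart) (hb : b ∈ oddPart) : a * b = -(b * a) := by
  induction a, ha using CliffordAlgebra.odd_induction with
  | ι v =>
    induction b, hb using CliffordAlgebra.odd_induction with
    | ι w => exact eq_neg_of_add_eq_zero_left (ExteriorAlgebra.ι_add_mul_swap (R := ℂ) v w)
    | add x y hx hy h1 h2 => rw [mul_add, h1, h2, add_mul, neg_add]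
    | ι_mul_ι_mul m₁ m₂ x hx h =>
      have hm := even_commute (CliffordAlgebra.ι_mul_ι_mem_evenOdd_zero
        (0 : QuadraticForm ℂ (ℕ →₀ ℂ)) m₁ m₂) (CliffordAlgebra.ι 0 v)
      rw [← mul_assoc, ← hm.eq, mul_assoc, h, mul_neg, ← mul_assoc]
  | add x y hx hy h1 h2 => rw [mul_add, add_mul, h1, h2, neg_add]
  | ι_mul_ι_mul m₁ m₂ x hx h =>
    have hm := even_commute (CliffordAlgebra.ι_mul_ι_mem_evenOdd_zero
      (0 : QuadraticForm ℂ (ℕ →₀ ℂ)) m₁ m₂) b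
    rw [mul_assoc, h, mul_neg, ← mul_assoc, hm.eq, mul_assoc]

theorem odd_sq {a : Gr} (ha : a ∈ oddPart) : a * a = 0 := by
  have h := odd_anticomm ha ha
  have h2 : (2 : ℂ) • (a * a) = 0 := by
    rw [two_smul]; exact add_eq_zero_iff_eq_neg.2 h
  exact (smul_eq_zero.1 h2).resolve_left two_ne_zero

theorem gr_comm {d e : ZMod 2} {a b : Gr} (ha : a ∈ gr d) (hb : b ∈ gr e) :
    a * b = sgn d e • (b * a) := by
  rcases even_or_odd d with rfl | rfl
  · simpa [sgn] using (even_commute ha b).eq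
  rcases even_or_odd e with rfl | rfl
  · simpa [sgn] using (even_commute hb a).eq.symm
  · simpa [sgn] using odd_anticomm ha hb

theorem gr_decomp (a : Gr) : ∃ a0 ∈ evenPart, ∃ a1 ∈ oddPart, a = a0 + a1 := by
  have hc := CliffordAlgebra.evenOdd_isCompl (0 : QuadraticForm ℂ (ℕ →₀ ℂ))
  have ht : a ∈ evenPart ⊔ oddPart := by
    have : evenPart ⊔ oddPart = ⊤ := hc.sup_eq_top
    rw [this]; trivial
  obtain ⟨u, hu0, v, hv1, huv⟩ := Submodule.mem_sup.1 ht
  exact ⟨u, hu0, v, hv1, huv.symm⟩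

theorem even_odd_zero {a : Gr} (h0 : a ∈ evenPart) (h1 : a ∈ oddPart) : a = 0 :=
  Submodule.disjoint_def.1
    (CliffordAlgebra.evenOdd_isCompl (0 : QuadraticForm ℂ (ℕ →₀ ℂ))).disjoint _ h0 h1

/-- An element involves only finitely many generators, so it is killed by contraction with all
but finitely many dual generators. -/
theorem eventually_contract (a : Gr) :
    ∀ᶠ n in atTop, CliffordAlgebra.contractLeft (Q := (0 : QuadraticForm ℂ (ℕ →₀ ℂ)))
      (Finsupp.lapply n : (ℕ →₀ ℂ) →ₗ[ℂ] ℂ) a = 0 := by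
  induction a using CliffordAlgebra.left_induction with
  | algebraMap r => simp
  | add x y hx hy => filter_upwards [hx, hy] with n h1 h2; rw [map_add, h1, h2, add_zero]
  | ι_mul x m hx =>
    have hm : ∀ᶠ n in atTop, m n = 0 := by
      filter_upwards [eventually_gt_atTop (m.support.sup id)] with n hn
      by_contra h
      have := Finset.le_sup (f := id) (Finsupp.mem_support_iff.2 h)
      exact absurd this (not_le.2 hn)
    filter_upwards [hx, hm] with n h1 h2
    rw [CliffordAlgebra.contractLeft_ι_mul, h1]
    simp [h2]

/-- All but finitely many generators may be cancelled from `ζ_n a = 0`: contract with the dual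
generator. Odd elements thus serve as test elements for identities. -/
theorem eventually_zeta_mul (a : Gr) : ∀ᶠ n in atTop, zeta n * a = 0 → a = 0 := by
  filter_upwards [eventually_contract a] with n hn h
  have := CliffordAlgebra.contractLeft_ι_mul (Q := (0 : QuadraticForm ℂ (ℕ →₀ ℂ)))
      (Finsupp.lapply n : (ℕ →₀ ℂ) →ₗ[ℂ] ℂ) (Finsupp.single n 1) a
  rw [hn] at this
  change CliffordAlgebra.contractLeft (Finsupp.lapply n : (ℕ →₀ ℂ) →ₗ[ℂ] ℂ) (zeta n * a) = _ at this
  rw [h] at this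
  simpa using this.symm

theorem cancel_odd {a : Gr} (h : ∀ e ∈ oddPart, e * a = 0) : a = 0 := by
  obtain ⟨n, hn⟩ := (eventually_zeta_mul a).exists
  exact hn (h _ (zeta_odd n))

theorem cancel_odd_eq {a b : Gr} (h : ∀ e ∈ oddPart, e * a = e * b) : a = b := by
  rw [← sub_eq_zero]
  exact cancel_odd fun e he => by rw [mul_sub, h e he, sub_self]

/-- Products of two odd test elements also detect zero. -/
theorem cancel_odd_odd {a : Gr} (h : ∀ e ∈ oddPart, ∀ e' ∈ oddPart, e * e' * a = 0) : a = 0 := by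
  refine cancel_odd fun e' he' => cancel_odd fun e he => ?_
  rw [← mul_assoc, h e he e' he']

theorem body_algebraMap (c : ℂ) : body (algebraMap ℂ Gr c) = c := by simp

theorem body_iota (v : ℕ →₀ ℂ) : body (ExteriorAlgebra.ι ℂ v) = 0 := by
  simp [body, ExteriorAlgebra.algebraMapInv]

theorem body_odd {a : Gr} (ha : a ∈ oddPart) : body a = 0 := by
  have h : body a * body a = 0 := by rw [← map_mul, odd_sq ha, map_zero]
  exact mul_self_eq_zero.1 h

theorem body_of_sq {a : Gr} (ha : a * a = 0) : body a = 0 := by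
  have h : body a * body a = 0 := by rw [← map_mul, ha, map_zero]
  exact mul_self_eq_zero.1 h

theorem even_pow {a : Gr} (ha : a ∈ evenPart) (n : ℕ) : a ^ n ∈ evenPart := by
  induction n with
  | zero => simpa using one_mem_even
  | succ n ih => rw [pow_succ]; exact even_mul_even ih ha

theorem even_mul_sq {a b : Gr} (ha : a ∈ evenPart) (hb : b * b = 0) : (a * b) * (a * b) = 0 := by
  rw [mul_assoc, ← mul_assoc b, ← (even_commute ha b).eq, mul_assoc, hb, mul_zero, mul_zero]

theorem odd_mul_sq {a b : Gr} (ha : a ∈ oddPart) (hb : b ∈ oddPart) : (a * b) * (a * b) = 0 := by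
  rw [mul_assoc, ← mul_assoc b, odd_anticomm hb ha, neg_mul, mul_assoc a b b, odd_sq hb, mul_zero,
    neg_zero, mul_zero]

/-- An even element is its body plus a sum of even elements of square zero. -/
theorem even_list {a : Gr} (ha : a ∈ evenPart) :
    ∃ l : List Gr, (∀ x ∈ l, x ∈ evenPart ∧ x * x = 0) ∧ a = algebraMap ℂ Gr (body a) + l.sum := by
  induction a, ha using CliffordAlgebra.even_induction with
  | algebraMap r => exact ⟨[], by simp, by
      rw [List.sum_nil, add_zero]; exact congrArg _ (body_algebraMap r).symm⟩
  | add x y hx hy h1 h2 =>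
    obtain ⟨l1, h1, e1⟩ := h1
    obtain ⟨l2, h2, e2⟩ := h2
    refine ⟨l1 ++ l2, fun z hz => (List.mem_append.1 hz).elim (h1 z) (h2 z), ?_⟩
    rw [List.sum_append, map_add body, map_add]
    nth_rewrite 1 [e1, e2]
    abel
  | ι_mul_ι_mul m₁ m₂ x hx h =>
    obtain ⟨l, h, e⟩ := h
    set m : Gr := ExteriorAlgebra.ι ℂ m₁ * ExteriorAlgebra.ι ℂ m₂ with hmdef
    have hm : m ∈ evenPart := odd_mul_odd (iota_odd m₁) (iota_odd m₂)
    have hm2 : m * m = 0 := odd_mul_sq (iota_odd m₁) (iota_odd m₂)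
    refine ⟨(body x • m) :: l.map (m * ·), ?_, ?_⟩
    · intro z hz
      rcases List.mem_cons.1 hz with rfl | hz
      · exact ⟨Submodule.smul_mem _ _ hm, by rw [smul_mul_smul_comm, hm2, smul_zero]⟩
      · obtain ⟨y, hy, rfl⟩ := List.mem_map.1 hz
        exact ⟨even_mul_even hm (h y hy).1, even_mul_sq hm (h y hy).2⟩
    · have hb : body (m * x) = 0 := by rw [map_mul, body_of_sq hm2, zero_mul]
      change m * x = algebraMap ℂ Gr (body (m * x)) + _
      rw [hb, map_zero, zero_add, List.sum_cons, List.sum_map_mul_left]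
      nth_rewrite 1 [e]
      rw [mul_add, Algebra.smul_def, (Algebra.commutes (body x) m)]
      simp

/-- Induction on even elements: from complex numbers, by adding elements of square zero. -/
theorem even_ind {p : ∀ a : Gr, a ∈ evenPart → Prop}
    (h0 : ∀ c : ℂ, p (algebraMap ℂ Gr c) (algebraMap_mem_even c))
    (h1 : ∀ a n (ha : a ∈ evenPart) (hn : n ∈ evenPart), n * n = 0 → p a ha →
      p (a + n) (Submodule.add_mem _ ha hn))
    (a : Gr) (ha : a ∈ evenPart) : p a ha := by
  suffices h : ∃ h, p a h from h.2
  obtain ⟨l, hl, e⟩ := even_list ha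
  rw [e]
  generalize body a = c
  clear e ha
  have key : ∀ (l : List Gr), (∀ x ∈ l, x ∈ evenPart ∧ x * x = 0) →
      ∃ h, p (algebraMap ℂ Gr c + l.sum) h := by
    intro l
    induction l with
    | nil =>
      intro _
      simp only [List.sum_nil, add_zero]
      exact ⟨algebraMap_mem_even c, h0 c⟩
    | cons x l ih =>
      intro hl
      obtain ⟨i1, i2⟩ := ih fun y hy => hl y (List.mem_cons_of_mem _ hy)
      obtain ⟨x1, x2⟩ := hl x List.mem_cons_self
      rw [List.sum_cons, add_comm x, ← add_assoc]
      exact ⟨_, h1 _ _ i1 x1 x2 i2⟩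
  exact key l hl

/-! ### The basis of monomials -/

theorem grBasis_empty : grBasis ∅ = 1 := by
  have h := ExteriorAlgebra.basis_apply_ofCard
    (Finsupp.basisSingleOne : Module.Basis ℕ ℂ (ℕ →₀ ℂ)) (s := ∅) (n := 0) rfl
  rw [grBasis, h]
  simp [ExteriorAlgebra.ιMulti_family, ExteriorAlgebra.ιMulti_apply]

theorem grBasis_mem (k : Finset ℕ) : grBasis k ∈ gr k.card := by
  have h := ExteriorAlgebra.basis_apply_ofCard
    (Finsupp.basisSingleOne : Module.Basis ℕ ℂ (ℕ →₀ ℂ)) (s := k) rfl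
  rw [grBasis, h, ExteriorAlgebra.ιMulti_family, ExteriorAlgebra.ιMulti_apply]
  suffices h : ∀ (n : ℕ) (v : Fin n → ℕ →₀ ℂ),
      (List.ofFn fun i => ExteriorAlgebra.ι ℂ (v i)).prod ∈ gr n from h _ _
  intro n v
  induction n with
  | zero => rw [Nat.cast_zero, List.ofFn_zero, List.prod_nil]; exact one_mem_even
  | succ n ih =>
    rw [List.ofFn_succ, List.prod_cons]
    have := gr_mul (iota_odd (v 0)) (ih fun i => v i.succ)
    convert this using 2
    push_cast; ring

theorem grBasis_mem_even {k : Finset ℕ} (hk : Even k.card) : grBasis k ∈ evenPart := by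
  have := grBasis_mem k
  rwa [(ZMod.natCast_eq_zero_iff_even).2 hk] at this

theorem grBasis_mem_odd {k : Finset ℕ} (hk : Odd k.card) : grBasis k ∈ oddPart := by
  have := grBasis_mem k
  rwa [(ZMod.natCast_eq_one_iff_odd).2 hk] at this

theorem coord_grBasis (k l : Finset ℕ) : coord k (grBasis l) = if l = k then 1 else 0 := by
  simp [coord, Finsupp.single_apply]

theorem gr_ext {a b : Gr} (h : ∀ k, coord k a = coord k b) : a = b :=
  grBasis.ext_elem h

theorem coord_finite (a : Gr) : {k | coord k a ≠ 0}.Finite := by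
  refine (grBasis.repr a).support.finite_toSet.subset fun k hk => ?_
  exact Finsupp.mem_support_iff.2 hk

theorem sum_coord {a : Gr} {S : Finset (Finset ℕ)} (h : ∀ k ∉ S, coord k a = 0) :
    a = ∑ k ∈ S, coord k a • grBasis k := by
  refine gr_ext fun l => ?_
  rw [map_sum]
  simp only [map_smul, coord_grBasis, smul_eq_mul, mul_ite, mul_one, mul_zero,
    Finset.sum_ite_eq']
  split_ifs with hl
  · rfl
  · exact h l hl

theorem exists_sum_coord (a : Gr) : ∃ S : Finset (Finset ℕ), (∀ k ∉ S, coord k a = 0) ∧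
    a = ∑ k ∈ S, coord k a • grBasis k := by
  have h : ∀ k ∉ (coord_finite a).toFinset, coord k a = 0 := by
    intro k hk; simpa using hk
  exact ⟨_, h, sum_coord h⟩

theorem coord_of_even {a : Gr} (ha : a ∈ evenPart) {k : Finset ℕ} (hk : Odd k.card) :
    coord k a = 0 := by
  obtain ⟨S, hS, e⟩ := exists_sum_coord a
  set o := ∑ l ∈ S with Odd l.card, coord l a • grBasis l with ho
  set v := ∑ l ∈ S with ¬ Odd l.card, coord l a • grBasis l with hv
  have hov : a = o + v := by rw [ho, hv, Finset.sum_filter_add_sum_filter_not]; exact e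
  have h1 : o ∈ oddPart := Submodule.sum_mem _ fun l hl =>
    Submodule.smul_mem _ _ (grBasis_mem_odd (Finset.mem_filter.1 hl).2)
  have h2 : v ∈ evenPart := Submodule.sum_mem _ fun l hl =>
    Submodule.smul_mem _ _ (grBasis_mem_even (Nat.not_odd_iff_even.1 (Finset.mem_filter.1 hl).2))
  have h3 : o = 0 := even_odd_zero (by
    rw [eq_sub_of_add_eq hov.symm]; exact Submodule.sub_mem _ ha h2) h1
  rw [hov, h3, zero_add, hv, map_sum]
  refine Finset.sum_eq_zero fun l hl => ?_
  rw [map_smul, coord_grBasis, if_neg, smul_zero]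
  rintro rfl
  exact (Finset.mem_filter.1 hl).2 hk

theorem coord_of_odd {a : Gr} (ha : a ∈ oddPart) {k : Finset ℕ} (hk : Even k.card) :
    coord k a = 0 := by
  obtain ⟨S, hS, e⟩ := exists_sum_coord a
  set o := ∑ l ∈ S with Even l.card, coord l a • grBasis l with ho
  set v := ∑ l ∈ S with ¬ Even l.card, coord l a • grBasis l with hv
  have hov : a = o + v := by rw [ho, hv, Finset.sum_filter_add_sum_filter_not]; exact e
  have h1 : o ∈ evenPart := Submodule.sum_mem _ fun l hl =>
    Submodule.smul_mem _ _ (grBasis_mem_even (Finset.mem_filter.1 hl).2)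
  have h2 : v ∈ oddPart := Submodule.sum_mem _ fun l hl =>
    Submodule.smul_mem _ _ (grBasis_mem_odd (Nat.not_even_iff_odd.1 (Finset.mem_filter.1 hl).2))
  have h3 : o = 0 := even_odd_zero h1 (by
    rw [eq_sub_of_add_eq hov.symm]; exact Submodule.sub_mem _ ha h2)
  rw [hov, h3, zero_add, hv, map_sum]
  refine Finset.sum_eq_zero fun l hl => ?_
  rw [map_smul, coord_grBasis, if_neg, smul_zero]
  rintro rfl
  exact (Finset.mem_filter.1 hl).2 hk

theorem body_grBasis {k : Finset ℕ} (hk : k ≠ ∅) : body (grBasis k) = 0 := by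
  obtain ⟨n, hn⟩ : ∃ n, k.card = n + 1 := Nat.exists_eq_succ_of_ne_zero (by simpa using hk)
  have h := ExteriorAlgebra.basis_apply_ofCard
    (Finsupp.basisSingleOne : Module.Basis ℕ ℂ (ℕ →₀ ℂ)) hn
  rw [grBasis, h, ExteriorAlgebra.ιMulti_family, ExteriorAlgebra.ιMulti_apply, List.ofFn_succ,
    List.prod_cons, map_mul, body_iota, zero_mul]

theorem coord_empty (a : Gr) : coord ∅ a = body a := by
  obtain ⟨S, hS, e⟩ := exists_sum_coord a
  conv_rhs => rw [e]
  rw [map_sum]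
  by_cases h : ∅ ∈ S
  · rw [Finset.sum_eq_single_of_mem ∅ h, map_smul, grBasis_empty, map_one, smul_eq_mul, mul_one]
    intro k _ hk
    rw [map_smul, body_grBasis hk, smul_zero]
  · rw [Finset.sum_eq_zero, hS _ h]
    intro k hk
    rw [map_smul, body_grBasis (fun hk' => h (hk' ▸ hk)), smul_zero]

/-! ### Nilpotent ideals generated by finitely many generators -/

/-- The span of the first `L` generators. -/
def genSpan (L : ℕ) : Submodule ℂ Gr := Submodule.span ℂ (zeta '' Set.Iio L)

/-- The `k`-th power of the ideal generated by the first `L` generators. -/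
def nilIdeal (L k : ℕ) : Submodule ℂ Gr := genSpan L ^ k * ⊤

theorem top_mul_genSpan (L : ℕ) : ⊤ * genSpan L ≤ genSpan L * ⊤ := by
  rw [Submodule.mul_le]
  intro a _ b hb
  obtain ⟨a0, h0, a1, h1, rfl⟩ := gr_decomp a
  have hbo : b ∈ oddPart := by
    refine Submodule.span_le.2 ?_ hb
    rintro _ ⟨n, -, rfl⟩
    exact zeta_odd n
  rw [add_mul, (even_commute h0 b).eq, odd_anticomm h1 hbo, ← mul_neg, ← mul_add]
  exact Submodule.mul_mem_mul hb trivial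

theorem top_mul_top : (⊤ : Submodule ℂ Gr) * ⊤ = ⊤ :=
  eq_top_iff.2 fun a _ => by
    rw [← one_mul a]; exact Submodule.mul_mem_mul trivial trivial

theorem top_mul_genSpan_pow (L k : ℕ) : ⊤ * genSpan L ^ k ≤ genSpan L ^ k * ⊤ := by
  induction k with
  | zero => simp
  | succ k ih =>
    calc ⊤ * genSpan L ^ (k + 1) = (⊤ * genSpan L ^ k) * genSpan L := by rw [pow_succ, mul_assoc]
      _ ≤ (genSpan L ^ k * ⊤) * genSpan L := mul_le_mul_left ih _
      _ = genSpan L ^ k * (⊤ * genSpan L) := mul_assoc _ _ _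
      _ ≤ genSpan L ^ k * (genSpan L * ⊤) := mul_le_mul_right (top_mul_genSpan L) _
      _ = _ := by rw [pow_succ, mul_assoc]

theorem nilIdeal_mul_mem {L j k : ℕ} {a b : Gr} (ha : a ∈ nilIdeal L j) (hb : b ∈ nilIdeal L k) :
    a * b ∈ nilIdeal L (j + k) := by
  have h : nilIdeal L j * nilIdeal L k ≤ nilIdeal L (j + k) :=
    calc nilIdeal L j * nilIdeal L k = genSpan L ^ j * (⊤ * genSpan L ^ k) * ⊤ := by
          simp only [nilIdeal, mul_assoc]
      _ ≤ genSpan L ^ j * (genSpan L ^ k * ⊤) * ⊤ :=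
          mul_le_mul_left (mul_le_mul_right (top_mul_genSpan_pow L k) _) _
      _ = _ := by simp only [nilIdeal, mul_assoc, pow_add, top_mul_top]
  exact h (Submodule.mul_mem_mul ha hb)

theorem nilIdeal_zero (L : ℕ) : nilIdeal L 0 = ⊤ := by simp [nilIdeal]

theorem mul_nilIdeal {L k : ℕ} {a b : Gr} (hb : b ∈ nilIdeal L k) : a * b ∈ nilIdeal L k := by
  have := nilIdeal_mul_mem (L := L) (j := 0) (a := a) (by rw [nilIdeal_zero]; trivial) hb
  rwa [zero_add] at this

theorem nilIdeal_mul {L k : ℕ} {a b : Gr} (ha : a ∈ nilIdeal L k) : a * b ∈ nilIdeal L k :=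
  nilIdeal_mul_mem (L := L) (k := 0) (b := b) ha (by rw [nilIdeal_zero]; trivial)

theorem nilIdeal_bot (L : ℕ) : nilIdeal L (L + 1) = ⊥ := by
  have h : genSpan L ^ (L + 1) = ⊥ := by
    rw [genSpan, Submodule.span_pow, Submodule.span_eq_bot]
    intro x hx
    obtain ⟨f, rfl⟩ := Set.mem_pow.1 hx
    choose g hg using fun i => (f i).2
    have hni : ¬ Function.Injective g := by
      intro hi
      have : Fintype.card (Fin (L + 1)) ≤ Fintype.card (Fin L) :=
        Fintype.card_le_of_injective (fun i => (⟨g i, (hg i).1⟩ : Fin L)) fun i j hij => hi (by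
          exact congrArg (fun x : Fin L => (x : ℕ)) hij)
      simp at this
    have h2 : (fun i => ((f i : Gr))) = fun i => ExteriorAlgebra.ι ℂ (Finsupp.single (g i) (1:ℂ)) :=
      funext fun i => (hg i).2.symm
    rw [h2]
    rw [← ExteriorAlgebra.ιMulti_apply]
    refine AlternatingMap.map_eq_zero_of_not_injective _ _ fun hi => hni fun i j hij => hi ?_
    simp only [hij]
  rw [nilIdeal, h, Submodule.bot_mul]

theorem body_nilIdeal {L : ℕ} {a : Gr} (ha : a ∈ nilIdeal L 1) : body a = 0 := by
  have : nilIdeal L 1 ≤ LinearMap.ker body.toLinearMap := by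
    rw [nilIdeal, pow_one, Submodule.mul_le]
    intro x hx y _
    have hbo : x ∈ oddPart := by
      refine Submodule.span_le.2 ?_ hx
      rintro _ ⟨n, -, rfl⟩
      exact zeta_odd n
    simp [body_odd hbo]
  exact this ha

/-- Every element with body zero lies in the ideal generated by finitely many generators. -/
theorem eventually_mem_nilIdeal {a : Gr} (ha : body a = 0) :
    ∀ᶠ L in atTop, a ∈ nilIdeal L 1 := by
  suffices h : ∀ a : Gr, ∀ᶠ L in atTop, soul a ∈ nilIdeal L 1 by
    have e : soul a = a := by simp [soul, ha]
    rw [← e]; exact h a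
  clear ha a
  intro a
  induction a using CliffordAlgebra.left_induction with
  | algebraMap r => 
    refine Eventually.of_forall fun L => ?_
    have : soul (algebraMap ℂ Gr r) = 0 := by simp [soul]
    erw [this]; exact Submodule.zero_mem _
  | add x y hx hy =>
    filter_upwards [hx, hy] with L h1 h2
    have e : soul (x + y) = soul x + soul y := by
      simp only [soul, map_add]; abel
    rw [e]; exact Submodule.add_mem _ h1 h2
  | ι_mul x m hx =>
    filter_upwards [eventually_gt_atTop (m.support.sup id)] with L hL
    have e : soul (ExteriorAlgebra.ι ℂ m * x) = ExteriorAlgebra.ι ℂ m * x := by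
      simp [soul, body_iota]
    erw [e]
    rw [nilIdeal, pow_one]
    refine Submodule.mul_mem_mul ?_ trivial
    rw [← Finsupp.sum_single m, Finsupp.sum, map_sum]
    refine Submodule.sum_mem _ fun i hi => ?_
    have : Finsupp.single i (m i) = m i • Finsupp.single i (1 : ℂ) := by simp
    rw [this, map_smul]
    refine Submodule.smul_mem _ _ (Submodule.subset_span ⟨i, ?_, rfl⟩)
    exact lt_of_le_of_lt (Finset.le_sup (f := id) hi) hL

/-! ### Grassmann analytic continuation of functions of one complex variable -/

/-- The `n`-th Taylor coefficient of `φ` at `w`. -/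
def tc (φ : ℂ → ℂ) (w : ℂ) (n : ℕ) : ℂ := iteratedDeriv n φ w / (Nat.factorial n : ℂ)

/-- The Grassmann analytic continuation of `φ`, the value at `a` of the Taylor expansion of `φ`
about the body of `a`. -/
def hat (φ : ℂ → ℂ) (a : Gr) : Gr := ∑ᶠ l : ℕ, tc φ (body a) l • soul a ^ l

theorem tc_zero (φ : ℂ → ℂ) (w : ℂ) : tc φ w 0 = φ w := by simp [tc]

theorem tc_succ (φ : ℂ → ℂ) (w : ℂ) (n : ℕ) :
    ((n : ℂ) + 1) * tc φ w (n + 1) = tc (deriv φ) w n := by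
  have h : (Nat.factorial n : ℂ) ≠ 0 := Nat.cast_ne_zero.2 n.factorial_ne_zero
  have h' : (n : ℂ) + 1 ≠ 0 := by exact_mod_cast n.succ_ne_zero
  rw [tc, tc, iteratedDeriv_succ', Nat.factorial_succ]
  push_cast
  field_simp

theorem hat_eq_sum (φ : ℂ → ℂ) {a : Gr} {N : ℕ} (h : soul a ^ N = 0) :
    hat φ a = ∑ l ∈ Finset.range N, tc φ (body a) l • soul a ^ l := by
  refine finsum_eq_sum_of_support_subset _ fun l hl => ?_
  by_contra hl'
  have : N ≤ l := by simpa using hl'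
  apply hl
  simp only
  rw [← Nat.sub_add_cancel this, pow_add, h, mul_zero, smul_zero]

theorem hat_algebraMap (φ : ℂ → ℂ) (c : ℂ) :
    hat φ (algebraMap ℂ Gr c) = algebraMap ℂ Gr (φ c) := by
  have h : soul (algebraMap ℂ Gr c) = 0 := by simp [soul]
  rw [hat_eq_sum φ (N := 1) (by rw [h, pow_one]), body_algebraMap]
  simp [tc_zero, Algebra.algebraMap_eq_smul_one]

theorem body_add_sq {a n : Gr} (h2 : n * n = 0) : body (a + n) = body a := by
  rw [map_add, body_of_sq h2, add_zero]

theorem add_sq_pow {a n : Gr} (hn : n ∈ evenPart) (h2 : n * n = 0) (l : ℕ) :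
    (a + n) ^ (l + 1) = a ^ (l + 1) + ((l : ℂ) + 1) • (n * a ^ l) := by
  induction l with
  | zero => simp
  | succ l ih =>
    have h3 : n * a ^ l * n = 0 := by
      rw [mul_assoc, ← (even_commute hn (a ^ l)).eq, ← mul_assoc, h2, zero_mul]
    rw [pow_succ, ih, mul_add, add_mul, add_mul, smul_mul_assoc, smul_mul_assoc, h3, smul_zero,
      add_zero, mul_assoc n, ← pow_succ, ← pow_succ, ← (even_commute hn _).eq, add_assoc]
    congr 1
    push_cast
    module

/-- First order Taylor expansion along an increment of square zero. -/
theorem hat_add_sq (φ : ℂ → ℂ) {a n : Gr} (ha : a ∈ evenPart) (hn : n ∈ evenPart)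
    (h2 : n * n = 0) : hat φ (a + n) = hat φ a + n * hat (deriv φ) a := by
  obtain ⟨N, hN⟩ := soul_nilpotent ha
  have hb := body_add_sq (a := a) h2
  have hs : soul (a + n) = soul a + n := by simp only [soul, hb]; abel
  have hN1 : soul a ^ (N + 1) = 0 := by rw [pow_succ, hN, zero_mul]
  have hN2 : soul (a + n) ^ (N + 1) = 0 := by
    rw [hs, add_sq_pow hn h2, hN1, hN, mul_zero, smul_zero, add_zero]
  rw [hat_eq_sum φ hN2, hat_eq_sum φ hN1, hat_eq_sum _ hN, hb, hs, Finset.sum_range_succ',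
    Finset.sum_range_succ', Finset.mul_sum, pow_zero, pow_zero, add_right_comm,
    ← Finset.sum_add_distrib]
  congr 1
  refine Finset.sum_congr rfl fun l _ => ?_
  rw [add_sq_pow hn h2, smul_add, smul_smul, mul_smul_comm, ← tc_succ, mul_comm (tc φ _ _)]

theorem body_hat (φ : ℂ → ℂ) {a : Gr} (ha : a ∈ evenPart) : body (hat φ a) = φ (body a) := by
  induction a, ha using even_ind generalizing φ with
  | h0 c => rw [hat_algebraMap, body_algebraMap, body_algebraMap]
  | h1 a n ha hn h2 ih =>
    rw [hat_add_sq φ ha hn h2, map_add, ih, map_mul, body_of_sq h2, zero_mul, add_zero,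
      body_add_sq h2]

theorem hat_mem_even (φ : ℂ → ℂ) {a : Gr} (ha : a ∈ evenPart) : hat φ a ∈ evenPart := by
  induction a, ha using even_ind generalizing φ with
  | h0 c => rw [hat_algebraMap]; exact algebraMap_mem_even _
  | h1 a n ha hn h2 ih =>
    rw [hat_add_sq φ ha hn h2]
    exact Submodule.add_mem _ (ih φ) (even_mul_even hn (ih _))

theorem hat_commute (φ : ℂ → ℂ) {a : Gr} (ha : a ∈ evenPart) (b : Gr) : Commute (hat φ a) b :=
  even_commute (hat_mem_even φ ha) b

theorem hat_congr {φ χ : ℂ → ℂ} {a : Gr} (h : φ =ᶠ[𝓝 (body a)] χ) : hat φ a = hat χ a := by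
  simp only [hat, tc, h.iteratedDeriv_eq]

theorem hat_id {a : Gr} (ha : a ∈ evenPart) : hat (fun w => w) a = a := by
  have hc : ∀ a ∈ evenPart, ∀ c : ℂ, hat (fun _ => c) a = algebraMap ℂ Gr c := by
    intro a ha
    induction a, ha using even_ind with
    | h0 c' => intro c; rw [hat_algebraMap]
    | h1 a n ha hn h2 ih =>
      intro c
      rw [hat_add_sq _ ha hn h2, deriv_const', ih, ih, map_zero, mul_zero, add_zero]
  induction a, ha using even_ind with
  | h0 c => rw [hat_algebraMap]
  | h1 a n ha hn h2 ih =>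
    rw [hat_add_sq _ ha hn h2, ih]
    simp only [deriv_id'']
    rw [hc _ ha, map_one, mul_one]

theorem hat_const (c : ℂ) {a : Gr} (ha : a ∈ evenPart) :
    hat (fun _ => c) a = algebraMap ℂ Gr c := by
  induction a, ha using even_ind generalizing c with
  | h0 c' => rw [hat_algebraMap]
  | h1 a n ha hn h2 ih =>
    rw [hat_add_sq _ ha hn h2, deriv_const', ih, ih, map_zero, mul_zero, add_zero]

theorem hat_add {φ χ : ℂ → ℂ} {a : Gr} (ha : a ∈ evenPart) (hφ : AnalyticAt ℂ φ (body a))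
    (hχ : AnalyticAt ℂ χ (body a)) : hat (fun w => φ w + χ w) a = hat φ a + hat χ a := by
  induction a, ha using even_ind generalizing φ χ with
  | h0 c => rw [hat_algebraMap, hat_algebraMap, hat_algebraMap, map_add]
  | h1 a n ha hn h2 ih =>
    rw [body_add_sq h2] at hφ hχ
    rw [hat_add_sq _ ha hn h2, hat_add_sq _ ha hn h2, hat_add_sq _ ha hn h2, ih hφ hχ]
    have : deriv (fun w => φ w + χ w) =ᶠ[𝓝 (body a)] fun w => deriv φ w + deriv χ w := by
      filter_upwards [hφ.eventually_analyticAt, hχ.eventually_analyticAt] with w h1 h2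
      exact deriv_add h1.differentiableAt h2.differentiableAt
    rw [hat_congr this, ih hφ.deriv hχ.deriv, mul_add]
    abel

theorem hat_mul {φ χ : ℂ → ℂ} {a : Gr} (ha : a ∈ evenPart) (hφ : AnalyticAt ℂ φ (body a))
    (hχ : AnalyticAt ℂ χ (body a)) : hat (fun w => φ w * χ w) a = hat φ a * hat χ a := by
  induction a, ha using even_ind generalizing φ χ with
  | h0 c => rw [hat_algebraMap, hat_algebraMap, hat_algebraMap, map_mul]
  | h1 a n ha hn h2 ih =>
    rw [body_add_sq h2] at hφ hχ
    rw [hat_add_sq _ ha hn h2, hat_add_sq _ ha hn h2, hat_add_sq _ ha hn h2, ih hφ hχ]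
    have : deriv (fun w => φ w * χ w) =ᶠ[𝓝 (body a)]
        fun w => deriv φ w * χ w + φ w * deriv χ w := by
      filter_upwards [hφ.eventually_analyticAt, hχ.eventually_analyticAt] with w h1 h2
      exact deriv_mul h1.differentiableAt h2.differentiableAt
    rw [hat_congr this, hat_add (φ := fun w => deriv φ w * χ w) (χ := fun w => φ w * deriv χ w) ha
      (hφ.deriv.mul hχ) (hφ.mul hχ.deriv), ih hφ.deriv hχ, ih hφ hχ.deriv]
    have e1 : hat φ a * (n * hat (deriv χ) a) = n * (hat φ a * hat (deriv χ) a) := by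
      rw [← mul_assoc, ← (even_commute hn _).eq, mul_assoc]
    have e2 : n * hat (deriv φ) a * (n * hat (deriv χ) a) = 0 := by
      rw [mul_assoc, ← mul_assoc _ n, ← (even_commute hn _).eq, mul_assoc, ← mul_assoc, h2,
        zero_mul]
    rw [add_mul, mul_add, mul_add, mul_add, e1, e2, mul_assoc]
    abel

theorem hat_comp {φ χ : ℂ → ℂ} {a : Gr} (ha : a ∈ evenPart) (hχ : AnalyticAt ℂ χ (body a))
    (hφ : AnalyticAt ℂ φ (χ (body a))) : hat (fun w => φ (χ w)) a = hat φ (hat χ a) := by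
  induction a, ha using even_ind generalizing φ χ with
  | h0 c => rw [hat_algebraMap, hat_algebraMap, hat_algebraMap]
  | h1 a n ha hn h2 ih =>
    rw [body_add_sq h2] at hφ hχ
    have hn' : n * hat (deriv χ) a ∈ evenPart := even_mul_even hn (hat_mem_even _ ha)
    have h2' : (n * hat (deriv χ) a) * (n * hat (deriv χ) a) = 0 := by
      rw [(even_commute hn _).eq]; exact even_mul_sq (hat_mem_even _ ha) h2
    rw [hat_add_sq _ ha hn h2, hat_add_sq χ ha hn h2, hat_add_sq _ (hat_mem_even _ ha) hn' h2',
      ih hχ hφ]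
    have : deriv (fun w => φ (χ w)) =ᶠ[𝓝 (body a)]
        fun w => deriv χ w * deriv φ (χ w) := by
      filter_upwards [hχ.eventually_analyticAt,
        hχ.continuousAt.eventually hφ.eventually_analyticAt] with w h1 h2
      rw [mul_comm]
      exact deriv_comp w h2.differentiableAt h1.differentiableAt
    rw [hat_congr this, hat_mul (χ := fun w => deriv φ (χ w)) ha hχ.deriv (hφ.deriv.comp hχ),
      ← ih hχ hφ.deriv, mul_assoc]

theorem hat_inv {a : Gr} (ha : a ∈ evenPart) (h : body a ≠ 0) :
    a * hat (fun w => w⁻¹) a = 1 := by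
  nth_rewrite 1 [← hat_id ha]
  have hm := hat_mul ha (φ := fun w => w) (χ := fun w => w⁻¹) analyticAt_id (analyticAt_id.inv h)
  rw [← hm, hat_congr (χ := fun _ => 1), hat_const 1 ha, map_one]
  filter_upwards [isOpen_ne.mem_nhds h] with w hw using mul_inv_cancel₀ hw

theorem ring_inverse_eq {a : Gr} (ha : a ∈ evenPart) (h : body a ≠ 0) :
    Ring.inverse a = hat (fun w => w⁻¹) a := by
  have hu := (isUnit_iff_body ha).2 h
  rw [← mul_one (Ring.inverse a), ← hat_inv ha h, ← mul_assoc, Ring.inverse_mul_cancel a hu,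
    one_mul]

theorem hat_smul (c : ℂ) {φ : ℂ → ℂ} {a : Gr} (ha : a ∈ evenPart)
    (hφ : AnalyticAt ℂ φ (body a)) : hat (fun w => c * φ w) a = c • hat φ a := by
  rw [hat_mul ha analyticAt_const hφ, hat_const c ha, Algebra.smul_def]

theorem hat_zero {a : Gr} (ha : a ∈ evenPart) : hat 0 a = 0 := by
  have := hat_const 0 ha
  rwa [map_zero] at this

theorem hat_sub_mem {L k : ℕ} (φ : ℂ → ℂ) {a b : Gr} (ha : a ∈ evenPart) (hb : b ∈ evenPart)
    (h : body a = body b) (hab : a - b ∈ nilIdeal L k) : hat φ a - hat φ b ∈ nilIdeal L k := by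
  obtain ⟨N, hN⟩ := soul_nilpotent ha
  obtain ⟨M, hM⟩ := soul_nilpotent hb
  have hN' : soul a ^ (N + M) = 0 := by rw [pow_add, hN, zero_mul]
  have hM' : soul b ^ (N + M) = 0 := by rw [pow_add, hM, mul_zero]
  have hs : soul a - soul b ∈ nilIdeal L k := by
    convert hab using 1
    rw [soul, soul, h]; abel
  rw [hat_eq_sum φ hN', hat_eq_sum φ hM', h, ← Finset.sum_sub_distrib]
  refine Submodule.sum_mem _ fun l hl => ?_
  clear hl
  rw [← smul_sub]
  refine Submodule.smul_mem _ _ ?_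
  induction l with
  | zero => simp
  | succ l ih =>
    have e : soul a ^ (l + 1) - soul b ^ (l + 1) =
        soul a ^ l * (soul a - soul b) + (soul a ^ l - soul b ^ l) * soul b := by
      rw [pow_succ, pow_succ]; noncomm_ring
    rw [e]
    exact Submodule.add_mem _ (mul_nilIdeal hs) (nilIdeal_mul ih)

theorem familyEval_eq (c : CoeffFamily) {z : Gr} (hz : z ∈ evenPart) :
    c.eval z = ∑ᶠ k : Finset ℕ, hat (c k) z * grBasis k := by
  obtain ⟨N, hN⟩ := soul_nilpotent hz
  refine finsum_congr fun k => ?_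
  rw [hat_eq_sum _ hN, Finset.sum_mul]
  refine (finsum_eq_sum_of_support_subset _ fun l hl => ?_).trans
    (Finset.sum_congr rfl fun l _ => by rw [smul_mul_assoc, tc])
  by_contra hl'
  have : N ≤ l := by simpa using hl'
  apply hl
  rw [← Nat.sub_add_cancel this, pow_add, hN, mul_zero, zero_mul, smul_zero]

/-! ### Germs of superanalytic functions -/

/-- The DeWitt neighborhoods of the fibre of superspace over the body point `w`. -/
def nb (w : ℂ) : Filter Pt := comap Pt.body (𝓝 w)

theorem nb_iff {w : ℂ} {P : Pt → Prop} :
    (∀ᶠ p in nb w, P p) ↔ ∀ᶠ v in 𝓝 w, ∀ p : Pt, p.body = v → P p := by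
  rw [nb, eventually_comap]

theorem nb_nb {w : ℂ} {P : Pt → Prop} (h : ∀ᶠ p in nb w, P p) :
    ∀ᶠ v in 𝓝 w, ∀ᶠ p in nb v, P p := by
  simp only [nb_iff] at *
  exact eventually_eventually_nhds.2 h

theorem nb_self {w : ℂ} {P : Pt → Prop} (h : ∀ᶠ p in nb w, P p) {p : Pt} (hp : p.body = w) :
    P p :=
  (nb_iff.1 h).self_of_nhds p hp

theorem tendsto_body_nb (w : ℂ) : Tendsto Pt.body (nb w) (𝓝 w) := tendsto_comap

theorem nb_eq_nhds (p : Pt) : nb p.body = 𝓝 p := (nhds_induced Pt.body p).symm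

theorem body_ofComplex (w : ℂ) : (Pt.ofComplex w).body = w := body_algebraMap w

/-- The functions `(z, θ⁺, θ⁻) ↦ (θ⁺)^i (θ⁻)^j φ(z) a`, with `φ` analytic at `w` and `a`
homogeneous, which span the superanalytic functions near `w`. -/
def saGen (w : ℂ) : Set (Pt → Gr) :=
  {G | ∃ (i j : ℕ) (φ : ℂ → ℂ) (d : ZMod 2) (a : Gr), AnalyticAt ℂ φ w ∧ a ∈ gr d ∧
    G = fun p => p.tp ^ i * p.tm ^ j * hat φ p.z * a}

/-- The functions that are superanalytic in a DeWitt neighborhood of the body point `w`. -/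
def SA (w : ℂ) : Submodule ℂ (Pt → Gr) where
  carrier := {G | ∃ G' ∈ Submodule.span ℂ (saGen w), G =ᶠ[nb w] G'}
  zero_mem' := ⟨0, Submodule.zero_mem _, EventuallyEq.rfl⟩
  add_mem' := fun ⟨G, h, e⟩ ⟨G', h', e'⟩ => ⟨G + G', Submodule.add_mem _ h h', e.add e'⟩
  smul_mem' := fun c _ ⟨G, h, e⟩ => ⟨c • G, Submodule.smul_mem _ c h, e.const_smul c⟩

theorem SA.congr {w : ℂ} {G G' : Pt → Gr} (h : G ∈ SA w) (e : G' =ᶠ[nb w] G) : G' ∈ SA w := by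
  obtain ⟨H, hH, e'⟩ := h
  exact ⟨H, hH, e.trans e'⟩

theorem SA.gen {w : ℂ} (i j : ℕ) {φ : ℂ → ℂ} {d : ZMod 2} {a : Gr} (hφ : AnalyticAt ℂ φ w)
    (ha : a ∈ gr d) : (fun p : Pt => p.tp ^ i * p.tm ^ j * hat φ p.z * a) ∈ SA w :=
  ⟨_, Submodule.subset_span ⟨i, j, φ, d, a, hφ, ha, rfl⟩, EventuallyEq.rfl⟩

theorem gen_mul_gen {d e : ZMod 2} (i j k l : ℕ) {x y u v a b : Gr} (hx : x ∈ oddPart)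
    (hy : y ∈ oddPart) (hu : u ∈ evenPart) (hv : v ∈ evenPart) (ha : a ∈ gr d) (_ : b ∈ gr e) :
    (x ^ i * y ^ j * u * a) * (x ^ k * y ^ l * v * b) =
      (sgn d (k * 1 + l * 1) * sgn (j * 1) (k * 1)) •
        (x ^ (i + k) * y ^ (j + l) * (u * v) * (a * b)) := by
  have hX := gr_mul (gr_pow hx k) (gr_pow hy l)
  have h1 := gr_comm ha hX
  have h2 := gr_comm (gr_pow hy j) (gr_pow hx k)
  calc (x ^ i * y ^ j * u * a) * (x ^ k * y ^ l * v * b)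
      = x ^ i * y ^ j * (u * (a * (x ^ k * y ^ l))) * (v * b) := by simp only [mul_assoc]
    _ = sgn d (k * 1 + l * 1) • (x ^ i * y ^ j * (u * ((x ^ k * y ^ l) * a)) * (v * b)) := by
        rw [h1]; simp only [mul_smul_comm, smul_mul_assoc]
    _ = sgn d (k * 1 + l * 1) • (x ^ i * (y ^ j * x ^ k) * y ^ l * (u * (a * v)) * b) := by
        rw [← mul_assoc u, (even_commute hu _).eq]; simp only [mul_assoc]
    _ = _ := by
        rw [h2, (even_commute hv a).eq.symm, pow_add, pow_add]
        simp only [mul_smul_comm, smul_mul_assoc, mul_assoc, smul_smul]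

theorem SA.mul {w : ℂ} {G G' : Pt → Gr} (h : G ∈ SA w) (h' : G' ∈ SA w) :
    (fun p => G p * G' p) ∈ SA w := by
  obtain ⟨H, hH, e⟩ := h
  obtain ⟨H', hH', e'⟩ := h'
  refine SA.congr (G := H * H') ?_ (e.mul e')
  clear e e'
  have key : ∀ g ∈ saGen w, ∀ g' ∈ saGen w, g * g' ∈ SA w := by
    rintro _ ⟨i, j, φ, d, a, hφ, ha, rfl⟩ _ ⟨k, l, χ, e, b, hχ, hb, rfl⟩
    refine SA.congr (Submodule.smul_mem _ (sgn d (k * 1 + l * 1) * sgn (j * 1) (k * 1))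
      (SA.gen (i + k) (j + l) (hφ.mul hχ) (gr_mul ha hb))) ?_
    have h1 := (tendsto_body_nb w).eventually hφ.eventually_analyticAt
    have h2 := (tendsto_body_nb w).eventually hχ.eventually_analyticAt
    filter_upwards [h1, h2] with p h1 h2
    have := hat_mul p.z_even h1 h2
    simp only [Pi.mul_apply, Pi.smul_apply]
    rw [gen_mul_gen i j k l p.tp_odd p.tm_odd (hat_mem_even φ p.z_even) (hat_mem_even χ p.z_even)
      ha hb, ← this]
    rfl
  have h1 : ∀ g ∈ saGen w, g * H' ∈ SA w := fun g hg =>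
    (Submodule.span_le (p := (SA w).comap (LinearMap.mulLeft ℂ g))).2 (fun g' hg' =>
      key g hg g' hg') hH'
  exact (Submodule.span_le (p := (SA w).comap (LinearMap.mulRight ℂ H'))).2
    (fun g hg => h1 g hg) hH

theorem SA.add {w : ℂ} {G G' : Pt → Gr} (h : G ∈ SA w) (h' : G' ∈ SA w) :
    (fun p => G p + G' p) ∈ SA w := Submodule.add_mem _ h h'

theorem SA.sub {w : ℂ} {G G' : Pt → Gr} (h : G ∈ SA w) (h' : G' ∈ SA w) :
    (fun p => G p - G' p) ∈ SA w := Submodule.sub_mem _ h h'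

theorem SA.smul {w : ℂ} {G : Pt → Gr} (c : ℂ) (h : G ∈ SA w) :
    (fun p => c • G p) ∈ SA w := Submodule.smul_mem _ c h

theorem SA.hat {w : ℂ} {φ : ℂ → ℂ} (hφ : AnalyticAt ℂ φ w) :
    (fun p : Pt => NTwo.hat φ p.z) ∈ SA w := by
  refine SA.congr (SA.gen 0 0 hφ one_mem_even) (Eventually.of_forall fun p => ?_)
  simp

theorem SA.const {w : ℂ} (a : Gr) : (fun _ : Pt => a) ∈ SA w := by
  obtain ⟨a0, h0, a1, h1, rfl⟩ := gr_decomp a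
  have h : ∀ d, ∀ b ∈ gr d, (fun _ : Pt => b) ∈ SA w := fun d b hb => by
    refine SA.congr (SA.gen 0 0 (φ := fun _ => 1) analyticAt_const hb)
      (Eventually.of_forall fun p => ?_)
    simp [hat_const 1 p.z_even]
  exact SA.add (h 0 _ h0) (h 1 _ h1)

theorem SA.z {w : ℂ} : Pt.z ∈ SA w := by
  refine SA.congr (SA.hat (φ := fun w => w) analyticAt_id) (Eventually.of_forall fun p => ?_)
  exact (hat_id p.z_even).symm

theorem SA.tp {w : ℂ} : Pt.tp ∈ SA w := by
  refine SA.congr (SA.gen 1 0 (φ := fun _ => 1) analyticAt_const one_mem_even)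
    (Eventually.of_forall fun p => ?_)
  simp [hat_const 1 p.z_even]

theorem SA.tm {w : ℂ} : Pt.tm ∈ SA w := by
  refine SA.congr (SA.gen 0 1 (φ := fun _ => 1) analyticAt_const one_mem_even)
    (Eventually.of_forall fun p => ?_)
  simp [hat_const 1 p.z_even]

theorem SA.sum {w : ℂ} {ι : Type*} (s : Finset ι) {G : ι → Pt → Gr} (h : ∀ i ∈ s, G i ∈ SA w) :
    (fun p => ∑ i ∈ s, G i p) ∈ SA w := by
  have := Submodule.sum_mem (SA w) h
  convert this using 1
  ext p
  simp

theorem SA.pow {w : ℂ} {G : Pt → Gr} (h : G ∈ SA w) (n : ℕ) : (fun p => G p ^ n) ∈ SA w := by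
  induction n with
  | zero => simpa using SA.const 1
  | succ n ih => simpa only [pow_succ] using SA.mul ih h

/-! ### Composition -/

theorem odd_sandwich_sq {d e : ZMod 2} {b x c : Gr} (hb : b ∈ gr d) (hx : x ∈ oddPart)
    (hc : c ∈ gr e) : (b * x * c) * (b * x * c) = 0 := by
  calc (b * x * c) * (b * x * c) = b * (x * (c * b)) * (x * c) := by simp only [mul_assoc]
    _ = sgn 1 (e + d) • (b * (c * b) * (x * x) * c) := by
      rw [gr_comm hx (gr_mul hc hb)]; simp only [mul_smul_comm, smul_mul_assoc, mul_assoc]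
    _ = 0 := by rw [odd_sq hx]; simp

/-- An even superanalytic function is the continuation of an analytic function plus finitely many
even superanalytic functions of square zero. -/
theorem SA.even_decomp {w : ℂ} {Z : Pt → Gr} (hZ : Z ∈ SA w)
    (he : ∀ᶠ p in nb w, Z p ∈ evenPart) :
    ∃ φ : ℂ → ℂ, AnalyticAt ℂ φ w ∧ ∃ l : List (Pt → Gr),
      (∀ N ∈ l, N ∈ SA w ∧ ∀ p, N p ∈ evenPart ∧ N p * N p = 0) ∧
      ∀ᶠ p in nb w, Z p = NTwo.hat φ p.z + (l.map fun N => N p).sum := by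
  obtain ⟨Z', hZ', e⟩ := hZ
  -- On generators the parity is not controlled, so an odd remainder `O` is carried along; it
  -- vanishes at the end because `Z` is even.
  suffices h : ∃ φ : ℂ → ℂ, AnalyticAt ℂ φ w ∧ ∃ l : List (Pt → Gr),
      (∀ N ∈ l, N ∈ SA w ∧ ∀ p, N p ∈ evenPart ∧ N p * N p = 0) ∧
      ∃ O : Pt → Gr, (∀ p, O p ∈ oddPart) ∧
      ∀ᶠ p in nb w, Z' p = NTwo.hat φ p.z + (l.map fun N => N p).sum + O p by
    obtain ⟨φ, hφ, l, hl, O, hO, h⟩ := h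
    refine ⟨φ, hφ, l, hl, ?_⟩
    filter_upwards [h, e, he] with p h1 h2 h3
    rw [← h2] at h1
    have h4 : (l.map fun N => N p).sum ∈ evenPart := by
      refine list_sum_mem fun x hx => ?_
      obtain ⟨N, hN, rfl⟩ := List.mem_map.1 hx
      exact ((hl N hN).2 p).1
    have h5 : O p = 0 := even_odd_zero (by
      rw [eq_sub_of_add_eq' h1.symm]
      exact Submodule.sub_mem _ h3 (Submodule.add_mem _ (hat_mem_even _ p.z_even) h4)) (hO p)
    rw [h1, h5, add_zero]
  clear e he
  induction hZ' using Submodule.span_induction with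
  | zero =>
    refine ⟨fun _ => 0, analyticAt_const, [], by simp, 0, fun p => Submodule.zero_mem _,
      Eventually.of_forall fun p => ?_⟩
    simp [hat_const 0 p.z_even]
  | add x y _ _ h1 h2 =>
    obtain ⟨φ, hφ, l, hl, O, hO, h1⟩ := h1
    obtain ⟨φ', hφ', l', hl', O', hO', h2⟩ := h2
    refine ⟨fun w => φ w + φ' w, hφ.add hφ', l ++ l',
      fun N hN => (List.mem_append.1 hN).elim (hl N) (hl' N), O + O',
      fun p => Submodule.add_mem _ (hO p) (hO' p), ?_⟩
    filter_upwards [h1, h2, (tendsto_body_nb w).eventually hφ.eventually_analyticAt,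
      (tendsto_body_nb w).eventually hφ'.eventually_analyticAt] with p h1 h2 h3 h4
    rw [Pi.add_apply, h1, h2, hat_add p.z_even h3 h4, List.map_append, List.sum_append,
      Pi.add_apply]
    abel
  | smul c x _ h1 =>
    obtain ⟨φ, hφ, l, hl, O, hO, h1⟩ := h1
    refine ⟨fun w => c * φ w, analyticAt_const.mul hφ, l.map fun N => c • N, ?_, c • O,
      fun p => Submodule.smul_mem _ _ (hO p), ?_⟩
    · intro N hN
      obtain ⟨M, hM, rfl⟩ := List.mem_map.1 hN
      refine ⟨Submodule.smul_mem _ _ (hl M hM).1, fun p =>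
        ⟨Submodule.smul_mem _ _ ((hl M hM).2 p).1, ?_⟩⟩
      rw [Pi.smul_apply, smul_mul_smul_comm, ((hl M hM).2 p).2, smul_zero]
    · filter_upwards [h1, (tendsto_body_nb w).eventually hφ.eventually_analyticAt] with p h1 h3
      rw [Pi.smul_apply, h1, hat_smul c p.z_even h3, List.map_map, smul_add, smul_add,
        List.smul_sum, List.map_map]
      rfl
  | mem x hx =>
    obtain ⟨i, j, φ, d, a, hφ, ha, rfl⟩ := hx
    have hpar : ∀ p : Pt, p.tp ^ i * p.tm ^ j * NTwo.hat φ p.z * a ∈ gr (i * 1 + j * 1 + 0 + d) :=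
      fun p => gr_mul (gr_mul (gr_mul (gr_pow p.tp_odd i) (gr_pow p.tm_odd j))
        (hat_mem_even φ p.z_even)) ha
    rcases even_or_odd (i * 1 + j * 1 + 0 + d : ZMod 2) with hd | hd
    · rw [hd] at hpar
      by_cases hij : i = 0 ∧ j = 0
      -- No odd variable: split the even coefficient `a` into its body and square-zero summands.
      · obtain ⟨rfl, rfl⟩ := hij
        have : d = 0 := by simpa using hd
        subst this
        obtain ⟨l, hl, ea⟩ := even_list ha
        refine ⟨fun w => body a * φ w, analyticAt_const.mul hφ,
          l.map fun x => fun p : Pt => NTwo.hat φ p.z * x, ?_, 0, fun p => Submodule.zero_mem _, ?_⟩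
        · intro N hN
          obtain ⟨x, hx, rfl⟩ := List.mem_map.1 hN
          exact ⟨SA.mul (SA.hat hφ) (SA.const x), fun p =>
            ⟨even_mul_even (hat_mem_even _ p.z_even) (hl x hx).1,
              even_mul_sq (hat_mem_even _ p.z_even) (hl x hx).2⟩⟩
        · filter_upwards [(tendsto_body_nb w).eventually hφ.eventually_analyticAt] with p h3
          rw [hat_smul _ p.z_even h3, List.map_map]
          nth_rewrite 1 [ea]
          have : (List.map ((fun N : Pt → Gr => N p) ∘ fun x => fun p : Pt => NTwo.hat φ p.z * x)
            l).sum = NTwo.hat φ p.z * l.sum := by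
            simpa [Function.comp_def] using
              List.sum_map_mul_left l (fun x : Gr => x) (NTwo.hat φ p.z)
          rw [this, Algebra.smul_def, Algebra.commutes]
          simp [mul_add]
      -- An odd variable occurs, so the monomial itself has square zero.
      · refine ⟨fun _ => 0, analyticAt_const, [fun p => p.tp ^ i * p.tm ^ j * NTwo.hat φ p.z * a],
          ?_, 0, fun p => Submodule.zero_mem _, Eventually.of_forall fun p => ?_⟩
        · intro N hN
          obtain rfl := List.mem_singleton.1 hN
          refine ⟨SA.gen i j hφ ha, fun p => ⟨hpar p, ?_⟩⟩
          rcases Nat.eq_zero_or_pos i with rfl | hi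
          · obtain ⟨j, rfl⟩ := Nat.exists_eq_succ_of_ne_zero (fun hj => hij ⟨rfl, hj⟩)
            have := odd_sandwich_sq (gr_pow p.tm_odd j) p.tm_odd
              (gr_mul (hat_mem_even φ p.z_even) ha)
            simpa only [pow_zero, one_mul, Nat.succ_eq_add_one, pow_succ, mul_assoc] using this
          · obtain ⟨i, rfl⟩ := Nat.exists_eq_succ_of_ne_zero hi.ne'
            have := odd_sandwich_sq (gr_pow p.tp_odd i) p.tp_odd
              (gr_mul (gr_pow p.tm_odd j) (gr_mul (hat_mem_even φ p.z_even) ha))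
            simpa only [Nat.succ_eq_add_one, pow_succ, mul_assoc] using this
        · simp [hat_const 0 p.z_even]
    · rw [hd] at hpar
      refine ⟨fun _ => 0, analyticAt_const, [], by simp, _, hpar, Eventually.of_forall fun p => ?_⟩
      simp [hat_const 0 p.z_even]

/-- The continuation of an analytic function, composed with an even superanalytic function. -/
theorem SA.hat_comp {w : ℂ} {Z : Pt → Gr} (hZ : Z ∈ SA w)
    (he : ∀ᶠ p in nb w, Z p ∈ evenPart) {χ : ℂ → ℂ}
    (hχ : ∀ p : Pt, p.body = w → AnalyticAt ℂ χ (NTwo.body (Z p))) :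
    (fun p => NTwo.hat χ (Z p)) ∈ SA w := by
  obtain ⟨φ, hφ, l, hl, h⟩ := SA.even_decomp hZ he
  have hsum : ∀ l : List (Pt → Gr), (∀ N ∈ l, N ∈ SA w ∧ ∀ p, N p ∈ evenPart ∧ N p * N p = 0) →
      ∀ p, (l.map fun N => N p).sum ∈ evenPart ∧ NTwo.body (l.map fun N => N p).sum = 0 := by
    intro l hl p
    induction l with
    | nil => simp
    | cons N l ih =>
      obtain ⟨i1, i2⟩ := ih fun M hM => hl M (List.mem_cons_of_mem _ hM)
      have hN := (hl N List.mem_cons_self).2 p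
      rw [List.map_cons, List.sum_cons]
      exact ⟨Submodule.add_mem _ hN.1 i1, by rw [map_add, i2, body_of_sq hN.2, add_zero]⟩
  have hw : AnalyticAt ℂ χ (φ w) := by
    have h1 := nb_self h (body_ofComplex w)
    have h2 := hχ _ (body_ofComplex w)
    rw [h1, map_add, (hsum l hl _).2, body_hat _ (Pt.z_even _), add_zero] at h2
    simpa [Pt.ofComplex] using h2
  -- Peel off one square-zero summand `n` at a time, with the first-order Taylor formula for
  -- `χ(a + n)`; the induction has to run over all `χ` because of the derivative.
  suffices key : ∀ l : List (Pt → Gr), (∀ N ∈ l, N ∈ SA w ∧ ∀ p, N p ∈ evenPart ∧ N p * N p = 0) →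
      ∀ χ : ℂ → ℂ, AnalyticAt ℂ χ (φ w) →
      (fun p : Pt => NTwo.hat χ (NTwo.hat φ p.z + (l.map fun N => N p).sum)) ∈ SA w by
    refine SA.congr (key l hl χ hw) ?_
    filter_upwards [h] with p hp
    rw [hp]
  clear hχ hw h hl l χ
  intro l
  induction l with
  | nil =>
    intro _ χ hχ
    refine SA.congr (SA.hat (φ := fun w => χ (φ w)) (hχ.comp hφ)) ?_
    filter_upwards [(tendsto_body_nb w).eventually hφ.eventually_analyticAt,
      (tendsto_body_nb w).eventually (hφ.continuousAt.eventually hχ.eventually_analyticAt)]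
      with p h1 h2
    rw [List.map_nil, List.sum_nil, add_zero]
    exact (NTwo.hat_comp p.z_even h1 h2).symm
  | cons N l ih =>
    intro hl χ hχ
    have hl' : ∀ N ∈ l, N ∈ SA w ∧ ∀ p, N p ∈ evenPart ∧ N p * N p = 0 :=
      fun M hM => hl M (List.mem_cons_of_mem _ hM)
    obtain ⟨hN, hN'⟩ := hl N List.mem_cons_self
    refine SA.congr (SA.add (ih hl' χ hχ) (SA.mul hN (ih hl' (deriv χ) hχ.deriv)))
      (Eventually.of_forall fun p => ?_)
    simp only
    rw [← hat_add_sq χ (Submodule.add_mem _ (hat_mem_even φ p.z_even) (hsum l hl' p).1)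
      (hN' p).1 (hN' p).2, List.map_cons, List.sum_cons]
    congr 1
    abel

/-- The map of body points under `H`. -/
def bodyMap (H : Pt → Pt) (w : ℂ) : ℂ := (H (Pt.ofComplex w)).body

/-- A map of superspace with components superanalytic near the body point `w`. -/
structure SAMap (H : Pt → Pt) (w : ℂ) : Prop where
  z : (fun p => (H p).z) ∈ SA w
  tp : (fun p => (H p).tp) ∈ SA w
  tm : (fun p => (H p).tm) ∈ SA w

theorem SAMap.congr {H H' : Pt → Pt} {w : ℂ} (h : SAMap H w) (e : H' =ᶠ[nb w] H) : SAMap H' w :=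
  ⟨SA.congr h.z (e.mono fun _ h => congrArg Pt.z h),
    SA.congr h.tp (e.mono fun _ h => congrArg Pt.tp h),
    SA.congr h.tm (e.mono fun _ h => congrArg Pt.tm h)⟩

theorem SAMap.exists_body {H : Pt → Pt} {w : ℂ} (h : SAMap H w) :
    ∃ φ, AnalyticAt ℂ φ w ∧ ∀ᶠ p in nb w, (H p).body = φ p.body := by
  obtain ⟨φ, hφ, l, hl, h⟩ := SA.even_decomp h.z (Eventually.of_forall fun p => (H p).z_even)
  refine ⟨φ, hφ, ?_⟩
  filter_upwards [h] with p hp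
  rw [Pt.body, hp, map_add, body_hat _ p.z_even]
  have : NTwo.body (l.map fun N => N p).sum = 0 := by
    rw [map_list_sum, List.map_map]
    refine List.sum_eq_zero fun x hx => ?_
    obtain ⟨N, hN, rfl⟩ := List.mem_map.1 hx
    exact body_of_sq ((hl N hN).2 p).2
  rw [this, add_zero]
  rfl

theorem SAMap.body_eq {H : Pt → Pt} {w : ℂ} (h : SAMap H w) :
    ∀ᶠ p in nb w, (H p).body = bodyMap H p.body := by
  obtain ⟨φ, -, h⟩ := h.exists_body
  rw [nb_iff] at h ⊢
  filter_upwards [h] with v hv p hp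
  rw [hv p hp, bodyMap, hv _ (by rw [body_ofComplex, hp]), body_ofComplex, hp]

theorem SAMap.analyticAt {H : Pt → Pt} {w : ℂ} (h : SAMap H w) : AnalyticAt ℂ (bodyMap H) w := by
  obtain ⟨φ, hφ, h⟩ := h.exists_body
  refine hφ.congr ?_
  rw [nb_iff] at h
  filter_upwards [h] with v hv
  rw [bodyMap, hv _ (body_ofComplex v), body_ofComplex]

theorem SAMap.tendsto {H : Pt → Pt} {w : ℂ} (h : SAMap H w) :
    Tendsto H (nb w) (nb (bodyMap H w)) := by
  refine tendsto_comap_iff.2 ?_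
  refine Tendsto.congr' (h.body_eq.mono fun _ h => h.symm) ?_
  exact h.analyticAt.continuousAt.tendsto.comp (tendsto_body_nb w)

theorem SA.comp {w : ℂ} {G : Pt → Gr} {H : Pt → Pt} (hH : SAMap H w) (hG : G ∈ SA (bodyMap H w)) :
    (fun p => G (H p)) ∈ SA w := by
  obtain ⟨G', hG', e⟩ := hG
  refine SA.congr (G := fun p => G' (H p)) ?_ (hH.tendsto.eventually e)
  clear e
  refine (Submodule.span_le (p := (SA w).comap (LinearMap.funLeft ℂ Gr H))).2 ?_ hG'
  rintro _ ⟨i, j, φ, d, a, hφ, ha, rfl⟩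
  refine SA.mul (SA.mul (SA.mul (SA.pow hH.tp i) (SA.pow hH.tm j)) (SA.hat_comp hH.z
    (Eventually.of_forall fun p => (H p).z_even) fun p hp => ?_)) (SA.const a)
  have := nb_self hH.body_eq hp
  rw [hp] at this
  change AnalyticAt ℂ φ (H p).body
  rwa [this]

theorem SAMap.comp {w : ℂ} {G H : Pt → Pt} (hG : SAMap G (bodyMap H w)) (hH : SAMap H w) :
    SAMap (fun p => G (H p)) w :=
  ⟨SA.comp (G := fun p => (G p).z) hH hG.z, SA.comp (G := fun p => (G p).tp) hH hG.tp,
    SA.comp (G := fun p => (G p).tm) hH hG.tm⟩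

theorem SAMap.bodyMap_comp {w : ℂ} {G H : Pt → Pt} (hG : SAMap G (bodyMap H w)) :
    bodyMap (fun p => G (H p)) w = bodyMap G (bodyMap H w) :=
  nb_self hG.body_eq rfl

/-! ### Component functions of superanalytic functions -/

/-- Near `w` the coefficients `c k` are analytic, and all but finitely many vanish. -/
def CoeffFamily.FinNear (c : CoeffFamily) (w : ℂ) : Prop :=
  (∀ k, AnalyticAt ℂ (c k) w) ∧
    ∃ S : Finset (Finset ℕ), ∀ᶠ v in 𝓝 w, ∀ k ∉ S, c k v = 0

/-- If `Σ_k c_k(w) ζ_k` is a finite sum at each point of an open set, then the number of nonzero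
terms is locally bounded: on a disc each `c_k ≠ 0` has only countably many zeros, so there is a
point of the disc at which no `c_k` vanishes other than those that vanish identically. -/
theorem CoeffFamily.AnalyticOn.finNear {c : CoeffFamily} {V : Set ℂ} (h : c.AnalyticOn V)
    (hV : IsOpen V) {w : ℂ} (hw : w ∈ V) : c.FinNear w := by
  refine ⟨fun k => h.1 k w hw, ?_⟩
  obtain ⟨r, hr, hB⟩ := Metric.isOpen_iff.1 hV w hw
  set B := Metric.ball w r with hBdef
  have hBo : IsOpen B := Metric.isOpen_ball
  have hBc : IsPreconnected B := (convex_ball w r).isPreconnected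
  have hz : ∀ k, ∃ s : Set ℂ, s.Countable ∧ ((∀ v ∈ B, c k v = 0) ∨ ∀ v ∈ B, v ∉ s → c k v ≠ 0) := by
    intro k
    rcases ((h.1 k).mono hB).eqOn_zero_or_eventually_ne_zero_of_preconnected hBc with h0 | h0
    · exact ⟨∅, Set.countable_empty, Or.inl fun v hv => h0 hv⟩
    · refine ⟨{v | c k v ≠ 0}ᶜ ∩ B, ?_, Or.inr fun v hv hvs h => hvs ⟨by simpa using h, hv⟩⟩
      apply (HereditarilyLindelofSpace.isLindelof _).countable_of_isDiscrete
        (isDiscrete_of_codiscreteWithin _)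
      simpa using! h0
  choose s hs1 hs2 using hz
  have hc : (⋃ k, s k).Countable := Set.countable_iUnion hs1
  obtain ⟨v, hv, hvB⟩ := (hc.dense_compl ℂ).exists_mem_open hBo ⟨w, Metric.mem_ball_self hr⟩
  refine ⟨(h.2 v (hB hvB)).toFinset, ?_⟩
  filter_upwards [hBo.mem_nhds (Metric.mem_ball_self hr)] with u hu k hk
  rcases hs2 k with h0 | h0
  · exact h0 u hu
  · exact absurd (h0 v hvB fun hvs => hv (Set.mem_iUnion.2 ⟨k, hvs⟩)) (by simpa using hk)

theorem CoeffFamily.FinNear.eval_eq {c : CoeffFamily} {w : ℂ} {S : Finset (Finset ℕ)}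
    (h : ∀ᶠ v in 𝓝 w, ∀ k ∉ S, c k v = 0) :
    ∀ᶠ p in nb w, c.eval p.z = ∑ k ∈ S, hat (c k) p.z * grBasis k := by
  filter_upwards [(tendsto_body_nb w).eventually (eventually_eventually_nhds.2 h)] with p hp
  rw [familyEval_eq c p.z_even]
  refine finsum_eq_sum_of_support_subset _ fun k hk => ?_
  by_contra hkS
  apply hk
  have : c k =ᶠ[𝓝 (body p.z)] 0 := by
    filter_upwards [hp] with v hv using hv k hkS
  simp only
  rw [hat_congr this, hat_zero p.z_even, zero_mul]

theorem CoeffFamily.FinNear.sa {c : CoeffFamily} {w : ℂ} (h : c.FinNear w) :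
    (fun p : Pt => c.eval p.z) ∈ SA w := by
  obtain ⟨h1, S, hS⟩ := h
  exact SA.congr (SA.sum S fun k _ => SA.mul (SA.hat (h1 k)) (SA.const (grBasis k)))
    (CoeffFamily.FinNear.eval_eq hS)

theorem CoeffFamily.FinNear.coord_eval {c : CoeffFamily} {w : ℂ} (h : c.FinNear w)
    (k : Finset ℕ) : coord k (c.eval (algebraMap ℂ Gr w)) = c k w := by
  obtain ⟨h1, S, hS⟩ := h
  have := nb_self (CoeffFamily.FinNear.eval_eq hS) (body_ofComplex w)
  change c.eval (algebraMap ℂ Gr w) = ∑ k ∈ S, hat (c k) (algebraMap ℂ Gr w) * grBasis k at this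
  rw [this, map_sum]
  simp only [hat_algebraMap, ← Algebra.smul_def, map_smul, coord_grBasis, smul_eq_mul, mul_ite,
    mul_one, mul_zero, Finset.sum_ite_eq']
  split_ifs with hk
  · rfl
  · exact (hS.self_of_nhds k hk).symm

theorem CoeffFamily.FinNear.eventually {c : CoeffFamily} {w : ℂ} (h : c.FinNear w) :
    ∀ᶠ v in 𝓝 w, c.FinNear v := by
  obtain ⟨h1, S, hS⟩ := h
  have h2 : ∀ᶠ v in 𝓝 w, ∀ k ∈ S, AnalyticAt ℂ (c k) v :=
    (Finset.eventually_all S).2 fun k _ => (h1 k).eventually_analyticAt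
  filter_upwards [h2, eventually_eventually_nhds.2 hS] with v hv hv'
  refine ⟨fun k => ?_, S, hv'⟩
  by_cases hk : k ∈ S
  · exact hv k hk
  · refine (analyticAt_const (v := (0 : ℂ))).congr ?_
    filter_upwards [hv'] with u hu using (hu k hk).symm

theorem CoeffFamily.FinNear.add {c c' : CoeffFamily} {w : ℂ} (h : c.FinNear w)
    (h' : c'.FinNear w) : (c + c').FinNear w ∧
      ∀ᶠ p in nb w, (c + c').eval p.z = c.eval p.z + c'.eval p.z := by
  obtain ⟨h1, S, hS⟩ := h
  obtain ⟨h1', S', hS'⟩ := h'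
  have e1 : ∀ᶠ v in 𝓝 w, ∀ k ∉ S ∪ S', c k v = 0 := by
    filter_upwards [hS] with v hv k hk using hv k fun h => hk (Finset.mem_union_left _ h)
  have e2 : ∀ᶠ v in 𝓝 w, ∀ k ∉ S ∪ S', c' k v = 0 := by
    filter_upwards [hS'] with v hv k hk using hv k fun h => hk (Finset.mem_union_right _ h)
  have e3 : ∀ᶠ v in 𝓝 w, ∀ k ∉ S ∪ S', (c + c') k v = 0 := by
    filter_upwards [e1, e2] with v h1 h2 k hk
    rw [Pi.add_apply, Pi.add_apply, h1 k hk, h2 k hk, add_zero]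
  refine ⟨⟨fun k => (h1 k).add (h1' k), _, e3⟩, ?_⟩
  have a1 : ∀ᶠ v in 𝓝 w, ∀ k ∈ S ∪ S', AnalyticAt ℂ (c k) v :=
    (Finset.eventually_all _).2 fun k _ => (h1 k).eventually_analyticAt
  have a2 : ∀ᶠ v in 𝓝 w, ∀ k ∈ S ∪ S', AnalyticAt ℂ (c' k) v :=
    (Finset.eventually_all _).2 fun k _ => (h1' k).eventually_analyticAt
  filter_upwards [eval_eq e1, eval_eq e2, eval_eq e3, (tendsto_body_nb w).eventually a1,
    (tendsto_body_nb w).eventually a2] with p h1 h2 h3 h4 h5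
  rw [h1, h2, h3, ← Finset.sum_add_distrib]
  refine Finset.sum_congr rfl fun k hk => ?_
  rw [← add_mul]
  congr 1
  exact hat_add p.z_even (h4 k hk) (h5 k hk)

theorem CoeffFamily.FinNear.smul {c : CoeffFamily} {w : ℂ} (s : ℂ) (h : c.FinNear w) :
    (s • c).FinNear w ∧ ∀ᶠ p in nb w, (s • c).eval p.z = s • c.eval p.z := by
  obtain ⟨h1, S, hS⟩ := h
  have e3 : ∀ᶠ v in 𝓝 w, ∀ k ∉ S, (s • c) k v = 0 := by
    filter_upwards [hS] with v hv k hk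
    rw [Pi.smul_apply, Pi.smul_apply, hv k hk, smul_zero]
  refine ⟨⟨fun k => show AnalyticAt ℂ (s • c k) w from (h1 k).const_smul, _, e3⟩, ?_⟩
  have a1 : ∀ᶠ v in 𝓝 w, ∀ k ∈ S, AnalyticAt ℂ (c k) v :=
    (Finset.eventually_all _).2 fun k _ => (h1 k).eventually_analyticAt
  filter_upwards [eval_eq hS, eval_eq e3, (tendsto_body_nb w).eventually a1] with p h1 h3 h4
  rw [h1, h3, Finset.smul_sum]
  refine Finset.sum_congr rfl fun k hk => ?_
  rw [← smul_mul_assoc]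
  congr 1
  exact hat_smul s p.z_even (h4 k hk)

theorem CoeffFamily.FinNear.zero (w : ℂ) : (0 : CoeffFamily).FinNear w :=
  ⟨fun _ => analyticAt_const, ∅, Eventually.of_forall fun _ _ _ => rfl⟩

theorem eval_zero_family {z : Gr} (hz : z ∈ evenPart) : (0 : CoeffFamily).eval z = 0 := by
  rw [familyEval_eq _ hz, finsum_eq_zero_of_forall_eq_zero]
  intro k
  rw [Pi.zero_apply, hat_zero hz, zero_mul]

theorem CoeffFamily.FinNear.diff {c : CoeffFamily} {w : ℂ} (h : c.FinNear w) :
    c.diff.FinNear w ∧ ∀ᶠ p in nb w, ∀ n ∈ evenPart, n * n = 0 →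
      c.eval (p.z + n) = c.eval p.z + n * c.diff.eval p.z := by
  obtain ⟨h1, S, hS⟩ := h
  have e3 : ∀ᶠ v in 𝓝 w, ∀ k ∉ S, c.diff k v = 0 := by
    filter_upwards [eventually_eventually_nhds.2 hS] with v hv k hk
    have : c k =ᶠ[𝓝 v] fun _ => 0 := by filter_upwards [hv] with u hu using hu k hk
    change deriv (c k) v = 0
    rw [this.deriv_eq, deriv_const]
  refine ⟨⟨fun k => (h1 k).deriv, S, e3⟩, ?_⟩
  rw [nb_iff]
  filter_upwards [nb_iff.1 (eval_eq hS), nb_iff.1 (eval_eq e3)] with v h1 h2 p hp n hn hn2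
  have hb := body_add_sq (a := p.z) hn2
  have := h1 ⟨p.z + n, 0, 0, Submodule.add_mem _ p.z_even hn, Submodule.zero_mem _,
    Submodule.zero_mem _⟩ (hb.trans hp)
  simp only at this
  rw [this, h1 p hp, h2 p hp, Finset.mul_sum, ← Finset.sum_add_distrib]
  refine Finset.sum_congr rfl fun k _ => ?_
  rw [hat_add_sq _ p.z_even hn hn2, add_mul, mul_assoc]
  rfl

/-- The family with value `φ(z) a`. -/
def scalarFamily (φ : ℂ → ℂ) (a : Gr) : CoeffFamily := fun k v => coord k a * φ v

theorem scalarFamily_finNear {φ : ℂ → ℂ} {w : ℂ} (hφ : AnalyticAt ℂ φ w) (a : Gr) :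
    (scalarFamily φ a).FinNear w ∧
      ∀ᶠ p in nb w, (scalarFamily φ a).eval p.z = hat φ p.z * a := by
  obtain ⟨S, hS, e⟩ := exists_sum_coord a
  have e3 : ∀ᶠ v in 𝓝 w, ∀ k ∉ S, scalarFamily φ a k v = 0 :=
    Eventually.of_forall fun v k hk => by rw [scalarFamily, hS k hk, zero_mul]
  refine ⟨⟨fun k => analyticAt_const.mul hφ, S, e3⟩, ?_⟩
  filter_upwards [CoeffFamily.FinNear.eval_eq e3,
    (tendsto_body_nb w).eventually hφ.eventually_analyticAt] with p h1 h2
  rw [h1]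
  conv_rhs => rw [e]
  rw [Finset.mul_sum]
  refine Finset.sum_congr rfl fun k _ => ?_
  have : hat (scalarFamily φ a k) p.z = coord k a • hat φ p.z := hat_smul _ p.z_even h2
  rw [this, smul_mul_assoc, mul_smul_comm]

/-- Near `w` the components of `F` are analytic, with finitely many nonzero coefficients. -/
structure SuperFn.FinNear (F : SuperFn) (w : ℂ) : Prop where
  f : F.f.FinNear w
  xp : F.xp.FinNear w
  xm : F.xm.FinNear w
  t : F.t.FinNear w

theorem SuperFn.AnalyticOn.finNear {F : SuperFn} {V : Set ℂ} (h : F.AnalyticOn V)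
    (hV : IsOpen V) {w : ℂ} (hw : w ∈ V) : F.FinNear w :=
  ⟨h.1.finNear hV hw, h.2.1.finNear hV hw, h.2.2.1.finNear hV hw, h.2.2.2.finNear hV hw⟩

theorem SuperFn.FinNear.sa {F : SuperFn} {w : ℂ} (h : F.FinNear w) : F.eval ∈ SA w :=
  SA.add (SA.add (SA.add h.f.sa (SA.mul SA.tp h.xp.sa)) (SA.mul SA.tm h.xm.sa))
    (SA.mul (SA.mul SA.tp SA.tm) h.t.sa)

theorem SuperFn.FinNear.eventually {F : SuperFn} {w : ℂ} (h : F.FinNear w) :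
    ∀ᶠ v in 𝓝 w, F.FinNear v := by
  filter_upwards [h.f.eventually, h.xp.eventually, h.xm.eventually, h.t.eventually]
    with v h1 h2 h3 h4 using ⟨h1, h2, h3, h4⟩

/-- Conversely, every germ of a superanalytic function has component functions. -/
theorem SA.exists_superFn {G : Pt → Gr} {w : ℂ} (h : G ∈ SA w) :
    ∃ F : SuperFn, F.FinNear w ∧ G =ᶠ[nb w] F.eval := by
  obtain ⟨G', hG', e⟩ := h
  suffices h : ∃ F : SuperFn, F.FinNear w ∧ G' =ᶠ[nb w] F.eval from
    h.imp fun F hF => ⟨hF.1, e.trans hF.2⟩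
  clear e
  have hz := CoeffFamily.FinNear.zero w
  have ez := fun p : Pt => eval_zero_family p.z_even
  induction hG' using Submodule.span_induction with
  | zero => exact ⟨⟨0, 0, 0, 0⟩, ⟨hz, hz, hz, hz⟩, Eventually.of_forall fun p => by
      simp [SuperFn.eval, ez]⟩
  | add x y _ _ h1 h2 =>
    obtain ⟨F, hF, h1⟩ := h1
    obtain ⟨F', hF', h2⟩ := h2
    obtain ⟨a1, b1⟩ := hF.f.add hF'.f
    obtain ⟨a2, b2⟩ := hF.xp.add hF'.xp
    obtain ⟨a3, b3⟩ := hF.xm.add hF'.xm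
    obtain ⟨a4, b4⟩ := hF.t.add hF'.t
    refine ⟨⟨F.f + F'.f, F.xp + F'.xp, F.xm + F'.xm, F.t + F'.t⟩, ⟨a1, a2, a3, a4⟩, ?_⟩
    filter_upwards [h1, h2, b1, b2, b3, b4] with p h1 h2 b1 b2 b3 b4
    rw [Pi.add_apply, h1, h2]
    simp only [SuperFn.eval, b1, b2, b3, b4, mul_add]
    abel
  | smul c x _ h1 =>
    obtain ⟨F, hF, h1⟩ := h1
    obtain ⟨a1, b1⟩ := hF.f.smul c
    obtain ⟨a2, b2⟩ := hF.xp.smul c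
    obtain ⟨a3, b3⟩ := hF.xm.smul c
    obtain ⟨a4, b4⟩ := hF.t.smul c
    refine ⟨⟨c • F.f, c • F.xp, c • F.xm, c • F.t⟩, ⟨a1, a2, a3, a4⟩, ?_⟩
    filter_upwards [h1, b1, b2, b3, b4] with p h1 b1 b2 b3 b4
    rw [Pi.smul_apply, h1]
    simp only [SuperFn.eval, b1, b2, b3, b4, smul_add, mul_smul_comm]
  | mem x hx =>
    obtain ⟨i, j, φ, d, a, hφ, ha, rfl⟩ := hx
    obtain ⟨c1, c2⟩ := scalarFamily_finNear hφ a
    have hsq : ∀ {x : Gr}, x ∈ oddPart → ∀ n, x ^ (n + 2) = 0 := fun hx n => by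
      rw [pow_add, pow_two, odd_sq hx, mul_zero]
    match i, j with
    | 0, 0 =>
      refine ⟨⟨scalarFamily φ a, 0, 0, 0⟩, ⟨c1, hz, hz, hz⟩, ?_⟩
      filter_upwards [c2] with p hp
      simp [SuperFn.eval, ez, hp]
    | 1, 0 =>
      refine ⟨⟨0, scalarFamily φ a, 0, 0⟩, ⟨hz, c1, hz, hz⟩, ?_⟩
      filter_upwards [c2] with p hp
      simp [SuperFn.eval, ez, hp, mul_assoc]
    | 0, 1 =>
      refine ⟨⟨0, 0, scalarFamily φ a, 0⟩, ⟨hz, hz, c1, hz⟩, ?_⟩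
      filter_upwards [c2] with p hp
      simp [SuperFn.eval, ez, hp, mul_assoc]
    | 1, 1 =>
      refine ⟨⟨0, 0, 0, scalarFamily φ a⟩, ⟨hz, hz, hz, c1⟩, ?_⟩
      filter_upwards [c2] with p hp
      simp [SuperFn.eval, ez, hp, mul_assoc]
    | i + 2, j =>
      refine ⟨⟨0, 0, 0, 0⟩, ⟨hz, hz, hz, hz⟩, Eventually.of_forall fun p => ?_⟩
      simp [SuperFn.eval, ez, hsq p.tp_odd]
    | i, j + 2 =>
      refine ⟨⟨0, 0, 0, 0⟩, ⟨hz, hz, hz, hz⟩, Eventually.of_forall fun p => ?_⟩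
      simp [SuperFn.eval, ez, hsq p.tm_odd]

/-- The components of a function at an even point are determined by its values. -/
theorem components_unique {A B C D A' B' C' D' : Gr}
    (h : ∀ x ∈ oddPart, ∀ y ∈ oddPart,
      A + x * B + y * C + x * y * D = A' + x * B' + y * C' + x * y * D') :
    A = A' ∧ B = B' ∧ C = C' ∧ D = D' := by
  have h0 : (0 : Gr) ∈ oddPart := Submodule.zero_mem _
  have hA : A = A' := by simpa using h 0 h0 0 h0
  subst hA
  have hB : B = B' := cancel_odd_eq fun x hx => by simpa using h x hx 0 h0
  have hC : C = C' := cancel_odd_eq fun y hy => by simpa using h 0 h0 y hy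
  subst hB hC
  refine ⟨rfl, rfl, rfl, ?_⟩
  rw [← sub_eq_zero]
  refine cancel_odd_odd fun x hx y hy => ?_
  rw [mul_sub, sub_eq_zero]
  exact add_left_cancel (h x hx y hy)

theorem SuperFn.FinNear.unique {F F' : SuperFn} {w : ℂ} (h : F.FinNear w) (h' : F'.FinNear w)
    (e : ∀ p : Pt, p.body = w → F.eval p = F'.eval p) (k : Finset ℕ) :
    F.f k w = F'.f k w ∧ F.xp k w = F'.xp k w ∧ F.xm k w = F'.xm k w ∧ F.t k w = F'.t k w := by
  obtain ⟨h1, h2, h3, h4⟩ := components_unique (A := F.f.eval (algebraMap ℂ Gr w))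
    (A' := F'.f.eval (algebraMap ℂ Gr w)) (B := F.xp.eval (algebraMap ℂ Gr w))
    (B' := F'.xp.eval (algebraMap ℂ Gr w)) (C := F.xm.eval (algebraMap ℂ Gr w))
    (C' := F'.xm.eval (algebraMap ℂ Gr w)) (D := F.t.eval (algebraMap ℂ Gr w))
    (D' := F'.t.eval (algebraMap ℂ Gr w)) fun x hx y hy =>
    e ⟨algebraMap ℂ Gr w, x, y, algebraMap_mem_even w, hx, hy⟩ (body_algebraMap w)
  refine ⟨?_, ?_, ?_, ?_⟩
  · rw [← h.f.coord_eval, ← h'.f.coord_eval, h1]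
  · rw [← h.xp.coord_eval, ← h'.xp.coord_eval, h2]
  · rw [← h.xm.coord_eval, ← h'.xm.coord_eval, h3]
  · rw [← h.t.coord_eval, ← h'.t.coord_eval, h4]

theorem eval_congr_family {c c' : CoeffFamily} {z : Gr} (hz : z ∈ evenPart)
    (h : ∀ᶠ v in 𝓝 (body z), ∀ k, c k v = c' k v) : c.eval z = c'.eval z := by
  rw [familyEval_eq _ hz, familyEval_eq _ hz]
  refine finsum_congr fun k => ?_
  rw [hat_congr (by filter_upwards [h] with v hv using hv k)]

theorem eval_congr_superFn {F F' : SuperFn} {p : Pt}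
    (h : ∀ᶠ v in 𝓝 p.body, ∀ k, F.f k v = F'.f k v ∧ F.xp k v = F'.xp k v ∧
      F.xm k v = F'.xm k v ∧ F.t k v = F'.t k v) : F.eval p = F'.eval p := by
  rw [SuperFn.eval, SuperFn.eval, eval_congr_family p.z_even (h.mono fun v hv k => (hv k).1),
    eval_congr_family p.z_even (h.mono fun v hv k => (hv k).2.1),
    eval_congr_family p.z_even (h.mono fun v hv k => (hv k).2.2.1),
    eval_congr_family p.z_even (h.mono fun v hv k => (hv k).2.2.2)]

/-- A function that is superanalytic near each body point of an open set is given by one set of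
component functions on the whole set. -/
theorem SA.glue {G : Pt → Gr} {V : Set ℂ} (hV : IsOpen V) (h : ∀ w ∈ V, G ∈ SA w) :
    ∃ F : SuperFn, F.AnalyticOn V ∧ ∀ p : Pt, p.body ∈ V → G p = F.eval p := by
  have : Nonempty SuperFn := ⟨⟨0, 0, 0, 0⟩⟩
  choose! F hF1 hF2 using fun w hw => SA.exists_superFn (h w hw)
  have key : ∀ w ∈ V, ∀ᶠ v in 𝓝 w, ∀ k, (F v).f k v = (F w).f k v ∧ (F v).xp k v = (F w).xp k v ∧
      (F v).xm k v = (F w).xm k v ∧ (F v).t k v = (F w).t k v := by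
    intro w hw
    filter_upwards [hV.mem_nhds hw, (hF1 w hw).eventually, nb_iff.1 (hF2 w hw)] with v hv h1 h2 k
    refine (hF1 v hv).unique h1 (fun p hp => ?_) k
    rw [← h2 p hp, nb_self (hF2 v hv) hp]
  have hfin : ∀ (c : SuperFn → CoeffFamily), (∀ w ∈ V, (c (F w)).FinNear w) →
      (∀ w ∈ V, ∀ᶠ v in 𝓝 w, ∀ k, c (F v) k v = c (F w) k v) →
      CoeffFamily.AnalyticOn (fun k v => c (F v) k v) V := by
    intro c h1 h2
    refine ⟨fun k w hw => ((h1 w hw).1 k).congr ?_, fun w hw => ?_⟩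
    · filter_upwards [h2 w hw] with v hv using (hv k).symm
    · obtain ⟨-, S, hS⟩ := h1 w hw
      refine S.finite_toSet.subset fun k hk => ?_
      by_contra hkS
      exact hk (hS.self_of_nhds k hkS)
  refine ⟨⟨fun k v => (F v).f k v, fun k v => (F v).xp k v, fun k v => (F v).xm k v,
    fun k v => (F v).t k v⟩,
    ⟨hfin SuperFn.f (fun w hw => (hF1 w hw).f) fun w hw => (key w hw).mono fun v hv k => (hv k).1,
     hfin SuperFn.xp (fun w hw => (hF1 w hw).xp) fun w hw =>
      (key w hw).mono fun v hv k => (hv k).2.1,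
     hfin SuperFn.xm (fun w hw => (hF1 w hw).xm) fun w hw =>
      (key w hw).mono fun v hv k => (hv k).2.2.1,
     hfin SuperFn.t (fun w hw => (hF1 w hw).t) fun w hw =>
      (key w hw).mono fun v hv k => (hv k).2.2.2⟩, fun p hp => ?_⟩
  rw [nb_self (hF2 _ hp) rfl]
  refine eval_congr_superFn ?_
  filter_upwards [key _ hp] with v hv k
  exact ⟨(hv k).1.symm, (hv k).2.1.symm, (hv k).2.2.1.symm, (hv k).2.2.2.symm⟩

/-- A superanalytic function that vanishes over a punctured neighborhood of `w` vanishes over a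
neighborhood of `w`. -/
theorem SA.eq_zero_of_punctured {G : Pt → Gr} {w : ℂ} (h : G ∈ SA w)
    (h0 : ∀ᶠ v in 𝓝[≠] w, ∀ p : Pt, p.body = v → G p = 0) : ∀ᶠ p in nb w, G p = 0 := by
  obtain ⟨F, hF, e⟩ := SA.exists_superFn h
  have hz : ∀ v, (⟨0, 0, 0, 0⟩ : SuperFn).FinNear v := fun v =>
    ⟨CoeffFamily.FinNear.zero v, CoeffFamily.FinNear.zero v, CoeffFamily.FinNear.zero v,
      CoeffFamily.FinNear.zero v⟩
  have ez : ∀ p : Pt, (⟨0, 0, 0, 0⟩ : SuperFn).eval p = 0 := fun p => by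
    simp [SuperFn.eval, eval_zero_family p.z_even]
  have key : ∀ᶠ v in 𝓝[≠] w, ∀ k, F.f k v = 0 ∧ F.xp k v = 0 ∧ F.xm k v = 0 ∧ F.t k v = 0 := by
    filter_upwards [h0, (nb_iff.1 e).filter_mono nhdsWithin_le_nhds,
      hF.eventually.filter_mono nhdsWithin_le_nhds] with v h1 h2 h3
    exact h3.unique (hz v) fun p hp => by rw [← h2 p hp, h1 p hp, ez]
  have hc : ∀ c : CoeffFamily, c.FinNear w → (∀ᶠ v in 𝓝[≠] w, ∀ k, c k v = 0) →
      ∀ᶠ v in 𝓝 w, ∀ k, c k v = 0 := by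
    rintro c ⟨h1, S, hS⟩ h2
    have : ∀ᶠ v in 𝓝 w, ∀ k ∈ S, c k v = 0 := by
      refine (Finset.eventually_all S).2 fun k _ => ?_
      exact ((h1 k).frequently_zero_iff_eventually_zero).1 (h2.mono fun v hv => hv k).frequently
    filter_upwards [this, hS] with v a1 a2 k
    by_cases hk : k ∈ S
    exacts [a1 k hk, a2 k hk]
  have hf := hc _ hF.f (key.mono fun v hv k => (hv k).1)
  have hxp := hc _ hF.xp (key.mono fun v hv k => (hv k).2.1)
  have hxm := hc _ hF.xm (key.mono fun v hv k => (hv k).2.2.1)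
  have ht := hc _ hF.t (key.mono fun v hv k => (hv k).2.2.2)
  rw [nb_iff]
  filter_upwards [nb_iff.1 e, eventually_eventually_nhds.2 hf, eventually_eventually_nhds.2 hxp,
    eventually_eventually_nhds.2 hxm, eventually_eventually_nhds.2 ht] with v h1 h2 h3 h4 h5 p hp
  rw [h1 p hp, ← ez p]
  refine eval_congr_superFn ?_
  rw [hp]
  filter_upwards [h2, h3, h4, h5] with u a1 a2 a3 a4 k
  exact ⟨a1 k, a2 k, a3 k, a4 k⟩

/-- Parity can be tested on the products with odd elements. -/
theorem mem_gr_of_odd_mul {a : Gr} {d : ZMod 2} (h : ∀ e ∈ oddPart, e * a ∈ gr (1 + d)) :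
    a ∈ gr d := by
  obtain ⟨a0, h0, a1, h1, rfl⟩ := gr_decomp a
  rcases even_or_odd d with rfl | rfl
  · have : a1 = 0 := cancel_odd fun e he => even_odd_zero (odd_mul_odd he h1) (by
      have := Submodule.sub_mem _ (h e he) (odd_mul_even he h0)
      rwa [mul_add, add_sub_cancel_left] at this)
    rw [this, add_zero]; exact h0
  · have h2 : (1 : ZMod 2) + 1 = 0 := by decide
    rw [h2] at h
    have : a0 = 0 := cancel_odd fun e he => even_odd_zero (by
      have := Submodule.sub_mem _ (h e he) (odd_mul_odd he h1)
      rwa [mul_add, add_sub_cancel_right] at this) (odd_mul_even he h0)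
    rw [this, zero_add]; exact h1

/-- The components of a function with values of parity `d` have parities `d`, `1 + d`, `1 + d`, `d`:
the values at all odd pairs are tested. -/
theorem SuperFn.parity {F : SuperFn} {w : ℂ} {d : ZMod 2}
    (e : ∀ p : Pt, p.body = w → F.eval p ∈ gr d) :
    F.f.eval (algebraMap ℂ Gr w) ∈ gr d ∧ F.xp.eval (algebraMap ℂ Gr w) ∈ gr (1 + d) ∧
      F.xm.eval (algebraMap ℂ Gr w) ∈ gr (1 + d) ∧ F.t.eval (algebraMap ℂ Gr w) ∈ gr d := by
  have h11 : (1 : ZMod 2) + (1 + d) = d := by clear e; revert d; decide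
  set A := F.f.eval (algebraMap ℂ Gr w)
  set B := F.xp.eval (algebraMap ℂ Gr w)
  set C := F.xm.eval (algebraMap ℂ Gr w)
  set D := F.t.eval (algebraMap ℂ Gr w)
  have h : ∀ x ∈ oddPart, ∀ y ∈ oddPart, A + x * B + y * C + x * y * D ∈ gr d := fun x hx y hy =>
    e ⟨algebraMap ℂ Gr w, x, y, algebraMap_mem_even w, hx, hy⟩ (body_algebraMap w)
  have h0 : (0 : Gr) ∈ oddPart := Submodule.zero_mem _
  have hA : A ∈ gr d := by simpa using h 0 h0 0 h0
  have hB : ∀ x ∈ oddPart, x * B ∈ gr d := fun x hx => by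
    have := Submodule.sub_mem _ (h x hx 0 h0) hA
    simpa using this
  have hC : ∀ x ∈ oddPart, x * C ∈ gr d := fun x hx => by
    have := Submodule.sub_mem _ (h 0 h0 x hx) hA
    simpa using this
  refine ⟨hA, mem_gr_of_odd_mul (by rwa [h11]), mem_gr_of_odd_mul (by rwa [h11]), ?_⟩
  refine mem_gr_of_odd_mul fun y hy => mem_gr_of_odd_mul fun x hx => ?_
  have := Submodule.sub_mem _ (h x hx y hy)
    (Submodule.add_mem _ (Submodule.add_mem _ hA (hB x hx)) (hC y hy))
  rw [h11, ← mul_assoc]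
  simpa using this

theorem SuperFn.isEvenOn {F : SuperFn} {V : Set ℂ} (hV : IsOpen V) (h : F.AnalyticOn V)
    (e : ∀ p : Pt, p.body ∈ V → F.eval p ∈ evenPart) : F.IsEvenOn V := by
  constructor
  all_goals
    intro k hk w hw
    have hF := h.finNear hV hw
    obtain ⟨h1, h2, h3, h4⟩ := SuperFn.parity (F := F) (d := 0) fun p hp => e p (hp ▸ hw)
  · rw [← hF.f.coord_eval, ← hF.t.coord_eval]
    exact ⟨coord_of_even h1 hk, coord_of_even h4 hk⟩
  · rw [← hF.xp.coord_eval, ← hF.xm.coord_eval]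
    exact ⟨coord_of_odd h2 hk, coord_of_odd h3 hk⟩

theorem SuperFn.isOddOn {F : SuperFn} {V : Set ℂ} (hV : IsOpen V) (h : F.AnalyticOn V)
    (e : ∀ p : Pt, p.body ∈ V → F.eval p ∈ oddPart) : F.IsOddOn V := by
  constructor
  all_goals
    intro k hk w hw
    have hF := h.finNear hV hw
    obtain ⟨h1, h2, h3, h4⟩ := SuperFn.parity (F := F) (d := 1) fun p hp => e p (hp ▸ hw)
  · rw [← hF.f.coord_eval, ← hF.t.coord_eval]
    exact ⟨coord_of_odd h1 hk, coord_of_odd h4 hk⟩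
  · rw [← hF.xp.coord_eval, ← hF.xm.coord_eval]
    exact ⟨coord_of_even h2 hk, coord_of_even h3 hk⟩

/-! ### Superconformality by odd translations -/

/-- The odd translation `(z, θ⁺, θ⁻) ↦ (z + εθ⁻, θ⁺ + ε, θ⁻)`, whose generator is `D⁺`. -/
def transP (e : Gr) (he : e ∈ oddPart) (p : Pt) : Pt :=
  ⟨p.z + e * p.tm, p.tp + e, p.tm, Submodule.add_mem _ p.z_even (odd_mul_odd he p.tm_odd),
    Submodule.add_mem _ p.tp_odd he, p.tm_odd⟩

/-- The odd translation `(z, θ⁺, θ⁻) ↦ (z + εθ⁺, θ⁺, θ⁻ + ε)`, whose generator is `D⁻`. -/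
def transM (e : Gr) (he : e ∈ oddPart) (p : Pt) : Pt :=
  ⟨p.z + e * p.tp, p.tp, p.tm + e, Submodule.add_mem _ p.z_even (odd_mul_odd he p.tp_odd),
    p.tp_odd, Submodule.add_mem _ p.tm_odd he⟩

theorem body_transP (e : Gr) (he : e ∈ oddPart) (p : Pt) : (transP e he p).body = p.body := by
  rw [Pt.body, transP, map_add, map_mul, body_odd he, zero_mul, add_zero]; rfl

theorem body_transM (e : Gr) (he : e ∈ oddPart) (p : Pt) : (transM e he p).body = p.body := by
  rw [Pt.body, transM, map_add, map_mul, body_odd he, zero_mul, add_zero]; rfl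

/-- `H` takes the odd translations of the first kind at `p` to such translations at `H p`, with
factor `g`. For superanalytic `H` this says `D⁺θ̃⁻ = 0`, `D⁺z̃ = θ̃⁻ D⁺θ̃⁺` and `g = D⁺θ̃⁺`
at `p`. -/
def IsDP (H : Pt → Pt) (p : Pt) (g : Gr) : Prop :=
  ∃ hg : g ∈ evenPart, ∀ e he, H (transP e he p) = transP (e * g) (odd_mul_even he hg) (H p)

/-- The analogue of `IsDP` for `D⁻`. -/
def IsDM (H : Pt → Pt) (p : Pt) (g : Gr) : Prop :=
  ∃ hg : g ∈ evenPart, ∀ e he, H (transM e he p) = transM (e * g) (odd_mul_even he hg) (H p)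

theorem transP_congr {e e' : Gr} (h : e = e') (he : e ∈ oddPart) (p : Pt) :
    transP e he p = transP e' (h ▸ he) p := by subst h; rfl

theorem transM_congr {e e' : Gr} (h : e = e') (he : e ∈ oddPart) (p : Pt) :
    transM e he p = transM e' (h ▸ he) p := by subst h; rfl

theorem IsDP.comp {G H : Pt → Pt} {p : Pt} {g g' : Gr} (h : IsDP H p g) (h' : IsDP G (H p) g') :
    IsDP (fun p => G (H p)) p (g * g') := by
  obtain ⟨hg, h⟩ := h
  obtain ⟨hg', h'⟩ := h'
  refine ⟨even_mul_even hg hg', fun e he => ?_⟩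
  change G (H (transP e he p)) = _
  rw [h, h', transP_congr (mul_assoc e g g')]

theorem IsDM.comp {G H : Pt → Pt} {p : Pt} {g g' : Gr} (h : IsDM H p g) (h' : IsDM G (H p) g') :
    IsDM (fun p => G (H p)) p (g * g') := by
  obtain ⟨hg, h⟩ := h
  obtain ⟨hg', h'⟩ := h'
  refine ⟨even_mul_even hg hg', fun e he => ?_⟩
  change G (H (transM e he p)) = _
  rw [h, h', transM_congr (mul_assoc e g g')]

theorem IsDP.unique {H : Pt → Pt} {p : Pt} {g g' : Gr} (h : IsDP H p g) (h' : IsDP H p g') :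
    g = g' := by
  refine cancel_odd_eq fun e he => ?_
  have := congrArg Pt.tp ((h.2 e he).symm.trans (h'.2 e he))
  exact add_left_cancel this

theorem IsDM.unique {H : Pt → Pt} {p : Pt} {g g' : Gr} (h : IsDM H p g) (h' : IsDM H p g') :
    g = g' := by
  refine cancel_odd_eq fun e he => ?_
  have := congrArg Pt.tm ((h.2 e he).symm.trans (h'.2 e he))
  exact add_left_cancel this

theorem IsDP.id (p : Pt) : IsDP (fun p => p) p 1 :=
  ⟨one_mem_even, fun e he => (transP_congr (mul_one e).symm he p)⟩

theorem IsDM.id (p : Pt) : IsDM (fun p => p) p 1 :=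
  ⟨one_mem_even, fun e he => (transM_congr (mul_one e).symm he p)⟩

theorem IsDP.congr {H H' : Pt → Pt} {p : Pt} {g : Gr} (h : IsDP H p g)
    (e : ∀ q : Pt, q.body = p.body → H' q = H q) : IsDP H' p g :=
  ⟨h.1, fun x hx => by rw [e _ (body_transP x hx p), h.2, e p rfl]⟩

theorem IsDM.congr {H H' : Pt → Pt} {p : Pt} {g : Gr} (h : IsDM H p g)
    (e : ∀ q : Pt, q.body = p.body → H' q = H q) : IsDM H' p g :=
  ⟨h.1, fun x hx => by rw [e _ (body_transM x hx p), h.2, e p rfl]⟩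

/-- If `H` is superconformal at `p` with invertible factor, so is a left inverse of `H`. -/
theorem IsDP.inverse {G H : Pt → Pt} {p : Pt} {g : Gr} (h : IsDP H p g) (hu : IsUnit g)
    (hG : ∀ q : Pt, q.body = p.body → G (H q) = q) :
    ∃ g', IsDP G (H p) g' ∧ IsUnit g' := by
  obtain ⟨hg, h⟩ := h
  have hi := inverse_mem_even hg
  refine ⟨Ring.inverse g, ⟨hi, fun e he => ?_⟩, hu.ringInverse⟩
  have h1 : e * Ring.inverse g * g = e := by rw [mul_assoc, Ring.inverse_mul_cancel g hu, mul_one]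
  have h2 := h (e * Ring.inverse g) (odd_mul_even he hi)
  rw [transP_congr h1] at h2
  rw [← h2, hG _ (body_transP _ _ _), hG p rfl]

theorem IsDM.inverse {G H : Pt → Pt} {p : Pt} {g : Gr} (h : IsDM H p g) (hu : IsUnit g)
    (hG : ∀ q : Pt, q.body = p.body → G (H q) = q) :
    ∃ g', IsDM G (H p) g' ∧ IsUnit g' := by
  obtain ⟨hg, h⟩ := h
  have hi := inverse_mem_even hg
  refine ⟨Ring.inverse g, ⟨hi, fun e he => ?_⟩, hu.ringInverse⟩
  have h1 : e * Ring.inverse g * g = e := by rw [mul_assoc, Ring.inverse_mul_cancel g hu, mul_one]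
  have h2 := h (e * Ring.inverse g) (odd_mul_even he hi)
  rw [transM_congr h1] at h2
  rw [← h2, hG _ (body_transM _ _ _), hG p rfl]

/-- `H` is superconformal near the body point `w`, with factors that may vanish. -/
structure PreLSC (H : Pt → Pt) (w : ℂ) : Prop where
  sa : SAMap H w
  dp : ∀ᶠ p in nb w, ∃ g, IsDP H p g
  dm : ∀ᶠ p in nb w, ∃ g, IsDM H p g

/-- `H` is superconformal near the body point `w`, with invertible factors. -/
structure LSC (H : Pt → Pt) (w : ℂ) : Prop where
  sa : SAMap H w
  dp : ∀ᶠ p in nb w, ∃ g, IsDP H p g ∧ IsUnit g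
  dm : ∀ᶠ p in nb w, ∃ g, IsDM H p g ∧ IsUnit g

theorem nb_congr {H H' : Pt → Pt} {w : ℂ} (e : H' =ᶠ[nb w] H) :
    ∀ᶠ p in nb w, ∀ q : Pt, q.body = p.body → H' q = H q := by
  rw [EventuallyEq, nb_iff] at e
  rw [nb_iff]
  filter_upwards [e] with v hv p hp q hq using hv q (hq.trans hp)

theorem LSC.congr {H H' : Pt → Pt} {w : ℂ} (h : LSC H w) (e : H' =ᶠ[nb w] H) : LSC H' w := by
  refine ⟨h.sa.congr e, ?_, ?_⟩
  · filter_upwards [h.dp, nb_congr e] with p ⟨g, hg, hu⟩ h2 using ⟨g, hg.congr h2, hu⟩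
  · filter_upwards [h.dm, nb_congr e] with p ⟨g, hg, hu⟩ h2 using ⟨g, hg.congr h2, hu⟩

theorem LSC.comp {G H : Pt → Pt} {w : ℂ} (hG : LSC G (bodyMap H w)) (hH : LSC H w) :
    LSC (fun p => G (H p)) w := by
  refine ⟨hG.sa.comp hH.sa, ?_, ?_⟩
  · filter_upwards [hH.dp, hH.sa.tendsto.eventually hG.dp] with p ⟨g, hg, hu⟩ ⟨g', hg', hu'⟩
    exact ⟨_, hg.comp hg', hu.mul hu'⟩
  · filter_upwards [hH.dm, hH.sa.tendsto.eventually hG.dm] with p ⟨g, hg, hu⟩ ⟨g', hg', hu'⟩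
    exact ⟨_, hg.comp hg', hu.mul hu'⟩

theorem SAMap.id (w : ℂ) : SAMap (fun p => p) w := ⟨SA.z, SA.tp, SA.tm⟩

theorem LSC.id (w : ℂ) : LSC (fun p => p) w :=
  ⟨SAMap.id w, Eventually.of_forall fun p => ⟨1, IsDP.id p, isUnit_one⟩,
    Eventually.of_forall fun p => ⟨1, IsDM.id p, isUnit_one⟩⟩

theorem isUnit_of_mul_eq_one_even {a b : Gr} (ha : a ∈ evenPart) (h : a * b = 1) : IsUnit a :=
  ⟨⟨a, b, h, by rw [← (even_commute ha b).eq, h]⟩, rfl⟩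

/-- A superconformal function with a superconformal local inverse has invertible factors. -/
theorem PreLSC.lsc {G H : Pt → Pt} {w : ℂ} (hH : PreLSC H w) (hG : PreLSC G (bodyMap H w))
    (h : ∀ᶠ p in nb w, G (H p) = p) : LSC H w := by
  have h' := nb_congr (H := fun p => p) (H' := fun p => G (H p)) h
  refine ⟨hH.sa, ?_, ?_⟩
  · filter_upwards [hH.dp, hH.sa.tendsto.eventually hG.dp, h'] with p ⟨g, hg⟩ ⟨g', hg'⟩ h2
    refine ⟨g, hg, isUnit_of_mul_eq_one_even (b := g') hg.1 ?_⟩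
    exact (hg.comp hg').unique ((IsDP.id p).congr h2)
  · filter_upwards [hH.dm, hH.sa.tendsto.eventually hG.dm, h'] with p ⟨g, hg⟩ ⟨g', hg'⟩ h2
    refine ⟨g, hg, isUnit_of_mul_eq_one_even (b := g') hg.1 ?_⟩
    exact (hg.comp hg').unique ((IsDM.id p).congr h2)

/-! ### The superderivations generate the odd translations -/

/-- The translation by `ε` along `D⁺` changes a superanalytic function by exactly `ε` times its
`D⁺`-derivative, since `εθ⁻` and `ε` have square zero. -/
theorem SuperFn.eval_transP {F : SuperFn} {w : ℂ} (h : F.FinNear w) :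
    ∀ᶠ p in nb w, ∀ e he, F.eval (transP e he p) = F.eval p + e * F.dPlus.eval p := by
  obtain ⟨a1, b1⟩ := h.f.diff
  obtain ⟨a2, b2⟩ := h.xp.diff
  obtain ⟨a3, b3⟩ := h.xm.diff
  obtain ⟨a4, b4⟩ := h.t.diff
  obtain ⟨c1, d1⟩ := h.t.add a1
  obtain ⟨c2, d2⟩ := a2.smul (-1)
  filter_upwards [b1, b2, b3, b4, d1, d2] with p b1 b2 b3 b4 d1 d2 e he
  have n1 := odd_mul_odd he p.tm_odd
  have n2 := odd_mul_sq he p.tm_odd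
  have c2' : (-F.xp.diff).eval p.z = -(F.xp.diff.eval p.z) := by
    rw [neg_one_smul, neg_one_smul] at d2; exact d2
  simp only [SuperFn.eval, SuperFn.dPlus, transP, b1 _ n1 n2, b2 _ n1 n2, b3 _ n1 n2, b4 _ n1 n2,
    d1, c2', eval_zero_family p.z_even]
  -- The sign rules that bring every monomial into the order `ε`, `θ⁺`, `θ⁻`, coefficient.
  have r1 := odd_anticomm p.tp_odd he
  have r2 := odd_anticomm p.tm_odd he
  have r3 : ∀ x, p.tp * (e * x) = -(e * (p.tp * x)) := fun x => by
    rw [← mul_assoc, r1, neg_mul, mul_assoc]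
  have r4 : ∀ x, p.tm * (e * x) = -(e * (p.tm * x)) := fun x => by
    rw [← mul_assoc, r2, neg_mul, mul_assoc]
  have r5 : ∀ x, e * (e * x) = 0 := fun x => by rw [← mul_assoc, odd_sq he, zero_mul]
  have r6 : ∀ x, p.tm * (p.tm * x) = 0 := fun x => by
    rw [← mul_assoc, odd_sq p.tm_odd, zero_mul]
  simp only [mul_add, add_mul, mul_assoc, r3, r4, r5, r6, mul_neg, mul_zero, neg_zero]
  abel

theorem SuperFn.eval_transM {F : SuperFn} {w : ℂ} (h : F.FinNear w) :
    ∀ᶠ p in nb w, ∀ e he, F.eval (transM e he p) = F.eval p + e * F.dMinus.eval p := by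
  obtain ⟨a1, b1⟩ := h.f.diff
  obtain ⟨a2, b2⟩ := h.xp.diff
  obtain ⟨a3, b3⟩ := h.xm.diff
  obtain ⟨a4, b4⟩ := h.t.diff
  obtain ⟨c2, d2⟩ := h.t.smul (-1)
  obtain ⟨c1, d1⟩ := a1.add c2
  filter_upwards [b1, b2, b3, b4, d1, d2] with p b1 b2 b3 b4 d1 d2 e he
  have n1 := odd_mul_odd he p.tp_odd
  have n2 := odd_mul_sq he p.tp_odd
  have c2' : (F.f.diff - F.t).eval p.z = F.f.diff.eval p.z - F.t.eval p.z := by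
    rw [neg_one_smul] at d1 d2
    rw [sub_eq_add_neg, d1, d2, neg_one_smul, sub_eq_add_neg]
  simp only [SuperFn.eval, SuperFn.dMinus, transM, b1 _ n1 n2, b2 _ n1 n2, b3 _ n1 n2, b4 _ n1 n2,
    c2', eval_zero_family p.z_even]
  have r1 := odd_anticomm p.tp_odd he
  have r2 := odd_anticomm p.tm_odd he
  have r0 := odd_anticomm p.tm_odd p.tp_odd
  have r3 : ∀ x, p.tp * (e * x) = -(e * (p.tp * x)) := fun x => by
    rw [← mul_assoc, r1, neg_mul, mul_assoc]
  have r4 : ∀ x, p.tm * (e * x) = -(e * (p.tm * x)) := fun x => by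
    rw [← mul_assoc, r2, neg_mul, mul_assoc]
  have r5 : ∀ x, e * (e * x) = 0 := fun x => by rw [← mul_assoc, odd_sq he, zero_mul]
  have r6 : ∀ x, p.tp * (p.tp * x) = 0 := fun x => by
    rw [← mul_assoc, odd_sq p.tp_odd, zero_mul]
  have r7 : ∀ x, p.tm * (p.tp * x) = -(p.tp * (p.tm * x)) := fun x => by
    rw [← mul_assoc, r0, neg_mul, mul_assoc]
  simp only [mul_add, add_mul, mul_sub, mul_assoc, r3, r4, r5, r6, r7, mul_neg, mul_zero, neg_zero,
    neg_neg]
  abel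

/-- The equations that express `IsDP` in terms of the components. -/
theorem IsDP.superFn {H : Pt → Pt} {p : Pt} {g : Gr} {Z P M : SuperFn} (h : IsDP H p g)
    (hZ : Z.FinNear p.body) (hP : P.FinNear p.body) (hM : M.FinNear p.body)
    (e : ∀ q : Pt, q.body = p.body →
      (H q).z = Z.eval q ∧ (H q).tp = P.eval q ∧ (H q).tm = M.eval q) :
    P.dPlus.eval p = g ∧ M.dPlus.eval p = 0 ∧ Z.dPlus.eval p - M.eval p * P.dPlus.eval p = 0 := by
  obtain ⟨hg, hH⟩ := h
  have tZ := nb_self (SuperFn.eval_transP hZ) rfl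
  have tP := nb_self (SuperFn.eval_transP hP) rfl
  have tM := nb_self (SuperFn.eval_transP hM) rfl
  obtain ⟨eZ, eP, eM⟩ := e p rfl
  have h1 : P.dPlus.eval p = g := cancel_odd_eq fun a ha => by
    have := (e _ (body_transP a ha p)).2.1
    rw [hH, tP, ← eP] at this
    exact (add_left_cancel this).symm
  have h2 : M.dPlus.eval p = 0 := cancel_odd fun a ha => by
    have := (e _ (body_transP a ha p)).2.2
    rw [hH, tM, ← eM] at this
    exact left_eq_add.1 this
  have h3 : Z.dPlus.eval p = g * M.eval p := cancel_odd_eq fun a ha => by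
    have := (e _ (body_transP a ha p)).1
    rw [hH, tZ, ← eZ] at this
    rw [← mul_assoc, ← eM]
    exact (add_left_cancel this).symm
  exact ⟨h1, h2, by rw [h3, h1, (even_commute hg _).eq, sub_self]⟩

/-- The equations that express `IsDM` in terms of the components. -/
theorem IsDM.superFn {H : Pt → Pt} {p : Pt} {g : Gr} {Z P M : SuperFn} (h : IsDM H p g)
    (hZ : Z.FinNear p.body) (hP : P.FinNear p.body) (hM : M.FinNear p.body)
    (e : ∀ q : Pt, q.body = p.body →
      (H q).z = Z.eval q ∧ (H q).tp = P.eval q ∧ (H q).tm = M.eval q) :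
    M.dMinus.eval p = g ∧ P.dMinus.eval p = 0 ∧
      Z.dMinus.eval p - P.eval p * M.dMinus.eval p = 0 := by
  obtain ⟨hg, hH⟩ := h
  have tZ := nb_self (SuperFn.eval_transM hZ) rfl
  have tP := nb_self (SuperFn.eval_transM hP) rfl
  have tM := nb_self (SuperFn.eval_transM hM) rfl
  obtain ⟨eZ, eP, eM⟩ := e p rfl
  have h1 : M.dMinus.eval p = g := cancel_odd_eq fun a ha => by
    have := (e _ (body_transM a ha p)).2.2
    rw [hH, tM, ← eM] at this
    exact (add_left_cancel this).symm
  have h2 : P.dMinus.eval p = 0 := cancel_odd fun a ha => by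
    have := (e _ (body_transM a ha p)).2.1
    rw [hH, tP, ← eP] at this
    exact left_eq_add.1 this
  have h3 : Z.dMinus.eval p = g * P.eval p := cancel_odd_eq fun a ha => by
    have := (e _ (body_transM a ha p)).1
    rw [hH, tZ, ← eZ] at this
    rw [← mul_assoc, ← eP]
    exact (add_left_cancel this).symm
  exact ⟨h1, h2, by rw [h3, h1, (even_commute hg _).eq, sub_self]⟩

/-- A function that is superconformal near each body point is superconformal. -/
theorem superconformalOn_of_lsc {H : Pt → Pt} {V : Set ℂ} (hV : IsOpen V) (hne : V.Nonempty)
    (h : ∀ w ∈ V, LSC H w) : SuperconformalOn H (Pt.body ⁻¹' V) := by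
  obtain ⟨Z, hZ, eZ⟩ := SA.glue hV fun w hw => (h w hw).sa.z
  obtain ⟨P, hP, eP⟩ := SA.glue hV fun w hw => (h w hw).sa.tp
  obtain ⟨M, hM, eM⟩ := SA.glue hV fun w hw => (h w hw).sa.tm
  have keyP : ∀ p : Pt, p.body ∈ V → M.dPlus.eval p = 0 ∧
      Z.dPlus.eval p - M.eval p * P.dPlus.eval p = 0 ∧ P.dPlus.eval p ≠ 0 := by
    intro p hp
    obtain ⟨g, hg, hu⟩ := nb_self (h _ hp).dp rfl
    obtain ⟨h1, h2, h3⟩ := hg.superFn (hZ.finNear hV hp) (hP.finNear hV hp) (hM.finNear hV hp)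
      fun q hq => ⟨eZ q (hq ▸ hp), eP q (hq ▸ hp), eM q (hq ▸ hp)⟩
    exact ⟨h2, h3, h1 ▸ hu.ne_zero⟩
  have keyM : ∀ p : Pt, p.body ∈ V → P.dMinus.eval p = 0 ∧
      Z.dMinus.eval p - P.eval p * M.dMinus.eval p = 0 ∧ M.dMinus.eval p ≠ 0 := by
    intro p hp
    obtain ⟨g, hg, hu⟩ := nb_self (h _ hp).dm rfl
    obtain ⟨h1, h2, h3⟩ := hg.superFn (hZ.finNear hV hp) (hP.finNear hV hp) (hM.finNear hV hp)
      fun q hq => ⟨eZ q (hq ▸ hp), eP q (hq ▸ hp), eM q (hq ▸ hp)⟩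
    exact ⟨h2, h3, h1 ▸ hu.ne_zero⟩
  obtain ⟨w, hw⟩ := hne
  have hw' : (Pt.ofComplex w).body ∈ V := by rwa [body_ofComplex]
  exact ⟨V, hV, rfl, Z, P, M, hZ, SuperFn.isEvenOn hV hZ fun p hp => eZ p hp ▸ (H p).z_even,
    hP, SuperFn.isOddOn hV hP fun p hp => eP p hp ▸ (H p).tp_odd,
    hM, SuperFn.isOddOn hV hM fun p hp => eM p hp ▸ (H p).tm_odd,
    fun p hp => ⟨eZ p hp, eP p hp, eM p hp⟩, fun p hp => (keyP p hp).1, fun p hp => (keyM p hp).1,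
    fun p hp => (keyP p hp).2.1, fun p hp => (keyM p hp).2.1,
    ⟨_, hw', (keyP _ hw').2.2⟩, ⟨_, hw', (keyM _ hw').2.2⟩⟩

/-- The translation property of a superconformal function. -/
theorem preLSC_of_superFn {H : Pt → Pt} {w : ℂ} {Z P M : SuperFn} (hZ : Z.FinNear w)
    (hP : P.FinNear w) (hM : M.FinNear w)
    (h : ∀ᶠ p in nb w, (H p).z = Z.eval p ∧ (H p).tp = P.eval p ∧ (H p).tm = M.eval p)
    (h1 : ∀ᶠ p in nb w, M.dPlus.eval p = 0) (h2 : ∀ᶠ p in nb w, P.dMinus.eval p = 0)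
    (h3 : ∀ᶠ p in nb w, Z.dPlus.eval p - M.eval p * P.dPlus.eval p = 0)
    (h4 : ∀ᶠ p in nb w, Z.dMinus.eval p - P.eval p * M.dMinus.eval p = 0) :
    SAMap H w ∧ (∀ᶠ p in nb w, IsDP H p (P.dPlus.eval p)) ∧
      ∀ᶠ p in nb w, IsDM H p (M.dMinus.eval p) := by
  have h' : ∀ᶠ p in nb w, ∀ q : Pt, q.body = p.body →
      ((H q).z = Z.eval q ∧ (H q).tp = P.eval q ∧ (H q).tm = M.eval q) := by
    rw [nb_iff] at h ⊢
    filter_upwards [h] with v hv p hp q hq using hv q (hq.trans hp)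
  refine ⟨⟨SA.congr hZ.sa (h.mono fun p hp => hp.1), SA.congr hP.sa (h.mono fun p hp => hp.2.1),
    SA.congr hM.sa (h.mono fun p hp => hp.2.2)⟩, ?_, ?_⟩
  · filter_upwards [h', h1, h3, SuperFn.eval_transP hZ, SuperFn.eval_transP hP,
      SuperFn.eval_transP hM] with p h h1 h3 tZ tP tM
    obtain ⟨eZ, eP, eM⟩ := h p rfl
    have hg : P.dPlus.eval p ∈ evenPart := by
      refine mem_gr_of_odd_mul (d := 0) fun e he => ?_
      have e2 : e * P.dPlus.eval p = (H (transP e he p)).tp - (H p).tp := by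
        rw [(h _ (body_transP e he p)).2.1, tP, eP, add_sub_cancel_left]
      rw [e2]
      exact Submodule.sub_mem _ (Pt.tp_odd _) (Pt.tp_odd _)
    refine ⟨hg, fun e he => ?_⟩
    obtain ⟨fZ, fP, fM⟩ := h _ (body_transP e he p)
    ext1
    · rw [fZ, tZ, sub_eq_zero.1 h3, ← (even_commute hg _).eq, ← mul_assoc, ← eZ, ← eM]; rfl
    · rw [fP, tP, ← eP]; rfl
    · rw [fM, tM, h1, mul_zero, add_zero, ← eM]; rfl
  · filter_upwards [h', h2, h4, SuperFn.eval_transM hZ, SuperFn.eval_transM hP,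
      SuperFn.eval_transM hM] with p h h1 h3 tZ tP tM
    obtain ⟨eZ, eP, eM⟩ := h p rfl
    have hg : M.dMinus.eval p ∈ evenPart := by
      refine mem_gr_of_odd_mul (d := 0) fun e he => ?_
      have e2 : e * M.dMinus.eval p = (H (transM e he p)).tm - (H p).tm := by
        rw [(h _ (body_transM e he p)).2.2, tM, eM, add_sub_cancel_left]
      rw [e2]
      exact Submodule.sub_mem _ (Pt.tm_odd _) (Pt.tm_odd _)
    refine ⟨hg, fun e he => ?_⟩
    obtain ⟨fZ, fP, fM⟩ := h _ (body_transM e he p)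
    ext1
    · rw [fZ, tZ, sub_eq_zero.1 h3, ← (even_commute hg _).eq, ← mul_assoc, ← eZ, ← eP]; rfl
    · rw [fP, tP, h1, mul_zero, add_zero, ← eP]; rfl
    · rw [fM, tM, ← eM]; rfl

theorem eventually_nb_of_mem {V : Set ℂ} (hV : IsOpen V) {w : ℂ} (hw : w ∈ V) {P : Pt → Prop}
    (h : ∀ p : Pt, p.body ∈ V → P p) : ∀ᶠ p in nb w, P p :=
  ((tendsto_body_nb w).eventually (hV.mem_nhds hw)).mono h

theorem SuperconformalOn.preLSC {H : Pt → Pt} {U : Set Pt} (h : SuperconformalOn H U) :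
    ∃ V : Set ℂ, IsOpen V ∧ U = Pt.body ⁻¹' V ∧ ∀ w ∈ V, PreLSC H w := by
  obtain ⟨V, hV, rfl, Z, P, M, hZ, -, hP, -, hM, -, e, h1, h2, h3, h4, -⟩ := h
  refine ⟨V, hV, rfl, fun w hw => ?_⟩
  obtain ⟨a, b, c⟩ := preLSC_of_superFn (hZ.finNear hV hw) (hP.finNear hV hw) (hM.finNear hV hw)
    (eventually_nb_of_mem hV hw e) (eventually_nb_of_mem hV hw h1) (eventually_nb_of_mem hV hw h2)
    (eventually_nb_of_mem hV hw h3) (eventually_nb_of_mem hV hw h4)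
  exact ⟨a, b.mono fun p hp => ⟨_, hp⟩, c.mono fun p hp => ⟨_, hp⟩⟩

/-! ### Elementary superconformal maps -/

/-- The symmetry of superspace that exchanges `θ⁺` and `θ⁻`. -/
def swap (p : Pt) : Pt := ⟨p.z, p.tm, p.tp, p.z_even, p.tm_odd, p.tp_odd⟩

theorem isDM_of_swap {H : Pt → Pt} {p : Pt} {g : Gr}
    (h : IsDP (fun q => swap (H (swap q))) (swap p) g) : IsDM H p g := by
  obtain ⟨hg, h⟩ := h
  refine ⟨hg, fun e he => ?_⟩
  have := congrArg swap (h e he)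
  exact this

theorem inverse_eq_of_mul {a b : Gr} (ha : a ∈ evenPart) (h : a * b = 1) : Ring.inverse a = b := by
  have hu := isUnit_of_mul_eq_one_even ha h
  rw [← mul_one (Ring.inverse a), ← h, ← mul_assoc, Ring.inverse_mul_cancel a hu, one_mul]

theorem inverse_add_sq {a n : Gr} (ha : a ∈ evenPart) (hn : n ∈ evenPart) (h2 : n * n = 0)
    (hu : IsUnit a) :
    Ring.inverse (a + n) = Ring.inverse a - n * (Ring.inverse a * Ring.inverse a) := by
  refine inverse_eq_of_mul (Submodule.add_mem _ ha hn) ?_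
  set y := Ring.inverse a
  have y1 : a * y = 1 := Ring.mul_inverse_cancel _ hu
  rw [add_mul, mul_sub, mul_sub, y1, ← mul_assoc n n, h2, zero_mul, sub_zero, ← mul_assoc a n,
    (even_commute ha n).eq, mul_assoc n a, ← mul_assoc a y, y1, one_mul, sub_add_cancel]

theorem isDP_recip {c : ℂ} (hc : c * c = -1) {p : Pt} (hp : p.body ≠ 0) :
    ∃ g, IsDP (recip c) p g ∧ IsUnit g := by
  set y := Ring.inverse p.z with hy
  have hu : IsUnit p.z := (isUnit_iff_body p.z_even).2 hp
  have ye : y ∈ evenPart := inverse_mem_even p.z_even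
  have hg0 : c • y + c • (p.tp * p.tm * (y * y)) ∈ evenPart :=
    Submodule.add_mem _ (Submodule.smul_mem _ _ ye)
      (Submodule.smul_mem _ _ (even_mul_even (odd_mul_odd p.tp_odd p.tm_odd) (even_mul_even ye ye)))
  refine ⟨c • y + c • (p.tp * p.tm * (y * y)), ⟨hg0, fun e he => ?_⟩, ?_⟩
  · have hinv : Ring.inverse (p.z + e * p.tm) = y - e * p.tm * (y * y) :=
      inverse_add_sq p.z_even (odd_mul_odd he p.tm_odd) (odd_mul_sq he p.tm_odd) hu
    have y0 : ∀ x, y * x = x * y := fun x => (even_commute ye x).eq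
    have y1 : ∀ x, y * (p.tm * x) = p.tm * (y * x) := fun x => by
      rw [← mul_assoc, y0, mul_assoc]
    have y2 := y0 p.tm
    have r1 : ∀ x, p.tp * (e * x) = -(e * (p.tp * x)) := fun x => by
      rw [← mul_assoc, odd_anticomm p.tp_odd he, neg_mul, mul_assoc]
    have r2 : ∀ x, p.tm * (e * x) = -(e * (p.tm * x)) := fun x => by
      rw [← mul_assoc, odd_anticomm p.tm_odd he, neg_mul, mul_assoc]
    have r3 : ∀ x, e * (e * x) = 0 := fun x => by rw [← mul_assoc, odd_sq he, zero_mul]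
    have r4 : ∀ x, p.tm * (p.tm * x) = 0 := fun x => by
      rw [← mul_assoc, odd_sq p.tm_odd, zero_mul]
    ext1
    · simp only [recip, transP, hinv]
      simp only [mul_add, add_mul, mul_assoc, smul_mul_assoc, mul_smul_comm, smul_smul, hc, y1, r4,
        ← hy, mul_zero, smul_zero, add_zero, neg_smul, one_smul]
      abel
    · simp only [recip, transP, hinv]
      simp only [mul_add, add_mul, mul_sub, mul_assoc, mul_smul_comm, r1, r3,
        ← hy, smul_add, smul_sub, smul_neg, smul_zero]
      abel
    · simp only [recip, transP, hinv]
      simp only [mul_sub, mul_assoc, r2, r4, ← hy, mul_zero, neg_zero, sub_zero]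
  · rw [isUnit_iff_body hg0]
    simp only [map_add, map_smul, map_mul, body_odd p.tp_odd, zero_mul, smul_zero, add_zero]
    have hb : body y ≠ 0 := by
      rw [← isUnit_iff_body ye]; exact hu.ringInverse
    refine smul_ne_zero ?_ hb
    rintro rfl
    simp at hc

theorem samap_recip (c : ℂ) {w : ℂ} (hw : w ≠ 0) : SAMap (recip c) w := by
  have hi : (fun p : Pt => Ring.inverse p.z) ∈ SA w := by
    refine SA.congr (SA.hat (φ := fun w => w⁻¹) (analyticAt_id.inv hw)) ?_
    filter_upwards [(tendsto_body_nb w).eventually (isOpen_ne.mem_nhds hw)] with p hp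
    exact ring_inverse_eq p.z_even hp
  exact ⟨hi, SA.smul c (SA.mul SA.tp hi), SA.smul c (SA.mul SA.tm hi)⟩

theorem lsc_recip {c : ℂ} (hc : c * c = -1) {w : ℂ} (hw : w ≠ 0) : LSC (recip c) w := by
  refine ⟨samap_recip c hw, ?_, ?_⟩
  · filter_upwards [(tendsto_body_nb w).eventually (isOpen_ne.mem_nhds hw)] with p hp
    exact isDP_recip hc hp
  · filter_upwards [(tendsto_body_nb w).eventually (isOpen_ne.mem_nhds hw)] with p hp
    obtain ⟨g, h1, h2⟩ := isDP_recip hc (p := swap p) hp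
    exact ⟨g, isDM_of_swap h1, h2⟩

/-- The scaling `(z, θ⁺, θ⁻) ↦ (abz, aθ⁺, bθ⁻)`. -/
def scale {a b : Gr} (ha : a ∈ evenPart) (hb : b ∈ evenPart) (p : Pt) : Pt :=
  ⟨a * b * p.z, a * p.tp, b * p.tm, even_mul_even (even_mul_even ha hb) p.z_even,
    even_mul_odd ha p.tp_odd, even_mul_odd hb p.tm_odd⟩

theorem lsc_scale {a b : Gr} (ha : a ∈ evenPart) (hb : b ∈ evenPart) (ua : IsUnit a)
    (ub : IsUnit b) (w : ℂ) : LSC (scale ha hb) w := by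
  refine ⟨⟨SA.mul (SA.const _) SA.z, SA.mul (SA.const _) SA.tp, SA.mul (SA.const _) SA.tm⟩,
    Eventually.of_forall fun p => ⟨a, ⟨ha, fun e he => ?_⟩, ua⟩,
    Eventually.of_forall fun p => ⟨b, ⟨hb, fun e he => ?_⟩, ub⟩⟩
  · have h1 := (even_commute ha e).eq
    ext1 <;> simp only [scale, transP]
    · rw [mul_add, ← h1]
      congr 1
      rw [mul_assoc, mul_assoc, ← mul_assoc b, (even_commute hb e).eq, mul_assoc]
    · rw [mul_add, h1]
  · have h1 := (even_commute hb e).eq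
    ext1 <;> simp only [scale, transM]
    · rw [mul_add, ← h1, (even_commute ha b).eq]
      congr 1
      rw [mul_assoc, mul_assoc, ← mul_assoc a, (even_commute ha e).eq, mul_assoc]
    · rw [mul_add, h1]

theorem lsc_shift (x : Pt) (w : ℂ) : LSC (shift x) w := by
  refine ⟨⟨SA.sub (SA.sub (SA.sub SA.z (SA.const _)) (SA.mul SA.tp (SA.const _)))
    (SA.mul SA.tm (SA.const _)), SA.sub SA.tp (SA.const _), SA.sub SA.tm (SA.const _)⟩,
    Eventually.of_forall fun p => ⟨1, ⟨one_mem_even, fun e he => ?_⟩, isUnit_one⟩,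
    Eventually.of_forall fun p => ⟨1, ⟨one_mem_even, fun e he => ?_⟩, isUnit_one⟩⟩
  · ext1 <;> simp only [shift, transP, mul_one, add_mul, mul_sub]
    · abel
    · abel
  · ext1 <;> simp only [shift, transM, mul_one, add_mul, mul_sub]
    · abel
    · abel

/-- The shift inverse to `shift x`. -/
def negPt (x : Pt) : Pt :=
  ⟨-x.z, -x.tp, -x.tm, Submodule.neg_mem _ x.z_even, Submodule.neg_mem _ x.tp_odd,
    Submodule.neg_mem _ x.tm_odd⟩

theorem shift_negPt (x p : Pt) : shift (negPt x) (shift x p) = p := by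
  have h := odd_anticomm x.tp_odd x.tm_odd
  ext1 <;> simp only [shift, negPt, mul_neg, sub_mul, sub_neg_eq_add]
  · rw [h]; abel
  · abel
  · abel

theorem negPt_negPt (x : Pt) : negPt (negPt x) = x := by
  ext1 <;> simp [negPt]

theorem shift_shift_negPt (x p : Pt) : shift x (shift (negPt x) p) = p := by
  conv_lhs => rw [← negPt_negPt x]
  rw [negPt_negPt (negPt x)]
  exact shift_negPt (negPt x) p

theorem shift_self (x : Pt) : shift x x = 0 := by
  have h := odd_anticomm x.tp_odd x.tm_odd
  ext1
  · change x.z - x.z - x.tp * x.tm - x.tm * x.tp = 0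
    rw [h]; abel
  · exact sub_self _
  · exact sub_self _

theorem body_shift (x p : Pt) : (shift x p).body = p.body - x.body := by
  simp only [Pt.body, shift, map_sub, map_mul, body_odd p.tp_odd, body_odd p.tm_odd, zero_mul,
    sub_zero]

/-- The map `(z, θ⁺, θ⁻) ↦ (z, -θ⁺, -θ⁻)`, the square of `invI`. -/
def flip (p : Pt) : Pt :=
  ⟨p.z, -p.tp, -p.tm, p.z_even, Submodule.neg_mem _ p.tp_odd, Submodule.neg_mem _ p.tm_odd⟩

theorem flip_flip (p : Pt) : flip (flip p) = p := by ext1 <;> simp [flip]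

theorem body_flip (p : Pt) : (flip p).body = p.body := rfl

theorem lsc_flip (w : ℂ) : LSC flip w := by
  have h1 : (-1 : Gr) ∈ evenPart := Submodule.neg_mem _ one_mem_even
  refine (lsc_scale h1 h1 isUnit_one.neg isUnit_one.neg w).congr (Eventually.of_forall fun p => ?_)
  ext1 <;> simp [flip, scale]

theorem recip_recip_flip {c : ℂ} (hc : c * c = -1) {p : Pt} (hp : p.body ≠ 0) :
    recip c (recip c p) = flip p := by
  have h : recip c (flip p) = recip (-c) p := by
    ext1
    · rfl
    · simp [recip, flip]
    · simp [recip, flip]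
  have h2 : c * (-c) = 1 := by rw [mul_neg, hc, neg_neg]
  have h3 := recip_recip h2 (p := flip p) hp
  have h4 : recip (-c) (flip p) = recip c p := by
    ext1
    · rfl
    · simp [recip, flip]
    · simp [recip, flip]
  rw [h4] at h3
  exact h3

/-! ### Superconformal charts and isomorphisms -/

/-- The transition between two coordinate maps is superconformal at the point `x`. -/
def CompatAt (Ω Ω' : OpenPartialHomeomorph Sphere Pt) (x : Sphere) : Prop :=
  LSC (fun p => Ω' (Ω.symm p)) (Ω x).body

theorem bodyMap_eq {H : Pt → Pt} {p : Pt} (h : SAMap H p.body) :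
    bodyMap H p.body = (H p).body := (nb_self h.body_eq rfl).symm

theorem eventually_symm_mem {Ω : OpenPartialHomeomorph Sphere Pt} {x : Sphere} (hx : x ∈ Ω.source)
    {s : Set Sphere} (hs : s ∈ 𝓝 x) : ∀ᶠ p in nb (Ω x).body, Ω.symm p ∈ s := by
  rw [nb_eq_nhds]
  exact Ω.tendsto_symm hx hs

theorem eventually_mem_target {Ω : OpenPartialHomeomorph Sphere Pt} {x : Sphere}
    (hx : x ∈ Ω.source) : ∀ᶠ p in nb (Ω x).body, p ∈ Ω.target := by
  rw [nb_eq_nhds]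
  exact Ω.open_target.mem_nhds (Ω.map_source hx)

theorem CompatAt.trans {Ω₁ Ω₂ Ω₃ : OpenPartialHomeomorph Sphere Pt} {x : Sphere}
    (h1 : x ∈ Ω₁.source) (h2 : x ∈ Ω₂.source) (h : CompatAt Ω₁ Ω₂ x) (h' : CompatAt Ω₂ Ω₃ x) :
    CompatAt Ω₁ Ω₃ x := by
  have e : bodyMap (fun p => Ω₂ (Ω₁.symm p)) (Ω₁ x).body = (Ω₂ x).body := by
    rw [bodyMap_eq h.sa, Ω₁.left_inv h1]
  have h3 := LSC.comp (G := fun p => Ω₃ (Ω₂.symm p)) (by rw [e]; exact h') h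
  refine h3.congr ?_
  filter_upwards [eventually_symm_mem h1 (Ω₂.open_source.mem_nhds h2)] with p hp
  rw [Ω₂.left_inv hp]

theorem CompatAt.refl {Ω : OpenPartialHomeomorph Sphere Pt} {x : Sphere} (h : x ∈ Ω.source) :
    CompatAt Ω Ω x :=
  (LSC.id _).congr ((eventually_mem_target h).mono fun _ hp => Ω.right_inv hp)

theorem lsc_inverse {G H : Pt → Pt} {w : ℂ} (hH : LSC H w) (hG : SAMap G (bodyMap H w))
    (h1 : ∀ᶠ p in nb w, G (H p) = p) (h2 : ∀ᶠ q in nb (bodyMap H w), H (G q) = q) :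
    LSC G (bodyMap H w) := by
  have e : bodyMap G (bodyMap H w) = w := by
    rw [← SAMap.bodyMap_comp hG, bodyMap, nb_self h1 (body_ofComplex w), body_ofComplex]
  have h1' := nb_congr (H := fun p => p) (H' := fun p => G (H p)) h1
  have ht := hG.tendsto
  rw [e] at ht
  refine ⟨hG, ?_, ?_⟩
  · filter_upwards [h2, ht.eventually hH.dp, ht.eventually h1'] with q a ⟨g, b, hu⟩ d
    have := b.inverse hu d
    rwa [a] at this
  · filter_upwards [h2, ht.eventually hH.dm, ht.eventually h1'] with q a ⟨g, b, hu⟩ d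
    have := b.inverse hu d
    rwa [a] at this

theorem north_mem {x : Sphere} (h : x ∉ south.source) : x ∈ north.source := by
  cases x with
  | fin p => exact absurd ⟨p, rfl⟩ h
  | inf q hq => exact ⟨q, by simp [northInv, hq]⟩

theorem exists_atlas (x : Sphere) : ∃ φ ∈ atlas, x ∈ φ.source := by
  by_cases h : x ∈ south.source
  · exact ⟨south, Or.inl rfl, h⟩
  · exact ⟨north, Or.inr rfl, north_mem h⟩

theorem atlas_compatAt {φ ψ : OpenPartialHomeomorph Sphere Pt} (hφ : φ ∈ atlas) (hψ : ψ ∈ atlas)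
    {x : Sphere} (h1 : x ∈ φ.source) (h2 : x ∈ ψ.source) : CompatAt φ ψ x := by
  have hI : Complex.I * Complex.I = -1 := Complex.I_mul_I
  rcases hφ with rfl | rfl <;> rcases hψ with rfl | rfl
  · exact CompatAt.refl h1
  · obtain ⟨p, rfl⟩ := h1
    have hp := (mem_range_northInv p).1 h2
    exact lsc_recip (by rw [neg_mul_neg, hI]) hp
  · obtain ⟨p, rfl⟩ := h2
    have hp := (mem_range_northInv p).1 h1
    have hb : (north (Sphere.fin p)).body ≠ 0 := by
      change (recip _ p).body ≠ 0
      rw [body_recip]; exact inv_ne_zero hp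
    refine (lsc_recip hI hb).congr ?_
    filter_upwards [(tendsto_body_nb _).eventually (isOpen_ne.mem_nhds hb)] with q hq
    exact south_north.2 q ((isUnit_iff_body q.z_even).2 hq)
  · exact CompatAt.refl h1

theorem exists_preimage_of_isOpen {U : Set Pt} (h : IsOpen U) :
    ∃ V : Set ℂ, IsOpen V ∧ U = Pt.body ⁻¹' V := by
  obtain ⟨V, hV, rfl⟩ := isOpen_induced_iff.1 h
  exact ⟨V, hV, rfl⟩

theorem ofComplex_surj {V : Set ℂ} {w : ℂ} (hw : w ∈ V) : Pt.ofComplex w ∈ Pt.body ⁻¹' V := by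
  rwa [Set.mem_preimage, body_ofComplex]

theorem superconformalOn_trans {Ω Ω' : OpenPartialHomeomorph Sphere Pt}
    (hne : (Ω.symm.trans Ω').source.Nonempty)
    (h : ∀ x, x ∈ Ω.source → x ∈ Ω'.source → CompatAt Ω Ω' x) :
    SuperconformalOn (Ω.symm.trans Ω') (Ω.symm.trans Ω').source := by
  obtain ⟨V, hV, e⟩ := exists_preimage_of_isOpen (Ω.symm.trans Ω').open_source
  rw [e] at hne ⊢
  obtain ⟨p, hp⟩ := hne
  refine superconformalOn_of_lsc hV ⟨_, hp⟩ fun w hw => ?_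
  have hm := ofComplex_surj hw
  rw [← e, OpenPartialHomeomorph.trans_source] at hm
  have := h (Ω.symm (Pt.ofComplex w)) (Ω.map_target hm.1) hm.2
  rw [CompatAt, Ω.right_inv hm.1, body_ofComplex] at this
  exact this

theorem isSuperconformalChart_iff {Ω : OpenPartialHomeomorph Sphere Pt} :
    IsSuperconformalChart Ω ↔ ∀ φ ∈ atlas, ∀ x, x ∈ φ.source → x ∈ Ω.source →
      CompatAt φ Ω x ∧ CompatAt Ω φ x := by
  constructor
  · intro h φ hφ x h1 h2
    obtain ⟨a, b⟩ := h φ hφ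
    have m1 : φ x ∈ (φ.symm.trans Ω).source := by
      rw [OpenPartialHomeomorph.trans_source]
      exact ⟨φ.map_source h1, by
        change φ.symm (φ x) ∈ Ω.source
        rwa [φ.left_inv h1]⟩
    have m2 : Ω x ∈ (Ω.symm.trans φ).source := by
      rw [OpenPartialHomeomorph.trans_source]
      exact ⟨Ω.map_source h2, by
        change Ω.symm (Ω x) ∈ φ.source
        rwa [Ω.left_inv h2]⟩
    obtain ⟨V, hV, eV, a⟩ := (a ⟨_, m1⟩).preLSC
    obtain ⟨W, hW, eW, b⟩ := (b ⟨_, m2⟩).preLSC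
    rw [eV] at m1
    rw [eW] at m2
    have a' : PreLSC (fun p => Ω (φ.symm p)) (φ x).body := a _ m1
    have b' : PreLSC (fun p => φ (Ω.symm p)) (Ω x).body := b _ m2
    have e1 : bodyMap (fun p => Ω (φ.symm p)) (φ x).body = (Ω x).body := by
      rw [bodyMap_eq a'.sa, φ.left_inv h1]
    have e2 : bodyMap (fun p => φ (Ω.symm p)) (Ω x).body = (φ x).body := by
      rw [bodyMap_eq b'.sa, Ω.left_inv h2]
    constructor
    · refine PreLSC.lsc a' (by rw [e1]; exact b') ?_
      filter_upwards [eventually_symm_mem h1 (Ω.open_source.mem_nhds h2),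
        eventually_mem_target h1] with p hp hp'
      rw [Ω.left_inv hp, φ.right_inv hp']
    · refine PreLSC.lsc b' (by rw [e2]; exact a') ?_
      filter_upwards [eventually_symm_mem h2 (φ.open_source.mem_nhds h1),
        eventually_mem_target h2] with p hp hp'
      rw [φ.left_inv hp, Ω.right_inv hp']
  · intro h φ hφ
    exact ⟨fun hne => superconformalOn_trans hne fun x h1 h2 => (h φ hφ x h1 h2).1,
      fun hne => superconformalOn_trans hne fun x h1 h2 => (h φ hφ x h2 h1).2⟩

theorem IsSuperconformalChart.compatAt {Ω Ω' : OpenPartialHomeomorph Sphere Pt}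
    (h : IsSuperconformalChart Ω) (h' : IsSuperconformalChart Ω') {x : Sphere}
    (h1 : x ∈ Ω.source) (h2 : x ∈ Ω'.source) : CompatAt Ω Ω' x := by
  obtain ⟨φ, hφ, hx⟩ := exists_atlas x
  exact CompatAt.trans h1 hx (isSuperconformalChart_iff.1 h φ hφ x hx h1).2
    (isSuperconformalChart_iff.1 h' φ hφ x hx h2).1

theorem isSuperconformalChart_of_compatAt {Ω : OpenPartialHomeomorph Sphere Pt}
    (h : ∀ x ∈ Ω.source, ∃ Ω', IsSuperconformalChart Ω' ∧ x ∈ Ω'.source ∧ CompatAt Ω Ω' x ∧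
      CompatAt Ω' Ω x) : IsSuperconformalChart Ω := by
  refine isSuperconformalChart_iff.2 fun φ hφ x h1 h2 => ?_
  obtain ⟨Ω', hΩ', hx, a, b⟩ := h x h2
  obtain ⟨c, d⟩ := isSuperconformalChart_iff.1 hΩ' φ hφ x h1 hx
  exact ⟨c.trans h1 hx b, a.trans h2 hx d⟩

theorem atlas_isSuperconformalChart {φ : OpenPartialHomeomorph Sphere Pt} (h : φ ∈ atlas) :
    IsSuperconformalChart φ :=
  isSuperconformalChart_iff.2 fun _ hψ _ h1 h2 =>
    ⟨atlas_compatAt hψ h h1 h2, atlas_compatAt h hψ h2 h1⟩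

/-- A superconformal isomorphism of the sphere: a homeomorphism that pulls superconformal charts
back to superconformal charts. -/
def IsSCHomeo (F : Sphere ≃ₜ Sphere) : Prop :=
  ∀ ψ ∈ atlas, IsSuperconformalChart (F.transOpenPartialHomeomorph ψ)

theorem compatAt_pull (F : Sphere ≃ₜ Sphere) {Ω Ω' : OpenPartialHomeomorph Sphere Pt} {x : Sphere}
    (h : CompatAt Ω Ω' (F x)) :
    CompatAt (F.transOpenPartialHomeomorph Ω) (F.transOpenPartialHomeomorph Ω') x := by
  refine LSC.congr h (Eventually.of_forall fun p => ?_)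
  change Ω' (F (F.symm (Ω.symm p))) = _
  rw [F.apply_symm_apply]

theorem IsSCHomeo.pull {F : Sphere ≃ₜ Sphere} (hF : IsSCHomeo F)
    {Ω : OpenPartialHomeomorph Sphere Pt} (h : IsSuperconformalChart Ω) :
    IsSuperconformalChart (F.transOpenPartialHomeomorph Ω) := by
  refine isSuperconformalChart_of_compatAt fun x hx => ?_
  obtain ⟨ψ, hψ, hx'⟩ := exists_atlas (F x)
  exact ⟨_, hF ψ hψ, hx', compatAt_pull F (h.compatAt (atlas_isSuperconformalChart hψ) hx hx'),
    compatAt_pull F ((atlas_isSuperconformalChart hψ).compatAt h hx' hx)⟩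

theorem IsSCHomeo.refl : IsSCHomeo (Homeomorph.refl Sphere) := by
  intro ψ hψ
  have e : (Homeomorph.refl Sphere).transOpenPartialHomeomorph ψ = ψ := by
    refine OpenPartialHomeomorph.ext _ _ (fun x => rfl) (fun x => rfl) rfl
  rw [e]
  exact atlas_isSuperconformalChart hψ

theorem IsSCHomeo.trans {F G : Sphere ≃ₜ Sphere} (hF : IsSCHomeo F) (hG : IsSCHomeo G) :
    IsSCHomeo (F.trans G) := by
  intro ψ hψ
  have e : (F.trans G).transOpenPartialHomeomorph ψ =
      F.transOpenPartialHomeomorph (G.transOpenPartialHomeomorph ψ) :=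
    OpenPartialHomeomorph.ext _ _ (fun x => rfl) (fun x => rfl) rfl
  rw [e]
  exact hF.pull (hG ψ hψ)

theorem IsSCHomeo.symm {F : Sphere ≃ₜ Sphere} (hF : IsSCHomeo F) : IsSCHomeo F.symm := by
  intro ψ hψ
  refine isSuperconformalChart_of_compatAt fun x hx => ?_
  obtain ⟨φ, hφ, hx'⟩ := exists_atlas x
  have h1 := atlas_isSuperconformalChart hψ
  have h2 := hF φ hφ
  have e : F (F.symm x) = x := F.apply_symm_apply x
  have hx2 : F.symm x ∈ ψ.source := hx
  have hs : F.symm x ∈ (F.transOpenPartialHomeomorph φ).source := by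
    rw [Homeomorph.transOpenPartialHomeomorph_source, Set.mem_preimage, e]
    exact hx'
  have a := h1.compatAt h2 hx2 hs
  have b := h2.compatAt h1 hs hx2
  rw [CompatAt] at a b
  rw [Homeomorph.transOpenPartialHomeomorph_apply, Function.comp_apply, e] at b
  refine ⟨φ, atlas_isSuperconformalChart hφ, hx', ?_, ?_⟩
  · rw [CompatAt]
    exact a
  · rw [CompatAt]
    exact b

theorem IsSCHomeo.isSuperconformalMap {F : Sphere ≃ₜ Sphere} (hF : IsSCHomeo F) :
    IsSuperconformalMap F := by
  intro φ hφ ψ hψ hne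
  have e : φ.target ∩ φ.symm ⁻¹' (F ⁻¹' ψ.source) =
      (φ.symm.trans (F.transOpenPartialHomeomorph ψ)).source := by
    rw [OpenPartialHomeomorph.trans_source]; rfl
  rw [e] at hne ⊢
  exact superconformalOn_trans hne fun x h1 h2 =>
    (atlas_isSuperconformalChart hφ).compatAt (hF ψ hψ) h1 h2

theorem atlas_target {φ : OpenPartialHomeomorph Sphere Pt} (h : φ ∈ atlas) :
    φ.target = Set.univ := by
  rcases h with rfl | rfl <;> rfl

/-- The domain of a coordinate expression of a superconformal map is open, and the expression is
superconformal there. -/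
theorem IsSuperconformalMap.local {F : Sphere → Sphere} (hF : IsSuperconformalMap F)
    {φ ψ : OpenPartialHomeomorph Sphere Pt} (hφ : φ ∈ atlas) (hψ : ψ ∈ atlas) {x : Sphere}
    (h1 : x ∈ φ.source) (h2 : F x ∈ ψ.source) :
    (∀ᶠ p in nb (φ x).body, F (φ.symm p) ∈ ψ.source) ∧
      PreLSC (fun p => ψ (F (φ.symm p))) (φ x).body := by
  have hm : φ x ∈ φ.target ∩ φ.symm ⁻¹' (F ⁻¹' ψ.source) :=
    ⟨φ.map_source h1, by
      change F (φ.symm (φ x)) ∈ ψ.source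
      rwa [φ.left_inv h1]⟩
  obtain ⟨V, hV, e, h⟩ := (hF φ hφ ψ hψ ⟨_, hm⟩).preLSC
  rw [e] at hm
  refine ⟨eventually_nb_of_mem hV hm fun p hp => ?_, h _ hm⟩
  have : p ∈ Pt.body ⁻¹' V := hp
  rw [← e] at this
  exact this.2

theorem continuousAt_of_local {F : Sphere → Sphere} {φ ψ : OpenPartialHomeomorph Sphere Pt}
    {x : Sphere} (h1 : x ∈ φ.source) {H : Pt → Pt} (hH : SAMap H (φ x).body)
    (hψ : ψ.target = Set.univ) (e : ∀ᶠ p in nb (φ x).body, F (φ.symm p) = ψ.symm (H p)) :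
    ContinuousAt F x := by
  have h3 : Tendsto H (𝓝 (φ x)) (𝓝 (H (φ x))) := by
    have := hH.tendsto
    rwa [bodyMap_eq hH, nb_eq_nhds, nb_eq_nhds] at this
  have h4 : ContinuousAt (fun y => ψ.symm (H (φ y))) x := by
    refine (ψ.continuousAt_symm (by rw [hψ]; trivial)).comp_of_eq ?_ rfl
    exact h3.comp (φ.continuousAt h1)
  refine h4.congr ?_
  rw [nb_eq_nhds] at e
  filter_upwards [φ.continuousAt h1 e, φ.open_source.mem_nhds h1] with y hy hy'
  have hy2 : F (φ.symm (φ y)) = ψ.symm (H (φ y)) := hy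
  rw [φ.left_inv hy'] at hy2
  exact hy2.symm

theorem IsSuperconformalMap.continuous {F : Sphere → Sphere} (hF : IsSuperconformalMap F) :
    Continuous F := by
  refine continuous_iff_continuousAt.2 fun x => ?_
  obtain ⟨φ, hφ, h1⟩ := exists_atlas x
  obtain ⟨ψ, hψ, h2⟩ := exists_atlas (F x)
  obtain ⟨a, b⟩ := hF.local hφ hψ h1 h2
  exact continuousAt_of_local h1 b.sa (atlas_target hψ)
    (a.mono fun p hp => (ψ.left_inv hp).symm)

theorem exists_isSCHomeo {F : Sphere ≃ Sphere} (hF : IsSuperconformalMap F)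
    (hF' : IsSuperconformalMap F.symm) : ∃ F' : Sphere ≃ₜ Sphere, F'.toEquiv = F ∧ IsSCHomeo F' := by
  refine ⟨⟨F, hF.continuous, hF'.continuous⟩, rfl, fun ψ hψ => ?_⟩
  refine isSuperconformalChart_iff.2 fun φ hφ x h1 h2 => ?_
  obtain ⟨a, b⟩ := hF.local hφ hψ h1 h2
  have h3 : F.symm (F x) ∈ φ.source := by rwa [F.symm_apply_apply]
  obtain ⟨a', b'⟩ := hF'.local hψ hφ h2 h3
  have e1 : bodyMap (fun p => ψ (F (φ.symm p))) (φ x).body = (ψ (F x)).body := by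
    rw [bodyMap_eq b.sa, φ.left_inv h1]
  have h2' : F x ∈ ψ.source := h2
  have e2 : bodyMap (fun p => φ (F.symm (ψ.symm p))) (ψ (F x)).body = (φ x).body := by
    rw [bodyMap_eq b'.sa, ψ.left_inv h2', F.symm_apply_apply]
  constructor
  · have : LSC (fun p => ψ (F (φ.symm p))) (φ x).body := by
      have b2 := b'
      rw [← e1] at b2
      refine PreLSC.lsc b b2 ?_
      filter_upwards [a] with p hp
      rw [ψ.left_inv hp, F.symm_apply_apply, φ.right_inv (by rw [atlas_target hφ]; trivial)]
    exact this
  · have : LSC (fun p => φ (F.symm (ψ.symm p))) (ψ (F x)).body := by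
      have b2 := b
      rw [← e2] at b2
      refine PreLSC.lsc b' b2 ?_
      filter_upwards [a'] with p hp
      rw [φ.left_inv hp, F.apply_symm_apply, ψ.right_inv (by rw [atlas_target hψ]; trivial)]
    exact this

/-- A bijection of the sphere that has, near each point, a superconformal coordinate expression
with superanalytic inverse, is a superconformal isomorphism. -/
theorem exists_isSCHomeo_of_local (F : Sphere ≃ Sphere)
    (h : ∀ x, ∃ φ ∈ atlas, ∃ ψ ∈ atlas, ∃ H G : Pt → Pt, x ∈ φ.source ∧ LSC H (φ x).body ∧
      SAMap G (bodyMap H (φ x).body) ∧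
      (∀ᶠ p in nb (φ x).body, F (φ.symm p) = ψ.symm (H p)) ∧
      ∀ᶠ q in nb (bodyMap H (φ x).body), F.symm (ψ.symm q) = φ.symm (G q)) :
    ∃ F' : Sphere ≃ₜ Sphere, F'.toEquiv = F ∧ IsSCHomeo F' := by
  have hbase : ∀ x φ ψ (H : Pt → Pt), φ ∈ atlas → ψ ∈ atlas → x ∈ φ.source → SAMap H (φ x).body →
      (∀ᶠ p in nb (φ x).body, F (φ.symm p) = ψ.symm (H p)) →
      F x ∈ ψ.source ∧ ψ (F x) = H (φ x) := by
    intro x φ ψ H _ hψ hx _ e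
    have e' := nb_self e rfl
    rw [φ.left_inv hx] at e'
    have ht : H (φ x) ∈ ψ.target := by rw [atlas_target hψ]; trivial
    rw [e']
    exact ⟨ψ.map_target ht, ψ.right_inv ht⟩
  refine ⟨⟨F, continuous_iff_continuousAt.2 fun x => ?_,
    continuous_iff_continuousAt.2 fun y => ?_⟩, rfl, fun χ hχ => ?_⟩
  · obtain ⟨φ, hφ, ψ, hψ, H, G, hx, hH, hG, e1, e2⟩ := h x
    exact continuousAt_of_local hx hH.sa (atlas_target hψ) e1
  · obtain ⟨x, rfl⟩ := F.surjective y
    obtain ⟨φ, hφ, ψ, hψ, H, G, hx, hH, hG, e1, e2⟩ := h x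
    obtain ⟨b1, b2⟩ := hbase x φ ψ H hφ hψ hx hH.sa e1
    rw [bodyMap_eq hH.sa, ← b2] at hG e2
    exact continuousAt_of_local b1 hG (atlas_target hφ) e2
  · refine isSuperconformalChart_of_compatAt fun x hx' => ?_
    obtain ⟨φ, hφ, ψ, hψ, H, G, hx, hH, hG, e1, e2⟩ := h x
    obtain ⟨b1, b2⟩ := hbase x φ ψ H hφ hψ hx hH.sa e1
    have hx'' : F x ∈ χ.source := hx'
    have hHe : (fun p => ψ (F (φ.symm p))) =ᶠ[nb (φ x).body] H := by
      filter_upwards [e1] with p hp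
      rw [hp, ψ.right_inv (by rw [atlas_target hψ]; trivial)]
    have hGe : (fun q => φ (F.symm (ψ.symm q))) =ᶠ[nb (bodyMap H (φ x).body)] G := by
      filter_upwards [e2] with q hq
      rw [hq, φ.right_inv (by rw [atlas_target hφ]; trivial)]
    have hGinv : LSC G (bodyMap H (φ x).body) := by
      refine lsc_inverse hH hG ?_ ?_
      · filter_upwards [e1, hH.sa.tendsto.eventually e2] with p h1 h2
        rw [← h1, F.symm_apply_apply] at h2
        have := congrArg φ h2
        rw [φ.right_inv (by rw [atlas_target hφ]; trivial),
          φ.right_inv (by rw [atlas_target hφ]; trivial)] at this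
        exact this.symm
      · have hb : bodyMap G (bodyMap H (φ x).body) = (φ x).body := by
          have h3 := nb_self e2 (p := H (φ x)) (bodyMap_eq hH.sa).symm
          rw [← b2, ψ.left_inv b1, F.symm_apply_apply] at h3
          rw [bodyMap_eq hH.sa, ← b2]
          rw [bodyMap_eq hH.sa, ← b2] at hG
          rw [bodyMap_eq hG]
          have := congrArg φ h3
          rw [φ.right_inv (by rw [atlas_target hφ]; trivial)] at this
          rw [this]
        have ht := hG.tendsto
        rw [hb] at ht
        filter_upwards [e2, ht.eventually e1] with q h1 h2
        rw [← h1, F.apply_symm_apply] at h2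
        have := congrArg ψ h2
        rw [ψ.right_inv (by rw [atlas_target hψ]; trivial),
          ψ.right_inv (by rw [atlas_target hψ]; trivial)] at this
        exact this.symm
    set F' : Sphere ≃ₜ Sphere := ⟨F, _, _⟩ with hF'
    have c1 : CompatAt φ (F'.transOpenPartialHomeomorph ψ) x := hH.congr hHe
    have c2 : CompatAt (F'.transOpenPartialHomeomorph ψ) φ x := by
      have : LSC (fun q => φ (F.symm (ψ.symm q))) (bodyMap H (φ x).body) := hGinv.congr hGe
      rw [bodyMap_eq hH.sa, ← b2] at this
      exact this
    have c3 := compatAt_pull F' (atlas_compatAt hψ hχ b1 hx'')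
    have c4 := compatAt_pull F' (atlas_compatAt hχ hψ hx'' b1)
    exact ⟨φ, atlas_isSuperconformalChart hφ, hx, c4.trans hx' b1 c2, c1.trans hx b1 c3⟩

/-! ### The inverse function theorem -/

/-- On the fibre over the body point `v`, differences of values of `G` lie `s` steps deeper in the
filtration by the powers of the ideal of `ζ_0, …, ζ_{L-1}` than differences of arguments. -/
def Lip (L s : ℕ) (v : ℂ) (G : Pt → Gr) : Prop :=
  ∀ (k : ℕ) (p q : Pt), p.body = v → q.body = v → p.z - q.z ∈ nilIdeal L k →
    p.tp - q.tp ∈ nilIdeal L k → p.tm - q.tm ∈ nilIdeal L k → G p - G q ∈ nilIdeal L (k + s)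

theorem Lip.add {L s : ℕ} {v : ℂ} {G G' : Pt → Gr} (h : Lip L s v G) (h' : Lip L s v G') :
    Lip L s v (fun p => G p + G' p) := by
  intro k p q hp hq a b c
  simp only
  rw [add_sub_add_comm]
  exact Submodule.add_mem _ (h k p q hp hq a b c) (h' k p q hp hq a b c)

theorem Lip.mul {L : ℕ} {v : ℂ} {G G' : Pt → Gr} (h : Lip L 0 v G) (h' : Lip L 0 v G') :
    Lip L 0 v (fun p => G p * G' p) := by
  intro k p q hp hq a b c
  have e : G p * G' p - G q * G' q = G p * (G' p - G' q) + (G p - G q) * G' q := by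
    rw [mul_sub, sub_mul]; abel
  simp only
  rw [e]
  exact Submodule.add_mem _ (mul_nilIdeal (h' k p q hp hq a b c))
    (nilIdeal_mul (h k p q hp hq a b c))

theorem Lip.tp (L : ℕ) (v : ℂ) : Lip L 0 v Pt.tp := fun _ _ _ _ _ _ b _ => b

theorem Lip.tm (L : ℕ) (v : ℂ) : Lip L 0 v Pt.tm := fun _ _ _ _ _ _ _ c => c

theorem Lip.hat (L : ℕ) (v : ℂ) (φ : ℂ → ℂ) : Lip L 0 v (fun p => hat φ p.z) :=
  fun _ p q hp hq a _ _ => hat_sub_mem φ p.z_even q.z_even (hp.trans hq.symm) a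

/-- On the fibre over `v`, the function `G` is nilpotent and contracting for the filtration by the
powers of the ideal of `ζ_0, …, ζ_{L-1}`. -/
structure Contracts (L : ℕ) (v : ℂ) (G : Pt → Gr) : Prop where
  mem : ∀ p : Pt, p.body = v → G p ∈ nilIdeal L 1
  lip : Lip L 1 v G

theorem Contracts.congr {L : ℕ} {v : ℂ} {G G' : Pt → Gr} (h : Contracts L v G)
    (e : ∀ p : Pt, p.body = v → G' p = G p) : Contracts L v G' :=
  ⟨fun p hp => by rw [e p hp]; exact h.mem p hp, fun k p q hp hq a b c => by
    rw [e p hp, e q hq]; exact h.lip k p q hp hq a b c⟩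

theorem Contracts.add {L : ℕ} {v : ℂ} {G G' : Pt → Gr} (h : Contracts L v G)
    (h' : Contracts L v G') : Contracts L v (fun p => G p + G' p) :=
  ⟨fun p hp => Submodule.add_mem _ (h.mem p hp) (h'.mem p hp), h.lip.add h'.lip⟩

theorem Contracts.mul_left {L : ℕ} {v : ℂ} {F G : Pt → Gr} (hF : Lip L 0 v F)
    (h : Contracts L v G) : Contracts L v (fun p => F p * G p) := by
  refine ⟨fun p hp => mul_nilIdeal (h.mem p hp), fun k p q hp hq a b c => ?_⟩
  have e : F p * G p - F q * G q = F p * (G p - G q) + (F p - F q) * G q := by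
    rw [mul_sub, sub_mul]; abel
  rw [e]
  exact Submodule.add_mem _ (mul_nilIdeal (h.lip k p q hp hq a b c))
    (nilIdeal_mul_mem (hF k p q hp hq a b c) (h.mem q hq))

theorem Contracts.const {L : ℕ} (v : ℂ) {a : Gr} (ha : a ∈ nilIdeal L 1) :
    Contracts L v (fun _ => a) :=
  ⟨fun _ _ => ha, fun _ _ _ _ _ _ _ _ => by simp only [sub_self, Submodule.zero_mem]⟩

theorem Contracts.sum {L : ℕ} {v : ℂ} {ι : Type*} (s : Finset ι) {G : ι → Pt → Gr}
    (h : ∀ i ∈ s, Contracts L v (G i)) : Contracts L v (fun p => ∑ i ∈ s, G i p) := by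
  classical
  induction s using Finset.induction_on with
  | empty => simpa using Contracts.const v (Submodule.zero_mem _)
  | insert i s hi ih =>
    simp only [Finset.sum_insert hi]
    exact (h i (Finset.mem_insert_self i s)).add
      (ih fun j hj => h j (Finset.mem_insert_of_mem hj))

/-- A superanalytic function of the even variable without body contracts. -/
theorem CoeffFamily.FinNear.contracts {c : CoeffFamily} {w : ℂ} (h : c.FinNear w)
    (h0 : ∀ᶠ v in 𝓝 w, c ∅ v = 0) :
    ∀ᶠ L in atTop, ∀ᶠ v in 𝓝 w, Contracts L v (fun p => c.eval p.z) := by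
  obtain ⟨-, S, hS⟩ := h
  have hS' : ∀ᶠ v in 𝓝 w, ∀ k ∉ S.erase ∅, c k v = 0 := by
    filter_upwards [hS, h0] with v h1 h2 k hk
    by_cases hk' : k = ∅
    · rw [hk']; exact h2
    · exact h1 k fun hm => hk (Finset.mem_erase.2 ⟨hk', hm⟩)
  have hL : ∀ᶠ L in atTop, ∀ k ∈ S.erase ∅, grBasis k ∈ nilIdeal L 1 :=
    (Finset.eventually_all _).2 fun k hk =>
      eventually_mem_nilIdeal (body_grBasis (Finset.ne_of_mem_erase hk))
  filter_upwards [hL] with L hL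
  filter_upwards [nb_iff.1 (CoeffFamily.FinNear.eval_eq hS')] with v hv
  refine Contracts.congr ?_ hv
  exact Contracts.sum _ fun k hk => Contracts.mul_left (Lip.hat L v _)
    (Contracts.const v (hL k hk))

/-- The family without its body component. -/
def CoeffFamily.soulPart (c : CoeffFamily) : CoeffFamily := fun k => if k = ∅ then 0 else c k

/-- Splitting off the body component leaves a family whose values are nilpotent. -/
theorem CoeffFamily.FinNear.soulPart {c : CoeffFamily} {w : ℂ} (h : c.FinNear w) :
    c.soulPart.FinNear w ∧
      ∀ᶠ p in nb w, c.eval p.z = hat (c ∅) p.z + c.soulPart.eval p.z := by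
  obtain ⟨h1, S, hS⟩ := h
  have hS2 : ∀ᶠ v in 𝓝 w, ∀ k ∉ insert ∅ S, c k v = 0 :=
    hS.mono fun v hv k hk => hv k fun h => hk (Finset.mem_insert_of_mem h)
  have hS' : ∀ᶠ v in 𝓝 w, ∀ k ∉ insert ∅ S, c.soulPart k v = 0 := by
    filter_upwards [hS2] with v hv k hk
    rw [CoeffFamily.soulPart]
    split_ifs with h
    · rfl
    · exact hv k hk
  refine ⟨⟨fun k => ?_, _, hS'⟩, ?_⟩
  · rw [CoeffFamily.soulPart]
    split_ifs with h
    · exact analyticAt_const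
    · exact h1 k
  · filter_upwards [CoeffFamily.FinNear.eval_eq hS2, CoeffFamily.FinNear.eval_eq hS'] with p e1 e2
    rw [e1, e2, ← Finset.add_sum_erase _ _ (Finset.mem_insert_self ∅ S),
      ← Finset.add_sum_erase _ _ (Finset.mem_insert_self ∅ S), grBasis_empty, mul_one]
    have h0 : c.soulPart ∅ = 0 := by simp [CoeffFamily.soulPart]
    rw [h0, hat_zero p.z_even, zero_mul, zero_add]
    congr 1
    refine Finset.sum_congr rfl fun k hk => ?_
    rw [CoeffFamily.soulPart, if_neg (Finset.ne_of_mem_erase hk)]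

/-- One step of the iteration that solves `H x = y`, where `H` is the sum of a diagonal map, given
by `φ`, `γ`, `δ`, and of a contracting map. Here `χ` is the inverse of `φ`. -/
def invStep (H : Pt → Pt) (φ χ γ δ : ℂ → ℂ) (y x : Pt) : Pt where
  z := hat χ (y.z - ((H x).z - hat φ x.z))
  tp := (y.tp - ((H x).tp - x.tp * hat γ x.z)) *
    hat (fun w => (γ w)⁻¹) (hat χ (y.z - ((H x).z - hat φ x.z)))
  tm := (y.tm - ((H x).tm - x.tm * hat δ x.z)) *
    hat (fun w => (δ w)⁻¹) (hat χ (y.z - ((H x).z - hat φ x.z)))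
  z_even := hat_mem_even _ (Submodule.sub_mem _ y.z_even
    (Submodule.sub_mem _ (H x).z_even (hat_mem_even _ x.z_even)))
  tp_odd := odd_mul_even (Submodule.sub_mem _ y.tp_odd (Submodule.sub_mem _ (H x).tp_odd
    (odd_mul_even x.tp_odd (hat_mem_even _ x.z_even)))) (hat_mem_even _ (hat_mem_even _
      (Submodule.sub_mem _ y.z_even (Submodule.sub_mem _ (H x).z_even (hat_mem_even _ x.z_even)))))
  tm_odd := odd_mul_even (Submodule.sub_mem _ y.tm_odd (Submodule.sub_mem _ (H x).tm_odd
    (odd_mul_even x.tm_odd (hat_mem_even _ x.z_even)))) (hat_mem_even _ (hat_mem_even _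
      (Submodule.sub_mem _ y.z_even (Submodule.sub_mem _ (H x).z_even (hat_mem_even _ x.z_even)))))

theorem hat_mul_hat_inv {γ : ℂ → ℂ} {a : Gr} (ha : a ∈ evenPart) (h : AnalyticAt ℂ γ (body a))
    (h0 : γ (body a) ≠ 0) : hat γ a * hat (fun w => (γ w)⁻¹) a = 1 := by
  have e := hat_mul ha h (h.inv h0)
  rw [hat_congr (χ := fun _ => 1), hat_const 1 ha, map_one] at e
  · exact e.symm
  filter_upwards [h.continuousAt.eventually_ne h0] with w hw
  exact mul_inv_cancel₀ hw

theorem SAMap.eventually {H : Pt → Pt} {w : ℂ} (h : SAMap H w) : ∀ᶠ v in 𝓝 w, SAMap H v := by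
  have key : ∀ G : Pt → Gr, G ∈ SA w → ∀ᶠ v in 𝓝 w, G ∈ SA v := fun G hG => by
    obtain ⟨F, hF, e⟩ := SA.exists_superFn hG
    filter_upwards [hF.eventually, nb_nb e] with v hv ev
    exact SA.congr hv.sa ev
  filter_upwards [key _ h.z, key _ h.tp, key _ h.tm] with v a b c
  exact ⟨a, b, c⟩

/-- **Inverse function theorem.** A superanalytic map that is, up to a contracting map, diagonal
with invertible derivative, is invertible near the fibre over `w`, with superanalytic inverse. -/
theorem exists_inverse {H : Pt → Pt} {L : ℕ} {φ γ δ : ℂ → ℂ} {w : ℂ} (hS : SAMap H w)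
    (hφ : AnalyticAt ℂ φ w) (hd : deriv φ w ≠ 0) (hγ : AnalyticAt ℂ γ w) (hγ0 : γ w ≠ 0)
    (hδ : AnalyticAt ℂ δ w) (hδ0 : δ w ≠ 0)
    (cz : ∀ᶠ v in 𝓝 w, Contracts L v (fun p => (H p).z - hat φ p.z))
    (cp : ∀ᶠ v in 𝓝 w, Contracts L v (fun p => (H p).tp - p.tp * hat γ p.z))
    (cm : ∀ᶠ v in 𝓝 w, Contracts L v (fun p => (H p).tm - p.tm * hat δ p.z))
    {V : Set ℂ} (hV : V ∈ 𝓝 w) :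
    ∃ e : OpenPartialHomeomorph Pt Pt, ∃ r > 0, e.source = Pt.body ⁻¹' Metric.ball w r ∧
      Metric.ball w r ⊆ V ∧ (e : Pt → Pt) = H ∧ ∀ p ∈ e.source, SAMap e.symm (e p).body := by
  set g0 := (hφ.hasStrictDerivAt.hasStrictFDerivAt_equiv hd).toOpenPartialHomeomorph φ with hg0
  have hgφ : (g0 : ℂ → ℂ) = φ := HasStrictFDerivAt.toOpenPartialHomeomorph_coe _
  have hgs : w ∈ g0.source := HasStrictFDerivAt.mem_toOpenPartialHomeomorph_source _
  have hga : AnalyticAt ℂ g0.symm (φ w) := hφ.analyticAt_localInverse hd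
  have hall := ((hφ.eventually_analyticAt.and (hγ.eventually_analyticAt.and
    hδ.eventually_analyticAt)).and ((hγ.continuousAt.eventually_ne hγ0).and
    (hδ.continuousAt.eventually_ne hδ0))).and ((cz.and (cp.and cm)).and
    ((hS.eventually.and (g0.open_source.mem_nhds hgs)).and
    ((hφ.continuousAt.eventually hga.eventually_analyticAt).and hV)))
  obtain ⟨r, hr, hB⟩ := Metric.eventually_nhds_iff_ball.1 hall
  clear hall hga hgs cz cp cm
  set χ : ℂ → ℂ := (g0.symm : ℂ → ℂ) with hχ
  set e0 := g0.restrOpen (Metric.ball w r) Metric.isOpen_ball with he0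
  have hes : e0.source = Metric.ball w r := by
    rw [he0, OpenPartialHomeomorph.restrOpen_source]
    exact Set.inter_eq_right.2 fun v hv => (hB v hv).2.2.1.2
  have hec : ∀ v, e0 v = φ v := fun v => congrFun hgφ v
  have hei : ∀ v, e0.symm v = χ v := fun v => rfl
  have hl : ∀ v ∈ Metric.ball w r, φ v ∈ e0.target ∧ χ (φ v) = v := fun v hv => by
    rw [← hes] at hv
    rw [← hec, ← hei]
    exact ⟨e0.map_source hv, e0.left_inv hv⟩
  have hrr : ∀ u ∈ e0.target, χ u ∈ Metric.ball w r ∧ φ (χ u) = u := fun u hu => by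
    rw [← hes, ← hec, ← hei]
    exact ⟨e0.map_target hu, e0.right_inv hu⟩
  have hχa : ∀ u ∈ e0.target, AnalyticAt ℂ χ u := fun u hu => by
    have := (hB _ (hrr u hu).1).2.2.2.1
    rwa [(hrr u hu).2] at this
  -- A fixed point of `T y` in the fibre over `χ(y_B)` is a solution of `H x = y`.
  set T := invStep H φ χ γ δ with hT
  have hsub : ∀ x y : Pt, x.body ∈ Metric.ball w r →
      y.z - ((H x).z - hat φ x.z) ∈ evenPart ∧
      body (y.z - ((H x).z - hat φ x.z)) = y.body := fun x y hx =>
    ⟨Submodule.sub_mem _ y.z_even (Submodule.sub_mem _ (H x).z_even (hat_mem_even _ x.z_even)),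
      by rw [map_sub, body_nilIdeal ((hB _ hx).2.1.1.mem x rfl), sub_zero]; rfl⟩
  have hTb : ∀ x y : Pt, x.body ∈ Metric.ball w r → (T y x).body = χ y.body := fun x y hx => by
    obtain ⟨h1, h2⟩ := hsub x y hx
    change body (hat χ _) = _
    rw [body_hat _ h1, h2]
  -- the iteration gains one step in the filtration
  have hTL : ∀ (y : Pt) (v : ℂ), v ∈ Metric.ball w r → ∀ (k : ℕ) (x x' : Pt), x.body = v →
      x'.body = v → x.z - x'.z ∈ nilIdeal L k → x.tp - x'.tp ∈ nilIdeal L k →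
      x.tm - x'.tm ∈ nilIdeal L k → (T y x).z - (T y x').z ∈ nilIdeal L (k + 1) ∧
      (T y x).tp - (T y x').tp ∈ nilIdeal L (k + 1) ∧
      (T y x).tm - (T y x').tm ∈ nilIdeal L (k + 1) := by
    intro y v hv k x x' hx hx' a b c
    obtain ⟨cz, cp, cm⟩ := (hB v hv).2.1
    obtain ⟨h1, h2⟩ := hsub x y (hx ▸ hv)
    obtain ⟨h3, h4⟩ := hsub x' y (hx' ▸ hv)
    have dz : (T y x).z - (T y x').z ∈ nilIdeal L (k + 1) := by
      refine hat_sub_mem χ h1 h3 (h2.trans h4.symm) ?_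
      rw [sub_sub_sub_cancel_left, ← neg_sub]
      exact Submodule.neg_mem _ (cz.lip k x x' hx hx' a b c)
    have hb : body (T y x).z = body (T y x').z :=
      (hTb x y (hx ▸ hv)).trans (hTb x' y (hx' ▸ hv)).symm
    have aux : ∀ (γ : ℂ → ℂ) (u u' : Gr), u - u' ∈ nilIdeal L (k + 1) →
        u * hat γ (T y x).z - u' * hat γ (T y x').z ∈ nilIdeal L (k + 1) := fun γ u u' hu => by
      have e : u * hat γ (T y x).z - u' * hat γ (T y x').z =
          u * (hat γ (T y x).z - hat γ (T y x').z) + (u - u') * hat γ (T y x').z := by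
        rw [mul_sub, sub_mul]; abel
      rw [e]
      exact Submodule.add_mem _
        (mul_nilIdeal (hat_sub_mem γ (T y x).z_even (T y x').z_even hb dz)) (nilIdeal_mul hu)
    refine ⟨dz, aux _ _ _ ?_, aux _ _ _ ?_⟩
    · rw [sub_sub_sub_cancel_left, ← neg_sub]
      exact Submodule.neg_mem _ (cp.lip k x x' hx hx' a b c)
    · rw [sub_sub_sub_cancel_left, ← neg_sub]
      exact Submodule.neg_mem _ (cm.lip k x x' hx hx' a b c)
  have hit : ∀ (y : Pt), y.body ∈ e0.target → ∀ (n : ℕ) (x : Pt), x.body = χ y.body →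
      ((T y)^[n] x).body = χ y.body := by
    intro y hy n
    induction n with
    | zero => exact fun x hx => hx
    | succ n ih =>
      intro x hx
      rw [Function.iterate_succ_apply]
      exact ih _ (hTb x y (hx ▸ (hrr _ hy).1))
  -- The filtration ends after `L` steps, so the iterate no longer depends on the starting point.
  have hconst : ∀ y : Pt, y.body ∈ e0.target → ∀ x x' : Pt, x.body = χ y.body →
      x'.body = χ y.body → (T y)^[L + 1] x = (T y)^[L + 1] x' := by
    intro y hy x x' hx hx'
    have key : ∀ n, ((T y)^[n] x).z - ((T y)^[n] x').z ∈ nilIdeal L n ∧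
        ((T y)^[n] x).tp - ((T y)^[n] x').tp ∈ nilIdeal L n ∧
        ((T y)^[n] x).tm - ((T y)^[n] x').tm ∈ nilIdeal L n := by
      intro n
      induction n with
      | zero => simp only [nilIdeal_zero, Submodule.mem_top, and_self]
      | succ n ih =>
        rw [Function.iterate_succ_apply', Function.iterate_succ_apply']
        exact hTL y _ (hrr _ hy).1 n _ _ (hit y hy n x hx) (hit y hy n x' hx') ih.1 ih.2.1 ih.2.2
    have := key (L + 1)
    simp only [nilIdeal_bot, Submodule.mem_bot, sub_eq_zero] at this
    exact Pt.ext this.1 this.2.1 this.2.2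
  -- The fixed points are the solutions: each coordinate of `T y x = x` is solved for `H x`.
  have hfix : ∀ x y : Pt, x.body ∈ Metric.ball w r → y.body = φ x.body → (T y x = x ↔ H x = y) := by
    intro x y hx hy
    obtain ⟨h1, h2⟩ := hsub x y hx
    have hyt : y.body ∈ e0.target := by rw [hy]; exact (hl _ hx).1
    obtain ⟨⟨aφ, aγ, aδ⟩, nγ, nδ⟩ := (hB _ hx).1
    have i1 := hat_mul_hat_inv x.z_even aγ nγ
    have i2 := hat_mul_hat_inv x.z_even aδ nδ
    have aux : ∀ u v t g g' : Gr, Commute g g' → g * g' = 1 → ((u - (v - t * g)) * g' = t ↔ v = u) := by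
      intro u v t g g' hc hg
      constructor
      · intro h
        have h5 : (u - v) * g' = 0 := by
          have : (u - (v - t * g)) * g' = (u - v) * g' + t * (g * g') := by
            rw [← mul_assoc, ← add_mul]; congr 1; abel
          rw [this, hg, mul_one] at h
          exact left_eq_add.1 (by rw [add_comm]; exact h.symm)
        have h6 : (u - v) * (g * g') = 0 := by rw [hc.eq, ← mul_assoc, h5, zero_mul]
        rw [hg, mul_one, sub_eq_zero] at h6
        exact h6.symm
      · rintro rfl
        rw [sub_sub_cancel, mul_assoc, hg, mul_one]
    have hz : hat χ (y.z - ((H x).z - hat φ x.z)) = x.z ↔ (H x).z = y.z := by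
      constructor
      · intro h
        have h5 := congrArg (hat φ) h
        rw [← hat_comp h1 (by rw [h2]; exact hχa _ hyt)
          (by rw [h2, hy, (hl _ hx).2]; exact aφ), hat_congr (χ := fun w => w), hat_id h1] at h5
        · rw [sub_eq_iff_eq_add, add_sub_cancel] at h5
          exact h5.symm
        · rw [h2]
          filter_upwards [e0.open_target.mem_nhds hyt] with u hu
          exact (hrr u hu).2
      · intro h
        rw [h, sub_sub_cancel, ← hat_comp x.z_even aφ
          (hχa _ (hl _ hx).1), hat_congr (χ := fun w => w), hat_id x.z_even]
        filter_upwards [Metric.isOpen_ball.mem_nhds hx] with u hu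
        exact (hl u hu).2
    constructor
    · intro h
      have h3 := hz.1 (congrArg Pt.z h)
      have h4 := congrArg Pt.z h
      have h5 := congrArg Pt.tp h
      have h6 := congrArg Pt.tm h
      simp only [hT, invStep] at h4 h5 h6
      rw [h4] at h5 h6
      exact Pt.ext h3 ((aux _ _ _ _ _ (hat_commute _ x.z_even _) i1).1 h5) ((aux _ _ _ _ _ (hat_commute _ x.z_even _) i2).1 h6)
    · intro h
      have h4 := hz.2 (congrArg Pt.z h)
      refine Pt.ext h4 ?_ ?_
      · simp only [hT, invStep]
        rw [h4]
        exact (aux _ _ _ _ _ (hat_commute _ x.z_even _) i1).2 (congrArg Pt.tp h)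
      · simp only [hT, invStep]
        rw [h4]
        exact (aux _ _ _ _ _ (hat_commute _ x.z_even _) i2).2 (congrArg Pt.tm h)
  have hHb : ∀ x : Pt, x.body ∈ Metric.ball w r → (H x).body = φ x.body := fun x hx => by
    have := body_nilIdeal ((hB _ hx).2.1.1.mem x rfl)
    rw [map_sub, body_hat _ x.z_even, sub_eq_zero] at this
    exact this
  -- The inverse map is a fixed number of iterations, started at `(χ(y.z), 0, 0)`.
  set G : ℕ → Pt → Pt := fun n y => (T y)^[n]
    ⟨hat χ y.z, 0, 0, hat_mem_even _ y.z_even, Submodule.zero_mem _, Submodule.zero_mem _⟩ with hG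
  have hGb : ∀ n (y : Pt), y.body ∈ e0.target → (G n y).body = χ y.body := fun n y hy =>
    hit y hy n _ (body_hat χ y.z_even)
  have hGr : ∀ y : Pt, y.body ∈ e0.target → H (G (L + 1) y) = y := by
    intro y hy
    have hb := hGb (L + 1) y hy
    refine (hfix _ y (hb ▸ (hrr _ hy).1) (by rw [hb, (hrr _ hy).2])).1 ?_
    change T y ((T y)^[L + 1] _) = (T y)^[L + 1] _
    rw [← Function.iterate_succ_apply' (T y), Function.iterate_succ_apply]
    refine hconst y hy _ _ ?_ (body_hat χ y.z_even)
    exact hit y hy 1 _ (body_hat χ y.z_even)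
  have hGl : ∀ x : Pt, x.body ∈ Metric.ball w r → G (L + 1) (H x) = x := by
    intro x hx
    have hb := hHb x hx
    have hy : (H x).body ∈ e0.target := by rw [hb]; exact (hl _ hx).1
    have hxb : x.body = χ (H x).body := by rw [hb, (hl _ hx).2]
    have h1 := hconst (H x) hy x ⟨hat χ (H x).z, 0, 0, hat_mem_even _ (H x).z_even,
      Submodule.zero_mem _, Submodule.zero_mem _⟩ hxb (body_hat χ (H x).z_even)
    have h2 : T (H x) x = x := (hfix x (H x) hx hb).2 rfl
    rw [Function.iterate_fixed h2] at h1
    exact h1.symm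
  -- Every iterate is superanalytic in `y`, being composed of superanalytic maps.
  have hGS : ∀ n, ∀ v ∈ e0.target, SAMap (G n) v := by
    intro n
    induction n with
    | zero =>
      intro v hv
      exact ⟨SA.hat (hχa v hv), SA.const 0, SA.const 0⟩
    | succ n ih =>
      intro v hv
      have hGn := ih v hv
      have hbm : bodyMap (G n) v = χ v := by
        have := hGb n (Pt.ofComplex v) (by rwa [body_ofComplex])
        rwa [body_ofComplex] at this
      obtain ⟨⟨aφ, aγ, aδ⟩, nγ, nδ⟩ := (hB _ (hrr v hv).1).1
      have hSH : SAMap H (bodyMap (G n) v) := by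
        rw [hbm]; exact (hB _ (hrr v hv).1).2.2.1.1
      have e1 : (fun y => y.z - ((H (G n y)).z - hat φ (G n y).z)) ∈ SA v := by
        refine SA.sub SA.z (SA.comp (G := fun x => (H x).z - hat φ x.z) hGn
          (SA.sub hSH.z (SA.hat ?_)))
        rw [hbm]; exact aφ
      have hbo : ∀ y : Pt, y.body = v → (G n y).body ∈ Metric.ball w r := fun y hy => by
        rw [hGb n y (hy ▸ hv), hy]; exact (hrr v hv).1
      have e2 : (fun y => hat χ (y.z - ((H (G n y)).z - hat φ (G n y).z))) ∈ SA v := by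
        refine SA.hat_comp e1 (Eventually.of_forall fun y => Submodule.sub_mem _ y.z_even
          (Submodule.sub_mem _ (H _).z_even (hat_mem_even _ (G n y).z_even))) fun y hy => ?_
        rw [(hsub (G n y) y (hbo y hy)).2, hy]
        exact hχa v hv
      have e3 : ∀ γ : ℂ → ℂ, AnalyticAt ℂ γ (χ v) → γ (χ v) ≠ 0 →
          (fun y => hat (fun w => (γ w)⁻¹)
            (hat χ (y.z - ((H (G n y)).z - hat φ (G n y).z)))) ∈ SA v := by
        intro γ aγ nγ
        refine SA.hat_comp e2 (Eventually.of_forall fun y => (T y (G n y)).z_even) fun y hy => ?_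
        have := hTb (G n y) y (hbo y hy)
        rw [hy] at this
        change AnalyticAt ℂ _ (T y (G n y)).body
        rw [this]
        exact aγ.inv nγ
      have hsuc : G (n + 1) = fun y => T y (G n y) := by
        funext y
        simp only [hG, Function.iterate_succ_apply']
      rw [hsuc]
      refine ⟨e2, SA.mul ?_ (e3 γ aγ nγ), SA.mul ?_ (e3 δ aδ nδ)⟩
      · refine SA.sub SA.tp (SA.comp (G := fun x => (H x).tp - x.tp * hat γ x.z) hGn
          (SA.sub hSH.tp (SA.mul SA.tp (SA.hat ?_))))
        rw [hbm]; exact aγ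
      · refine SA.sub SA.tm (SA.comp (G := fun x => (H x).tm - x.tm * hat δ x.z) hGn
          (SA.sub hSH.tm (SA.mul SA.tm (SA.hat ?_))))
        rw [hbm]; exact aδ
  refine ⟨
    { toFun := H
      invFun := G (L + 1)
      source := Pt.body ⁻¹' Metric.ball w r
      target := Pt.body ⁻¹' e0.target
      map_source' := fun x hx => by
        change (H x).body ∈ e0.target
        rw [hHb x hx]; exact (hl _ hx).1
      map_target' := fun y hy => by
        change (G (L + 1) y).body ∈ Metric.ball w r
        rw [hGb _ y hy]; exact (hrr _ hy).1
      left_inv' := fun x hx => hGl x hx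
      right_inv' := fun y hy => hGr y hy
      open_source := Metric.isOpen_ball.preimage continuous_ptBody
      open_target := e0.open_target.preimage continuous_ptBody
      continuousOn_toFun := ?_
      continuousOn_invFun := ?_ }, r, hr, rfl, fun v hv => (hB v hv).2.2.2.2, rfl, ?_⟩
  · have : Topology.IsInducing Pt.body := ⟨rfl⟩
    refine this.continuousOn_iff.2 (ContinuousOn.congr (f := fun x : Pt => φ x.body) ?_ fun x hx => hHb x hx)
    exact fun x hx => ((hB _ hx).1.1.1.continuousAt.comp
      continuous_ptBody.continuousAt).continuousWithinAt
  · have : Topology.IsInducing Pt.body := ⟨rfl⟩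
    refine this.continuousOn_iff.2 (ContinuousOn.congr (f := fun x : Pt => χ x.body) ?_ fun x hx => hGb (L + 1) x hx)
    exact fun x hx => ((hχa _ hx).continuousAt.comp
      continuous_ptBody.continuousAt).continuousWithinAt
  · intro p hp
    refine hGS (L + 1) _ ?_
    change (H p).body ∈ _
    rw [hHb p hp]; exact (hl _ hp).1

/-! ### Absolutely convergent series in the Grassmann algebra -/

theorem coord_grBasis_mul {k A B : Finset ℕ} (h : ¬ (A ⊆ k ∧ B ⊆ k)) :
    coord k (grBasis A * grBasis B) = 0 := by
  set b : Module.Basis ℕ ℂ (ℕ →₀ ℂ) := Finsupp.basisSingleOne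
  set s : Set.powersetCard ℕ A.card := Set.powersetCard.ofCard rfl
  set t : Set.powersetCard ℕ B.card := Set.powersetCard.ofCard rfl
  have hs : s.val = A := rfl
  have ht : t.val = B := rfl
  change coord k (b.ExteriorAlgebra s * b.ExteriorAlgebra t) = 0
  by_cases hd : Disjoint s.val t.val
  · rw [ExteriorAlgebra.basis_mul_of_disjoint b s t hd]
    have : coord k (b.ExteriorAlgebra (Set.powersetCard.disjUnion hd)) = 0 := by
      refine (coord_grBasis k _).trans (if_neg ?_)
      rintro rfl
      refine h ⟨fun x hx => ?_, fun x hx => ?_⟩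
      · simp [hs, hx]
      · simp [ht, hx]
    rw [Units.smul_def, map_zsmul, this, smul_zero]
  · rw [ExteriorAlgebra.basis_mul_of_not_disjoint b s t hd, map_zero]

/-- Each coefficient of a product involves finitely many coefficients of the factors. -/
theorem coord_mul (k : Finset ℕ) (a b : Gr) :
    coord k (a * b) = ∑ A ∈ k.powerset, ∑ B ∈ k.powerset,
      coord A a * coord B b * coord k (grBasis A * grBasis B) := by
  obtain ⟨S, hS, -⟩ := exists_sum_coord a
  obtain ⟨T, hT, -⟩ := exists_sum_coord b
  have ha : a = ∑ A ∈ S ∪ k.powerset, coord A a • grBasis A :=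
    sum_coord fun l hl => hS l fun h => hl (Finset.mem_union_left _ h)
  have hb : b = ∑ B ∈ T ∪ k.powerset, coord B b • grBasis B :=
    sum_coord fun l hl => hT l fun h => hl (Finset.mem_union_left _ h)
  conv_lhs => rw [ha, hb]
  rw [Finset.sum_mul_sum, map_sum]
  simp only [map_sum, smul_mul_smul_comm, map_smul, smul_eq_mul]
  symm
  refine (Finset.sum_subset Finset.subset_union_right fun A _ hA => ?_).trans
    (Finset.sum_congr rfl fun A _ => Finset.sum_subset Finset.subset_union_right fun B _ hB => ?_)
  · refine Finset.sum_eq_zero fun B _ => ?_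
    rw [coord_grBasis_mul fun h => hA (Finset.mem_powerset.2 h.1), mul_zero]
  · rw [coord_grBasis_mul fun h => hB (Finset.mem_powerset.2 h.2), mul_zero]

section AbsHasSum

variable {ι κ : Type} {x y : ι → Gr} {s t : Gr}

theorem AbsHasSum.congr (h : AbsHasSum x s) (e : ∀ i, y i = x i) : AbsHasSum y s := by
  rwa [show y = x from funext e]

theorem AbsHasSum.unique (h : AbsHasSum x s) (h' : AbsHasSum x t) : s = t :=
  gr_ext fun k => (h k).unique (h' k)

theorem AbsHasSum.add (h : AbsHasSum x s) (h' : AbsHasSum y t) :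
    AbsHasSum (fun i => x i + y i) (s + t) := fun k => by
  simpa only [map_add] using (h k).add (h' k)

theorem AbsHasSum.sub (h : AbsHasSum x s) (h' : AbsHasSum y t) :
    AbsHasSum (fun i => x i - y i) (s - t) := fun k => by
  simpa only [map_sub] using (h k).sub (h' k)

theorem AbsHasSum.sum {α : Type} (S : Finset α) {x : α → ι → Gr} {s : α → Gr}
    (h : ∀ a ∈ S, AbsHasSum (x a) (s a)) :
    AbsHasSum (fun i => ∑ a ∈ S, x a i) (∑ a ∈ S, s a) := fun k => by
  simpa only [map_sum] using hasSum_sum fun a ha => h a ha k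

theorem AbsHasSum.mul {x : ι → Gr} {y : κ → Gr} (h : AbsHasSum x s) (h' : AbsHasSum y t) :
    AbsHasSum (fun i : ι × κ => x i.1 * y i.2) (s * t) := by
  intro k
  have key : HasSum (fun i : ι × κ => ∑ A ∈ k.powerset, ∑ B ∈ k.powerset,
      coord A (x i.1) * coord B (y i.2) * coord k (grBasis A * grBasis B))
      (∑ A ∈ k.powerset, ∑ B ∈ k.powerset,
      coord A s * coord B t * coord k (grBasis A * grBasis B)) := by
    refine hasSum_sum fun A _ => hasSum_sum fun B _ => ?_
    have h2 : Summable fun i : ι × κ => coord A (x i.1) * coord B (y i.2) :=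
      summable_mul_of_summable_norm (f := fun i => coord A (x i)) (g := fun j => coord B (y j))
        (h A).summable.norm (h' B).summable.norm
    have h1 : HasSum (fun i : ι × κ => coord A (x i.1) * coord B (y i.2)) (coord A s * coord B t) :=
      HasSum.mul (f := fun i => coord A (x i)) (g := fun j => coord B (y j)) (h A) (h' B) h2
    exact h1.mul_right _
  have e := coord_mul k s t
  rw [← e] at key
  exact key.congr_fun fun i => coord_mul k (x i.1) (y i.2)

theorem AbsHasSum.mul_left (a : Gr) (h : AbsHasSum x s) : AbsHasSum (fun i => a * x i) (a * s) :=
  fun k => by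
    rw [coord_mul k]
    refine HasSum.congr_fun ?_ fun i => coord_mul k _ _
    exact hasSum_sum fun A _ => hasSum_sum fun B _ => ((h B).mul_left _).mul_right _

theorem AbsHasSum.mul_right (a : Gr) (h : AbsHasSum x s) : AbsHasSum (fun i => x i * a) (s * a) :=
  fun k => by
    rw [coord_mul k]
    refine HasSum.congr_fun ?_ fun i => coord_mul k _ _
    exact hasSum_sum fun A _ => hasSum_sum fun B _ => ((h A).mul_right _).mul_right _

theorem AbsHasSum.comp_injective {x : κ → Gr} (h : AbsHasSum x s) {g : ι → κ}
    (hg : Function.Injective g) (h0 : ∀ j ∉ Set.range g, x j = 0) :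
    AbsHasSum (fun i => x (g i)) s := fun k =>
  (hg.hasSum_iff fun j hj => by rw [h0 j hj, map_zero]).2 (h k)

theorem AbsHasSum.of_comp_injective {x : κ → Gr} {g : ι → κ} (h : AbsHasSum (fun i => x (g i)) s)
    (hg : Function.Injective g) (h0 : ∀ j ∉ Set.range g, x j = 0) : AbsHasSum x s := fun k =>
  (hg.hasSum_iff fun j hj => by rw [h0 j hj, map_zero]).1 (h k)

theorem AbsHasSum.antidiagonal {x : ℕ × ℕ → Gr} (h : AbsHasSum x s) :
    AbsHasSum (fun n => ∑ i ∈ Finset.HasAntidiagonal.antidiagonal n, x i) s := fun k => by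
  have h1 := Finset.HasAntidiagonal.sigmaAntidiagonalEquivProd.hasSum_iff.2 (h k)
  have h2 := h1.sigma (g := fun n => ∑ i ∈ Finset.HasAntidiagonal.antidiagonal n, coord k (x i)) fun n => by
    have := Finset.hasSum (Finset.HasAntidiagonal.antidiagonal n) (fun i => coord k (x i))
    exact this
  simpa only [map_sum] using h2

/-- Rearrangement of a double series whose coefficients are absolutely summable. -/
theorem AbsHasSum.of_antidiagonal {x : ℕ × ℕ → Gr}
    (hx : ∀ k, Summable fun i => coord k (x i))
    (h : AbsHasSum (fun n => ∑ i ∈ Finset.HasAntidiagonal.antidiagonal n, x i) s) : AbsHasSum x s := fun k => by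
  obtain ⟨t, ht⟩ := hx k
  have h1 := Finset.HasAntidiagonal.sigmaAntidiagonalEquivProd.hasSum_iff.2 ht
  have h2 := h1.sigma (g := fun n => ∑ i ∈ Finset.HasAntidiagonal.antidiagonal n, coord k (x i)) fun n => by
    have := Finset.hasSum (Finset.HasAntidiagonal.antidiagonal n) (fun i => coord k (x i))
    exact this
  have h3 := h k
  simp only [map_sum] at h3
  rwa [h3.unique h2]

theorem AbsHasSum.summable_smul (h : AbsHasSum x s) {c : ι → ℂ} (hc : ∀ i, ‖c i‖ ≤ 1)
    (k : Finset ℕ) : Summable fun i => coord k (c i • x i) := by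
  refine Summable.of_norm_bounded (h k).summable.norm fun i => ?_
  rw [map_smul, norm_smul]
  exact mul_le_of_le_one_left (norm_nonneg _) (hc i)

end AbsHasSum

/-! ### Taylor series -/

theorem powerSeries_unique {a b : ℕ → ℂ} {s : ℂ → ℂ}
    (ha : ∀ᶠ w in 𝓝 0, HasSum (fun n => a n * w ^ n) (s w))
    (hb : ∀ᶠ w in 𝓝 0, HasSum (fun n => b n * w ^ n) (s w)) : a = b := by
  have key : ∀ a : ℕ → ℂ, (∀ᶠ w in 𝓝 0, HasSum (fun n => a n * w ^ n) (s w)) →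
      HasFPowerSeriesAt s (FormalMultilinearSeries.ofScalars ℂ a) 0 := fun a ha => by
    refine hasFPowerSeriesAt_iff.2 ?_
    filter_upwards [ha] with w hw
    simpa only [FormalMultilinearSeries.coeff_ofScalars, zero_add, smul_eq_mul, mul_comm] using hw
  have e := (key a ha).eq_formalMultilinearSeries (key b hb)
  funext n
  simpa only [FormalMultilinearSeries.coeff_ofScalars] using
    congrArg (fun p => FormalMultilinearSeries.coeff p n) e

theorem hasSum_tc {φ : ℂ → ℂ} {r : ℝ} (h : DifferentiableOn ℂ φ (Metric.ball 0 r)) {w : ℂ}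
    (hw : w ∈ Metric.ball 0 r) : HasSum (fun n => tc φ 0 n * w ^ n) (φ w) := by
  refine (Complex.hasSum_taylorSeries_on_ball h hw).congr_fun fun n => ?_
  simp only [tc, smul_eq_mul, sub_zero]
  ring

theorem AnalyticAt.exists_ball {φ : ℂ → ℂ} {w : ℂ} (h : AnalyticAt ℂ φ w) :
    ∃ r > 0, DifferentiableOn ℂ φ (Metric.ball w r) := by
  obtain ⟨r, hr, hB⟩ := Metric.eventually_nhds_iff_ball.1 h.eventually_analyticAt
  exact ⟨r, hr, fun v hv => (hB v hv).differentiableAt.differentiableWithinAt⟩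

theorem tc_eq_of_hasSum {φ : ℂ → ℂ} {a : ℕ → ℂ} (h : AnalyticAt ℂ φ 0)
    (ha : ∀ᶠ w in 𝓝 0, HasSum (fun n => a n * w ^ n) (φ w)) : tc φ 0 = a := by
  obtain ⟨r, hr, hd⟩ := AnalyticAt.exists_ball h
  refine powerSeries_unique (s := φ) ?_ ha
  filter_upwards [Metric.ball_mem_nhds 0 hr] with w hw using hasSum_tc hd hw

/-- The Taylor series of an analytic function sums absolutely to its continuation, over the same
disc of bodies. -/
theorem absHasSum_hat {r : ℝ} {z : Gr} (hz : z ∈ evenPart) (hr : body z ∈ Metric.ball 0 r) :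
    ∀ {φ : ℂ → ℂ}, DifferentiableOn ℂ φ (Metric.ball 0 r) →
      AbsHasSum (fun n => tc φ 0 n • z ^ n) (hat φ z) := by
  induction z, hz using even_ind with
  | h0 c =>
    intro φ hφ k
    rw [body_algebraMap] at hr
    have := (hasSum_tc hφ hr).mul_right (coord k 1)
    rw [hat_algebraMap, Algebra.algebraMap_eq_smul_one (φ c), map_smul, smul_eq_mul]
    refine this.congr_fun fun n => ?_
    simp only
    rw [Algebra.algebraMap_eq_smul_one, smul_pow, one_pow, map_smul, map_smul, smul_eq_mul,
      smul_eq_mul, mul_assoc]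
  | h1 a n ha hn h2 ih =>
    intro φ hφ
    rw [body_add_sq h2] at hr
    have hd := ih hr (hφ.deriv Metric.isOpen_ball)
    rw [hat_add_sq φ ha hn h2]
    -- The Taylor series of `φ` at `a + n` is that at `a` plus `n` times the derived series.
    have h3 : AbsHasSum (fun l : ℕ => if l = 0 then 0 else n * ((l : ℂ) * tc φ 0 l) • a ^ (l - 1))
        (n * hat (deriv φ) a) := by
      refine AbsHasSum.of_comp_injective (g := Nat.succ) ?_ Nat.succ_injective ?_
      · refine (hd.mul_left n).congr fun l => ?_
        rw [if_neg (Nat.succ_ne_zero l), Nat.succ_eq_add_one, ← tc_succ, Nat.add_sub_cancel]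
        push_cast
        rfl
      · intro j hj
        cases j with
        | zero => simp
        | succ j => exact absurd ⟨j, rfl⟩ hj
    refine ((ih hr hφ).add h3).congr fun l => ?_
    cases l with
    | zero => simp
    | succ l =>
      rw [if_neg (Nat.succ_ne_zero l), add_sq_pow hn h2, smul_add, Nat.add_sub_cancel,
        mul_smul_comm, smul_smul]
      push_cast
      rw [mul_comm (tc φ 0 (l + 1))]

/-- `x` is the sequence of Taylor coefficients at zero of the superanalytic function `c`. -/
def IsTaylor (x : ℕ → Gr) (c : CoeffFamily) : Prop :=
  c.FinNear 0 ∧ ∀ k n, tc (c k) 0 n = coord k (x n)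

/-- A superanalytic function is the absolutely convergent sum of its Taylor series: only finitely
many components are nonzero, and each is a scalar Taylor series. -/
theorem IsTaylor.absHasSum {x : ℕ → Gr} {c : CoeffFamily} (h : IsTaylor x c) :
    ∀ᶠ p in nb 0, AbsHasSum (fun n => x n * p.z ^ n) (c.eval p.z) := by
  obtain ⟨⟨h1, S, hS⟩, h2⟩ := h
  have hr : ∀ᶠ r in 𝓝[>] (0 : ℝ), ∀ k ∈ S, DifferentiableOn ℂ (c k) (Metric.ball 0 r) := by
    refine (Finset.eventually_all S).2 fun k _ => ?_
    obtain ⟨r, hr, hd⟩ := AnalyticAt.exists_ball (h1 k)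
    filter_upwards [Ioo_mem_nhdsGT hr] with r' hr'
    exact hd.mono (Metric.ball_subset_ball hr'.2.le)
  obtain ⟨r, hr, hr0⟩ := (hr.and self_mem_nhdsWithin).exists
  have hx : ∀ n, x n = ∑ k ∈ S, tc (c k) 0 n • grBasis k := fun n => by
    rw [sum_coord (a := x n) (S := S)]
    · exact Finset.sum_congr rfl fun k _ => by rw [h2]
    · intro k hk
      rw [← h2]
      have : c k =ᶠ[𝓝 0] 0 := hS.mono fun v hv => hv k hk
      rw [tc, Filter.EventuallyEq.iteratedDeriv_eq n this]
      have h0 : iteratedDeriv n (0 : ℂ → ℂ) 0 = 0 := by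
        have := iteratedDeriv_const (n := n) (c := (0 : ℂ)) (x := (0 : ℂ))
        have e : (0 : ℂ → ℂ) = fun _ => 0 := rfl
        rw [e, this]; split_ifs <;> rfl
      rw [h0, zero_div]
  filter_upwards [CoeffFamily.FinNear.eval_eq hS, (tendsto_body_nb 0).eventually
    (Metric.ball_mem_nhds 0 hr0)] with p hp hpr
  rw [hp]
  refine (AbsHasSum.sum S fun k hk =>
    (absHasSum_hat p.z_even hpr (hr k hk)).mul_right (grBasis k)).congr fun n => ?_
  rw [hx, Finset.sum_mul]
  refine Finset.sum_congr rfl fun k _ => ?_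
  rw [smul_mul_assoc, smul_mul_assoc, (even_commute (even_pow p.z_even n) _).eq]

theorem isTaylor_of_absHasSum {x : ℕ → Gr} {c : CoeffFamily} (hc : c.FinNear 0)
    (h : ∀ᶠ w in 𝓝 (0 : ℂ), AbsHasSum (fun n => x n * algebraMap ℂ Gr w ^ n)
      (c.eval (algebraMap ℂ Gr w))) : IsTaylor x c := by
  refine ⟨hc, fun k n => ?_⟩
  refine congrFun (tc_eq_of_hasSum (a := fun n => coord k (x n)) (hc.1 k) ?_) n
  filter_upwards [h, hc.eventually] with w hw hcw
  have := hw k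
  rw [hcw.coord_eval] at this
  refine this.congr_fun fun n => ?_
  simp only
  rw [← map_pow, ← Algebra.commutes, ← Algebra.smul_def, map_smul, smul_eq_mul, mul_comm]

theorem CoeffFamily.FinNear.exists_isTaylor {c : CoeffFamily} (h : c.FinNear 0) :
    ∃ x, IsTaylor x c := by
  obtain ⟨h1, S, hS⟩ := h
  refine ⟨fun n => ∑ k ∈ S, tc (c k) 0 n • grBasis k, ⟨h1, S, hS⟩, fun k n => ?_⟩
  simp only [map_sum, map_smul, coord_grBasis, smul_eq_mul, mul_ite, mul_one, mul_zero,
    Finset.sum_ite_eq']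
  split_ifs with hk
  · rfl
  · have : c k =ᶠ[𝓝 0] 0 := hS.mono fun v hv => hv k hk
    rw [tc, Filter.EventuallyEq.iteratedDeriv_eq n this]
    have h0 : iteratedDeriv n (0 : ℂ → ℂ) 0 = 0 := by
      have := iteratedDeriv_const (n := n) (c := (0 : ℂ)) (x := (0 : ℂ))
      have e : (0 : ℂ → ℂ) = fun _ => 0 := rfl
      rw [e, this]; split_ifs <;> rfl
    rw [h0, zero_div]

/-- A power series that converges absolutely on a disc, with sums in the Grassmann algebra, is a
superanalytic function. -/
theorem exists_isTaylor_of_summable {x : ℕ → Gr} {r : ℝ} (hr : 0 < r)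
    (h : ∀ w : ℂ, ‖w‖ < r → ∃ s, AbsHasSum (fun n => x n * algebraMap ℂ Gr w ^ n) s) :
    ∃ c, IsTaylor x c := by
  have hco : ∀ (w : ℂ) (k n), coord k (x n * algebraMap ℂ Gr w ^ n) = coord k (x n) * w ^ n :=
    fun w k n => by
      rw [← map_pow, ← Algebra.commutes, ← Algebra.smul_def, map_smul, smul_eq_mul, mul_comm]
  choose! s hs using h
  have hs' : ∀ w : ℂ, ‖w‖ < r → ∀ k, HasSum (fun n => coord k (x n) * w ^ n) (coord k (s w)) :=
    fun w hw k => (hs w hw k).congr_fun fun n => (hco w k n).symm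
  set c : CoeffFamily := fun k w => ∑' n, coord k (x n) * w ^ n with hc
  have hcs : ∀ w : ℂ, ‖w‖ < r → ∀ k, c k w = coord k (s w) := fun w hw k => (hs' w hw k).tsum_eq
  have hd : ∀ k, ∀ w ∈ Metric.ball (0 : ℂ) r, AnalyticAt ℂ (c k) w := by
    intro k w hw
    rw [mem_ball_zero_iff] at hw
    obtain ⟨ρ, h1, h2⟩ := exists_between hw
    have hρ : ‖(ρ : ℂ)‖ = ρ := by
      rw [Complex.norm_real, Real.norm_of_nonneg ((norm_nonneg w).trans h1.le)]
    have hsum := (hs' (ρ : ℂ) (by rwa [hρ]) k).summable.norm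
    have hdiff := Complex.differentiableOn_tsum_of_summable_norm hsum
      (F := fun n w => coord k (x n) * w ^ n) (U := Metric.ball 0 ρ)
      (fun n => (by fun_prop)) Metric.isOpen_ball (fun n v hv => by
        rw [mem_ball_zero_iff] at hv
        rw [norm_mul, norm_mul, norm_pow, norm_pow, hρ]
        gcongr)
    exact hdiff.analyticAt (Metric.isOpen_ball.mem_nhds (by rwa [mem_ball_zero_iff]))
  have hcA : c.AnalyticOn (Metric.ball 0 r) := by
    refine ⟨fun k w hw => hd k w hw, fun w hw => ?_⟩
    rw [mem_ball_zero_iff] at hw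
    refine (coord_finite (s w)).subset fun k hk => ?_
    rwa [Set.mem_ofPred_eq, hcs w hw] at hk
  refine ⟨c, hcA.finNear Metric.isOpen_ball (Metric.mem_ball_self hr), fun k n => ?_⟩
  refine congrFun (tc_eq_of_hasSum (a := fun n => coord k (x n)) (hd k 0 (Metric.mem_ball_self hr)) ?_) n
  filter_upwards [Metric.ball_mem_nhds 0 hr] with w hw
  rw [mem_ball_zero_iff] at hw
  rw [hcs w hw]
  exact hs' w hw k

/-! ### The normal form of a superconformal map -/

theorem CoeffFamily.FinNear.sub {c c' : CoeffFamily} {w : ℂ} (h : c.FinNear w)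
    (h' : c'.FinNear w) : (c - c').FinNear w ∧
      ∀ᶠ p in nb w, (c - c').eval p.z = c.eval p.z - c'.eval p.z := by
  obtain ⟨a, b⟩ := h'.smul (-1)
  obtain ⟨c1, d⟩ := h.add a
  have e : c - c' = c + (-1 : ℂ) • c' := by rw [neg_one_smul, sub_eq_add_neg]
  rw [e]
  refine ⟨c1, ?_⟩
  filter_upwards [b, d] with p b d
  rw [d, b, neg_one_smul, sub_eq_add_neg]

/-- The derivative of a homogeneous function of the even variable is homogeneous. -/
theorem CoeffFamily.FinNear.diff_mem {c : CoeffFamily} {w : ℂ} (h : c.FinNear w) {d : ZMod 2}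
    (hc : ∀ᶠ p in nb w, c.eval p.z ∈ gr d) : ∀ᶠ p in nb w, c.diff.eval p.z ∈ gr d := by
  have hc' : ∀ᶠ p in nb w, ∀ q : Pt, q.body = p.body → c.eval q.z ∈ gr d := by
    rw [nb_iff] at hc ⊢
    filter_upwards [hc] with v hv p hp q hq using hv q (hq.trans hp)
  filter_upwards [hc', h.diff.2] with p h1 h2
  have h11 : (1 : ZMod 2) + (1 + d) = d := by clear h1 hc hc'; revert d; decide
  refine mem_gr_of_odd_mul fun y hy => mem_gr_of_odd_mul fun x hx => ?_
  have hn := odd_mul_odd hx hy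
  have := Submodule.sub_mem _ (h1 ⟨p.z + x * y, 0, 0, Submodule.add_mem _ p.z_even hn,
    Submodule.zero_mem _, Submodule.zero_mem _⟩ (body_add_sq (odd_mul_sq hx hy))) (h1 p rfl)
  rw [h2 _ hn (odd_mul_sq hx hy), add_sub_cancel_left] at this
  rwa [h11, ← mul_assoc]

/-- The normal form of a superconformal map near the body point `w`, in terms of the functions
`f`, `g⁺`, `g⁻`, `ψ⁺`, `ψ⁻`. -/
structure SCForm (H : Pt → Pt) (w : ℂ) (f gp gm sp sm : CoeffFamily) : Prop where
  f_fin : f.FinNear w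
  gp_fin : gp.FinNear w
  gm_fin : gm.FinNear w
  sp_fin : sp.FinNear w
  sm_fin : sm.FinNear w
  gp_even : ∀ᶠ p in nb w, gp.eval p.z ∈ evenPart
  gm_even : ∀ᶠ p in nb w, gm.eval p.z ∈ evenPart
  sp_odd : ∀ᶠ p in nb w, sp.eval p.z ∈ oddPart
  sm_odd : ∀ᶠ p in nb w, sm.eval p.z ∈ oddPart
  diff : ∀ᶠ p in nb w, f.diff.eval p.z = gp.eval p.z * gm.eval p.z +
    (sp.diff.eval p.z * sm.eval p.z - sp.eval p.z * sm.diff.eval p.z)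
  z : ∀ᶠ p in nb w, (H p).z = f.eval p.z + p.tp * (gp.eval p.z * sm.eval p.z) +
    p.tm * (gm.eval p.z * sp.eval p.z) +
    p.tp * p.tm * (sp.diff.eval p.z * sm.eval p.z + sp.eval p.z * sm.diff.eval p.z)
  tp : ∀ᶠ p in nb w, (H p).tp = sp.eval p.z + p.tp * gp.eval p.z +
    p.tp * p.tm * sp.diff.eval p.z
  tm : ∀ᶠ p in nb w, (H p).tm = sm.eval p.z + p.tm * gm.eval p.z -
    p.tp * p.tm * sm.diff.eval p.z

theorem eventually_swap {w : ℂ} {Q : Pt → Prop} (h : ∀ᶠ p in nb w, Q p) :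
    ∀ᶠ p in nb w, Q (swap p) := by
  rw [nb_iff] at h ⊢
  filter_upwards [h] with v hv p hp using hv (swap p) hp

/-- The exchange of the two odd variables turns the normal form into another one, so that statements
about `D⁻` follow from those about `D⁺`. -/
theorem SCForm.swap {H : Pt → Pt} {w : ℂ} {f gp gm sp sm : CoeffFamily}
    (h : SCForm H w f gp gm sp sm) :
    SCForm (fun p => NTwo.swap (H (NTwo.swap p))) w f gm gp sm sp where
  f_fin := h.f_fin
  gp_fin := h.gm_fin
  gm_fin := h.gp_fin
  sp_fin := h.sm_fin
  sm_fin := h.sp_fin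
  gp_even := h.gm_even
  gm_even := h.gp_even
  sp_odd := h.sm_odd
  sm_odd := h.sp_odd
  diff := by
    filter_upwards [h.diff, h.gp_even, h.sp_odd, h.sm_odd, h.sp_fin.diff_mem h.sp_odd,
      h.sm_fin.diff_mem h.sm_odd] with p h1 h2 h3 h4 h5 h6
    rw [h1, (even_commute h2 _).eq, odd_anticomm h6 h3, odd_anticomm h4 h5]
    abel
  z := by
    filter_upwards [eventually_swap h.z, h.gp_even, h.sp_odd, h.sm_odd, h.sp_fin.diff_mem h.sp_odd,
      h.sm_fin.diff_mem h.sm_odd] with p h1 h2 h3 h4 h5 h6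
    refine h1.trans ?_
    change _ + p.tm * _ + p.tp * _ + p.tm * p.tp * _ = _
    change f.eval p.z + p.tm * (gp.eval p.z * sm.eval p.z) + p.tp * (gm.eval p.z * sp.eval p.z) +
      p.tm * p.tp * (sp.diff.eval p.z * sm.eval p.z + sp.eval p.z * sm.diff.eval p.z) = _
    rw [odd_anticomm h6 h3, odd_anticomm h4 h5, odd_anticomm p.tm_odd p.tp_odd]
    simp only [mul_add, mul_neg, neg_mul]
    abel
  tp := by
    filter_upwards [eventually_swap h.tm] with p h1
    refine h1.trans ?_
    change sm.eval p.z + p.tp * gm.eval p.z - p.tm * p.tp * sm.diff.eval p.z = _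
    rw [odd_anticomm p.tm_odd p.tp_odd, neg_mul, sub_neg_eq_add]
  tm := by
    filter_upwards [eventually_swap h.tp] with p h1
    refine h1.trans ?_
    change sp.eval p.z + p.tm * gp.eval p.z + p.tm * p.tp * sp.diff.eval p.z = _
    rw [odd_anticomm p.tm_odd p.tp_odd, neg_mul, sub_eq_add_neg]

theorem mul_shift {n a a' b b' : Gr} (hn : n ∈ evenPart) (hn2 : n * n = 0) :
    (a + n * a') * (b + n * b') = a * b + n * (a' * b + a * b') := by
  have e1 : a * (n * b') = n * (a * b') := by
    rw [← mul_assoc, ← (even_commute hn a).eq, mul_assoc]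
  have e2 : n * a' * (n * b') = 0 := by
    rw [mul_assoc, ← mul_assoc a', ← (even_commute hn a').eq, mul_assoc n a', ← mul_assoc n n, hn2,
      zero_mul]
  rw [add_mul, mul_add, mul_add, e1, e2, add_zero, mul_add, mul_assoc]
  abel

/-- The odd translation `(z + εθ⁻, θ⁺ + ε, θ⁻)` acts on a superconformal map in normal form through
the factor `D⁺θ̃⁺`. -/
theorem SCForm.isDP {H : Pt → Pt} {w : ℂ} {f gp gm sp sm : CoeffFamily}
    (h : SCForm H w f gp gm sp sm) : ∀ᶠ p in nb w, IsDP H p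
      (gp.eval p.z + (2 : ℂ) • (p.tm * sp.diff.eval p.z) - p.tp * p.tm * gp.diff.eval p.z) := by
  have key : ∀ {Q : Pt → Prop}, (∀ᶠ p in nb w, Q p) →
      ∀ᶠ p in nb w, ∀ q : Pt, q.body = p.body → Q q := fun hQ => by
    rw [nb_iff] at hQ ⊢
    filter_upwards [hQ] with v hv p hp q hq using hv q (hq.trans hp)
  have hdd := h.sp_fin.diff.1.diff.2
  have hdm := h.sm_fin.diff.1.diff.2
  filter_upwards [key h.z, key h.tp, key h.tm, h.gp_even, h.gm_even, h.sp_odd, h.sm_odd,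
    h.sp_fin.diff_mem h.sp_odd, h.sm_fin.diff_mem h.sm_odd, h.gp_fin.diff_mem h.gp_even,
    h.f_fin.diff.2, h.gp_fin.diff.2, h.gm_fin.diff.2, h.sp_fin.diff.2, h.sm_fin.diff.2, h.diff,
    hdd, hdm] with p hz htp htm e1 e2 o1 o2 o3 o4 e3 sf sgp sgm ssp ssm hd sdd sdm
  have o5 := p.tm_odd
  have o6 := p.tp_odd
  set A := gp.eval p.z
  set A' := gp.diff.eval p.z
  set B := gm.eval p.z
  set S := sp.eval p.z
  set S' := sp.diff.eval p.z
  set M := sm.eval p.z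
  set M' := sm.diff.eval p.z
  refine ⟨Submodule.sub_mem _ (Submodule.add_mem _ e1 (Submodule.smul_mem _ _
    (odd_mul_odd o5 o3))) (even_mul_even (odd_mul_odd o6 o5) e3), fun e he => ?_⟩
  -- All component functions are evaluated at `z + n` with `n² = 0`, by the first-order Taylor
  -- formula; the rest is the reordering of odd factors.
  set n := e * p.tm with hn
  have hne : n ∈ evenPart := odd_mul_odd he o5
  have hn2 : n * n = 0 := odd_mul_sq he o5
  have r2 : ∀ x, p.tm * (e * x) = -(e * (p.tm * x)) := fun x => by
    rw [← mul_assoc, odd_anticomm o5 he, neg_mul, mul_assoc]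
  have r1 : ∀ x, p.tp * (e * x) = -(e * (p.tp * x)) := fun x => by
    rw [← mul_assoc, odd_anticomm o6 he, neg_mul, mul_assoc]
  have r3 : ∀ x, e * (e * x) = 0 := fun x => by rw [← mul_assoc, odd_sq he, zero_mul]
  have r4 : ∀ x, p.tm * (p.tm * x) = 0 := fun x => by rw [← mul_assoc, odd_sq o5, zero_mul]
  have r5 : ∀ x, p.tm * (p.tp * x) = -(p.tp * (p.tm * x)) := fun x => by
    rw [← mul_assoc, odd_anticomm o5 o6, neg_mul, mul_assoc]
  have r6 : ∀ x, p.tp * (p.tp * x) = 0 := fun x => by rw [← mul_assoc, odd_sq o6, zero_mul]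
  have c1 : ∀ x, A * (p.tm * x) = p.tm * (A * x) := fun x => by
    rw [← mul_assoc, (even_commute e1 _).eq, mul_assoc]
  have c2 : ∀ x, A * (p.tp * x) = p.tp * (A * x) := fun x => by
    rw [← mul_assoc, (even_commute e1 _).eq, mul_assoc]
  have c3 : ∀ x, A' * (p.tm * x) = p.tm * (A' * x) := fun x => by
    rw [← mul_assoc, (even_commute e3 _).eq, mul_assoc]
  have c4 : ∀ x, A' * (p.tp * x) = p.tp * (A' * x) := fun x => by
    rw [← mul_assoc, (even_commute e3 _).eq, mul_assoc]
  have c5 : ∀ x, S' * (p.tm * x) = -(p.tm * (S' * x)) := fun x => by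
    rw [← mul_assoc, odd_anticomm o3 o5, neg_mul, mul_assoc]
  have c6 : ∀ x, S' * (p.tp * x) = -(p.tp * (S' * x)) := fun x => by
    rw [← mul_assoc, odd_anticomm o3 o6, neg_mul, mul_assoc]
  have n1 : ∀ x, p.tm * (n * x) = 0 := fun x => by
    rw [hn, mul_assoc, r2, r4, mul_zero, neg_zero]
  have n2 : ∀ x, e * (n * x) = 0 := fun x => by rw [hn, mul_assoc, r3]
  have hb := body_transP e he p
  have hz1 : (H (transP e he p)).z = f.eval (p.z + n) +
      (p.tp + e) * (gp.eval (p.z + n) * sm.eval (p.z + n)) +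
      p.tm * (gm.eval (p.z + n) * sp.eval (p.z + n)) + (p.tp + e) * p.tm *
      (sp.diff.eval (p.z + n) * sm.eval (p.z + n) + sp.eval (p.z + n) * sm.diff.eval (p.z + n)) :=
    hz _ hb
  have htp1 : (H (transP e he p)).tp = sp.eval (p.z + n) + (p.tp + e) * gp.eval (p.z + n) +
      (p.tp + e) * p.tm * sp.diff.eval (p.z + n) := htp _ hb
  have htm1 : (H (transP e he p)).tm = sm.eval (p.z + n) + p.tm * gm.eval (p.z + n) -
      (p.tp + e) * p.tm * sm.diff.eval (p.z + n) := htm _ hb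
  rw [sf n hne hn2, sgp n hne hn2, sgm n hne hn2, ssp n hne hn2, ssm n hne hn2, sdd n hne hn2,
    sdm n hne hn2, mul_shift hne hn2, mul_shift hne hn2, mul_shift hne hn2, mul_shift hne hn2,
    hd] at hz1
  rw [ssp n hne hn2, sgp n hne hn2, sdd n hne hn2] at htp1
  rw [ssm n hne hn2, sgm n hne hn2, sdm n hne hn2] at htm1
  ext1
  · rw [hz1]
    simp only [transP]
    rw [hz p rfl, htm p rfl]
    simp only [mul_add, add_mul, mul_sub, sub_mul, mul_assoc, n1, n2, mul_zero, add_zero, two_smul]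
    simp only [hn, mul_assoc, r1, r4, r5, c1, c2, c3, c4, c5, c6, mul_zero, neg_zero,
      mul_neg, sub_zero, add_zero, neg_neg]
    abel
  · rw [htp1]
    simp only [transP]
    rw [htp p rfl]
    simp only [mul_add, add_mul, mul_sub, mul_assoc, n1, n2, mul_zero, add_zero, two_smul]
    simp only [hn, mul_assoc, r1]
    abel
  · rw [htm1]
    simp only [transP]
    rw [htm p rfl]
    simp only [mul_add, add_mul, mul_assoc, n1, mul_zero, add_zero]
    simp only [hn, mul_assoc]
    abel

theorem CoeffFamily.FinNear.body_eval {c : CoeffFamily} {w : ℂ} (h : c.FinNear w) :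
    ∀ᶠ p in nb w, body (c.eval p.z) = c ∅ p.body := by
  obtain ⟨h1, h2⟩ := h.soulPart
  obtain ⟨-, S, hS⟩ := h1
  have hS' : ∀ᶠ p in nb w, c.soulPart.eval p.z = ∑ k ∈ S, hat (c.soulPart k) p.z * grBasis k :=
    CoeffFamily.FinNear.eval_eq hS
  filter_upwards [h2, hS'] with p e1 e2
  rw [e1, e2, map_add, body_hat _ p.z_even, map_sum, Finset.sum_eq_zero, add_zero]
  · rfl
  · intro k _
    rw [map_mul]
    by_cases hk : k = ∅
    · have : c.soulPart k = 0 := by rw [hk]; simp [CoeffFamily.soulPart]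
      rw [this, hat_zero p.z_even, map_zero, zero_mul]
    · rw [body_grBasis hk, mul_zero]

theorem SCForm.samap {H : Pt → Pt} {w : ℂ} {f gp gm sp sm : CoeffFamily}
    (h : SCForm H w f gp gm sp sm) : SAMap H w := by
  have a1 := h.f_fin.sa
  have a2 := h.gp_fin.sa
  have a3 := h.gm_fin.sa
  have a4 := h.sp_fin.sa
  have a5 := h.sm_fin.sa
  have a6 := h.sp_fin.diff.1.sa
  have a7 := h.sm_fin.diff.1.sa
  refine ⟨SA.congr ?_ h.z, SA.congr ?_ h.tp, SA.congr ?_ h.tm⟩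
  · exact SA.add (SA.add (SA.add a1 (SA.mul SA.tp (SA.mul a2 a5))) (SA.mul SA.tm (SA.mul a3 a4)))
      (SA.mul (SA.mul SA.tp SA.tm) (SA.add (SA.mul a6 a5) (SA.mul a4 a7)))
  · exact SA.add (SA.add a4 (SA.mul SA.tp a2)) (SA.mul (SA.mul SA.tp SA.tm) a6)
  · exact SA.sub (SA.add a5 (SA.mul SA.tm a3)) (SA.mul (SA.mul SA.tp SA.tm) a7)

theorem SCForm.dp {H : Pt → Pt} {w : ℂ} {f gp gm sp sm : CoeffFamily}
    (h : SCForm H w f gp gm sp sm) (hu : gp ∅ w ≠ 0) :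
    ∀ᶠ p in nb w, ∃ g, IsDP H p g ∧ IsUnit g := by
  have hu' : ∀ᶠ p in nb w, gp ∅ p.body ≠ 0 := (tendsto_body_nb w).eventually
    ((h.gp_fin.1 ∅).continuousAt.eventually_ne hu)
  filter_upwards [h.isDP, hu', h.gp_fin.body_eval] with p h1 h2 h3
  refine ⟨_, h1, (isUnit_iff_body h1.choose).2 ?_⟩
  simp only [map_add, map_sub, map_smul, map_mul, body_odd p.tp_odd, body_odd p.tm_odd, zero_mul,
    smul_zero, add_zero, sub_zero]
  rwa [h3]

theorem SCForm.lsc {H : Pt → Pt} {w : ℂ} {f gp gm sp sm : CoeffFamily}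
    (h : SCForm H w f gp gm sp sm) (hp : gp ∅ w ≠ 0) (hm : gm ∅ w ≠ 0) : LSC H w := by
  refine ⟨h.samap, h.dp hp, ?_⟩
  filter_upwards [eventually_swap (h.swap.dp hm)] with p ⟨g, h1, h2⟩
  exact ⟨g, isDM_of_swap h1, h2⟩

theorem nb_fibre {w : ℂ} {Q : Pt → Prop} (h : ∀ᶠ p in nb w, Q p) :
    ∀ᶠ p in nb w, ∀ q : Pt, q.body = p.body → Q q := by
  rw [nb_iff] at h ⊢
  filter_upwards [h] with v hv p hp q hq using hv q (hq.trans hp)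

theorem smul_two_cancel {a b : Gr} (h : (2 : ℂ) • a = (2 : ℂ) • b) : a = b :=
  smul_right_injective Gr (two_ne_zero : (2 : ℂ) ≠ 0) h

/-- Every superconformal map has the normal form. -/
theorem exists_scForm {H : Pt → Pt} {V : Set ℂ} (hV : IsOpen V) (hne : V.Nonempty)
    (h : ∀ w ∈ V, LSC H w) : ∃ f gp gm sp sm : CoeffFamily,
      f.AnalyticOn V ∧ gp.AnalyticOn V ∧ gm.AnalyticOn V ∧ sp.AnalyticOn V ∧ sm.AnalyticOn V ∧
      ∀ w ∈ V, SCForm H w f gp gm sp sm ∧ gp ∅ w ≠ 0 ∧ gm ∅ w ≠ 0 := by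
  obtain ⟨V', hV', e, Z, P, M, hZ, -, hP, -, hM, -, e0, h1, h2, h3, h4, -⟩ :=
    superconformalOn_of_lsc hV hne h
  have hVV : V' = V := by
    ext w
    have := Set.ext_iff.1 e (Pt.ofComplex w)
    rw [Set.mem_preimage, Set.mem_preimage, body_ofComplex] at this
    exact this.symm
  subst hVV
  clear e
  refine ⟨Z.f, P.xp, M.xm, P.f, M.f, hZ.1, hP.2.1, hM.2.2.1, hP.1, hM.1, fun w hw => ?_⟩
  have fZ := hZ.finNear hV hw
  have fP := hP.finNear hV hw
  have fM := hM.finNear hV hw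
  have E0 := nb_fibre (eventually_nb_of_mem hV hw e0)
  have E1 := nb_fibre (eventually_nb_of_mem hV hw h1)
  have E2 := nb_fibre (eventually_nb_of_mem hV hw h2)
  have E3 := nb_fibre (eventually_nb_of_mem hV hw h3)
  have E4 := nb_fibre (eventually_nb_of_mem hV hw h4)
  obtain ⟨-, D1, D2⟩ := preLSC_of_superFn fZ fP fM (eventually_nb_of_mem hV hw e0)
    (eventually_nb_of_mem hV hw h1) (eventually_nb_of_mem hV hw h2)
    (eventually_nb_of_mem hV hw h3) (eventually_nb_of_mem hV hw h4)
  have a1 := (fM.t.add fM.f.diff.1).2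
  have a2 := (fP.f.diff.1.sub fP.t).2
  have a3 := (fP.t.add fP.f.diff.1).2
  have a4 := (fM.f.diff.1.sub fM.t).2
  have a5 := (fZ.t.add fZ.f.diff.1).2
  have a6 := (fZ.f.diff.1.sub fZ.t).2
  have z0 : ∀ p : Pt, (0 : CoeffFamily).eval p.z = 0 := fun p => eval_zero_family p.z_even
  have h0 : (0 : Gr) ∈ oddPart := Submodule.zero_mem _
  -- the parities of the components
  have par : ∀ᶠ p in nb w, P.f.eval p.z ∈ oddPart ∧ M.f.eval p.z ∈ oddPart ∧
      P.xp.eval p.z ∈ evenPart ∧ M.xm.eval p.z ∈ evenPart := by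
    filter_upwards [E0] with p E0
    obtain ⟨-, q1, q2⟩ := E0 ⟨p.z, 0, 0, p.z_even, h0, h0⟩ rfl
    have b1 : (H ⟨p.z, 0, 0, p.z_even, h0, h0⟩).tp = P.f.eval p.z := by
      rw [q1]; simp [SuperFn.eval]
    have b2 : (H ⟨p.z, 0, 0, p.z_even, h0, h0⟩).tm = M.f.eval p.z := by
      rw [q2]; simp [SuperFn.eval]
    have o1 : P.f.eval p.z ∈ oddPart := b1 ▸ Pt.tp_odd _
    have o2 : M.f.eval p.z ∈ oddPart := b2 ▸ Pt.tm_odd _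
    refine ⟨o1, o2, mem_gr_of_odd_mul (d := 0) fun x hx => ?_, mem_gr_of_odd_mul (d := 0) fun x hx => ?_⟩
    · obtain ⟨-, q1, -⟩ := E0 ⟨p.z, x, 0, p.z_even, hx, h0⟩ rfl
      have b3 : x * P.xp.eval p.z = (H ⟨p.z, x, 0, p.z_even, hx, h0⟩).tp - P.f.eval p.z := by
        rw [q1]; simp [SuperFn.eval]
      rw [b3]
      exact Submodule.sub_mem _ (Pt.tp_odd _) o1
    · obtain ⟨-, -, q1⟩ := E0 ⟨p.z, 0, x, p.z_even, h0, hx⟩ rfl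
      have b3 : x * M.xm.eval p.z = (H ⟨p.z, 0, x, p.z_even, h0, hx⟩).tm - M.f.eval p.z := by
        rw [q1]; simp [SuperFn.eval]
      rw [b3]
      exact Submodule.sub_mem _ (Pt.tm_odd _) o2
  -- the consequences of `D⁺θ̃⁻ = 0` and `D⁻θ̃⁺ = 0`
  have c1 : ∀ᶠ p in nb w, M.xp.eval p.z = 0 ∧ M.t.eval p.z = -M.f.diff.eval p.z := by
    filter_upwards [E1, a1] with p E1 a1
    have q1 := E1 ⟨p.z, 0, 0, p.z_even, h0, h0⟩ rfl
    have b1 : M.xp.eval p.z = 0 := by simpa [SuperFn.eval, SuperFn.dPlus] using q1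
    refine ⟨b1, eq_neg_of_add_eq_zero_left (cancel_odd fun y hy => ?_)⟩
    have q2 := E1 ⟨p.z, 0, y, p.z_even, h0, hy⟩ rfl
    simpa [SuperFn.eval, SuperFn.dPlus, b1, a1] using q2
  have c2 : ∀ᶠ p in nb w, P.xm.eval p.z = 0 ∧ P.t.eval p.z = P.f.diff.eval p.z := by
    filter_upwards [E2, a2] with p E2 a2
    have q1 := E2 ⟨p.z, 0, 0, p.z_even, h0, h0⟩ rfl
    have b1 : P.xm.eval p.z = 0 := by simpa [SuperFn.eval, SuperFn.dMinus] using q1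
    refine ⟨b1, (sub_eq_zero.1 (cancel_odd fun y hy => ?_)).symm⟩
    have q2 := E2 ⟨p.z, y, 0, p.z_even, hy, h0⟩ rfl
    simpa [SuperFn.eval, SuperFn.dMinus, b1, a2] using q2
  -- the consequences of `D⁺z̃ = θ̃⁻ D⁺θ̃⁺` and `D⁻z̃ = θ̃⁺ D⁻θ̃⁻`
  have c3 : ∀ᶠ p in nb w, Z.xp.eval p.z = P.xp.eval p.z * M.f.eval p.z ∧
      Z.t.eval p.z + Z.f.diff.eval p.z = P.xp.eval p.z * M.xm.eval p.z +
        (2 : ℂ) • (P.f.diff.eval p.z * M.f.eval p.z) := by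
    filter_upwards [E3, a5, a3, c1, c2, par, (fP.f.diff_mem (d := 1) (par.mono fun p hp => hp.1))]
      with p E3 a5 a3 c1 c2 par o3
    obtain ⟨o1, o2, e1, e2⟩ := par
    have q1 := E3 ⟨p.z, 0, 0, p.z_even, h0, h0⟩ rfl
    have b1 : Z.xp.eval p.z = P.xp.eval p.z * M.f.eval p.z := by
      rw [(even_commute e1 _).eq, ← sub_eq_zero]
      simpa [SuperFn.eval, SuperFn.dPlus] using q1
    refine ⟨b1, cancel_odd_eq fun y hy => ?_⟩
    have q2 := E3 ⟨p.z, 0, y, p.z_even, h0, hy⟩ rfl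
    simp only [SuperFn.eval, SuperFn.dPlus, b1, a5, a3, c2.2, z0 p, zero_mul, mul_zero,
      add_zero] at q2
    rw [sub_eq_zero, ← two_smul ℂ] at q2
    have r1 : M.f.eval p.z * (y * ((2 : ℂ) • P.f.diff.eval p.z)) =
        (2 : ℂ) • (y * (P.f.diff.eval p.z * M.f.eval p.z)) := by
      rw [mul_smul_comm, mul_smul_comm, ← mul_assoc, odd_anticomm o2 hy, neg_mul, mul_assoc,
        odd_anticomm o2 o3, mul_neg, neg_neg]
    have r2 : y * M.xm.eval p.z * (y * ((2 : ℂ) • P.f.diff.eval p.z)) = 0 := by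
      rw [(even_commute e2 y).eq.symm, mul_assoc, ← mul_assoc y, odd_sq hy, zero_mul, mul_zero]
    simp only [add_mul, mul_add, r1, r2, add_zero] at q2
    rw [(even_commute e1 (M.f.eval p.z)).eq, add_assoc] at q2
    rw [mul_add, add_left_cancel q2, mul_add, mul_smul_comm, mul_assoc, (even_commute e1 _).eq, add_comm]
  have c4 : ∀ᶠ p in nb w, Z.xm.eval p.z = M.xm.eval p.z * P.f.eval p.z ∧
      Z.f.diff.eval p.z - Z.t.eval p.z = P.xp.eval p.z * M.xm.eval p.z -
        (2 : ℂ) • (P.f.eval p.z * M.f.diff.eval p.z) := by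
    filter_upwards [E4, a6, a4, c1, c2, par, (fM.f.diff_mem (d := 1) (par.mono fun p hp => hp.2.1))]
      with p E4 a6 a4 c1 c2 par o3
    obtain ⟨o1, o2, e1, e2⟩ := par
    have q1 := E4 ⟨p.z, 0, 0, p.z_even, h0, h0⟩ rfl
    have b1 : Z.xm.eval p.z = M.xm.eval p.z * P.f.eval p.z := by
      rw [(even_commute e2 _).eq, ← sub_eq_zero]
      simpa [SuperFn.eval, SuperFn.dMinus] using q1
    refine ⟨b1, cancel_odd_eq fun y hy => ?_⟩
    have q2 := E4 ⟨p.z, y, 0, p.z_even, hy, h0⟩ rfl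
    simp only [SuperFn.eval, SuperFn.dMinus, b1, a6, a4, c1.2, z0 p, zero_mul, mul_zero,
      add_zero, sub_neg_eq_add] at q2
    rw [sub_eq_zero, ← two_smul ℂ] at q2
    have r1 : P.f.eval p.z * (y * ((2 : ℂ) • M.f.diff.eval p.z)) =
        -((2 : ℂ) • (y * (P.f.eval p.z * M.f.diff.eval p.z))) := by
      rw [mul_smul_comm, mul_smul_comm, ← mul_assoc, odd_anticomm o1 hy, neg_mul, mul_assoc,
        smul_neg]
    have r2 : y * P.xp.eval p.z * (y * ((2 : ℂ) • M.f.diff.eval p.z)) = 0 := by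
      rw [(even_commute e1 y).eq.symm, mul_assoc, ← mul_assoc y, odd_sq hy, zero_mul, mul_zero]
    simp only [add_mul, mul_add, r1, r2, add_zero] at q2
    rw [(even_commute e2 (P.f.eval p.z)).eq, add_assoc] at q2
    rw [add_left_cancel q2, mul_sub, mul_smul_comm, mul_assoc, ← sub_eq_add_neg]
  -- `D⁺θ̃⁺` and `D⁻θ̃⁻` are units, and their bodies are those of `g⁺` and `g⁻`.
  have hunit : P.xp ∅ w ≠ 0 ∧ M.xm ∅ w ≠ 0 := by
    obtain ⟨g, g1, g2⟩ := nb_self (h w hw).dp (body_ofComplex w)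
    obtain ⟨g', g3, g4⟩ := nb_self (h w hw).dm (body_ofComplex w)
    have d1 := nb_self D1 (body_ofComplex w)
    have d2 := nb_self D2 (body_ofComplex w)
    rw [g1.unique d1, isUnit_iff_body (g1.unique d1 ▸ g1.choose)] at g2
    rw [g3.unique d2, isUnit_iff_body (g3.unique d2 ▸ g3.choose)] at g4
    have t1 := nb_self fP.xp.body_eval (body_ofComplex w)
    have t2 := nb_self fM.xm.body_eval (body_ofComplex w)
    rw [body_ofComplex] at t1 t2
    rw [← t1, ← t2]
    constructor
    · simpa [SuperFn.eval, SuperFn.dPlus, Pt.ofComplex] using g2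
    · simpa [SuperFn.eval, SuperFn.dMinus, Pt.ofComplex] using g4
  -- Half the sum of the two second components eliminates the `θ⁺θ⁻`-component of `z̃`.
  have hdiff : ∀ᶠ p in nb w, Z.f.diff.eval p.z = P.xp.eval p.z * M.xm.eval p.z +
      (P.f.diff.eval p.z * M.f.eval p.z - P.f.eval p.z * M.f.diff.eval p.z) := by
    filter_upwards [c3, c4] with p c3 c4
    replace c3 := c3.2
    replace c4 := c4.2
    refine smul_two_cancel ?_
    have e5 : (2 : ℂ) • Z.f.diff.eval p.z = (Z.t.eval p.z + Z.f.diff.eval p.z) +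
        (Z.f.diff.eval p.z - Z.t.eval p.z) := by rw [two_smul]; abel
    rw [e5, c3, c4, smul_add, smul_sub, two_smul ℂ (P.xp.eval p.z * M.xm.eval p.z)]
    abel
  refine ⟨⟨fZ.f, fP.xp, fM.xm, fP.f, fM.f, par.mono fun p hp => hp.2.2.1,
    par.mono fun p hp => hp.2.2.2, par.mono fun p hp => hp.1, par.mono fun p hp => hp.2.1,
    hdiff, ?_, ?_, ?_⟩, hunit⟩
  · filter_upwards [E0, c3, c4, hdiff] with p E0 c3 c4 hd
    have ht : Z.t.eval p.z = P.f.diff.eval p.z * M.f.eval p.z +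
        P.f.eval p.z * M.f.diff.eval p.z := by
      have := c3.2
      rw [hd, ← eq_sub_iff_add_eq, two_smul] at this
      rw [this]
      abel
    rw [(E0 p rfl).1, SuperFn.eval, c3.1, c4.1, ht]
  · filter_upwards [E0, c2] with p E0 c2
    rw [(E0 p rfl).2.1, SuperFn.eval, c2.1, c2.2, mul_zero, add_zero]
  · filter_upwards [E0, c1] with p E0 c1
    rw [(E0 p rfl).2.2, SuperFn.eval, c1.1, c1.2, mul_zero, add_zero, mul_neg, sub_eq_add_neg]

/-! ### Primitives -/

theorem exists_primitive_scalar {φ : ℂ → ℂ} {w : ℂ} (h : AnalyticAt ℂ φ w) :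
    ∃ χ, AnalyticAt ℂ χ w ∧ χ w = 0 ∧ ∀ᶠ v in 𝓝 w, deriv χ v = φ v := by
  obtain ⟨r, hr, hd⟩ := AnalyticAt.exists_ball h
  obtain ⟨χ, hχ⟩ := hd.isExactOn_ball
  have hw := Metric.mem_ball_self (x := w) hr
  have hdiff : DifferentiableOn ℂ χ (Metric.ball w r) := fun v hv =>
    (hχ v hv).differentiableAt.differentiableWithinAt
  refine ⟨fun v => χ v - χ w, (hdiff.analyticAt (Metric.isOpen_ball.mem_nhds hw)).sub
    analyticAt_const, sub_self _, ?_⟩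
  filter_upwards [Metric.isOpen_ball.mem_nhds hw] with v hv
  rw [deriv_sub_const]
  exact (hχ v hv).deriv

/-- A superanalytic function of the even variable has a primitive that vanishes at `w`. -/
theorem CoeffFamily.FinNear.exists_primitive {c : CoeffFamily} {w : ℂ} (h : c.FinNear w) :
    ∃ F : CoeffFamily, F.FinNear w ∧ (∀ k, F k w = 0) ∧
      (∀ k, (∀ᶠ v in 𝓝 w, c k v = 0) → F k = 0) ∧
      ∀ᶠ v in 𝓝 w, ∀ k, F.diff k v = c k v := by
  classical
  obtain ⟨h1, S, hS⟩ := h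
  choose χ hχ hχ0 hχd using fun k => exists_primitive_scalar (h1 k)
  set F : CoeffFamily := fun k => if ∀ᶠ v in 𝓝 w, c k v = 0 then 0 else χ k with hF
  have F0 : ∀ k, (∀ᶠ v in 𝓝 w, c k v = 0) → F k = 0 := fun k hk => if_pos hk
  have FS : ∀ k ∉ S, F k = 0 := fun k hk => F0 k (hS.mono fun v hv => hv k hk)
  refine ⟨F, ⟨fun k => ?_, S, Eventually.of_forall fun v k hk => by rw [FS k hk]; rfl⟩,
    fun k => ?_, F0, ?_⟩
  · by_cases hk : ∀ᶠ v in 𝓝 w, c k v = 0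
    · rw [F0 k hk]; exact analyticAt_const
    · simp only [hF, if_neg hk]; exact hχ k
  · by_cases hk : ∀ᶠ v in 𝓝 w, c k v = 0
    · rw [F0 k hk]; rfl
    · simp only [hF, if_neg hk]; exact hχ0 k
  · have hall : ∀ᶠ v in 𝓝 w, ∀ k ∈ S, F.diff k v = c k v := by
      refine (Finset.eventually_all S).2 fun k _ => ?_
      by_cases hk : ∀ᶠ v in 𝓝 w, c k v = 0
      · filter_upwards [hk] with v hv
        change deriv (F k) v = _
        have e : (0 : ℂ → ℂ) = fun _ => 0 := rfl
        rw [F0 k hk, hv, e, deriv_const]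
      · filter_upwards [hχd k] with v hv
        change deriv (F k) v = _
        simp only [hF, if_neg hk]; exact hv
    filter_upwards [hall, hS] with v hv hv' k
    by_cases hk : k ∈ S
    · exact hv k hk
    · change deriv (F k) v = _
      have e : (0 : ℂ → ℂ) = fun _ => 0 := rfl
      rw [FS k hk, hv' k hk, e, deriv_const]

theorem eval_eq_of_eventually {c c' : CoeffFamily} {w : ℂ}
    (h : ∀ᶠ v in 𝓝 w, ∀ k, c k v = c' k v) : ∀ᶠ p in nb w, c.eval p.z = c'.eval p.z := by
  filter_upwards [(tendsto_body_nb w).eventually (eventually_eventually_nhds.2 h)] with p hp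
  exact eval_congr_family p.z_even hp

/-! ### Superconformal maps as superconformal power series -/

theorem even_of_coord {a : Gr} (h : ∀ k : Finset ℕ, Odd k.card → coord k a = 0) :
    a ∈ evenPart := by
  obtain ⟨S, -, e⟩ := exists_sum_coord a
  rw [e]
  refine Submodule.sum_mem _ fun k _ => ?_
  rcases Nat.even_or_odd k.card with hk | hk
  · exact Submodule.smul_mem _ _ (grBasis_mem_even hk)
  · rw [h k hk, zero_smul]; exact Submodule.zero_mem _

theorem odd_of_coord {a : Gr} (h : ∀ k : Finset ℕ, Even k.card → coord k a = 0) :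
    a ∈ oddPart := by
  obtain ⟨S, -, e⟩ := exists_sum_coord a
  rw [e]
  refine Submodule.sum_mem _ fun k _ => ?_
  rcases Nat.even_or_odd k.card with hk | hk
  · rw [h k hk, zero_smul]; exact Submodule.zero_mem _
  · exact Submodule.smul_mem _ _ (grBasis_mem_odd hk)

theorem AbsHasSum.mem_even {ι : Type} {x : ι → Gr} {s : Gr} (h : AbsHasSum x s)
    (hx : ∀ i, x i ∈ evenPart) : s ∈ evenPart := even_of_coord fun k hk =>
  (h k).unique (by simpa only [coord_of_even (hx _) hk] using hasSum_zero)

theorem AbsHasSum.mem_odd {ι : Type} {x : ι → Gr} {s : Gr} (h : AbsHasSum x s)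
    (hx : ∀ i, x i ∈ oddPart) : s ∈ oddPart := odd_of_coord fun k hk =>
  (h k).unique (by simpa only [coord_of_odd (hx _) hk] using hasSum_zero)

theorem IsTaylor.eval_even {x : ℕ → Gr} {c : CoeffFamily} (h : IsTaylor x c)
    (hx : ∀ n, x n ∈ evenPart) : ∀ᶠ p in nb 0, c.eval p.z ∈ evenPart :=
  h.absHasSum.mono fun p hp => hp.mem_even fun n => even_mul_even (hx n) (even_pow p.z_even n)

theorem IsTaylor.eval_odd {x : ℕ → Gr} {c : CoeffFamily} (h : IsTaylor x c)
    (hx : ∀ n, x n ∈ oddPart) : ∀ᶠ p in nb 0, c.eval p.z ∈ oddPart :=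
  h.absHasSum.mono fun p hp => hp.mem_odd fun n => odd_mul_even (hx n) (even_pow p.z_even n)

theorem tc_congr {φ χ : ℂ → ℂ} {w : ℂ} (h : φ =ᶠ[𝓝 w] χ) (n : ℕ) : tc φ w n = tc χ w n := by
  rw [tc, tc, Filter.EventuallyEq.iteratedDeriv_eq n h]

theorem eventually_ofComplex {w : ℂ} {Q : Pt → Prop} (h : ∀ᶠ p in nb w, Q p) :
    ∀ᶠ v in 𝓝 w, Q (Pt.ofComplex v) := by
  filter_upwards [nb_iff.1 h] with v hv using hv _ (body_ofComplex v)

theorem tc_zero_fun (w : ℂ) (n : ℕ) : tc (fun _ => 0) w n = 0 := by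
  rw [tc, iteratedDeriv_const]
  split_ifs <;> simp

theorem IsTaylor.mem_even {x : ℕ → Gr} {c : CoeffFamily} (h : IsTaylor x c)
    (hc : ∀ᶠ p in nb 0, c.eval p.z ∈ evenPart) (n : ℕ) : x n ∈ evenPart := by
  refine even_of_coord fun k hk => ?_
  rw [← h.2, tc_congr (χ := fun _ => 0), tc_zero_fun]
  filter_upwards [eventually_ofComplex hc, h.1.eventually] with v hv hv'
  rw [← hv'.coord_eval]
  exact coord_of_even hv hk

theorem IsTaylor.mem_odd {x : ℕ → Gr} {c : CoeffFamily} (h : IsTaylor x c)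
    (hc : ∀ᶠ p in nb 0, c.eval p.z ∈ oddPart) (n : ℕ) : x n ∈ oddPart := by
  refine odd_of_coord fun k hk => ?_
  rw [← h.2, tc_congr (χ := fun _ => 0), tc_zero_fun]
  filter_upwards [eventually_ofComplex hc, h.1.eventually] with v hv hv'
  rw [← hv'.coord_eval]
  exact coord_of_odd hv hk

theorem IsTaylor.diff {x : ℕ → Gr} {c : CoeffFamily} (h : IsTaylor x c) :
    IsTaylor (fun n => ((n : ℂ) + 1) • x (n + 1)) c.diff :=
  ⟨h.1.diff.1, fun k n => by
    rw [map_smul, ← h.2 k (n + 1), smul_eq_mul, tc_succ]; rfl⟩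

/-- The sequence `0, m 0, m 1, …`. -/
def shiftSeq (m : ℕ → Gr) : ℕ → Gr
  | 0 => 0
  | n + 1 => m n

theorem IsTaylor.absHasSum_shift {m : ℕ → Gr} {c : CoeffFamily} (h : IsTaylor (shiftSeq m) c) :
    ∀ᶠ p in nb 0, AbsHasSum (fun n => m n * p.z ^ (n + 1)) (c.eval p.z) := by
  filter_upwards [h.absHasSum] with p hp
  refine hp.comp_injective (g := Nat.succ) Nat.succ_injective fun j hj => ?_
  cases j with
  | zero => exact zero_mul _
  | succ j => exact absurd ⟨j, rfl⟩ hj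

theorem absHasSum_shiftSeq {m : ℕ → Gr} {z s : Gr} (h : AbsHasSum (fun n => m n * z ^ (n + 1)) s) :
    AbsHasSum (fun n => shiftSeq m n * z ^ n) s := by
  refine AbsHasSum.of_comp_injective (g := Nat.succ) h Nat.succ_injective fun j hj => ?_
  cases j with
  | zero => exact zero_mul _
  | succ j => exact absurd ⟨j, rfl⟩ hj

theorem exists_family_of_sa {G : Gr → Gr} {w : ℂ} (h : (fun p : Pt => G p.z) ∈ SA w) :
    ∃ c : CoeffFamily, c.FinNear w ∧ ∀ᶠ p in nb w, c.eval p.z = G p.z := by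
  obtain ⟨F, hF, e⟩ := SA.exists_superFn h
  refine ⟨F.f, hF.f, ?_⟩
  have h0 : (0 : Gr) ∈ oddPart := Submodule.zero_mem _
  filter_upwards [nb_fibre e] with p hp
  have := hp ⟨p.z, 0, 0, p.z_even, h0, h0⟩ rfl
  simpa [SuperFn.eval] using this.symm

/-- Termwise integration of a double series. -/
theorem absHasSum_primitive {F : CoeffFamily} {y : ℕ × ℕ → Gr} (t : ℕ) (hF : F.FinNear 0)
    (h0 : ∀ k, F k 0 = 0)
    (hs : ∀ᶠ p in nb 0, AbsHasSum (fun i => y i * p.z ^ (i.1 + i.2 + t)) (F.diff.eval p.z)) :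
    ∀ᶠ p in nb 0, AbsHasSum (fun i => ((1 : ℂ) / ((i.1 + i.2 + t : ℕ) + 1)) •
      (y i * p.z ^ (i.1 + i.2 + t + 1))) (F.eval p.z) := by
  -- Along antidiagonals the double series is a one-variable power series, whose coefficients are
  -- the Taylor coefficients of the derivative.
  set Y : ℕ → Gr := fun n => ∑ i ∈ Finset.HasAntidiagonal.antidiagonal n, y i with hY
  set X : ℕ → Gr := fun m => if m < t then 0 else Y (m - t) with hX
  have hXt : ∀ n, X (n + t) = Y n := fun n => by simp [hX]
  have hinj : ∀ s, Function.Injective fun n : ℕ => n + s := fun s => add_left_injective s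
  have hmem : ∀ s m : ℕ, m ∉ Set.range (fun n : ℕ => n + s) → m < s := fun s m hm => by
    by_contra hc
    exact hm ⟨m - s, Nat.sub_add_cancel (not_lt.1 hc)⟩
  have hXs : ∀ᶠ p in nb 0, AbsHasSum (fun m => X m * p.z ^ m) (F.diff.eval p.z) := by
    filter_upwards [hs] with p hp
    refine AbsHasSum.of_comp_injective (g := fun n => n + t) ?_ (hinj t) fun m hm => ?_
    · refine hp.antidiagonal.congr fun n => ?_
      rw [hXt, hY, Finset.sum_mul]
      refine Finset.sum_congr rfl fun i hi => ?_
      rw [Finset.HasAntidiagonal.mem_antidiagonal.1 hi]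
    · rw [hX]; simp only; rw [if_pos (hmem t m hm), zero_mul]
  have hXT : IsTaylor X F.diff := isTaylor_of_absHasSum hF.diff.1 (eventually_ofComplex hXs)
  set X' : ℕ → Gr := shiftSeq fun m => ((1 : ℂ) / (m + 1)) • X m with hX'
  have hXT' : IsTaylor X' F := by
    refine ⟨hF, fun k n => ?_⟩
    cases n with
    | zero => rw [tc_zero, h0]; exact (map_zero _).symm
    | succ n =>
      have h1 : ((n : ℂ) + 1) ≠ 0 := by exact_mod_cast n.succ_ne_zero
      have h2 := tc_succ (F k) 0 n
      have h3 : tc (deriv (F k)) 0 n = coord k (X n) := hXT.2 k n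
      change _ = coord k (((1 : ℂ) / (n + 1)) • X n)
      rw [map_smul, ← h3, ← h2, smul_eq_mul]
      field_simp
  filter_upwards [hXT'.absHasSum, hs] with p hp hsp
  refine AbsHasSum.of_antidiagonal (fun k => ?_) ?_
  -- The integrated double series converges absolutely, being dominated by the given one.
  · have h1 := (hsp.mul_right p.z).summable_smul
      (c := fun i : ℕ × ℕ => (1 : ℂ) / ((i.1 + i.2 + t : ℕ) + 1)) (fun i => ?_) k
    · simpa only [mul_assoc, ← pow_succ] using h1
    · rw [norm_div, norm_one]
      have e : ‖(((i.1 + i.2 + t : ℕ) : ℂ) + 1)‖ = ((i.1 + i.2 + t : ℕ) : ℝ) + 1 := by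
        rw [← Nat.cast_succ, Complex.norm_natCast, Nat.cast_succ]
      rw [e]
      exact div_le_one_of_le₀ (by linarith [Nat.cast_nonneg (α := ℝ) (i.1 + i.2 + t)])
        (by positivity)
  · refine (hp.comp_injective (hinj (t + 1)) fun m hm => ?_).congr fun n => ?_
    · have := hmem (t + 1) m hm
      cases m with
      | zero => exact zero_mul _
      | succ m =>
        change ((1 : ℂ) / (m + 1)) • X m * _ = 0
        rw [hX]; simp only
        rw [if_pos (by omega), smul_zero, zero_mul]
    · change _ = ((1 : ℂ) / ((n + t : ℕ) + 1)) • X (n + t) * p.z ^ (n + (t + 1))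
      rw [hXt, hY, Finset.smul_sum, Finset.sum_mul]
      refine Finset.sum_congr rfl fun i hi => ?_
      rw [Finset.HasAntidiagonal.mem_antidiagonal.1 hi, smul_mul_assoc, add_assoc]

theorem mul_pow_mul_pow {z : Gr} (hz : z ∈ evenPart) (a b : Gr) (i j : ℕ) :
    (a * z ^ i) * (b * z ^ j) = a * b * z ^ (i + j) := by
  rw [mul_assoc, ← mul_assoc (z ^ i), (even_commute (even_pow hz i) b).eq, mul_assoc b, ← pow_add,
    mul_assoc]

/-- A superconformal map in normal form, vanishing at zero, is the sum of the superconformal power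
series formed from the Taylor coefficients of `g⁺`, `g⁻`, `ψ⁺`, `ψ⁻`. -/
theorem SCForm.evalsTo {H : Pt → Pt} {f gp gm sp sm : CoeffFamily} (h : SCForm H 0 f gp gm sp sm)
    (h0 : ∀ k, f k 0 = 0) {K : LocalSeries} (hp : IsTaylor K.ap gp) (hm : IsTaylor K.am gm)
    (hsp : IsTaylor (shiftSeq K.mp) sp) (hsm : IsTaylor (shiftSeq K.mm) sm) :
    ∀ᶠ p in nb 0, K.EvalsTo p (H p) := by
  -- Split `f = f₁ + f₂`, where `f₁` is the primitive of `g⁺g⁻` and `f₂` that of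
  -- `(ψ⁺)'ψ⁻ - ψ⁺(ψ⁻)'`: the two double series have different exponents.
  obtain ⟨q, hq, eq⟩ := exists_family_of_sa (G := fun z => gp.eval z * gm.eval z) (w := 0)
    (SA.mul h.gp_fin.sa h.gm_fin.sa)
  obtain ⟨f₁, hf₁, f₁0, -, f₁d⟩ := hq.exists_primitive
  have ef₁ := eval_eq_of_eventually f₁d
  obtain ⟨hf₂, ef⟩ := h.f_fin.sub hf₁
  have ef₂ : ∀ᶠ p in nb 0, (f - f₁).diff.eval p.z = f.diff.eval p.z - f₁.diff.eval p.z := by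
    obtain ⟨-, e1⟩ := h.f_fin.diff.1.sub hf₁.diff.1
    have e2 : ∀ᶠ v in 𝓝 (0 : ℂ), ∀ k, (f - f₁).diff k v = (f.diff - f₁.diff) k v := by
      filter_upwards [h.f_fin.eventually, hf₁.eventually] with v h1 h2 k
      exact deriv_sub (h1.1 k).differentiableAt (h2.1 k).differentiableAt
    filter_upwards [e1, eval_eq_of_eventually e2] with p e1 e2
    rw [e2, e1]
  have S1 := absHasSum_primitive (y := fun i => K.ap i.1 * K.am i.2) 0 hf₁ f₁0 (by
    filter_upwards [hp.absHasSum, hm.absHasSum, ef₁, eq] with p a b c d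
    rw [c, d]
    exact (a.mul b).congr fun i => by rw [mul_pow_mul_pow p.z_even, add_zero])
  have hspd : ∀ᶠ p in nb 0, AbsHasSum (fun n : ℕ => ((n : ℂ) + 1) • K.mp n * p.z ^ n)
    (sp.diff.eval p.z) := hsp.diff.absHasSum
  have hsmd : ∀ᶠ p in nb 0, AbsHasSum (fun n : ℕ => ((n : ℂ) + 1) • K.mm n * p.z ^ n)
    (sm.diff.eval p.z) := hsm.diff.absHasSum
  have S2 := absHasSum_primitive (y := fun i => ((i.1 : ℂ) - i.2) • (K.mp i.1 * K.mm i.2)) 1 hf₂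
    (fun k => by rw [Pi.sub_apply, Pi.sub_apply, h0, f₁0, sub_zero]) (by
    filter_upwards [hspd, hsmd, hsp.absHasSum_shift, hsm.absHasSum_shift, ef₂, ef₁, eq, h.diff]
      with p a b c d e1 e2 e3 e4
    rw [e1, e2, e3, e4, add_sub_cancel_left]
    refine ((a.mul d).sub (c.mul b)).congr fun i => ?_
    rw [mul_pow_mul_pow p.z_even, mul_pow_mul_pow p.z_even, smul_mul_assoc, mul_smul_comm,
      smul_mul_assoc, smul_mul_assoc, smul_mul_assoc, ← add_assoc, add_right_comm i.1 1 i.2,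
      ← sub_smul]
    congr 1
    ring)
  filter_upwards [S1, S2, hp.absHasSum, hm.absHasSum, hspd, hsmd, hsp.absHasSum_shift,
    hsm.absHasSum_shift, h.z, h.tp, h.tm, ef] with p S1 S2 A B A' B' C D hz htp htm ef
  refine ⟨?_, ?_, ?_⟩
  · have ef' : f.eval p.z = f₁.eval p.z + (f - f₁).eval p.z := by rw [ef]; abel
    rw [hz, ef']
    have T5 := ((A'.mul D).add (C.mul B')).congr (y := fun i : ℕ × ℕ => ((i.1 : ℂ) + i.2 + 2) •
        (K.mp i.1 * K.mm i.2 * p.z ^ (i.1 + i.2 + 1))) fun i => by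
      rw [mul_pow_mul_pow p.z_even, mul_pow_mul_pow p.z_even, smul_mul_assoc, mul_smul_comm,
        smul_mul_assoc, smul_mul_assoc, ← add_assoc, add_right_comm i.1 1 i.2, ← add_smul]
      congr 1
      ring
    have T3 := ((A.mul D).congr (y := fun i : ℕ × ℕ => K.ap i.1 * K.mm i.2 *
      p.z ^ (i.1 + i.2 + 1)) fun i => by rw [mul_pow_mul_pow p.z_even, add_assoc])
    have T4 := ((B.mul C).congr (y := fun i : ℕ × ℕ => K.am i.1 * K.mp i.2 *
      p.z ^ (i.1 + i.2 + 1)) fun i => by rw [mul_pow_mul_pow p.z_even, add_assoc])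
    refine ((((S1.add S2).add (T3.mul_left p.tp)).add (T4.mul_left p.tm)).add
      (T5.mul_left (p.tp * p.tm))).congr fun i => ?_
    simp only [LocalSeries.evenTerm, smul_mul_assoc, mul_smul_comm,
      smul_smul, add_zero, Nat.cast_add, Nat.cast_one, ← mul_assoc]
    congr 4
    rw [add_assoc (i.1 + i.2 : ℂ), one_add_one_eq_two]
    ring_nf
  · rw [htp]
    refine ((C.add (A.mul_left p.tp)).add (A'.mul_left (p.tp * p.tm))).congr fun n => ?_
    simp only [LocalSeries.plusTerm, smul_mul_assoc, mul_smul_comm, mul_assoc]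
  · rw [htm]
    refine ((D.add (B.mul_left p.tm)).sub (B'.mul_left (p.tp * p.tm))).congr fun n => ?_
    simp only [LocalSeries.minusTerm, smul_mul_assoc, mul_smul_comm, mul_assoc]

theorem Lip.congr {L s : ℕ} {v : ℂ} {G G' : Pt → Gr} (h : Lip L s v G)
    (e : ∀ p : Pt, p.body = v → G' p = G p) : Lip L s v G' := fun k p q hp hq a b c => by
  rw [e p hp, e q hq]; exact h k p q hp hq a b c

theorem Lip.const (L : ℕ) (v : ℂ) (a : Gr) : Lip L 0 v (fun _ => a) :=
  fun _ _ _ _ _ _ _ _ => by simp only [sub_self, Submodule.zero_mem]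

theorem Lip.sum {L : ℕ} {v : ℂ} {ι : Type*} (s : Finset ι) {G : ι → Pt → Gr}
    (h : ∀ i ∈ s, Lip L 0 v (G i)) : Lip L 0 v (fun p => ∑ i ∈ s, G i p) := by
  classical
  induction s using Finset.induction_on with
  | empty => simpa using Lip.const L v 0
  | insert i s hi ih =>
    simp only [Finset.sum_insert hi]
    exact (h i (Finset.mem_insert_self i s)).add
      (ih fun j hj => h j (Finset.mem_insert_of_mem hj))

theorem CoeffFamily.FinNear.lip {c : CoeffFamily} {w : ℂ} (h : c.FinNear w) (L : ℕ) :
    ∀ᶠ v in 𝓝 w, Lip L 0 v (fun p => c.eval p.z) := by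
  obtain ⟨-, S, hS⟩ := h
  filter_upwards [nb_iff.1 (CoeffFamily.FinNear.eval_eq hS)] with v hv
  exact Lip.congr (Lip.sum _ fun k _ => (Lip.hat L v _).mul (Lip.const L v _)) hv

theorem LSC.eventually {H : Pt → Pt} {w : ℂ} (h : LSC H w) : ∀ᶠ v in 𝓝 w, LSC H v := by
  filter_upwards [h.sa.eventually, nb_nb h.dp, nb_nb h.dm] with v a b c using ⟨a, b, c⟩

theorem body_component_zero {c : CoeffFamily} {w : ℂ} (h : c.FinNear w)
    (ho : ∀ᶠ p in nb w, c.eval p.z ∈ oddPart) : ∀ᶠ v in 𝓝 w, c ∅ v = 0 := by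
  filter_upwards [eventually_ofComplex (h.body_eval.and ho)] with v hv
  rw [← body_ofComplex v, ← hv.1]
  exact body_odd hv.2

/-- A superconformal map in normal form with invertible `g⁺`, `g⁻` restricts to a homeomorphism
of a disc onto an open set, with superconformal inverse. -/
theorem SCForm.exists_chart {H : Pt → Pt} {w : ℂ} {f gp gm sp sm : CoeffFamily}
    (h : SCForm H w f gp gm sp sm) (hp : gp ∅ w ≠ 0) (hm : gm ∅ w ≠ 0) {V : Set ℂ}
    (hV : V ∈ 𝓝 w) : ∃ e : OpenPartialHomeomorph Pt Pt, ∃ r > 0,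
      e.source = Pt.body ⁻¹' Metric.ball w r ∧ Metric.ball w r ⊆ V ∧ (e : Pt → Pt) = H ∧
      ∀ p ∈ e.source, LSC H p.body ∧ LSC e.symm (e p).body := by
  have osp := body_component_zero h.sp_fin h.sp_odd
  have osm := body_component_zero h.sm_fin h.sm_odd
  have osp' := body_component_zero h.sp_fin.diff.1 (h.sp_fin.diff_mem h.sp_odd)
  have osm' := body_component_zero h.sm_fin.diff.1 (h.sm_fin.diff_mem h.sm_odd)
  obtain ⟨fin_s, es⟩ := h.f_fin.soulPart
  obtain ⟨fin_p, ep⟩ := h.gp_fin.soulPart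
  obtain ⟨fin_m, em⟩ := h.gm_fin.soulPart
  have z0 : ∀ c : CoeffFamily, ∀ᶠ v in 𝓝 w, c.soulPart ∅ v = 0 := fun c =>
    Eventually.of_forall fun v => by simp [CoeffFamily.soulPart]
  -- Everything except the body parts of `f` in `z̃` and of `θ^± g^±` in `θ̃^±` is contracting.
  obtain ⟨L, c1, c2, c3, c4, c5, c6, c7⟩ := ((fin_s.contracts (z0 f)).and
    ((fin_p.contracts (z0 gp)).and ((fin_m.contracts (z0 gm)).and
    ((h.sp_fin.contracts osp).and ((h.sm_fin.contracts osm).and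
    ((h.sp_fin.diff.1.contracts osp').and (h.sm_fin.diff.1.contracts osm'))))))).exists
  have hlsc := (h.lsc hp hm).eventually
  -- The products of odd functions have body zero.
  have hd : deriv (f ∅) w = gp ∅ w * gm ∅ w := by
    have e1 := h.diff.and (h.f_fin.diff.1.body_eval.and (h.gp_fin.body_eval.and
      (h.gm_fin.body_eval.and h.sp_odd)))
    have e0 := h.sm_odd
    obtain ⟨e1, e2, e3, e4, e5⟩ := nb_self e1 (body_ofComplex w)
    have e6 := nb_self e0 (body_ofComplex w)
    rw [body_ofComplex] at e2 e3 e4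
    have := congrArg body e1
    rw [map_add, map_mul, map_sub, map_mul, map_mul, e2, e3, e4, body_odd e5, body_odd e6,
      mul_zero, zero_mul, sub_zero, add_zero] at this
    exact this
  obtain ⟨e, r, hr, hs, hsub, he, hinv⟩ := exists_inverse (H := H) (L := L) (φ := f ∅)
    (γ := gp ∅) (δ := gm ∅) (w := w) h.samap (h.f_fin.1 ∅) (by rw [hd]; exact mul_ne_zero hp hm)
    (h.gp_fin.1 ∅) hp (h.gm_fin.1 ∅) hm (V := V ∩ {v | LSC H v})
    (by
      filter_upwards [c1, c4, c5, c6, c7, h.gp_fin.lip L, h.gm_fin.lip L, h.sp_fin.lip L,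
        h.sp_fin.diff.1.lip L, nb_iff.1 h.z, nb_iff.1 es] with v c1 c4 c5 c6 c7 l1 l2 l3 l4 hz es
      refine Contracts.congr (((c1.add (Contracts.mul_left (Lip.tp L v) (c5.mul_left l1))).add
        (Contracts.mul_left (Lip.tm L v) (c4.mul_left l2))).add
        (Contracts.mul_left ((Lip.tp L v).mul (Lip.tm L v))
          ((c5.mul_left l4).add (c7.mul_left l3)))) fun p hp => ?_
      rw [hz p hp, es p hp]
      abel)
    (by
      filter_upwards [c2, c4, c6, nb_iff.1 h.tp, nb_iff.1 ep] with v c2 c4 c6 hz es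
      refine Contracts.congr ((c4.add (Contracts.mul_left (Lip.tp L v) c2)).add
        (Contracts.mul_left ((Lip.tp L v).mul (Lip.tm L v)) c6)) fun p hp => ?_
      rw [hz p hp, es p hp, mul_add]
      abel)
    (by
      filter_upwards [c3, c5, c7, nb_iff.1 h.tm, nb_iff.1 em] with v c2 c4 c6 hz es
      refine Contracts.congr ((c4.add (Contracts.mul_left (Lip.tm L v) c2)).add
        (Contracts.mul_left (((Lip.const L v (-1)).mul (Lip.tp L v)).mul (Lip.tm L v)) c6))
        fun p hp => ?_
      rw [hz p hp, es p hp, mul_add, neg_one_mul, neg_mul, neg_mul]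
      abel)
    (inter_mem hV hlsc)
  refine ⟨e, r, hr, hs, hsub.trans Set.inter_subset_left, he, fun p hp => ?_⟩
  have hpl : LSC H p.body := by
    rw [hs] at hp
    exact (hsub hp).2
  refine ⟨hpl, ?_⟩
  have hb : bodyMap H p.body = (e p).body := by rw [bodyMap_eq hpl.sa, he]
  have h1 : ∀ᶠ q in nb p.body, e.symm (H q) = q := by
    rw [nb_eq_nhds]
    filter_upwards [e.open_source.mem_nhds hp] with q hq
    rw [← he]
    exact e.left_inv hq
  have h2 : ∀ᶠ q in nb (e p).body, H (e.symm q) = q := by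
    rw [nb_eq_nhds]
    filter_upwards [e.open_target.mem_nhds (e.map_source hp)] with q hq
    rw [← he]
    exact e.right_inv hq
  rw [← hb] at h2 ⊢
  exact lsc_inverse hpl (hb ▸ hinv p hp) h1 h2

/-- Near zero, `H` is the sum of the superconformal power series `K`, in the sense that it has the
normal form with `f(0) = 0` and with `g^±`, `ψ^±` given by their Taylor series. -/
def HasSeries (H : Pt → Pt) (K : LocalSeries) : Prop :=
  ∃ f gp gm sp sm : CoeffFamily, SCForm H 0 f gp gm sp sm ∧ (∀ k, f k 0 = 0) ∧
    IsTaylor K.ap gp ∧ IsTaylor K.am gm ∧ IsTaylor (shiftSeq K.mp) sp ∧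
    IsTaylor (shiftSeq K.mm) sm

theorem HasSeries.evalsTo {H : Pt → Pt} {K : LocalSeries} (h : HasSeries H K) :
    ∀ᶠ p in nb 0, K.EvalsTo p (H p) := by
  obtain ⟨f, gp, gm, sp, sm, h, h0, h1, h2, h3, h4⟩ := h
  exact h.evalsTo h0 h1 h2 h3 h4

theorem IsTaylor.apply_zero {x : ℕ → Gr} {c : CoeffFamily} (h : IsTaylor x c) (k : Finset ℕ) :
    c k 0 = coord k (x 0) := by rw [← h.2, tc_zero]

theorem IsTaylor.body_ne {x : ℕ → Gr} {c : CoeffFamily} (h : IsTaylor x c) (hu : IsUnit (x 0)) :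
    c ∅ 0 ≠ 0 := by
  rw [h.apply_zero, coord_empty]
  exact (hu.map body).ne_zero

theorem HasSeries.lsc {H : Pt → Pt} {K : LocalSeries} (h : HasSeries H K) : LSC H 0 := by
  obtain ⟨f, gp, gm, sp, sm, h, h0, h1, h2, h3, h4⟩ := h
  exact h.lsc (h1.body_ne K.ap_unit) (h2.body_ne K.am_unit)

theorem HasSeries.exists_chart {H : Pt → Pt} {K : LocalSeries} (h : HasSeries H K) :
    ∃ e : OpenPartialHomeomorph Pt Pt, ∃ r > 0, e.source = ball 0 r ∧ (e : Pt → Pt) = H ∧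
      ∀ p ∈ e.source, LSC H p.body ∧ LSC e.symm (e p).body := by
  obtain ⟨f, gp, gm, sp, sm, h, h0, h1, h2, h3, h4⟩ := h
  obtain ⟨e, r, hr, hs, -, he, h⟩ :=
    h.exists_chart (h1.body_ne K.ap_unit) (h2.body_ne K.am_unit) univ_mem
  refine ⟨e, r, hr, ?_, he, h⟩
  rw [hs]
  ext p
  change dist p.body 0 < r ↔ ‖p.body - (0 : Pt).body‖ < r
  rw [dist_eq_norm]
  have : (0 : Pt).body = 0 := map_zero body
  rw [this]

theorem exists_radius {Q : Pt → Prop} (h : ∀ᶠ p in nb 0, Q p) :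
    ∃ r : ℝ, 0 < r ∧ ∀ p : Pt, ‖p.body‖ < r → Q p := by
  rw [nb_iff, Metric.eventually_nhds_iff] at h
  obtain ⟨r, hr, h⟩ := h
  exact ⟨r, hr, fun p hp => h (by rwa [dist_zero_right]) p rfl⟩

theorem HasSeries.converges {H : Pt → Pt} {K : LocalSeries} (h : HasSeries H K) :
    K.Converges := by
  obtain ⟨f, gp, gm, sp, sm, h, h0, h1, h2, h3, h4⟩ := h
  obtain ⟨r, hr, H⟩ := exists_radius (h1.absHasSum.and (h2.absHasSum.and
    (h3.absHasSum_shift.and h4.absHasSum_shift)))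
  refine ⟨r, hr, fun z hz hzr => ?_⟩
  obtain ⟨a, b, c, d⟩ := H ⟨z, 0, 0, hz, Submodule.zero_mem _, Submodule.zero_mem _⟩ hzr
  exact ⟨⟨_, a⟩, ⟨_, b⟩, ⟨_, c⟩, ⟨_, d⟩⟩

theorem ofComplex_zero : Pt.ofComplex 0 = 0 := by
  ext1
  · exact map_zero _
  · rfl
  · rfl

/-- Every invertible superconformal map that vanishes at zero is a superconformal power series. -/
theorem exists_hasSeries {H : Pt → Pt} (h : LSC H 0) (h0 : H 0 = 0) : ∃ K, HasSeries H K := by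
  obtain ⟨r, hr, hb⟩ := Metric.eventually_nhds_iff_ball.1 h.eventually
  obtain ⟨f, gp, gm, sp, sm, -, -, -, -, -, hS⟩ :=
    exists_scForm (H := H) Metric.isOpen_ball ⟨0, Metric.mem_ball_self hr⟩ hb
  obtain ⟨hS, up, um⟩ := hS 0 (Metric.mem_ball_self hr)
  obtain ⟨ap, hap⟩ := hS.gp_fin.exists_isTaylor
  obtain ⟨am, ham⟩ := hS.gm_fin.exists_isTaylor
  obtain ⟨xp, hxp⟩ := hS.sp_fin.exists_isTaylor
  obtain ⟨xm, hxm⟩ := hS.sm_fin.exists_isTaylor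
  have b0 : (0 : Pt).body = 0 := map_zero body
  have hz := nb_self hS.z b0
  have hp := nb_self hS.tp b0
  have hm := nb_self hS.tm b0
  have e0 : (0 : Pt).z = algebraMap ℂ Gr 0 := (map_zero _).symm
  have e1 : (0 : Pt).tp = 0 := rfl
  have e2 : (0 : Pt).tm = 0 := rfl
  rw [h0, e1, e2, zero_mul, zero_mul, zero_mul, zero_mul, add_zero, add_zero, add_zero, e0] at hz
  rw [h0, e1, e2, zero_mul, zero_mul, zero_mul, add_zero, add_zero, e0] at hp
  rw [h0, e1, e2, zero_mul, zero_mul, zero_mul, add_zero, sub_zero, e0] at hm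
  have unit : ∀ {x : ℕ → Gr} {c : CoeffFamily}, IsTaylor x c → x 0 ∈ evenPart → c ∅ 0 ≠ 0 →
      IsUnit (x 0) := fun hx he hc => by
    rwa [isUnit_iff_body he, ← coord_empty, ← hx.apply_zero]
  have shift : ∀ {x : ℕ → Gr} {c : CoeffFamily}, IsTaylor x c → 0 = c.eval (algebraMap ℂ Gr 0) →
      shiftSeq (fun n => x (n + 1)) = x := fun {x c} hx hc => by
    funext n
    cases n with
    | zero =>
      refine (gr_ext fun k => ?_).symm
      rw [← hx.apply_zero, ← hx.1.coord_eval, ← hc]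
      rfl
    | succ n => rfl
  refine ⟨⟨ap, am, fun n => xp (n + 1), fun n => xm (n + 1), hap.mem_even hS.gp_even,
    ham.mem_even hS.gm_even, fun j => hxp.mem_odd hS.sp_odd _, fun j => hxm.mem_odd hS.sm_odd _,
    unit hap (hap.mem_even hS.gp_even 0) up, unit ham (ham.mem_even hS.gm_even 0) um⟩,
    f, gp, gm, sp, sm, hS, fun k => ?_, hap, ham, ?_, ?_⟩
  · rw [← hS.f_fin.coord_eval, ← hz]
    exact map_zero _
  · change IsTaylor (shiftSeq fun n => xp (n + 1)) sp
    rwa [shift hxp hp]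
  · change IsTaylor (shiftSeq fun n => xm (n + 1)) sm
    rwa [shift hxm hm]

theorem shiftSeq_odd {m : ℕ → Gr} (h : ∀ j, m j ∈ oddPart) (n : ℕ) : shiftSeq m n ∈ oddPart := by
  cases n with
  | zero => exact Submodule.zero_mem _
  | succ n => exact h n

/-- Every convergent superconformal power series is the series of a map. -/
theorem LocalSeries.Converges.exists_hasSeries {K : LocalSeries} (h : K.Converges) :
    ∃ H, HasSeries H K := by
  classical
  obtain ⟨r, hr, h⟩ := h
  have h' : ∀ w : ℂ, ‖w‖ < r → _ := fun w hw => h (algebraMap ℂ Gr w) (algebraMap_mem_even w)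
    (by rwa [body_algebraMap])
  obtain ⟨gp, hap⟩ := exists_isTaylor_of_summable hr fun w hw => (h' w hw).1
  obtain ⟨gm, ham⟩ := exists_isTaylor_of_summable hr fun w hw => (h' w hw).2.1
  obtain ⟨sp, hsp⟩ := exists_isTaylor_of_summable (x := shiftSeq K.mp) hr fun w hw =>
    (h' w hw).2.2.1.imp fun s hs => absHasSum_shiftSeq hs
  obtain ⟨sm, hsm⟩ := exists_isTaylor_of_summable (x := shiftSeq K.mm) hr fun w hw =>
    (h' w hw).2.2.2.imp fun s hs => absHasSum_shiftSeq hs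
  have egp := hap.eval_even K.ap_even
  have egm := ham.eval_even K.am_even
  have osp := hsp.eval_odd (shiftSeq_odd K.mp_odd)
  have osm := hsm.eval_odd (shiftSeq_odd K.mm_odd)
  have osp' := hsp.1.diff_mem osp
  have osm' := hsm.1.diff_mem osm
  obtain ⟨q, hq, eq⟩ := exists_family_of_sa (w := 0) (G := fun z => gp.eval z * gm.eval z +
      (sp.diff.eval z * sm.eval z - sp.eval z * sm.diff.eval z))
    (SA.add (SA.mul hap.1.sa ham.1.sa)
      (SA.sub (SA.mul hsp.1.diff.1.sa hsm.1.sa) (SA.mul hsp.1.sa hsm.1.diff.1.sa)))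
  have qe : ∀ᶠ p in nb 0, q.eval p.z ∈ evenPart := by
    filter_upwards [eq, egp, egm, osp, osm, osp', osm'] with p e a b c d c' d'
    rw [e]
    exact Submodule.add_mem _ (even_mul_even a b) (Submodule.sub_mem _ (odd_mul_odd c' d)
      (odd_mul_odd c d'))
  -- The primitive `f` is even because its components at odd monomials are chosen to be zero.
  obtain ⟨f, hf, f0, fpar, fd⟩ := hq.exists_primitive
  have fe : ∀ᶠ p in nb 0, f.eval p.z ∈ evenPart := by
    obtain ⟨x, hx⟩ := hf.exists_isTaylor
    refine hx.eval_even fun n => even_of_coord fun k hk => ?_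
    have hk0 : f k = 0 := fpar k (by
      filter_upwards [eventually_ofComplex qe, hq.eventually] with v hv hv'
      rw [← hv'.coord_eval]
      exact coord_of_even hv hk)
    rw [← hx.2, hk0]
    exact tc_zero_fun 0 n
  let Z : Pt → Gr := fun p => f.eval p.z + p.tp * (gp.eval p.z * sm.eval p.z) +
    p.tm * (gm.eval p.z * sp.eval p.z) +
    p.tp * p.tm * (sp.diff.eval p.z * sm.eval p.z + sp.eval p.z * sm.diff.eval p.z)
  let P : Pt → Gr := fun p => sp.eval p.z + p.tp * gp.eval p.z + p.tp * p.tm * sp.diff.eval p.z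
  let M : Pt → Gr := fun p => sm.eval p.z + p.tm * gm.eval p.z - p.tp * p.tm * sm.diff.eval p.z
  have par : ∀ᶠ p in nb 0, Z p ∈ evenPart ∧ P p ∈ oddPart ∧ M p ∈ oddPart := by
    filter_upwards [fe, egp, egm, osp, osm, osp', osm'] with p e a b c d c' d'
    have t := odd_mul_odd p.tp_odd p.tm_odd
    exact ⟨Submodule.add_mem _ (Submodule.add_mem _ (Submodule.add_mem _ e
      (odd_mul_odd p.tp_odd (even_mul_odd a d))) (odd_mul_odd p.tm_odd (even_mul_odd b c)))
      (even_mul_even t (Submodule.add_mem _ (odd_mul_odd c' d) (odd_mul_odd c d'))),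
      Submodule.add_mem _ (Submodule.add_mem _ c (odd_mul_even p.tp_odd a)) (even_mul_odd t c'),
      Submodule.sub_mem _ (Submodule.add_mem _ d (odd_mul_even p.tm_odd b)) (even_mul_odd t d')⟩
  -- The components have the right parities only near the fibre over zero; elsewhere the value is
  -- irrelevant.
  let H : Pt → Pt := fun p => if h : Z p ∈ evenPart ∧ P p ∈ oddPart ∧ M p ∈ oddPart then
    ⟨Z p, P p, M p, h.1, h.2.1, h.2.2⟩ else 0
  have hH : ∀ᶠ p in nb 0, (H p).z = Z p ∧ (H p).tp = P p ∧ (H p).tm = M p := by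
    filter_upwards [par] with p hp
    simp only [H]
    rw [dif_pos hp]
    exact ⟨rfl, rfl, rfl⟩
  refine ⟨H, f, gp, gm, sp, sm, ⟨hf, hap.1, ham.1, hsp.1, hsm.1, egp, egm, osp, osm, ?_,
    hH.mono fun p h => h.1, hH.mono fun p h => h.2.1, hH.mono fun p h => h.2.2⟩, f0, hap, ham,
    hsp, hsm⟩
  filter_upwards [eval_eq_of_eventually fd, eq] with p h1 h2
  rw [h1, h2]

theorem series_unique {x y : ℕ → Gr} {s : ℂ → Gr}
    (hx : ∀ᶠ w in 𝓝 (0 : ℂ), AbsHasSum (fun n => x n * algebraMap ℂ Gr w ^ n) (s w))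
    (hy : ∀ᶠ w in 𝓝 (0 : ℂ), AbsHasSum (fun n => y n * algebraMap ℂ Gr w ^ n) (s w)) : x = y := by
  have e : ∀ (x : ℕ → Gr) (n : ℕ) (k : Finset ℕ) (w : ℂ),
      coord k (x n * algebraMap ℂ Gr w ^ n) = coord k (x n) * w ^ n := fun x n k w => by
    rw [← map_pow, ← Algebra.commutes, ← Algebra.smul_def, map_smul, smul_eq_mul, mul_comm]
  funext n
  refine gr_ext fun k => congrFun (powerSeries_unique (a := fun n => coord k (x n))
    (b := fun n => coord k (y n)) (s := fun w => coord k (s w)) ?_ ?_) n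
  · filter_upwards [hx] with w hw
    simpa only [e] using hw k
  · filter_upwards [hy] with w hw
    simpa only [e] using hw k

theorem odd_series_unique {m a m' a' : ℕ → Gr} {s : ℂ → Gr → Gr}
    (h : ∀ᶠ w in 𝓝 (0 : ℂ), ∀ e ∈ oddPart, AbsHasSum (fun j => m j * algebraMap ℂ Gr w ^ (j + 1) +
      e * a j * algebraMap ℂ Gr w ^ j) (s w e))
    (h' : ∀ᶠ w in 𝓝 (0 : ℂ), ∀ e ∈ oddPart, AbsHasSum (fun j => m' j * algebraMap ℂ Gr w ^ (j + 1) +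
      e * a' j * algebraMap ℂ Gr w ^ j) (s w e)) : m = m' ∧ a = a' := by
  have z : (0 : Gr) ∈ oddPart := Submodule.zero_mem _
  have e1 : shiftSeq m = shiftSeq m' := by
    refine series_unique (s := fun w => s w 0) ?_ ?_
    · filter_upwards [h] with w hw
      exact absHasSum_shiftSeq (by simpa using hw 0 z)
    · filter_upwards [h'] with w hw
      exact absHasSum_shiftSeq (by simpa using hw 0 z)
  have e2 : m = m' := by
    funext n
    exact congrFun e1 (n + 1)
  refine ⟨e2, ?_⟩
  funext n
  refine cancel_odd_eq fun e he => congrFun (f := fun n => e * a n) (g := fun n => e * a' n)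
    (series_unique (s := fun w => s w e - s w 0) ?_ ?_) n
  · filter_upwards [h] with w hw
    exact ((hw e he).sub (hw 0 z)).congr fun j => by simp
  · filter_upwards [h'] with w hw
    exact ((hw e he).sub (hw 0 z)).congr fun j => by simp

/-- A superconformal power series is determined by its values near zero. -/
theorem LocalSeries.unique {K K' : LocalSeries} {H : Pt → Pt}
    (h : ∀ᶠ p in nb 0, K.EvalsTo p (H p)) (h' : ∀ᶠ p in nb 0, K'.EvalsTo p (H p)) : K = K' := by
  classical
  have z : (0 : Gr) ∈ oddPart := Submodule.zero_mem _
  -- The coefficients are recovered from the values at `(w, e, 0)` and `(w, 0, e)` with `e` odd.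
  let q : ℂ → Gr → Pt := fun w e => if he : e ∈ oddPart then
    ⟨algebraMap ℂ Gr w, e, 0, algebraMap_mem_even w, he, z⟩ else 0
  let q' : ℂ → Gr → Pt := fun w e => if he : e ∈ oddPart then
    ⟨algebraMap ℂ Gr w, 0, e, algebraMap_mem_even w, z, he⟩ else 0
  have hq : ∀ w e (he : e ∈ oddPart), q w e =
    ⟨algebraMap ℂ Gr w, e, 0, algebraMap_mem_even w, he, z⟩ := fun w e he => dif_pos he
  have hq' : ∀ w e (he : e ∈ oddPart), q' w e =
    ⟨algebraMap ℂ Gr w, 0, e, algebraMap_mem_even w, z, he⟩ := fun w e he => dif_pos he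
  have key : ∀ {K : LocalSeries}, (∀ᶠ p in nb 0, K.EvalsTo p (H p)) → ∀ᶠ w in 𝓝 (0 : ℂ),
      ∀ e ∈ oddPart, AbsHasSum (fun j => K.mp j * algebraMap ℂ Gr w ^ (j + 1) +
        e * K.ap j * algebraMap ℂ Gr w ^ j) (H (q w e)).tp := fun {K} h => by
    filter_upwards [nb_iff.1 h] with w hw e he
    have := (hw (q w e) (by rw [hq w e he]; exact body_algebraMap w)).2.1
    refine this.congr fun j => ?_
    rw [hq w e he]
    simp [LocalSeries.plusTerm]
  have key' : ∀ {K : LocalSeries}, (∀ᶠ p in nb 0, K.EvalsTo p (H p)) → ∀ᶠ w in 𝓝 (0 : ℂ),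
      ∀ e ∈ oddPart, AbsHasSum (fun j => K.mm j * algebraMap ℂ Gr w ^ (j + 1) +
        e * K.am j * algebraMap ℂ Gr w ^ j) (H (q' w e)).tm := fun {K} h => by
    filter_upwards [nb_iff.1 h] with w hw e he
    have := (hw (q' w e) (by rw [hq' w e he]; exact body_algebraMap w)).2.2
    refine this.congr fun j => ?_
    rw [hq' w e he]
    simp [LocalSeries.minusTerm]
  obtain ⟨e1, e2⟩ := odd_series_unique (key h) (key h')
  obtain ⟨e3, e4⟩ := odd_series_unique (key' h) (key' h')
  exact LocalSeries.ext e2 e4 e1 e3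

theorem LocalSeries.EvalsTo.unique {K : LocalSeries} {p y y' : Pt} (h : K.EvalsTo p y)
    (h' : K.EvalsTo p y') : y = y' :=
  Pt.ext (h.1.unique h'.1) (h.2.1.unique h'.2.1) (h.2.2.unique h'.2.2)

/-- If the values of `H` near zero are given by the convergent series `K`, then `H` has the
series `K`. -/
theorem HasSeries.of_evalsTo {K : LocalSeries} (hK : K.Converges) {H : Pt → Pt}
    (h : ∀ᶠ p in nb 0, K.EvalsTo p (H p)) : HasSeries H K := by
  obtain ⟨G, hG⟩ := hK.exists_hasSeries
  have e := hG.evalsTo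
  obtain ⟨f, gp, gm, sp, sm, hS, h0, ht⟩ := hG
  have e' : ∀ᶠ p in nb 0, H p = G p := by
    filter_upwards [h, e] with p h1 h2 using h1.unique h2
  exact ⟨f, gp, gm, sp, sm, ⟨hS.f_fin, hS.gp_fin, hS.gm_fin, hS.sp_fin, hS.sm_fin, hS.gp_even,
    hS.gm_even, hS.sp_odd, hS.sm_odd, hS.diff, by filter_upwards [e', hS.z] with p e h; rw [e, h],
    by filter_upwards [e', hS.tp] with p e h; rw [e, h],
    by filter_upwards [e', hS.tm] with p e h; rw [e, h]⟩, h0, ht⟩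

/-! ### Low order coefficients and the normalizations at infinity -/

theorem absHasSum_finset {ι : Type} {x : ι → Gr} (S : Finset ι) (h : ∀ i ∉ S, x i = 0) :
    AbsHasSum x (∑ i ∈ S, x i) := fun k => by
  rw [map_sum]
  exact hasSum_sum_of_ne_finset_zero fun i hi => by rw [h i hi, map_zero]

theorem pow_eq_zero_of_le {z : Gr} {m n : ℕ} (h : z ^ m = 0) (hmn : m ≤ n) : z ^ n = 0 := by
  rw [← Nat.sub_add_cancel hmn, pow_add, h, mul_zero]

/-- At nilpotent arguments the series breaks off. The hypotheses kill all terms of total order above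
two. -/
theorem LocalSeries.EvalsTo.z_eq {K : LocalSeries} {p y : Pt} (h : K.EvalsTo p y)
    (h3 : p.z ^ 3 = 0) (hp : p.tp * p.z ^ 2 = 0) (hm : p.tm * p.z ^ 2 = 0)
    (hpm : p.tp * p.tm * p.z = 0) :
    y.z = K.ap 0 * K.am 0 * p.z +
      ((1 : ℂ) / 2) • ((K.ap 0 * K.am 1 + K.ap 1 * K.am 0) * p.z ^ 2) +
      p.tp * K.ap 0 * K.mm 0 * p.z + p.tm * K.am 0 * K.mp 0 * p.z := by
  have c : ∀ (a b x : Gr) (n : ℕ), x * a * b * p.z ^ n = x * p.z ^ n * (a * b) := fun a b x n => by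
    rw [mul_assoc, mul_assoc, ← mul_assoc a, ← (even_commute (even_pow p.z_even n) (a * b)).eq,
      ← mul_assoc]
  have zp : ∀ x n, x * p.z ^ 2 = 0 → x * p.z ^ (n + 2) = 0 := fun x n hx => by
    rw [pow_add, (even_commute (even_pow p.z_even n) _).eq, ← mul_assoc, hx, zero_mul]
  have zq : ∀ n, p.tp * p.tm * p.z ^ (n + 1) = 0 := fun n => by
    rw [pow_succ', ← mul_assoc, hpm, zero_mul]
  have key := absHasSum_finset (x := K.evenTerm p) {(0, 0), (0, 1), (1, 0)} fun i hi => by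
    have hi2 : 2 ≤ i.1 + i.2 := by
      obtain ⟨a, b⟩ := i
      simp only [Finset.mem_insert, Finset.mem_singleton, Prod.mk.injEq, not_or] at hi
      simp only
      omega
    have e : ∀ x, x * p.z ^ 2 = 0 → x * p.z ^ (i.1 + i.2 + 1) = 0 := fun x hx => by
      have := zp x (i.1 + i.2 - 1) hx
      rwa [show i.1 + i.2 - 1 + 2 = i.1 + i.2 + 1 by omega] at this
    rw [LocalSeries.evenTerm, pow_eq_zero_of_le h3 (by omega : 3 ≤ i.1 + i.2 + 1),
      pow_eq_zero_of_le h3 (by omega : 3 ≤ i.1 + i.2 + 2)]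
    simp
  rw [h.1.unique key]
  rw [Finset.sum_insert (by simp), Finset.sum_insert (by simp), Finset.sum_singleton]
  have e5 : ∀ i, p.tp * p.tm * K.mp i * K.mm 0 * p.z = 0 := fun i => by
    have := c (K.mp i) (K.mm 0) (p.tp * p.tm) 1
    rw [pow_one, hpm, zero_mul] at this
    exact this
  have e6 : ∀ i j, p.tp * p.tm * K.mp i * K.mm j * p.z ^ 2 = 0 := fun i j => by
    rw [c, zq 1, zero_mul]
  have e3 : ∀ i j, p.tp * K.ap i * K.mm j * p.z ^ 2 = 0 := fun i j => by rw [c, hp, zero_mul]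
  have e4 : ∀ i j, p.tm * K.am i * K.mp j * p.z ^ 2 = 0 := fun i j => by rw [c, hm, zero_mul]
  simp only [LocalSeries.evenTerm, Nat.cast_zero, Nat.cast_one, zero_add, add_zero, pow_one, e3, e4,
    e5, e6, smul_zero, sub_self, zero_div, zero_smul, one_div, inv_one, one_smul, Nat.reduceAdd, h3,
    mul_zero, add_mul, smul_add, one_add_one_eq_two]
  abel

theorem LocalSeries.EvalsTo.tp_eq {K : LocalSeries} {p y : Pt} (h : K.EvalsTo p y)
    (h2 : p.z ^ 2 = 0) (hp : p.tp * p.z = 0) (hpm : p.tp * p.tm = 0) :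
    y.tp = K.mp 0 * p.z + p.tp * K.ap 0 := by
  have key := absHasSum_finset (x := K.plusTerm p) {0} fun i hi => by
    obtain ⟨i, rfl⟩ := Nat.exists_eq_succ_of_ne_zero (by simpa using hi)
    rw [LocalSeries.plusTerm, hpm, pow_eq_zero_of_le h2 (by omega : 2 ≤ i.succ + 1), mul_assoc,
      (even_commute (even_pow p.z_even i.succ) _).symm.eq, ← mul_assoc, pow_succ', ← mul_assoc, hp]
    simp
  rw [h.2.1.unique key, Finset.sum_singleton]
  simp [LocalSeries.plusTerm, hpm]

theorem LocalSeries.EvalsTo.tm_eq {K : LocalSeries} {p y : Pt} (h : K.EvalsTo p y)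
    (h2 : p.z ^ 2 = 0) (hp : p.tm * p.z = 0) (hpm : p.tp * p.tm = 0) :
    y.tm = K.mm 0 * p.z + p.tm * K.am 0 := by
  have key := absHasSum_finset (x := K.minusTerm p) {0} fun i hi => by
    obtain ⟨i, rfl⟩ := Nat.exists_eq_succ_of_ne_zero (by simpa using hi)
    rw [LocalSeries.minusTerm, hpm, pow_eq_zero_of_le h2 (by omega : 2 ≤ i.succ + 1), mul_assoc,
      (even_commute (even_pow p.z_even i.succ) _).symm.eq, ← mul_assoc, pow_succ', ← mul_assoc, hp]
    simp
  rw [h.2.2.unique key, Finset.sum_singleton]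
  simp [LocalSeries.minusTerm, hpm]

theorem odd_mul_pow_two {x y : Gr} (hx : x ∈ oddPart) (hy : y ∈ oddPart) : (x * y) ^ 2 = 0 := by
  rw [pow_two, odd_mul_sq hx hy]

/-- Coefficients of first order can be read off at the even elements with square zero. -/
theorem cancel_linear {a b : Gr} (h : ∀ n ∈ evenPart, n ^ 2 = 0 → a * n = b * n) : a = b := by
  rw [← sub_eq_zero]
  refine cancel_odd_odd fun e he e' he' => ?_
  have hn := odd_mul_odd he he'
  rw [(even_commute hn _).eq, sub_mul, h _ hn (odd_mul_pow_two he he'), sub_self]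

/-- Coefficients of second order can be read off at the even elements with cube zero. -/
theorem cancel_quadratic {a b : Gr} (h : ∀ n ∈ evenPart, n ^ 3 = 0 → a * n ^ 2 = b * n ^ 2) :
    a = b := by
  rw [← sub_eq_zero]
  -- Test with `n = ee' + dd'`, for which `n² = 2 dd'ee'` and `n³ = 0`.
  refine cancel_odd_odd fun e he e' he' => cancel_odd_odd fun d hd d' hd' => ?_
  have hn := odd_mul_odd he he'
  have hm := odd_mul_odd hd hd'
  have hn2 := odd_mul_sq he he'
  have hm2 := odd_mul_sq hd hd'
  have hc : d * d' * (e * e') = e * e' * (d * d') := (even_commute hm _).eq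
  have h2 : (e * e' + d * d') ^ 2 = (2 : ℂ) • (d * d' * (e * e')) := by
    rw [pow_two, add_mul, mul_add, mul_add, hn2, hm2, hc, two_smul]
    abel
  have h3 : (e * e' + d * d') ^ 3 = 0 := by
    have a1 : d * d' * (e * e') * (e * e') = 0 := by rw [mul_assoc, hn2, mul_zero]
    have a2 : d * d' * (e * e') * (d * d') = 0 := by rw [hc, mul_assoc, hm2, mul_zero]
    rw [pow_succ, h2, smul_mul_assoc, mul_add, a1, a2, add_zero, smul_zero]
  have := h _ (Submodule.add_mem _ hn hm) h3
  rw [h2, mul_smul_comm, mul_smul_comm] at this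
  rw [← mul_assoc (d * d'), (even_commute (even_mul_even hm hn) _).eq, sub_mul,
    smul_two_cancel this, sub_self]

/-- The point `(n, 0, 0)`. -/
def evenPt (n : Gr) (hn : n ∈ evenPart) : Pt :=
  ⟨n, 0, 0, hn, Submodule.zero_mem _, Submodule.zero_mem _⟩

theorem body_of_pow {n : Gr} {k : ℕ} (h : n ^ k = 0) : body n = 0 := by
  have := congrArg body h
  rw [map_pow, map_zero] at this
  exact IsReduced.eq_zero _ ⟨k, this⟩

theorem IsTaylor.eval_of_cube {x : ℕ → Gr} {c : CoeffFamily} (h : IsTaylor x c) {n : Gr}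
    (hn : n ∈ evenPart) (h3 : n ^ 3 = 0) : c.eval n = x 0 + x 1 * n + x 2 * n ^ 2 := by
  have h1 := nb_self h.absHasSum (p := evenPt n hn) (body_of_pow h3)
  have h2 := absHasSum_finset (x := fun j => x j * n ^ j) {0, 1, 2} fun i hi => by
    simp only [Finset.mem_insert, Finset.mem_singleton, not_or] at hi
    rw [pow_eq_zero_of_le h3 (by omega), mul_zero]
  rw [show c.eval n = _ from h1.unique h2, Finset.sum_insert (by simp), Finset.sum_insert (by simp),
    Finset.sum_singleton, pow_zero, mul_one, pow_one, add_assoc]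

theorem HasSeries.apply {H : Pt → Pt} {K : LocalSeries} (h : HasSeries H K) {p : Pt}
    (hp : p.body = 0) : K.EvalsTo p (H p) := nb_self h.evalsTo hp

theorem HasSeries.map_zero {H : Pt → Pt} {K : LocalSeries} (h : HasSeries H K) : H 0 = 0 := by
  have := h.apply (p := 0) (_root_.map_zero body)
  have z : (0 : Pt).z = 0 := rfl
  have p : (0 : Pt).tp = 0 := rfl
  have m : (0 : Pt).tm = 0 := rfl
  ext1
  · rw [this.z_eq (by rw [z]; simp) (by rw [z]; simp) (by rw [z]; simp) (by rw [z]; simp), z]; simp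
  · rw [this.tp_eq (by rw [z]; simp) (by rw [z]; simp) (by rw [p]; simp), z, p]; simp
  · rw [this.tm_eq (by rw [z]; simp) (by rw [z]; simp) (by rw [p]; simp), z, m]; simp

/-- The second order Taylor expansion of the function `f` of a superconformal power series. -/
theorem HasSeries.taylor {K : LocalSeries} {H : Pt → Pt} (hs : HasSeries H K) {f gp gm sp sm}
    (h : SCForm H 0 f gp gm sp sm) {X : ℕ → Gr} (hX : IsTaylor X f) (h0 : ∀ k, f k 0 = 0) :
    X 0 = 0 ∧ X 1 = K.ap 0 * K.am 0 ∧
      X 2 = ((1 : ℂ) / 2) • (K.ap 0 * K.am 1 + K.ap 1 * K.am 0) := by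
  have x0 : X 0 = 0 := gr_ext fun k => by rw [← hX.apply_zero, h0, _root_.map_zero]
  have key : ∀ n ∈ evenPart, n ^ 3 = 0 → X 1 * n + X 2 * n ^ 2 = K.ap 0 * K.am 0 * n +
      (((1 : ℂ) / 2) • (K.ap 0 * K.am 1 + K.ap 1 * K.am 0)) * n ^ 2 := fun n hn h3 => by
    have hb : (evenPt n hn).body = 0 := body_of_pow h3
    have e1 := nb_self h.z hb
    have e2 := (hs.apply hb).z_eq h3 (zero_mul _) (zero_mul _)
      (by change (0 : Gr) * 0 * n = 0; simp)
    change _ = f.eval n + 0 * _ + 0 * _ + 0 * 0 * _ at e1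
    change _ = K.ap 0 * K.am 0 * n + ((1 : ℂ) / 2) • ((K.ap 0 * K.am 1 + K.ap 1 * K.am 0) * n ^ 2) +
      0 * K.ap 0 * K.mm 0 * n + 0 * K.am 0 * K.mp 0 * n at e2
    rw [e2, hX.eval_of_cube hn h3, x0] at e1
    simp only [zero_mul, add_zero, zero_add] at e1
    rw [← e1, smul_mul_assoc]
  have x1 : X 1 = K.ap 0 * K.am 0 := cancel_linear fun n hn h2 => by
    have := key n hn (pow_eq_zero_of_le h2 (by norm_num))
    rwa [h2, mul_zero, mul_zero, add_zero, add_zero] at this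
  refine ⟨x0, x1, cancel_quadratic fun n hn h3 => ?_⟩
  have := key n hn h3
  rw [x1] at this
  exact add_left_cancel this

theorem analyticAt_dslope {φ : ℂ → ℂ} (h : AnalyticAt ℂ φ 0) : AnalyticAt ℂ (dslope φ 0) 0 := by
  obtain ⟨p, hp⟩ := h
  exact ⟨_, hp.has_fpower_series_dslope_fslope⟩

theorem tc_dslope {φ : ℂ → ℂ} (h : AnalyticAt ℂ φ 0) (n : ℕ) :
    tc (dslope φ 0) 0 n = tc φ 0 (n + 1) := by
  obtain ⟨r, hr, hd⟩ := AnalyticAt.exists_ball h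
  refine congrFun (tc_eq_of_hasSum (a := fun n => tc φ 0 (n + 1)) (analyticAt_dslope h) ?_) n
  filter_upwards [Metric.ball_mem_nhds (0 : ℂ) hr] with v hv
  by_cases hv0 : v = 0
  · subst hv0
    rw [dslope_same]
    have e : deriv φ 0 = tc φ 0 (0 + 1) := by simp [tc]
    rw [e]
    convert hasSum_ite_eq (0 : ℕ) (tc φ 0 (0 + 1)) using 2 with n
    split_ifs with hn
    · rw [hn]; simp
    · simp [hn]
  · rw [dslope_of_ne _ hv0, slope_def_field, sub_zero]
    have := ((hasSum_nat_add_iff' 1).2 (hasSum_tc hd hv)).div_const v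
    simp only [Finset.range_one, Finset.sum_singleton, pow_zero, mul_one, tc_zero] at this
    refine this.congr_fun fun m => ?_
    simp only [pow_succ]
    field_simp

theorem tendsto_first {φ : ℂ → ℂ} (h : AnalyticAt ℂ φ 0) (h0 : φ 0 = 0) :
    Tendsto (fun v => v⁻¹ * φ v) (𝓝[≠] 0) (𝓝 (tc φ 0 1)) := by
  have h1 := (analyticAt_dslope h).continuousAt.tendsto
  rw [← tc_zero (dslope φ 0), tc_dslope h] at h1
  refine (h1.mono_left nhdsWithin_le_nhds).congr' ?_
  filter_upwards [self_mem_nhdsWithin] with v hv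
  rw [dslope_of_ne _ hv, slope_def_field, h0, sub_zero, sub_zero, div_eq_inv_mul]

theorem tendsto_second {φ : ℂ → ℂ} (h : AnalyticAt ℂ φ 0) (h0 : φ 0 = 0) :
    Tendsto (fun v => v⁻¹ ^ 2 * (φ v - tc φ 0 1 * v)) (𝓝[≠] 0) (𝓝 (tc φ 0 2)) := by
  have a := analyticAt_dslope h
  have h1 := (analyticAt_dslope a).continuousAt.tendsto
  rw [← tc_zero (dslope _ 0), tc_dslope a, tc_dslope h] at h1
  refine (h1.mono_left nhdsWithin_le_nhds).congr' ?_
  filter_upwards [self_mem_nhdsWithin] with v hv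
  have hv' : v ≠ 0 := hv
  rw [dslope_of_ne _ hv, slope_def_field, ← tc_zero (dslope φ 0) 0, tc_dslope h,
    dslope_of_ne _ hv, slope_def_field, h0, sub_zero, sub_zero]
  field_simp

theorem coordTendsto_inv {G : ℂ → Gr} {a : Gr} :
    CoordTendsto (fun w => G w⁻¹) (cocompact ℂ) a ↔ CoordTendsto G (𝓝[≠] 0) a := by
  rw [← Metric.cobounded_eq_cocompact]
  have e : Tendsto Inv.inv (Bornology.cobounded ℂ) (𝓝[≠] 0) := Filter.inv_cobounded₀.le
  refine ⟨fun h k => ?_, fun h k => (h k).comp e⟩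
  exact ((h k).comp Filter.tendsto_inv₀_nhdsNE_zero).congr fun v => by
    simp only [Function.comp_apply, inv_inv]

theorem CoordTendsto.unique {α : Type} {x : α → Gr} {l : Filter α} [l.NeBot] {a b : Gr}
    (h : CoordTendsto x l a) (h' : CoordTendsto x l b) : a = b :=
  gr_ext fun k => tendsto_nhds_unique (h k) (h' k)

theorem CoordTendsto.congr {α : Type} {x y : α → Gr} {l : Filter α} {a : Gr}
    (h : CoordTendsto x l a) (e : ∀ᶠ i in l, y i = x i) : CoordTendsto y l a :=
  fun k => (h k).congr' (e.mono fun i hi => by simp only [hi])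

theorem CoordTendsto.iff_eq {α : Type} {x : α → Gr} {l : Filter α} [l.NeBot] {a b : Gr}
    (h : CoordTendsto x l a) : CoordTendsto x l b ↔ a = b :=
  ⟨h.unique, fun e => e ▸ h⟩

theorem IsTaylor.coordTendsto {x : ℕ → Gr} {c : CoeffFamily} (h : IsTaylor x c) :
    CoordTendsto (fun v => c.eval (algebraMap ℂ Gr v)) (𝓝 0) (x 0) := fun k => by
  rw [← h.apply_zero]
  refine (h.1.1 k).continuousAt.tendsto.congr' ?_
  filter_upwards [h.1.eventually] with v hv
  exact (hv.coord_eval k).symm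

theorem IsTaylor.coordTendsto_first {x : ℕ → Gr} {c : CoeffFamily} (h : IsTaylor x c)
    (h0 : x 0 = 0) :
    CoordTendsto (fun v => v⁻¹ • c.eval (algebraMap ℂ Gr v)) (𝓝[≠] 0) (x 1) := fun k => by
  rw [← h.2]
  refine (tendsto_first (h.1.1 k) (by rw [h.apply_zero, h0, map_zero])).congr' ?_
  filter_upwards [h.1.eventually.filter_mono nhdsWithin_le_nhds] with v hv
  rw [map_smul, hv.coord_eval k, smul_eq_mul]

theorem IsTaylor.coordTendsto_second {x : ℕ → Gr} {c : CoeffFamily} (h : IsTaylor x c)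
    (h0 : x 0 = 0) :
    CoordTendsto (fun v => v⁻¹ ^ 2 • (c.eval (algebraMap ℂ Gr v) - v • x 1)) (𝓝[≠] 0) (x 2) :=
  fun k => by
  rw [← h.2]
  refine (tendsto_second (h.1.1 k) (by rw [h.apply_zero, h0, map_zero])).congr' ?_
  filter_upwards [h.1.eventually.filter_mono nhdsWithin_le_nhds] with v hv
  rw [map_smul, map_sub, hv.coord_eval k, map_smul, smul_eq_mul, smul_eq_mul, h.2, mul_comm v]

theorem ring_inverse_algebraMap {w : ℂ} (hw : w ≠ 0) :
    Ring.inverse (algebraMap ℂ Gr w) = algebraMap ℂ Gr w⁻¹ :=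
  inverse_eq_of_mul (algebraMap_mem_even w) (by rw [← map_mul, mul_inv_cancel₀ hw, map_one])

theorem invI_ofComplex {w : ℂ} (hw : w ≠ 0) : invI (Pt.ofComplex w) = Pt.ofComplex w⁻¹ := by
  ext1
  · exact ring_inverse_algebraMap hw
  · change Complex.I • ((0 : Gr) * _) = 0; simp
  · change Complex.I • ((0 : Gr) * _) = 0; simp

theorem eventually_cocompact_inv {Q : ℂ → Prop} (h : ∀ᶠ v in 𝓝 0, Q v) :
    ∀ᶠ w in cocompact ℂ, w ≠ 0 ∧ Q w⁻¹ := by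
  rw [← Metric.cobounded_eq_cocompact]
  have e : Tendsto Inv.inv (Bornology.cobounded ℂ) (𝓝 0) := Filter.tendsto_inv₀_cobounded
  refine (Bornology.eventually_ne_cobounded 0).and (e.eventually h)

instance : (cocompact ℂ).NeBot := by
  rw [← Metric.cobounded_eq_cocompact]; infer_instance

theorem SCForm.ofComplex {H : Pt → Pt} {f gp gm sp sm} (h : SCForm H 0 f gp gm sp sm) :
    ∀ᶠ v in 𝓝 (0 : ℂ), (H (Pt.ofComplex v)).z = f.eval (algebraMap ℂ Gr v) ∧
      (H (Pt.ofComplex v)).tp = sp.eval (algebraMap ℂ Gr v) ∧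
      (H (Pt.ofComplex v)).tm = sm.eval (algebraMap ℂ Gr v) := by
  filter_upwards [eventually_ofComplex (h.z.and (h.tp.and h.tm))] with v ⟨a, b, c⟩
  have z : (Pt.ofComplex v).z = algebraMap ℂ Gr v := rfl
  have p : (Pt.ofComplex v).tp = 0 := rfl
  have m : (Pt.ofComplex v).tm = 0 := rfl
  rw [z, p, m] at a b c
  rw [a, b, c]
  simp

theorem SCForm.ofComplex_inv {H G : Pt → Pt} {f gp gm sp sm}
    (h : SCForm G 0 f gp gm sp sm) (e : ∀ p : Pt, p.body ≠ 0 → H p = G (invI p)) :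
    ∀ᶠ w in cocompact ℂ, (H (Pt.ofComplex w)).z = f.eval (algebraMap ℂ Gr w⁻¹) ∧
    (H (Pt.ofComplex w)).tp = sp.eval (algebraMap ℂ Gr w⁻¹) ∧
    (H (Pt.ofComplex w)).tm = sm.eval (algebraMap ℂ Gr w⁻¹) := by
  filter_upwards [eventually_cocompact_inv h.ofComplex] with w ⟨hw, hv⟩
  rw [e _ (by rwa [body_ofComplex]), invI_ofComplex hw]
  exact hv

theorem invI_of_complex_z {p : Pt} {w : ℂ} (hw : w ≠ 0) (hp : p.z = algebraMap ℂ Gr w) :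
    (invI p).z = algebraMap ℂ Gr w⁻¹ ∧ (invI p).tp = (Complex.I * w⁻¹) • p.tp ∧
      (invI p).tm = (Complex.I * w⁻¹) • p.tm := by
  refine ⟨?_, ?_, ?_⟩
  · change Ring.inverse p.z = _
    rw [hp, ring_inverse_algebraMap hw]
  · change Complex.I • (p.tp * Ring.inverse p.z) = _
    rw [hp, ring_inverse_algebraMap hw, ← Algebra.commutes, ← Algebra.smul_def, smul_smul]
  · change Complex.I • (p.tm * Ring.inverse p.z) = _
    rw [hp, ring_inverse_algebraMap hw, ← Algebra.commutes, ← Algebra.smul_def, smul_smul]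

/-- The expression near infinity of a map that has the normal form in the coordinate there, at
points where one odd variable vanishes. -/
theorem SCForm.at_infinity {H G : Pt → Pt} {f gp gm sp sm}
    (h : SCForm G 0 f gp gm sp sm) (e : ∀ p : Pt, p.body ≠ 0 → H p = G (invI p)) :
    ∀ᶠ w in cocompact ℂ, ∀ p : Pt, p.z = algebraMap ℂ Gr w →
    (p.tm = 0 → p.z * (H p).tp =
      w • sp.eval (algebraMap ℂ Gr w⁻¹) + p.tp * (Complex.I • gp.eval (algebraMap ℂ Gr w⁻¹))) ∧
    (p.tp = 0 → p.z * (H p).tm =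
      w • sm.eval (algebraMap ℂ Gr w⁻¹) + p.tm * (Complex.I • gm.eval (algebraMap ℂ Gr w⁻¹))) := by
  filter_upwards [eventually_cocompact_inv (nb_iff.1 (h.tp.and h.tm))] with w ⟨hw, hv⟩ p hp
  have hb : p.body = w := by rw [Pt.body, hp, body_algebraMap]
  obtain ⟨hz, htp, htm⟩ := invI_of_complex_z hw hp
  obtain ⟨e1, e2⟩ := hv (invI p) (by rw [Pt.body, hz, body_algebraMap])
  have hwi : w * (Complex.I * w⁻¹) = Complex.I := by field_simp
  rw [e p (hb ▸ hw), hp, ← Algebra.smul_def, ← Algebra.smul_def, e1, e2, hz, htp, htm]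
  refine ⟨fun h => ?_, fun h => ?_⟩
  · rw [h, smul_zero, mul_zero, zero_mul, add_zero, smul_add, smul_mul_assoc, smul_smul, hwi,
      mul_smul_comm]
  · rw [h, smul_zero, zero_mul, zero_mul, sub_zero, smul_add, smul_mul_assoc, smul_smul, hwi,
      mul_smul_comm]

theorem SCForm.thetaPlusDeriv {H G : Pt → Pt} {f gp gm sp sm}
    (h : SCForm G 0 f gp gm sp sm) (e : ∀ p : Pt, p.body ≠ 0 → H p = G (invI p)) :
    ∀ᶠ w in cocompact ℂ, ∀ d, IsThetaPlusDeriv (fun p => p.z * (H p).tp)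
    (Pt.ofComplex w) d ↔ d = Complex.I • gp.eval (algebraMap ℂ Gr w⁻¹) := by
  have key := h.at_infinity e
  filter_upwards [key] with w hw d
  have e0 := (hw (Pt.ofComplex w) rfl).1 rfl
  have t0 : (Pt.ofComplex w).tp = 0 := rfl
  rw [t0, zero_mul, add_zero] at e0
  constructor
  · refine fun h => cancel_odd_eq fun x hx => ?_
    have h1 := h ⟨algebraMap ℂ Gr w, x, 0, algebraMap_mem_even w, hx, Submodule.zero_mem _⟩ rfl rfl
    have h2 := (hw ⟨algebraMap ℂ Gr w, x, 0, algebraMap_mem_even w, hx, Submodule.zero_mem _⟩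
      rfl).1 rfl
    simp only [e0, h2, t0, sub_zero, add_sub_cancel_left] at h1
    exact h1
  · rintro rfl p hz hm
    simp only [e0, (hw p hz).1 hm, t0, sub_zero, add_sub_cancel_left]

theorem SCForm.thetaMinusDeriv {H G : Pt → Pt} {f gp gm sp sm}
    (h : SCForm G 0 f gp gm sp sm) (e : ∀ p : Pt, p.body ≠ 0 → H p = G (invI p)) :
    ∀ᶠ w in cocompact ℂ, ∀ d, IsThetaMinusDeriv (fun p => p.z * (H p).tm)
    (Pt.ofComplex w) d ↔ d = Complex.I • gm.eval (algebraMap ℂ Gr w⁻¹) := by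
  have key := h.at_infinity e
  filter_upwards [key] with w hw d
  have e0 := (hw (Pt.ofComplex w) rfl).2 rfl
  have t0 : (Pt.ofComplex w).tm = 0 := rfl
  rw [t0, zero_mul, add_zero] at e0
  constructor
  · refine fun h => cancel_odd_eq fun x hx => ?_
    have h1 := h ⟨algebraMap ℂ Gr w, 0, x, algebraMap_mem_even w, Submodule.zero_mem _, hx⟩ rfl rfl
    have h2 := (hw ⟨algebraMap ℂ Gr w, 0, x, algebraMap_mem_even w, Submodule.zero_mem _, hx⟩
      rfl).2 rfl
    simp only [e0, h2, t0, sub_zero, add_sub_cancel_left] at h1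
    exact h1
  · rintro rfl p hz hm
    simp only [e0, (hw p hz).2 hm, t0, sub_zero, add_sub_cancel_left]

theorem IsTaylor.coordTendsto_inv {x : ℕ → Gr} {c : CoeffFamily} (h : IsTaylor x c) :
    CoordTendsto (fun w => c.eval (algebraMap ℂ Gr w⁻¹)) (cocompact ℂ) (x 0) :=
  NTwo.coordTendsto_inv (G := fun v => c.eval (algebraMap ℂ Gr v)).2 fun k =>
    (h.coordTendsto k).mono_left nhdsWithin_le_nhds

theorem CoordTendsto.I_smul {α : Type} {x : α → Gr} {l : Filter α} {a : Gr}
    (h : CoordTendsto x l a) : CoordTendsto (fun i => Complex.I • x i) l (Complex.I • a) :=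
  fun k => by
    simp only [map_smul]
    exact (h k).const_smul _

theorem I_smul_eq_iff {a : Gr} : Complex.I • a = algebraMap ℂ Gr Complex.I ↔ a = 1 := by
  rw [Algebra.algebraMap_eq_smul_one]
  exact (smul_right_injective Gr Complex.I_ne_zero).eq_iff

/-- In terms of the series in the coordinate at infinity, the normalization at infinity says that
`a_0^± = 1`. -/
theorem normalizedAtInfinity_iff {H G : Pt → Pt} {K : LocalSeries} (hG : HasSeries G K)
    (e : ∀ p : Pt, p.body ≠ 0 → H p = G (invI p)) :
    NormalizedAtInfinity H ↔ K.ap 0 = 1 ∧ K.am 0 = 1 := by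
  obtain ⟨f, gp, gm, sp, sm, h, h0, h1, h2, h3, h4⟩ := id hG
  obtain ⟨X, hX⟩ := h.f_fin.exists_isTaylor
  obtain ⟨X0, -, -⟩ := hG.taylor h hX h0
  have val := h.ofComplex_inv e
  have dp := h.thetaPlusDeriv e
  have dm := h.thetaMinusDeriv e
  have l0 := (X0 ▸ hX.coordTendsto_inv).congr (val.mono fun w hw => hw.1)
  have lp := h3.coordTendsto_inv.congr (val.mono fun w hw => hw.2.1)
  have lm := h4.coordTendsto_inv.congr (val.mono fun w hw => hw.2.2)
  have k1 := h1.coordTendsto_inv.I_smul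
  have k2 := h2.coordTendsto_inv.I_smul
  rw [← I_smul_eq_iff, ← I_smul_eq_iff (a := K.am 0)]
  constructor
  · rintro ⟨-, -, -, d, d', hd, hd', ld, ld'⟩
    constructor
    · refine k1.unique (ld.congr ?_)
      filter_upwards [hd, dp] with w a b using ((b _).1 a).symm
    · refine k2.unique (ld'.congr ?_)
      filter_upwards [hd', dm] with w a b using ((b _).1 a).symm
  · rintro ⟨a, b⟩
    rw [a] at k1
    rw [b] at k2
    exact ⟨l0, lp, lm, fun w => Complex.I • gp.eval (algebraMap ℂ Gr w⁻¹),
      fun w => Complex.I • gm.eval (algebraMap ℂ Gr w⁻¹),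
      dp.mono fun w hw => (hw _).2 rfl, dm.mono fun w hw => (hw _).2 rfl, k1, k2⟩

/-- In terms of the series in the coordinate at infinity, the further normalization for one tube
says that `a_1⁺ = -a_1⁻` and `m_{1/2}^± = 0`. -/
theorem oneTubeNormalized_iff {H G : Pt → Pt} {K : LocalSeries} (hG : HasSeries G K)
    (e : ∀ p : Pt, p.body ≠ 0 → H p = G (invI p)) (hp : K.ap 0 = 1) (hm : K.am 0 = 1) :
    OneTubeNormalized H ↔ K.ap 1 = -K.am 1 ∧ K.mp 0 = 0 ∧ K.mm 0 = 0 := by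
  obtain ⟨f, gp, gm, sp, sm, h, h0, h1, h2, h3, h4⟩ := id hG
  obtain ⟨X, hX⟩ := h.f_fin.exists_isTaylor
  obtain ⟨X0, X1, X2⟩ := hG.taylor h hX h0
  rw [hp, hm, one_mul, mul_one] at X2
  rw [hp, hm, one_mul] at X1
  have val := h.ofComplex_inv e
  have l1 := (coordTendsto_inv.2 (hX.coordTendsto_second X0)).congr
    (y := fun w => w ^ 2 • ((H (Pt.ofComplex w)).z - algebraMap ℂ Gr w⁻¹)) (by
      filter_upwards [val] with w hw
      rw [hw.1, X1, inv_inv, Algebra.algebraMap_eq_smul_one w⁻¹])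
  have l2 := (coordTendsto_inv.2 (h3.coordTendsto_first rfl)).congr
    (y := fun w => w • (H (Pt.ofComplex w)).tp) (by
      filter_upwards [val] with w hw
      rw [hw.2.1, inv_inv])
  have l3 := (coordTendsto_inv.2 (h4.coordTendsto_first rfl)).congr
    (y := fun w => w • (H (Pt.ofComplex w)).tm) (by
      filter_upwards [val] with w hw
      rw [hw.2.2, inv_inv])
  rw [OneTubeNormalized, l1.iff_eq, l2.iff_eq, l3.iff_eq, X2]
  have half : ((1 : ℂ) / 2) • (K.am 1 + K.ap 1) = 0 ↔ K.ap 1 = -K.am 1 := by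
    rw [smul_eq_zero, or_iff_right (by norm_num), add_comm, add_eq_zero_iff_eq_neg]
  rw [half]
  rfl

theorem shift_addComplex (x : Pt) (t : ℂ) : shift x (x.addComplex t) = Pt.ofComplex t := by
  have h := odd_anticomm x.tp_odd x.tm_odd
  ext1
  · change x.z + algebraMap ℂ Gr t - x.z - x.tp * x.tm - x.tm * x.tp = algebraMap ℂ Gr t
    rw [h]; abel
  · exact sub_self _
  · exact sub_self _

/-- A local coordinate with a superconformal power series vanishes with invertible limit. -/
theorem vanishesWithInvertibleLimit {H G : Pt → Pt} {K : LocalSeries} {x : Pt}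
    (hG : HasSeries G K) (e : ∀ p, H p = G (shift x p)) : VanishesWithInvertibleLimit H x := by
  obtain ⟨f, gp, gm, sp, sm, h, h0, h1, h2, h3, h4⟩ := id hG
  obtain ⟨X, hX⟩ := h.f_fin.exists_isTaylor
  obtain ⟨X0, X1, -⟩ := hG.taylor h hX h0
  refine ⟨by rw [e, shift_self, hG.map_zero], ⟨K.ap 0 * K.am 0, K.mp 0, K.mm 0,
    even_mul_even (K.ap_even 0) (K.am_even 0), K.mp_odd 0, K.mm_odd 0⟩,
    K.ap_unit.mul K.am_unit, ?_, ?_, ?_⟩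
  · refine CoordTendsto.congr (X1 ▸ hX.coordTendsto_first X0) ?_
    filter_upwards [h.ofComplex.filter_mono nhdsWithin_le_nhds] with v hv
    rw [e, shift_addComplex, hv.1]
  · refine (h3.coordTendsto_first rfl).congr ?_
    filter_upwards [h.ofComplex.filter_mono nhdsWithin_le_nhds] with v hv
    rw [e, shift_addComplex, hv.2.1]
  · refine (h4.coordTendsto_first rfl).congr ?_
    filter_upwards [h.ofComplex.filter_mono nhdsWithin_le_nhds] with v hv
    rw [e, shift_addComplex, hv.2.2]

/-! ### Extension over a point, and local coordinates at the punctures -/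

theorem SAMap.eq_of_punctured {H H' : Pt → Pt} {w : ℂ} (h : SAMap H w) (h' : SAMap H' w)
    (e : ∀ᶠ v in 𝓝[≠] w, ∀ p : Pt, p.body = v → H p = H' p) : ∀ᶠ p in nb w, H p = H' p := by
  have a := SA.eq_zero_of_punctured (SA.sub h.z h'.z)
    (e.mono fun v hv p hp => by simp only [hv p hp, sub_self])
  have b := SA.eq_zero_of_punctured (SA.sub h.tp h'.tp)
    (e.mono fun v hv p hp => by simp only [hv p hp, sub_self])
  have c := SA.eq_zero_of_punctured (SA.sub h.tm h'.tm)
    (e.mono fun v hv p hp => by simp only [hv p hp, sub_self])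
  filter_upwards [a, b, c] with p a b c
  exact Pt.ext (sub_eq_zero.1 a) (sub_eq_zero.1 b) (sub_eq_zero.1 c)

theorem SuperFn.FinNear.dPlus {F : SuperFn} {w : ℂ} (h : F.FinNear w) : F.dPlus.FinNear w := by
  refine ⟨h.xp, CoeffFamily.FinNear.zero w, (h.t.add h.f.diff.1).1, ?_⟩
  have := (h.xp.diff.1.smul (-1)).1
  rwa [neg_one_smul] at this

theorem SuperFn.FinNear.dMinus {F : SuperFn} {w : ℂ} (h : F.FinNear w) : F.dMinus.FinNear w :=
  ⟨h.xm, (h.f.diff.1.sub h.t).1, CoeffFamily.FinNear.zero w, h.xm.diff.1⟩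

/-- A map that is superanalytic near `w`, and superconformal away from `w`, is superconformal. -/
theorem PreLSC.of_punctured {H : Pt → Pt} {w : ℂ} (h : SAMap H w)
    (e : ∀ᶠ v in 𝓝[≠] w, LSC H v) : PreLSC H w := by
  obtain ⟨Z, hZ, eZ⟩ := SA.exists_superFn h.z
  obtain ⟨P, hP, eP⟩ := SA.exists_superFn h.tp
  obtain ⟨M, hM, eM⟩ := SA.exists_superFn h.tm
  have e0 : ∀ᶠ p in nb w, (H p).z = Z.eval p ∧ (H p).tp = P.eval p ∧ (H p).tm = M.eval p := by
    filter_upwards [eZ, eP, eM] with p a b c using ⟨a, b, c⟩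
  have key : ∀ᶠ v in 𝓝[≠] w, ∀ p : Pt, p.body = v →
      (M.dPlus.eval p = 0 ∧ Z.dPlus.eval p - M.eval p * P.dPlus.eval p = 0) ∧
      (P.dMinus.eval p = 0 ∧ Z.dMinus.eval p - P.eval p * M.dMinus.eval p = 0) := by
    filter_upwards [e, hZ.eventually.filter_mono nhdsWithin_le_nhds,
      hP.eventually.filter_mono nhdsWithin_le_nhds, hM.eventually.filter_mono nhdsWithin_le_nhds,
      (nb_iff.1 e0).filter_mono nhdsWithin_le_nhds] with v a hZ hP hM e0
    rintro p rfl
    obtain ⟨g, hg, -⟩ := nb_self a.dp rfl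
    obtain ⟨g', hg', -⟩ := nb_self a.dm rfl
    exact ⟨(hg.superFn hZ hP hM e0).2, (hg'.superFn hZ hP hM e0).2⟩
  -- The superconformality equations are superanalytic, hence extend over the puncture.
  obtain ⟨a, b, c⟩ := preLSC_of_superFn hZ hP hM e0
    (SA.eq_zero_of_punctured hM.dPlus.sa (key.mono fun v hv p hp => (hv p hp).1.1))
    (SA.eq_zero_of_punctured hP.dMinus.sa (key.mono fun v hv p hp => (hv p hp).2.1))
    (SA.eq_zero_of_punctured (SA.sub hZ.dPlus.sa (SA.mul hM.sa hP.dPlus.sa))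
      (key.mono fun v hv p hp => (hv p hp).1.2))
    (SA.eq_zero_of_punctured (SA.sub hZ.dMinus.sa (SA.mul hP.sa hM.dMinus.sa))
      (key.mono fun v hv p hp => (hv p hp).2.2))
  exact ⟨a, b.mono fun p h => ⟨_, h⟩, c.mono fun p h => ⟨_, h⟩⟩

theorem flip_invI (p : Pt) : flip (invI p) = recip (-Complex.I) p := by
  ext1
  · rfl
  · simp [flip, invI, recip]
  · simp [flip, invI, recip]

theorem body_invI (p : Pt) : (invI p).body = p.body⁻¹ := body_recip _ p

theorem invI_flip_invI {p : Pt} (hp : p.body ≠ 0) : invI (flip (invI p)) = p := by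
  rw [flip_invI]; exact recip_recip (by simp) hp

theorem northInv_of_ne {q : Pt} (hq : q.body ≠ 0) : northInv q = Sphere.fin (invI q) :=
  dif_neg hq

theorem northInv_flip_invI {p : Pt} (hp : p.body ≠ 0) :
    northInv (flip (invI p)) = Sphere.fin p := by
  have : (flip (invI p)).body ≠ 0 := by
    rw [body_flip, body_invI]; exact inv_ne_zero hp
  rw [northInv_of_ne this, invI_flip_invI hp]

theorem northInv_injective : Function.Injective northInv :=
  Function.LeftInverse.injective northFun_northInv

theorem north_mem_source (q : Pt) : north.symm q ∈ north.source := ⟨q, rfl⟩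

theorem south_mem_source (p : Pt) : Sphere.fin p ∈ south.source := ⟨p, rfl⟩

/-- The local coordinate expressed in the coordinate `flip ∘ north`, which is related to the
southern coordinate by `invI`. -/
def inNorth (Ω : OpenPartialHomeomorph Sphere Pt) (q : Pt) : Pt := Ω (north.symm (flip q))

theorem inSouth_eq (Ω : OpenPartialHomeomorph Sphere Pt) {p : Pt} (hp : p.body ≠ 0) :
    inSouth Ω p = inNorth Ω (invI p) :=
  congrArg Ω (northInv_flip_invI hp).symm

theorem lsc_inNorth {Ω : OpenPartialHomeomorph Sphere Pt} (hΩ : IsSuperconformalChart Ω) {q : Pt}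
    (hq : north.symm (flip q) ∈ Ω.source) : LSC (inNorth Ω) q.body := by
  have h := (atlas_isSuperconformalChart (φ := north) (Or.inr rfl)).compatAt hΩ
    (north_mem_source (flip q)) hq
  have e : (north (north.symm (flip q))).body = q.body := by
    rw [north.right_inv (by trivial)]; rfl
  rw [CompatAt, e] at h
  refine LSC.comp (G := fun p => Ω (north.symm p)) (H := flip) ?_ (lsc_flip _)
  rw [bodyMap_eq (lsc_flip _).sa]
  exact h

theorem lsc_inSouth {Ω : OpenPartialHomeomorph Sphere Pt} (hΩ : IsSuperconformalChart Ω) {p : Pt}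
    (hp : Sphere.fin p ∈ Ω.source) : LSC (inSouth Ω) p.body :=
  (atlas_isSuperconformalChart (φ := south) (Or.inl rfl)).compatAt hΩ (south_mem_source p) hp

/-- The local coordinate at the point with southern coordinate `x`, as a function of the
coordinate shifted to vanish there. -/
def atPoint (Ω : OpenPartialHomeomorph Sphere Pt) (x p : Pt) : Pt := inSouth Ω (shift (negPt x) p)

theorem inSouth_eq_atPoint (Ω : OpenPartialHomeomorph Sphere Pt) (x p : Pt) :
    inSouth Ω p = atPoint Ω x (shift x p) := by rw [atPoint, shift_negPt]

theorem shift_negPt_zero (x : Pt) : shift (negPt x) 0 = x := by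
  rw [← shift_self x, shift_negPt]

theorem body_zero : (0 : Pt).body = 0 := map_zero body

theorem lsc_atPoint {Ω : OpenPartialHomeomorph Sphere Pt} (hΩ : IsSuperconformalChart Ω) {x : Pt}
    (hx : Sphere.fin x ∈ Ω.source) : LSC (atPoint Ω x) 0 := by
  rw [← body_zero]
  refine LSC.comp (G := inSouth Ω) (H := shift (negPt x)) ?_ (lsc_shift _ _)
  rw [bodyMap_eq (lsc_shift _ _).sa, shift_negPt_zero]
  exact lsc_inSouth hΩ hx

theorem flip_zero : flip 0 = 0 := by
  ext1
  · rfl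
  · exact neg_zero
  · exact neg_zero

theorem lsc_inNorth_zero {Ω : OpenPartialHomeomorph Sphere Pt} (hΩ : IsSuperconformalChart Ω)
    (h : north.symm 0 ∈ Ω.source) : LSC (inNorth Ω) 0 := by
  rw [← body_zero]
  exact lsc_inNorth hΩ (by rwa [flip_zero])

theorem exists_hasSeries_inNorth {Ω : OpenPartialHomeomorph Sphere Pt}
    (hΩ : IsSuperconformalChart Ω) (h : north.symm 0 ∈ Ω.source) (h0 : Ω (north.symm 0) = 0) :
    ∃ K, HasSeries (inNorth Ω) K :=
  exists_hasSeries (lsc_inNorth_zero hΩ h) (by rw [inNorth, flip_zero, h0])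

theorem exists_hasSeries_atPoint {Ω : OpenPartialHomeomorph Sphere Pt} {x : Pt}
    (hΩ : IsSuperconformalChart Ω) (h : Sphere.fin x ∈ Ω.source) (h0 : Ω (Sphere.fin x) = 0) :
    ∃ K, HasSeries (atPoint Ω x) K :=
  exists_hasSeries (lsc_atPoint hΩ h) (by rw [atPoint, shift_negPt_zero]; exact h0)

theorem eventually_north_mem {Ω : OpenPartialHomeomorph Sphere Pt}
    (h : north.symm 0 ∈ Ω.source) : ∀ᶠ q in nb 0, north.symm (flip q) ∈ Ω.source := by
  have := eventually_symm_mem (Ω := north) (north_mem_source 0) (Ω.open_source.mem_nhds h)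
  rw [north.right_inv (by trivial), body_zero] at this
  have e := (lsc_flip 0).sa.tendsto
  have b : bodyMap flip 0 = 0 := by
    have := bodyMap_eq (H := flip) (p := 0) (lsc_flip _).sa
    rwa [body_flip, body_zero] at this
  rw [b] at e
  exact e.eventually this

/-- The germ at infinity is determined by the points over a punctured neighborhood, where the
coordinate `invI` is defined. -/
theorem expandsAtInfinity_iff {Ω : OpenPartialHomeomorph Sphere Pt} {K : LocalSeries}
    (hΩ : IsSuperconformalChart Ω) (h : north.symm 0 ∈ Ω.source) (hK : K.Converges) :
    ExpandsAtInfinity Ω K ↔ HasSeries (inNorth Ω) K := by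
  constructor
  · rintro ⟨R, hR, H⟩
    obtain ⟨G, hG⟩ := hK.exists_hasSeries
    refine HasSeries.of_evalsTo hK ?_
    have e : ∀ᶠ p in nb 0, inNorth Ω p = G p := by
      refine SAMap.eq_of_punctured (lsc_inNorth_zero hΩ h).sa hG.lsc.sa ?_
      have h1 := (nb_iff.1 hG.evalsTo).filter_mono (nhdsWithin_le_nhds (s := {0}ᶜ))
      have h2 : ∀ᶠ v : ℂ in 𝓝[≠] 0, ‖v‖ < R⁻¹ := by
        refine Filter.Eventually.filter_mono nhdsWithin_le_nhds ?_
        filter_upwards [Metric.ball_mem_nhds (0 : ℂ) (inv_pos.2 hR)] with v hv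
        simpa using hv
      filter_upwards [h1, h2, self_mem_nhdsWithin] with v h1 h2 h3 q hq
      have hq0 : q.body ≠ 0 := hq ▸ h3
      have hp : (flip (invI q)).body = v⁻¹ := by rw [body_flip, body_invI, hq]
      have hn : R < ‖(flip (invI q)).body‖ := by
        rw [hp, norm_inv]
        exact (lt_inv_comm₀ (norm_pos_iff.2 (by exact h3)) hR).1 h2
      have := (H _ hn).2
      rw [inSouth_eq Ω (by rw [hp]; exact inv_ne_zero h3), invI_flip_invI hq0] at this
      exact this.unique (h1 q hq)
    filter_upwards [e, hG.evalsTo] with p h1 h2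
    rwa [h1]
  · intro hS
    obtain ⟨r, hr, H⟩ := exists_radius (hS.evalsTo.and (eventually_north_mem h))
    refine ⟨r⁻¹, inv_pos.2 hr, fun p hp => ?_⟩
    have hp0 : p.body ≠ 0 := norm_pos_iff.1 ((inv_pos.2 hr).trans hp)
    obtain ⟨h1, h2⟩ := H (invI p) (by
      rw [body_invI, norm_inv]; exact (inv_lt_comm₀ (norm_pos_iff.2 hp0) hr).2 hp)
    rw [← inSouth_eq Ω hp0] at h1
    refine ⟨?_, h1⟩
    have e := northInv_flip_invI hp0
    change northInv (flip (invI p)) ∈ _ at h2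
    rw [e] at h2
    exact h2

/-- The analogous statement at a finite point, where no point of the neighborhood is missing. -/
theorem expandsAt_iff {Ω : OpenPartialHomeomorph Sphere Pt} {x : Pt} {K : LocalSeries}
    (h : Sphere.fin x ∈ Ω.source) (hK : K.Converges) :
    ExpandsAt Ω x K ↔ HasSeries (atPoint Ω x) K := by
  constructor
  · rintro ⟨r, hr, H⟩
    refine HasSeries.of_evalsTo hK (nb_iff.2 ?_)
    filter_upwards [Metric.ball_mem_nhds (0 : ℂ) hr] with v hv p hp
    have hb : shift (negPt x) p ∈ ball x r := by
      have : (negPt x).body = -x.body := map_neg body _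
      change ‖(shift (negPt x) p).body - x.body‖ < r
      rw [body_shift, this, sub_neg_eq_add, add_sub_cancel_right, hp]
      simpa using hv
    have := (H _ hb).2
    rw [inSouth_eq_atPoint Ω x, shift_shift_negPt] at this
    exact this
  · intro hS
    have h2 := eventually_symm_mem (Ω := south) (south_mem_source x) (Ω.open_source.mem_nhds h)
    have e : south (Sphere.fin x) = x := rfl
    rw [e, nb_iff] at h2
    obtain ⟨r, hr, H⟩ := exists_radius hS.evalsTo
    obtain ⟨s, hs, h2⟩ := Metric.eventually_nhds_iff.1 h2
    refine ⟨min r s, lt_min hr hs, fun p hp => ?_⟩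
    have hp' : ‖p.body - x.body‖ < min r s := hp
    refine ⟨h2 (by rw [dist_eq_norm]; exact hp'.trans_le (min_le_right _ _)) p rfl, ?_⟩
    rw [inSouth_eq_atPoint Ω x]
    exact H _ (by rw [body_shift]; exact hp'.trans_le (min_le_left _ _))

/-! ### Automorphisms of the super-Riemann sphere -/

/-- The automorphism that exchanges zero and infinity. -/
theorem exists_inversion : ∃ F : Sphere ≃ₜ Sphere, IsSCHomeo F ∧
    (∀ p, F (Sphere.fin p) = northInv p) ∧
    ∀ q, F (northInv q) = Sphere.fin (flip q) := by
  let F : Sphere → Sphere := fun x => match x with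
    | Sphere.fin p => northInv p
    | Sphere.inf q _ => Sphere.fin (flip q)
  let G : Sphere → Sphere := fun x => match x with
    | Sphere.fin p => northInv (flip p)
    | Sphere.inf q _ => Sphere.fin q
  have hF : ∀ q, F (northInv q) = Sphere.fin (flip q) := fun q => by
    by_cases h : q.body = 0
    · have : northInv q = Sphere.inf q h := dif_pos h
      rw [this]
    · rw [northInv_of_ne h]
      change northInv (invI q) = _
      have hb : (invI q).body ≠ 0 := by rw [body_invI]; exact inv_ne_zero h
      rw [northInv_of_ne hb, invI, invI, recip_recip_flip Complex.I_mul_I h]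
  have hG : ∀ q, G (northInv q) = Sphere.fin q := fun q => by
    by_cases h : q.body = 0
    · have : northInv q = Sphere.inf q h := dif_pos h
      rw [this]
    · rw [northInv_of_ne h]
      exact northInv_flip_invI h
  have hn : ∀ q h, Sphere.inf q h = northInv q := fun q h => (dif_pos h).symm
  let E : Sphere ≃ Sphere :=
    { toFun := F
      invFun := G
      left_inv := fun x => by
        cases x with
        | fin p => exact hG p
        | inf q h => change northInv (flip (flip q)) = _; rw [flip_flip, hn]
      right_inv := fun x => by
        cases x with
        | fin p => change F (northInv (flip p)) = _; rw [hF, flip_flip]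
        | inf q h => exact (hn q h).symm }
  obtain ⟨F', hF', h⟩ := exists_isSCHomeo_of_local E fun x => by
    cases x with
    | fin p =>
      exact ⟨south, Or.inl rfl, north, Or.inr rfl, fun p => p, fun p => p, south_mem_source p,
        LSC.id _, SAMap.id _, Eventually.of_forall fun p => rfl, Eventually.of_forall fun q => hG q⟩
    | inf q h =>
      rw [hn]
      exact ⟨north, Or.inr rfl, south, Or.inl rfl, flip, flip, north_mem_source q,
        lsc_flip _, (lsc_flip _).sa, Eventually.of_forall fun p => hF p,
        Eventually.of_forall fun q => rfl⟩
  have e : ∀ x, F' x = E x := fun x => congrFun (congrArg (fun e : Sphere ≃ Sphere => (e : _ → _)) hF') x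
  exact ⟨F', h, fun p => e _, fun q => (e _).trans (hF q)⟩

/-- An automorphism that fixes infinity is given by a superconformal map `S` in the southern
coordinate whose expression `B` in the northern coordinate is superconformal at infinity. -/
theorem exists_automorphism {S S' B B' : Pt → Pt} (hS : ∀ w, LSC S w) (hS' : ∀ w, LSC S' w)
    (h1 : ∀ p, S' (S p) = p) (h2 : ∀ p, S (S' p) = p) (hB : LSC B 0) (hB' : SAMap B' 0)
    (b : ∀ q : Pt, q.body = 0 → (B q).body = 0) (b' : ∀ q : Pt, q.body = 0 → (B' q).body = 0)
    (k1 : ∀ q : Pt, q.body = 0 → B' (B q) = q) (k2 : ∀ q : Pt, q.body = 0 → B (B' q) = q)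
    (e : ∀ᶠ q in nb 0, q.body ≠ 0 → Sphere.fin (S (invI q)) = northInv (B q))
    (e' : ∀ᶠ q in nb 0, q.body ≠ 0 → Sphere.fin (S' (invI q)) = northInv (B' q)) :
    ∃ F : Sphere ≃ₜ Sphere, IsSCHomeo F ∧ (∀ p, F (Sphere.fin p) = Sphere.fin (S p)) ∧
      (∀ p, F.symm (Sphere.fin p) = Sphere.fin (S' p)) ∧
      (∀ᶠ q in nb 0, F (northInv q) = northInv (B q)) ∧
      ∀ᶠ q in nb 0, F.symm (northInv q) = northInv (B' q) := by
  let E : Sphere ≃ Sphere :=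
    { toFun := fun x => match x with
        | Sphere.fin p => Sphere.fin (S p)
        | Sphere.inf q h => Sphere.inf (B q) (b q h)
      invFun := fun x => match x with
        | Sphere.fin p => Sphere.fin (S' p)
        | Sphere.inf q h => Sphere.inf (B' q) (b' q h)
      left_inv := fun x => by
        cases x with
        | fin p => exact congrArg Sphere.fin (h1 p)
        | inf q h => simp only [k1 q h]
      right_inv := fun x => by
        cases x with
        | fin p => exact congrArg Sphere.fin (h2 p)
        | inf q h => simp only [k2 q h] }
  have hn : ∀ q h, Sphere.inf q h = northInv q := fun q h => (dif_pos h).symm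
  have eB : ∀ᶠ q in nb 0, E (northInv q) = northInv (B q) := by
    filter_upwards [e] with q hq
    by_cases h : q.body = 0
    · rw [← hn q h, ← hn (B q) (b q h)]; rfl
    · rw [northInv_of_ne h]; exact hq h
  have eB' : ∀ᶠ q in nb 0, E.symm (northInv q) = northInv (B' q) := by
    filter_upwards [e'] with q hq
    by_cases h : q.body = 0
    · rw [← hn q h, ← hn (B' q) (b' q h)]; rfl
    · rw [northInv_of_ne h]; exact hq h
  obtain ⟨F', hF', h⟩ := exists_isSCHomeo_of_local E fun x => by
    cases x with
    | fin p =>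
      exact ⟨south, Or.inl rfl, south, Or.inl rfl, S, S', south_mem_source p, hS _, (hS' _).sa,
        Eventually.of_forall fun p => rfl, Eventually.of_forall fun q => rfl⟩
    | inf q h =>
      have hq : (north (northInv q)).body = 0 := by
        change (northFun (northInv q)).body = 0
        rw [northFun_northInv, h]
      have hb : bodyMap B 0 = 0 := by
        have := bodyMap_eq (H := B) (p := 0) (by rw [body_zero]; exact hB.sa)
        rw [body_zero] at this
        rw [this, b 0 body_zero]
      rw [hn]
      refine ⟨north, Or.inr rfl, north, Or.inr rfl, B, B', north_mem_source q, ?_⟩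
      rw [hq, hb]
      exact ⟨hB, hB', eB, eB'⟩
  have e1 : ∀ x, F' x = E x := fun x => congrArg (fun e : Sphere ≃ Sphere => e x) hF'
  have e2 : ∀ x, F'.symm x = E.symm x := fun x =>
    congrArg (fun e : Sphere ≃ Sphere => e.symm x) hF'
  exact ⟨F', h, fun p => e1 _, fun p => e2 _, eB.mono fun q h => (e1 _).trans h,
    eB'.mono fun q h => (e2 _).trans h⟩

theorem inverse_mem_unit {a : Gr} (ha : IsUnit a) : IsUnit (Ring.inverse a) := by
  obtain ⟨u, rfl⟩ := ha
  rw [Ring.inverse_unit]; exact u⁻¹.isUnit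

/-- The scaling automorphism `(abz, aθ⁺, bθ⁻)`. In the northern coordinate it is the scaling by the
inverses of `b` and `a`. -/
theorem exists_scaling {a b : Gr} (ha : a ∈ evenPart) (hb : b ∈ evenPart) (ua : IsUnit a)
    (ub : IsUnit b) : ∃ F : Sphere ≃ₜ Sphere, IsSCHomeo F ∧
      (∀ p, F (Sphere.fin p) = Sphere.fin (scale ha hb p)) ∧
      (∀ᶠ q in nb 0, F (northInv q) =
        northInv (scale (inverse_mem_even hb) (inverse_mem_even ha) q)) ∧
      ∀ᶠ q in nb 0, F.symm (northInv q) = northInv (scale hb ha q) := by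
  have ia := inverse_mem_even ha
  have ib := inverse_mem_even hb
  have cancel : ∀ {a b c d : Gr} (ha : a ∈ evenPart) (hb : b ∈ evenPart) (hc : c ∈ evenPart)
      (hd : d ∈ evenPart), a * c = 1 → b * d = 1 → ∀ p, scale ha hb (scale hc hd p) = p := by
    intro a b c d ha hb hc hd h h' p
    ext1
    · change a * b * (c * d * p.z) = p.z
      rw [← mul_assoc, mul_assoc a, ← mul_assoc b, (even_commute hb c).eq, mul_assoc c, h', mul_one,
        h, one_mul]
    · change a * (c * p.tp) = p.tp
      rw [← mul_assoc, h, one_mul]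
    · change b * (d * p.tm) = p.tm
      rw [← mul_assoc, h', one_mul]
  have a1 := Ring.mul_inverse_cancel a ua
  have a2 := Ring.inverse_mul_cancel a ua
  have b1 := Ring.mul_inverse_cancel b ub
  have b2 := Ring.inverse_mul_cancel b ub
  have bz : ∀ {a b : Gr} (ha : a ∈ evenPart) (hb : b ∈ evenPart) (q : Pt), q.body = 0 →
      (scale ha hb q).body = 0 := fun {a b} ha hb q hq => by
    change body (a * b * q.z) = 0
    rw [map_mul]
    exact mul_eq_zero_of_right _ hq
  -- The computation at infinity, symmetric in the scaling and its inverse.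
  have north : ∀ {a b c d : Gr} (ha : a ∈ evenPart) (hb : b ∈ evenPart) (hc : c ∈ evenPart)
      (hd : d ∈ evenPart), a * c = 1 → b * d = 1 → ∀ q : Pt, q.body ≠ 0 →
      Sphere.fin (scale ha hb (invI q)) = northInv (scale hd hc q) := by
    intro a b c d ha hb hc hd h h' q hq
    have uz : IsUnit q.z := (isUnit_iff_body q.z_even).2 hq
    have z1 := Ring.mul_inverse_cancel q.z uz
    have hdc : d * c * (a * b) = 1 := by
      rw [← mul_assoc, mul_assoc d, (even_commute hc a).eq, h, mul_one, (even_commute hd b).eq, h']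
    have hbd : (scale hd hc q).body ≠ 0 := by
      change body (d * c * q.z) ≠ 0
      rw [map_mul]
      refine mul_ne_zero (fun h0 => ?_) hq
      have := congrArg body hdc
      rw [map_mul, h0, zero_mul, map_one] at this
      exact zero_ne_one this
    have hinv : Ring.inverse (d * c * q.z) = a * b * Ring.inverse q.z := by
      refine inverse_eq_of_mul (even_mul_even (even_mul_even hd hc) q.z_even) ?_
      rw [mul_assoc (d * c), ← mul_assoc q.z, (even_commute q.z_even (a * b)).eq, mul_assoc (a * b),
        z1, mul_one, hdc]
    rw [northInv_of_ne hbd]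
    congr 1
    ext1
    · exact hinv.symm
    · change a * (Complex.I • (q.tp * Ring.inverse q.z)) =
        Complex.I • (d * q.tp * Ring.inverse (d * c * q.z))
      rw [hinv, mul_smul_comm, (even_commute hd q.tp).eq, mul_assoc q.tp, ← mul_assoc d,
        ← mul_assoc d, (even_commute hd a).eq, mul_assoc a, (even_commute hd b).eq, h', mul_one,
        ← mul_assoc, ← mul_assoc, (even_commute ha q.tp).eq]
    · change b * (Complex.I • (q.tm * Ring.inverse q.z)) =
        Complex.I • (c * q.tm * Ring.inverse (d * c * q.z))
      rw [hinv, mul_smul_comm, (even_commute hc q.tm).eq, mul_assoc q.tm, ← mul_assoc c,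
        ← mul_assoc c, (even_commute hc a).eq, h, one_mul,
        ← mul_assoc, ← mul_assoc, (even_commute hb q.tm).eq]
  obtain ⟨F, hF, f1, -, f2, f3⟩ := exists_automorphism (S := scale ha hb) (S' := scale ia ib)
    (B := scale ib ia) (B' := scale hb ha) (lsc_scale ha hb ua ub)
    (lsc_scale ia ib (inverse_mem_unit ua) (inverse_mem_unit ub))
    (cancel ia ib ha hb a2 b2) (cancel ha hb ia ib a1 b1)
    (lsc_scale ib ia (inverse_mem_unit ub) (inverse_mem_unit ua) 0) (lsc_scale hb ha ub ua 0).sa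
    (bz ib ia) (bz hb ha) (fun q _ => cancel hb ha ib ia b1 a1 q)
    (fun q _ => cancel ib ia hb ha b2 a2 q)
    (Eventually.of_forall (north ha hb ia ib a1 b1))
    (Eventually.of_forall (north ia ib ha hb a2 b2))
  exact ⟨F, hF, f1, f2, f3⟩

/-- The denominator of the expression of a shift in the northern coordinate. -/
def shiftDenom (x q : Pt) : Gr :=
  1 - x.z * q.z - Complex.I • (q.tp * x.tm) - Complex.I • (q.tm * x.tp)

theorem shiftDenom_even (x q : Pt) : shiftDenom x q ∈ evenPart :=
  Submodule.sub_mem _ (Submodule.sub_mem _ (Submodule.sub_mem _ one_mem_even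
    (even_mul_even x.z_even q.z_even)) (Submodule.smul_mem _ _ (odd_mul_odd q.tp_odd x.tm_odd)))
    (Submodule.smul_mem _ _ (odd_mul_odd q.tm_odd x.tp_odd))

theorem body_shiftDenom (x q : Pt) : body (shiftDenom x q) = 1 - x.body * q.body := by
  rw [shiftDenom, map_sub, map_sub, map_sub, map_one, map_mul, map_smul, map_smul, map_mul, map_mul,
    body_odd q.tp_odd, body_odd q.tm_odd]
  simp only [zero_mul, smul_zero, sub_zero]
  rfl

/-- The shift `shift x` in the northern coordinate. -/
def shiftNorth (x q : Pt) : Pt :=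
  ⟨q.z * Ring.inverse (shiftDenom x q),
    (q.tp + Complex.I • (x.tp * q.z)) * Ring.inverse (shiftDenom x q),
    (q.tm + Complex.I • (x.tm * q.z)) * Ring.inverse (shiftDenom x q),
    even_mul_even q.z_even (inverse_mem_even (shiftDenom_even x q)),
    odd_mul_even (Submodule.add_mem _ q.tp_odd (Submodule.smul_mem _ _
      (odd_mul_even x.tp_odd q.z_even))) (inverse_mem_even (shiftDenom_even x q)),
    odd_mul_even (Submodule.add_mem _ q.tm_odd (Submodule.smul_mem _ _
      (odd_mul_even x.tm_odd q.z_even))) (inverse_mem_even (shiftDenom_even x q))⟩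

theorem body_shiftNorth {x q : Pt} (h : 1 - x.body * q.body ≠ 0) :
    (shiftNorth x q).body = q.body * (1 - x.body * q.body)⁻¹ := by
  change body (q.z * Ring.inverse (shiftDenom x q)) = _
  rw [map_mul, ring_inverse_eq (shiftDenom_even x q) (by rwa [body_shiftDenom]),
    body_hat _ (shiftDenom_even x q), body_shiftDenom]
  rfl

/-- `shiftNorth` expresses the shift in the northern coordinate, away from infinity. -/
theorem fin_shift_invI {x q : Pt} (hq : q.body ≠ 0) (h : 1 - x.body * q.body ≠ 0) :
    Sphere.fin (shift x (invI q)) = northInv (shiftNorth x q) := by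
  have hu : shiftDenom x q * Ring.inverse (shiftDenom x q) = 1 := Ring.mul_inverse_cancel _
    ((isUnit_iff_body (shiftDenom_even x q)).2 (by rwa [body_shiftDenom]))
  have uz : IsUnit q.z := (isUnit_iff_body q.z_even).2 hq
  have z1 := Ring.mul_inverse_cancel q.z uz
  have iu := inverse_mem_even (shiftDenom_even x q)
  have iz := inverse_mem_even q.z_even
  have hb : (shiftNorth x q).body ≠ 0 := by
    rw [body_shiftNorth h]; exact mul_ne_zero hq (inv_ne_zero h)
  have hinv : Ring.inverse (q.z * Ring.inverse (shiftDenom x q)) =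
      shiftDenom x q * Ring.inverse q.z := by
    refine inverse_eq_of_mul (even_mul_even q.z_even iu) ?_
    rw [mul_assoc, ← mul_assoc (Ring.inverse (shiftDenom x q)), (even_commute iu _).eq, hu, one_mul,
      z1]
  have hcomm : ∀ y : Gr, y * Ring.inverse (shiftDenom x q) *
      (shiftDenom x q * Ring.inverse q.z) = y * Ring.inverse q.z := fun y => by
    rw [mul_assoc, ← mul_assoc (Ring.inverse (shiftDenom x q)), (even_commute iu _).eq, hu, one_mul]
  have comp : ∀ y t : Gr, Complex.I • ((y + Complex.I • (t * q.z)) *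
      Ring.inverse (shiftDenom x q) * (shiftDenom x q * Ring.inverse q.z)) =
      Complex.I • (y * Ring.inverse q.z) - t := fun y t => by
    rw [hcomm, add_mul, smul_mul_assoc, mul_assoc t, z1, mul_one, smul_add, smul_smul,
      Complex.I_mul_I, neg_one_smul, sub_eq_add_neg]
  rw [northInv_of_ne hb]
  congr 1
  ext1
  · change Ring.inverse q.z - x.z - Complex.I • (q.tp * Ring.inverse q.z) * x.tm -
      Complex.I • (q.tm * Ring.inverse q.z) * x.tp = Ring.inverse (q.z * Ring.inverse (shiftDenom x q))
    rw [hinv, shiftDenom, sub_mul, sub_mul, sub_mul, one_mul, mul_assoc x.z, z1, mul_one,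
      smul_mul_assoc, smul_mul_assoc, smul_mul_assoc, smul_mul_assoc, mul_assoc q.tp,
      (even_commute iz x.tm).eq, mul_assoc q.tm, (even_commute iz x.tp).eq, ← mul_assoc,
      ← mul_assoc]
  · change Complex.I • (q.tp * Ring.inverse q.z) - x.tp =
      Complex.I • ((q.tp + Complex.I • (x.tp * q.z)) * Ring.inverse (shiftDenom x q) *
        Ring.inverse (q.z * Ring.inverse (shiftDenom x q)))
    rw [hinv, comp]
  · change Complex.I • (q.tm * Ring.inverse q.z) - x.tm =
      Complex.I • ((q.tm + Complex.I • (x.tm * q.z)) * Ring.inverse (shiftDenom x q) *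
        Ring.inverse (q.z * Ring.inverse (shiftDenom x q)))
    rw [hinv, comp]

theorem eventually_shift_ne (x : Pt) : ∀ᶠ v : ℂ in 𝓝 0, 1 - x.body * v ≠ 0 := by
  have : ContinuousAt (fun v : ℂ => 1 - x.body * v) 0 := by fun_prop
  exact this.eventually_ne (by simp)

theorem samap_shiftNorth (x : Pt) : SAMap (shiftNorth x) 0 := by
  have hd : shiftDenom x ∈ SA 0 := SA.sub (SA.sub (SA.sub (SA.const 1) (SA.mul (SA.const _) SA.z))
    (SA.smul _ (SA.mul SA.tp (SA.const _)))) (SA.smul _ (SA.mul SA.tm (SA.const _)))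
  have hi : (fun q => Ring.inverse (shiftDenom x q)) ∈ SA 0 := by
    refine SA.congr (SA.hat_comp hd (Eventually.of_forall (shiftDenom_even x))
      (χ := fun w => w⁻¹) fun p hp => ?_) ?_
    · rw [body_shiftDenom, hp, mul_zero, sub_zero]
      exact analyticAt_id.inv one_ne_zero
    · filter_upwards [(tendsto_body_nb 0).eventually (eventually_shift_ne x)] with q hq
      exact ring_inverse_eq (shiftDenom_even x q) (by rwa [body_shiftDenom])
  exact ⟨SA.mul SA.z hi, SA.mul (SA.add SA.tp (SA.smul _ (SA.mul (SA.const _) SA.z))) hi,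
    SA.mul (SA.add SA.tm (SA.smul _ (SA.mul (SA.const _) SA.z))) hi⟩

theorem body_shiftNorth_zero (x : Pt) {q : Pt} (hq : q.body = 0) : (shiftNorth x q).body = 0 := by
  rw [body_shiftNorth (by simp [hq]), hq, zero_mul]

theorem bodyMap_shiftNorth (x : Pt) : bodyMap (shiftNorth x) 0 = 0 := by
  have := bodyMap_eq (H := shiftNorth x) (p := 0) (by rw [body_zero]; exact samap_shiftNorth x)
  rw [body_zero, body_shiftNorth_zero x body_zero] at this
  exact this

/-- Both sides are superanalytic, and they agree over a punctured neighborhood because shifts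
compose there. -/
theorem shiftNorth_shiftNorth (x : Pt) :
    ∀ᶠ q in nb 0, shiftNorth (negPt x) (shiftNorth x q) = q := by
  have hs : SAMap (fun q => shiftNorth (negPt x) (shiftNorth x q)) 0 :=
    SAMap.comp (by rw [bodyMap_shiftNorth]; exact samap_shiftNorth _) (samap_shiftNorth x)
  refine SAMap.eq_of_punctured hs (SAMap.id 0) ?_
  have h1 := (samap_shiftNorth x).tendsto
  rw [bodyMap_shiftNorth] at h1
  replace h1 := h1.eventually ((tendsto_body_nb _).eventually (eventually_shift_ne (negPt x)))
  filter_upwards [(nb_iff.1 h1).filter_mono nhdsWithin_le_nhds,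
    (eventually_shift_ne x).filter_mono nhdsWithin_le_nhds, self_mem_nhdsWithin]
    with v h1 h2 h3 q hq
  have hq0 : q.body ≠ 0 := hq ▸ h3
  have h2' : 1 - x.body * q.body ≠ 0 := by rwa [hq]
  have hb : (shiftNorth x q).body ≠ 0 := by
    rw [body_shiftNorth h2']; exact mul_ne_zero hq0 (inv_ne_zero h2')
  have e := fin_shift_invI hq0 h2'
  rw [northInv_of_ne hb] at e
  apply northInv_injective
  rw [← fin_shift_invI hb (h1 q hq), ← Sphere.fin.inj e, shift_negPt, northInv_of_ne hq0]

/-- Away from infinity this is a composition of superconformal maps, and superconformality extends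
over the puncture. -/
theorem lsc_shiftNorth (x : Pt) : LSC (shiftNorth x) 0 := by
  have key : ∀ x, PreLSC (shiftNorth x) 0 := fun x => by
    refine PreLSC.of_punctured (samap_shiftNorth x) ?_
    filter_upwards [eventually_nhdsWithin_of_eventually_nhds (eventually_shift_ne x),
      self_mem_nhdsWithin] with v hv hv0
    have hv0' : v ≠ 0 := hv0
    have b1 : bodyMap invI v = v⁻¹ := by rw [bodyMap, body_invI, body_ofComplex]
    have b2 : bodyMap (fun q => shift x (invI q)) v ≠ 0 := by
      rw [bodyMap, body_shift, body_invI, body_ofComplex]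
      intro h0
      apply hv
      rw [← sub_eq_zero.1 h0, inv_mul_cancel₀ hv0', sub_self]
    have c1 : LSC (fun q => shift x (invI q)) v :=
      LSC.comp (lsc_shift x _) (lsc_recip Complex.I_mul_I hv0')
    have c2 : LSC (fun q => recip (-Complex.I) (shift x (invI q))) v :=
      LSC.comp (lsc_recip (by simp) b2) c1
    refine LSC.congr c2 (nb_iff.2 ?_)
    filter_upwards [(continuousAt_id.eventually_ne hv0'),
      ((by fun_prop : ContinuousAt (fun v : ℂ => 1 - x.body * v) v).eventually_ne hv)]
      with u hu hu' q hq
    have e := fin_shift_invI (x := x) (q := q) (by rw [hq]; exact hu) (by rw [hq]; exact hu')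
    have hb : (shiftNorth x q).body ≠ 0 := by
      rw [body_shiftNorth (by rw [hq]; exact hu'), hq]; exact mul_ne_zero hu (inv_ne_zero hu')
    rw [northInv_of_ne hb] at e
    rw [Sphere.fin.inj e, invI, recip_recip (by simp) hb]
  exact (key x).lsc (by rw [bodyMap_shiftNorth]; exact key (negPt x)) (shiftNorth_shiftNorth x)

/-- The shift automorphism, which moves the point with southern coordinate `x` to zero. -/
theorem exists_shift (x : Pt) : ∃ F : Sphere ≃ₜ Sphere, IsSCHomeo F ∧
    (∀ p, F (Sphere.fin p) = Sphere.fin (shift x p)) ∧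
    (∀ᶠ q in nb 0, F (northInv q) = northInv (shiftNorth x q)) ∧
    ∀ᶠ q in nb 0, F.symm (northInv q) = northInv (shiftNorth (negPt x) q) := by
  have hn : ∀ x, ∀ᶠ q in nb 0, q.body ≠ 0 →
      Sphere.fin (shift x (invI q)) = northInv (shiftNorth x q) := fun x => by
    filter_upwards [(tendsto_body_nb 0).eventually (eventually_shift_ne x)] with q h hq
    exact fin_shift_invI hq h
  have k2 := shiftNorth_shiftNorth (negPt x)
  rw [negPt_negPt] at k2
  obtain ⟨F, hF, f1, -, f2, f3⟩ := exists_automorphism (S := shift x) (S' := shift (negPt x))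
    (B := shiftNorth x) (B' := shiftNorth (negPt x)) (lsc_shift x) (lsc_shift _) (shift_negPt x)
    (shift_shift_negPt x) (lsc_shiftNorth x) (samap_shiftNorth _)
    (fun q hq => body_shiftNorth_zero x hq) (fun q hq => body_shiftNorth_zero _ hq)
    (fun q hq => nb_self (shiftNorth_shiftNorth x) hq) (fun q hq => nb_self k2 hq)
    (hn x) (hn _)
  exact ⟨F, hF, f1, f2, f3⟩

/-! ### Rigidity of automorphisms -/

theorem tendsto_slope {φ : ℂ → ℂ} (h : AnalyticAt ℂ φ 0) :
    Tendsto (fun v => v⁻¹ * (φ v - φ 0)) (𝓝[≠] 0) (𝓝 (tc φ 0 1)) := by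
  have h1 := (analyticAt_dslope h).continuousAt.tendsto
  rw [← tc_zero (dslope φ 0), tc_dslope h] at h1
  refine (h1.mono_left nhdsWithin_le_nhds).congr' ?_
  filter_upwards [self_mem_nhdsWithin] with v hv
  rw [dslope_of_ne _ hv, slope_def_field, sub_zero, div_eq_inv_mul]

theorem tendsto_cocompact_inv {β : Type*} {φ : ℂ → β} {l : Filter β} (h : Tendsto φ (𝓝[≠] 0) l) :
    Tendsto (fun w => φ w⁻¹) (cocompact ℂ) l := by
  rw [← Metric.cobounded_eq_cocompact]
  exact h.comp (Filter.inv_cobounded₀.le)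

/-- An entire function with `φ(w)/w → c` at infinity is affine. -/
theorem entire_affine {φ : ℂ → ℂ} (h : Differentiable ℂ φ) {c : ℂ}
    (hc : Tendsto (fun w => w⁻¹ * φ w) (cocompact ℂ) (𝓝 c)) (w : ℂ) : φ w = φ 0 + c * w := by
  have hd : Differentiable ℂ (dslope φ 0) := by
    rw [← differentiableOn_univ]
    exact (Complex.differentiableOn_dslope univ_mem).2 h.differentiableOn
  have ne : ∀ᶠ w : ℂ in cocompact ℂ, w ≠ 0 := by
    rw [← Metric.cobounded_eq_cocompact]; exact Bornology.eventually_ne_cobounded 0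
  have h0 : Tendsto (fun w : ℂ => w⁻¹ * φ 0) (cocompact ℂ) (𝓝 0) := by
    have : Tendsto (fun w : ℂ => w⁻¹) (cocompact ℂ) (𝓝 0) := by
      rw [← Metric.cobounded_eq_cocompact]; exact Filter.tendsto_inv₀_cobounded
    simpa using this.mul_const (φ 0)
  have lim : Tendsto (dslope φ 0) (cocompact ℂ) (𝓝 c) := by
    have := hc.sub h0
    rw [sub_zero] at this
    refine this.congr' ?_
    filter_upwards [ne] with w hw
    rw [dslope_of_ne _ hw, slope_def_field, sub_zero, ← mul_sub, div_eq_inv_mul]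
  have e := hd.apply_eq_of_tendsto_cocompact w lim
  by_cases hw : w = 0
  · rw [hw, mul_zero, add_zero]
  · rw [dslope_of_ne _ hw, slope_def_field, sub_zero] at e
    rw [← e]
    field_simp
    ring

/-- Division of a superanalytic function by the variable. -/
theorem IsTaylor.exists_div {X : ℕ → Gr} {c : CoeffFamily} (h : IsTaylor X c) (h0 : X 0 = 0) :
    ∃ U, IsTaylor (fun n => X (n + 1)) U ∧
      ∀ᶠ v in 𝓝 (0 : ℂ), c.eval (algebraMap ℂ Gr v) = v • U.eval (algebraMap ℂ Gr v) := by
  obtain ⟨ha, S, hS⟩ := h.1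
  have c0 : ∀ k, c k 0 = 0 := fun k => by rw [h.apply_zero, h0, map_zero]
  have fin : CoeffFamily.FinNear (fun k => dslope (c k) 0) 0 := by
    refine ⟨fun k => analyticAt_dslope (ha k), S, ?_⟩
    filter_upwards [hS] with v hv k hk
    have e : c k =ᶠ[𝓝 0] fun _ => 0 := hS.mono fun u hu => hu k hk
    by_cases hv0 : v = 0
    · rw [hv0, dslope_same, e.deriv_eq, deriv_const]
    · rw [dslope_of_ne _ hv0, slope_def_field, hv k hk, c0, sub_self, zero_div]
  refine ⟨_, ⟨fin, fun k n => ?_⟩, ?_⟩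
  · rw [tc_dslope (ha k), h.2]
  · filter_upwards [h.1.eventually, fin.eventually] with v h1 h2
    refine gr_ext fun k => ?_
    rw [map_smul, h1.coord_eval, h2.coord_eval, smul_eq_mul]
    by_cases hv0 : v = 0
    · rw [hv0, c0, zero_mul]
    · rw [dslope_of_ne _ hv0, slope_def_field, c0, sub_zero, sub_zero]
      field_simp

theorem CoeffFamily.FinNear.eval_even_of_ofComplex {c : CoeffFamily} (h : c.FinNear 0)
    (he : ∀ᶠ v in 𝓝[≠] (0 : ℂ), c.eval (algebraMap ℂ Gr v) ∈ evenPart) :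
    ∀ᶠ p in nb 0, c.eval p.z ∈ evenPart := by
  obtain ⟨X, hX⟩ := h.exists_isTaylor
  refine hX.eval_even fun n => even_of_coord fun k hk => ?_
  rw [← hX.2, tc_congr (χ := fun _ => 0), tc_zero_fun]
  have : ∀ᶠ v in 𝓝[≠] (0 : ℂ), c k v = 0 := by
    filter_upwards [he, h.eventually.filter_mono nhdsWithin_le_nhds] with v hv hv'
    rw [← hv'.coord_eval]
    exact coord_of_even hv hk
  exact (((h.1 k).frequently_eq_iff_eventually_eq analyticAt_const).1 this.frequently)

/-- The multiplicative inverse of a superanalytic even function of the even variable. -/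
theorem IsTaylor.exists_inverse {X : ℕ → Gr} {c : CoeffFamily} (h : IsTaylor X c)
    (he : ∀ᶠ p in nb 0, c.eval p.z ∈ evenPart) (hu : IsUnit (X 0)) :
    ∃ C d, IsTaylor C d ∧ ∀ᶠ p in nb 0, d.eval p.z * c.eval p.z = 1 := by
  have hb := h.body_ne hu
  have hne : ∀ᶠ p in nb 0, c.eval p.z ∈ evenPart ∧ body (c.eval p.z) ≠ 0 := by
    filter_upwards [he, h.1.body_eval,
      (tendsto_body_nb 0).eventually ((h.1.1 ∅).continuousAt.eventually_ne hb)] with p a b c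
    exact ⟨a, by rwa [b]⟩
  obtain ⟨d, hd, ed⟩ := exists_family_of_sa (G := fun z => hat (fun w => w⁻¹) (c.eval z)) (w := 0)
    (SA.hat_comp (Z := fun p => c.eval p.z) h.1.sa he (χ := fun w => w⁻¹) fun p hp =>
      analyticAt_id.inv (nb_self hne hp).2)
  obtain ⟨C, hC⟩ := hd.exists_isTaylor
  refine ⟨C, d, hC, ?_⟩
  filter_upwards [ed, hne] with p e h
  rw [e, ← (even_commute h.1 _).eq, hat_inv h.1 h.2]

theorem coordTendsto_mul {α : Type} {l : Filter α} {x y : α → Gr} {a b : Gr}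
    (h : CoordTendsto x l a) (h' : CoordTendsto y l b) :
    CoordTendsto (fun i => x i * y i) l (a * b) := fun k => by
  rw [coord_mul k a b]
  refine Tendsto.congr (fun i => (coord_mul k (x i) (y i)).symm) ?_
  exact tendsto_finsetSum _ fun A _ => tendsto_finsetSum _ fun B _ =>
    ((h A).mul (h' B)).mul_const _

/-- A map of the sphere in the coordinate `flip ∘ north`. -/
def northExpr (F : Sphere → Sphere) (q : Pt) : Pt := flip (north (F (north.symm (flip q))))

theorem inseparable_northInv {p q : Pt} (h : p.body = q.body) :
    Inseparable (northInv p) (northInv q) := by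
  have : Inseparable p q :=
    (Topology.IsInducing.mk rfl : Topology.IsInducing Pt.body).inseparable_iff.1 (h ▸ Inseparable.rfl)
  exact this.map continuous_northInv

theorem fin_not_inseparable {p q : Pt} (hq : q.body = 0) :
    ¬ Inseparable (Sphere.fin p) (northInv q) := fun h => by
  have := (h.mem_open_iff isOpen_range_fin).1 ⟨p, rfl⟩
  obtain ⟨p', hp'⟩ := this
  rw [northInv, dif_pos hq] at hp'
  exact Sphere.noConfusion hp'

theorem exists_south_expr {F : Sphere ≃ₜ Sphere} (h : F (north.symm 0) = north.symm 0) (p : Pt) :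
    F (Sphere.fin p) = Sphere.fin (south (F (Sphere.fin p))) := by
  cases hx : F (Sphere.fin p) with
  | fin p' => rfl
  | inf q hq =>
    exfalso
    have e : Sphere.inf q hq = northInv q := (dif_pos hq).symm
    have h1 : Inseparable (northInv q) (northInv 0) :=
      inseparable_northInv (hq.trans body_zero.symm)
    have h2 : Inseparable (F (Sphere.fin p)) (F (northInv 0)) := by
      rw [hx, e]; exact h1.trans (by rw [show F (northInv 0) = northInv 0 from h])
    have h3 := h2.map F.symm.continuous
    rw [F.symm_apply_apply, F.symm_apply_apply] at h3
    exact fin_not_inseparable body_zero h3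

theorem lsc_southExpr {F : Sphere ≃ₜ Sphere} (hF : IsSCHomeo F)
    (h : F (north.symm 0) = north.symm 0) (w : ℂ) :
    LSC (fun p => south (F (Sphere.fin p))) w := by
  have := lsc_inSouth (hF south (Or.inl rfl)) (p := Pt.ofComplex w)
    (by change F (Sphere.fin _) ∈ south.source; rw [exists_south_expr h]; exact south_mem_source _)
  rw [body_ofComplex] at this
  exact this

theorem lsc_northExpr {F : Sphere ≃ₜ Sphere} (hF : IsSCHomeo F)
    (h : F (north.symm 0) = north.symm 0) : LSC (northExpr F) 0 :=
  LSC.comp (G := flip) (H := inNorth (F.transOpenPartialHomeomorph north)) (lsc_flip _) (lsc_inNorth_zero (hF north (Or.inr rfl))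
    (by change F (north.symm 0) ∈ north.source; rw [h]; exact north_mem_source _))

theorem northExpr_zero {F : Sphere ≃ₜ Sphere} (h : F (north.symm 0) = north.symm 0) :
    northExpr F 0 = 0 := by
  rw [northExpr, flip_zero, h, north.right_inv (by trivial), flip_zero]

theorem northExpr_invI {F : Sphere ≃ₜ Sphere} (h : F (north.symm 0) = north.symm 0) {p : Pt}
    (hp : p.body ≠ 0) : northExpr F (invI p) = invI (south (F (Sphere.fin p))) := by
  have e : north.symm (flip (invI p)) = Sphere.fin p := northInv_flip_invI hp
  rw [northExpr, e, exists_south_expr h]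
  change flip (recip (-Complex.I) _) = _
  rw [← flip_invI, flip_flip]
  rfl

theorem CoeffFamily.AnalyticOn.eq_of_tendsto {c : CoeffFamily} (h : c.AnalyticOn Set.univ) {a : Gr}
    (ha : CoordTendsto (fun w => c.eval (algebraMap ℂ Gr w)) (cocompact ℂ) a) (k : Finset ℕ) (w : ℂ) :
    c k w = coord k a := by
  have hd : Differentiable ℂ (c k) := fun v => (h.1 k v trivial).differentiableAt
  refine hd.apply_eq_of_tendsto_cocompact w ((ha k).congr fun v => ?_)
  exact (h.finNear isOpen_univ trivial).coord_eval k

/-- The odd part of an automorphism fixing infinity is constant. -/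
theorem odd_part_constant {s s' c : CoeffFamily} {M C : ℕ → Gr} (hs : s.AnalyticOn Set.univ)
    (hM : IsTaylor M s') (M0 : M 0 = 0) (hC : IsTaylor C c) (C0 : C 0 = 1)
    (h : ∀ᶠ w in cocompact ℂ, s.eval (algebraMap ℂ Gr w) =
      -(Complex.I • (s'.eval (algebraMap ℂ Gr w⁻¹) * (w • c.eval (algebraMap ℂ Gr w⁻¹)))))
    (k : Finset ℕ) (w : ℂ) : s k w = coord k (-(Complex.I • M 1)) := by
  refine hs.eq_of_tendsto (CoordTendsto.congr ?_ h) k w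
  have h1 := coordTendsto_mul (coordTendsto_inv.2 (hM.coordTendsto_first M0)) hC.coordTendsto_inv
  rw [C0, mul_one] at h1
  have h2 := h1.I_smul
  intro k
  rw [map_neg]
  refine (h2 k).neg.congr fun w => ?_
  simp only [inv_inv, smul_mul_assoc, mul_smul_comm, map_neg]

/-- The part of an automorphism fixing infinity that is linear in an odd variable is trivial. -/
theorem linear_part_constant {g s' g' c : CoeffFamily} {A C : ℕ → Gr} (hg : g.AnalyticOn Set.univ)
    (hA : IsTaylor A g') (A0 : A 0 = 1) (hC : IsTaylor C c) (C0 : C 0 = 1)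
    (h : ∀ᶠ w in cocompact ℂ, w ≠ 0 ∧ ∀ e ∈ oddPart, e * g.eval (algebraMap ℂ Gr w) =
      -(Complex.I • ((s'.eval (algebraMap ℂ Gr w⁻¹) +
        (Complex.I * w⁻¹) • (e * g'.eval (algebraMap ℂ Gr w⁻¹))) *
          (w • c.eval (algebraMap ℂ Gr w⁻¹))))) (k : Finset ℕ) (w : ℂ) : g k w = coord k 1 := by
  refine hg.eq_of_tendsto (CoordTendsto.congr (x := fun w =>
    g'.eval (algebraMap ℂ Gr w⁻¹) * c.eval (algebraMap ℂ Gr w⁻¹)) ?_ ?_) k w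
  · have := coordTendsto_mul hA.coordTendsto_inv hC.coordTendsto_inv
    rwa [A0, C0, one_mul] at this
  · filter_upwards [h] with w ⟨hw, h⟩
    refine cancel_odd_eq fun e he => ?_
    have h0 := h 0 (Submodule.zero_mem _)
    rw [zero_mul, zero_mul, smul_zero, add_zero] at h0
    have i : -(Complex.I * (w * (Complex.I * w⁻¹))) = 1 := by
      rw [mul_comm w, mul_assoc, inv_mul_cancel₀ hw, mul_one, Complex.I_mul_I, neg_neg]
    rw [h e he, add_mul, smul_add, neg_add, ← h0, zero_add, smul_mul_smul_comm, smul_smul,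
      ← neg_smul, mul_comm _ w, i, one_smul, mul_assoc]

/-- An automorphism that fixes infinity and is the identity in the finite part of the sphere is
the identity. -/
theorem eq_id_of_fin {F : Sphere ≃ₜ Sphere} (hF : IsSCHomeo F)
    (hi : F (north.symm 0) = north.symm 0) (h : ∀ p, F (Sphere.fin p) = Sphere.fin p) (x : Sphere) :
    F x = x := by
  cases x with
  | fin p => exact h p
  | inf q hq =>
    have e : Sphere.inf q hq = northInv q := (dif_pos hq).symm
    have key := (lsc_northExpr hF hi).sa.eq_of_punctured (SAMap.id 0) (by
      filter_upwards [self_mem_nhdsWithin] with v hv q hq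
      have hb : (flip (invI q)).body ≠ 0 := by
        rw [body_flip, body_invI, hq]; exact inv_ne_zero hv
      have := northExpr_invI hi hb
      rw [h] at this
      change northExpr F (invI (flip (invI q))) = invI (flip (invI q)) at this
      rwa [invI_flip_invI (by rw [hq]; exact hv)] at this)
    have k := nb_self key (p := flip q) (by rw [body_flip, hq])
    rw [northExpr, flip_flip] at k
    replace k := congrArg flip k
    rw [flip_flip, flip_flip, show north.symm q = Sphere.inf q hq from e.symm] at k
    cases hx : F (Sphere.inf q hq) with
    | fin p =>
      exact absurd (F.injective (hx.trans (h p).symm)) (by intro h; exact Sphere.noConfusion h)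
    | inf q' hq' =>
      rw [hx] at k
      change q' = q at k
      subst k
      rfl

/-- An automorphism that fixes infinity, to first order, and that fixes zero, or infinity to
second order, is the identity. -/
theorem IsSCHomeo.rigid {F : Sphere ≃ₜ Sphere} (hF : IsSCHomeo F)
    (hi : F (north.symm 0) = north.symm 0) {K : LocalSeries} (hK : HasSeries (northExpr F) K)
    (kp : K.ap 0 = 1) (km : K.am 0 = 1)
    (h : F (Sphere.fin 0) = Sphere.fin 0 ∨ (K.ap 1 = -K.am 1 ∧ K.mp 0 = 0 ∧ K.mm 0 = 0)) (x : Sphere) :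
    F x = x := by
  set S : Pt → Pt := fun p => south (F (Sphere.fin p)) with hS
  obtain ⟨f, gp, gm, sp, sm, af, agp, agm, asp, asm, hform⟩ :=
    exists_scForm (H := S) isOpen_univ Set.univ_nonempty fun w _ => lsc_southExpr hF hi w
  replace hform := fun w => (hform w trivial).1
  obtain ⟨f', gp', gm', sp', sm', hB, f0', tp', tm', tsp', tsm'⟩ := id hK
  obtain ⟨X, hX⟩ := hB.f_fin.exists_isTaylor
  obtain ⟨X0, X1, X2⟩ := hK.taylor hB hX f0'
  rw [kp, km, one_mul] at X1
  rw [kp, km, one_mul, mul_one] at X2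
  -- Write `f'(v) = v U(v)`, where `f'` is the function of the normal form at infinity, and let `c`
  -- be the inverse of `U`; then the even component in the southern coordinate is `w c(1/w)`.
  obtain ⟨U, hU, eU⟩ := hX.exists_div X0
  have U0 : X (0 + 1) = 1 := X1
  have Ue : ∀ᶠ p in nb 0, U.eval p.z ∈ evenPart := by
    refine hU.1.eval_even_of_ofComplex ?_
    filter_upwards [eU.filter_mono nhdsWithin_le_nhds,
      hB.ofComplex.filter_mono nhdsWithin_le_nhds, self_mem_nhdsWithin] with v h1 h2 h3
    have : U.eval (algebraMap ℂ Gr v) = v⁻¹ • f'.eval (algebraMap ℂ Gr v) := by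
      rw [h1, smul_smul, inv_mul_cancel₀ h3, one_smul]
    rw [this, ← h2.1]
    exact Submodule.smul_mem _ _ (Pt.z_even _)
  obtain ⟨C, c, hC, ec⟩ := hU.exists_inverse Ue (by rw [U0]; exact isUnit_one)
  have C01 : C 0 = 1 ∧ (X 2 = 0 → C 1 = 0) := by
    have key : ∀ n ∈ evenPart, n ^ 2 = 0 → (C 0 + C 1 * n) * (1 + X 2 * n) = 1 := fun n hn h2 => by
      have h3 := pow_eq_zero_of_le h2 (by norm_num : 2 ≤ 3)
      have := nb_self ec (p := evenPt n hn) (body_of_pow h2)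
      change c.eval n * U.eval n = 1 at this
      rwa [hC.eval_of_cube hn h3, hU.eval_of_cube hn h3, h2, mul_zero, mul_zero, add_zero, add_zero,
        U0] at this
    have k0 : C 0 = 1 := by simpa using key 0 (Submodule.zero_mem _) (by simp)
    refine ⟨k0, fun hx => cancel_linear fun n hn h2 => ?_⟩
    have := key n hn h2
    rw [hx, zero_mul, add_zero, mul_one, k0, add_eq_left] at this
    rw [this, zero_mul]
  obtain ⟨C0, C1⟩ := C01
  have values : ∀ w, (S (Pt.ofComplex w)).z = f.eval (algebraMap ℂ Gr w) ∧
      (S (Pt.ofComplex w)).tp = sp.eval (algebraMap ℂ Gr w) ∧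
      (S (Pt.ofComplex w)).tm = sm.eval (algebraMap ℂ Gr w) := fun w => by
    have a := nb_self (hform w).z (body_ofComplex w)
    have b := nb_self (hform w).tp (body_ofComplex w)
    have c := nb_self (hform w).tm (body_ofComplex w)
    rw [show (Pt.ofComplex w).z = algebraMap ℂ Gr w from rfl, show (Pt.ofComplex w).tp = 0 from rfl,
      show (Pt.ofComplex w).tm = 0 from rfl] at a b c
    simp only [mul_zero, zero_mul, add_zero, sub_zero] at a b c
    exact ⟨a, b, c⟩
  -- the relation between the expressions of the automorphism near infinity
  have rel : ∀ᶠ w in cocompact ℂ, ∀ p : Pt, p.z = algebraMap ℂ Gr w →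
      (S p).z * (northExpr F (invI p)).z = 1 ∧
      (S p).tp = -(Complex.I • ((northExpr F (invI p)).tp * (S p).z)) ∧
      (S p).tm = -(Complex.I • ((northExpr F (invI p)).tm * (S p).z)) := by
    have hb : ∀ᶠ v in 𝓝[≠] (0 : ℂ), ∀ q : Pt, q.body = v → (northExpr F q).body ≠ 0 := by
      have h1 : ∀ᶠ v in 𝓝[≠] (0 : ℂ), f' ∅ v ≠ 0 := by
        have e1 : ∀ᶠ v in 𝓝 (0 : ℂ), f' ∅ v = v * U ∅ v := by
          filter_upwards [eU, hB.f_fin.eventually, hU.1.eventually] with v a b c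
          rw [← b.coord_eval, a, map_smul, c.coord_eval, smul_eq_mul]
        filter_upwards [e1.filter_mono nhdsWithin_le_nhds,
          ((hU.1.1 ∅).continuousAt.eventually_ne (hU.body_ne (by rw [U0]; exact isUnit_one))
            ).filter_mono nhdsWithin_le_nhds, self_mem_nhdsWithin] with v a b c
        rw [a]
        exact mul_ne_zero c b
      filter_upwards [h1, (nb_iff.1 (hB.z.and (hB.f_fin.body_eval))).filter_mono
        nhdsWithin_le_nhds] with v h1 h2 q hq
      obtain ⟨a, b⟩ := h2 q hq
      rw [Pt.body, a]
      simp only [map_add, map_mul, body_odd q.tp_odd, body_odd q.tm_odd, zero_mul, add_zero]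
      rw [b, hq]
      exact h1
    have hb' : ∀ᶠ w in cocompact ℂ, w ≠ 0 ∧
        ∀ q : Pt, q.body = w⁻¹ → (northExpr F q).body ≠ 0 := by
      have := tendsto_cocompact_inv (φ := fun v => v) (l := 𝓝[≠] (0 : ℂ)) tendsto_id
      refine Filter.Eventually.and ?_ (this.eventually hb)
      rw [← Metric.cobounded_eq_cocompact]; exact Bornology.eventually_ne_cobounded 0
    filter_upwards [hb'] with w ⟨hw, hv⟩ p hp
    have pb : p.body = w := by rw [Pt.body, hp, body_algebraMap]
    have e := northExpr_invI hi (p := p) (by rwa [pb])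
    have hn : (S p).body ≠ 0 := by
      intro h0
      have := hv (invI p) (by rw [body_invI, pb])
      rw [e, body_invI] at this
      exact this (by rw [inv_eq_zero]; exact h0)
    have u := Ring.mul_inverse_cancel (S p).z ((isUnit_iff_body (S p).z_even).2 hn)
    have u' := Ring.inverse_mul_cancel (S p).z ((isUnit_iff_body (S p).z_even).2 hn)
    rw [e]
    refine ⟨u, ?_, ?_⟩
    · change _ = -(Complex.I • (Complex.I • ((S p).tp * Ring.inverse (S p).z) * (S p).z))
      rw [smul_mul_assoc, mul_assoc, u', mul_one, smul_smul, Complex.I_mul_I, neg_one_smul, neg_neg]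
    · change _ = -(Complex.I • (Complex.I • ((S p).tm * Ring.inverse (S p).z) * (S p).z))
      rw [smul_mul_assoc, mul_assoc, u', mul_one, smul_smul, Complex.I_mul_I, neg_one_smul, neg_neg]
  have rel' : ∀ᶠ w in cocompact ℂ, w ≠ 0 ∧
      f.eval (algebraMap ℂ Gr w) = w • c.eval (algebraMap ℂ Gr w⁻¹) ∧
      sp.eval (algebraMap ℂ Gr w) =
        -(Complex.I • (sp'.eval (algebraMap ℂ Gr w⁻¹) * (w • c.eval (algebraMap ℂ Gr w⁻¹)))) ∧
      sm.eval (algebraMap ℂ Gr w) =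
        -(Complex.I • (sm'.eval (algebraMap ℂ Gr w⁻¹) * (w • c.eval (algebraMap ℂ Gr w⁻¹)))) := by
    filter_upwards [rel, eventually_cocompact_inv (hB.ofComplex.and (eU.and
      (eventually_ofComplex (ec.and Ue))))] with w hr ⟨hw, ⟨b1, b2, b3⟩, b4, b5, b6⟩
    obtain ⟨r1, r2, r3⟩ := hr (Pt.ofComplex w) rfl
    obtain ⟨s1, s2, s3⟩ := values w
    rw [invI_ofComplex hw] at r1 r2 r3
    have ef : f.eval (algebraMap ℂ Gr w) = w • c.eval (algebraMap ℂ Gr w⁻¹) := by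
      rw [s1, b1, b4] at r1
      have e1 : U.eval (algebraMap ℂ Gr w⁻¹) * c.eval (algebraMap ℂ Gr w⁻¹) = 1 := by
        rw [(even_commute (show U.eval (algebraMap ℂ Gr w⁻¹) ∈ evenPart from b6) _).eq]; exact b5
      have := congrArg (fun x => x * (w • c.eval (algebraMap ℂ Gr w⁻¹))) r1
      simp only [one_mul] at this
      rw [← this, mul_assoc, smul_mul_smul_comm, e1, inv_mul_cancel₀ hw, one_smul, mul_one]
    rw [← ef, ← b2, ← b3, ← s1, ← s2, ← s3]
    exact ⟨hw, rfl, r2, r3⟩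
  have hsp := odd_part_constant asp tsp' rfl hC C0 (rel'.mono fun w h => h.2.2.1)
  have hsm := odd_part_constant asm tsm' rfl hC C0 (rel'.mono fun w h => h.2.2.2)
  change ∀ k w, sp k w = coord k (-(Complex.I • K.mp 0)) at hsp
  change ∀ k w, sm k w = coord k (-(Complex.I • K.mm 0)) at hsm
  have fin0 : ∀ w, f.FinNear w ∧ sp.FinNear w ∧ sm.FinNear w := fun w =>
    ⟨(hform w).f_fin, (hform w).sp_fin, (hform w).sm_fin⟩
  -- Liouville: all components are entire, and the expansions at infinity bound their growth.
  have hf : ∀ k w, f k w = f k 0 + coord k 1 * w := fun k w => by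
    refine entire_affine (fun v => (af.1 k v trivial).differentiableAt) ?_ w
    have := hC.coordTendsto_inv k
    rw [C0] at this
    refine this.congr' ?_
    filter_upwards [rel'] with v ⟨hv, h, _⟩
    rw [← (fin0 v).1.coord_eval k, h, map_smul, smul_eq_mul, inv_mul_cancel_left₀ hv]
  have hf0 : ∀ k, f k 0 = coord k (C 1) := fun k => by
    have h1 := tendsto_cocompact_inv (tendsto_slope (hC.1.1 k))
    rw [hC.2] at h1
    refine tendsto_nhds_unique (tendsto_const_nhds.congr' ?_) h1
    filter_upwards [rel', eventually_cocompact_inv hC.1.eventually] with v ⟨hv, h, _⟩ ⟨_, h'⟩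
    rw [← h'.coord_eval, hC.apply_zero, C0, inv_inv, mul_sub, ← smul_eq_mul, ← map_smul, ← h,
      (fin0 v).1.coord_eval k, hf k v, mul_comm v, add_sub_cancel_right]
  -- The remaining constants vanish by either of the two hypotheses.
  have zero : (∀ k, f k 0 = 0) ∧ (∀ k w, sp k w = 0) ∧ ∀ k w, sm k w = 0 := by
    rcases h with h | ⟨ha, hp, hm⟩
    · obtain ⟨s1, s2, s3⟩ := values 0
      have S0 : S (Pt.ofComplex 0) = 0 := by rw [ofComplex_zero, hS]; simp only [h]; rfl
      rw [S0] at s1 s2 s3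
      refine ⟨fun k => ?_, fun k w => ?_, fun k w => ?_⟩
      · rw [← (fin0 0).1.coord_eval k, ← s1]; exact map_zero _
      · rw [hsp k w, ← hsp k 0, ← (fin0 0).2.1.coord_eval k, ← s2]; exact map_zero _
      · rw [hsm k w, ← hsm k 0, ← (fin0 0).2.2.coord_eval k, ← s3]; exact map_zero _
    · refine ⟨fun k => ?_, fun k w => ?_, fun k w => ?_⟩
      · rw [hf0, C1 (by rw [X2, ha, add_neg_cancel, smul_zero]), map_zero]
      · rw [hsp, hp, smul_zero, neg_zero, map_zero]
      · rw [hsm, hm, smul_zero, neg_zero, map_zero]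
  obtain ⟨z0, zp, zm⟩ := zero
  obtain rfl : sp = 0 := by funext k w; exact zp k w
  obtain rfl : sm = 0 := by funext k w; exact zm k w
  have d0 : CoeffFamily.diff 0 = 0 := by funext k w; exact deriv_const w 0
  have form : ∀ p : Pt, (S p).z = f.eval p.z ∧ (S p).tp = p.tp * gp.eval p.z ∧
      (S p).tm = p.tm * gm.eval p.z := fun p => by
    have a := nb_self (hform p.body).z rfl
    have b := nb_self (hform p.body).tp rfl
    have c := nb_self (hform p.body).tm rfl
    rw [d0, eval_zero_family p.z_even] at a b c
    simp only [mul_zero, add_zero, zero_add, sub_zero] at a b c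
    exact ⟨a, b, c⟩
  have hgp := linear_part_constant (s' := sp') agp tp' kp hC C0 (by
    filter_upwards [rel, rel', eventually_cocompact_inv (nb_iff.1 hB.tp)] with w hr ⟨hw, h1, _⟩ ⟨_, b⟩
    refine ⟨hw, fun e he => ?_⟩
    let p : Pt := ⟨algebraMap ℂ Gr w, e, 0, algebraMap_mem_even w, he, Submodule.zero_mem _⟩
    obtain ⟨i1, i2, i3⟩ := invI_of_complex_z (p := p) hw rfl
    have h2 := (hr p rfl).2.1
    rw [(form p).1, (form p).2.1, b (invI p) (by rw [Pt.body, i1, body_algebraMap]), i1, i2, i3,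
      show p.tm = 0 from rfl, smul_zero, mul_zero, zero_mul, add_zero, smul_mul_assoc] at h2
    rw [← h1]
    exact h2)
  have hgm := linear_part_constant (s' := sm') agm tm' km hC C0 (by
    filter_upwards [rel, rel', eventually_cocompact_inv (nb_iff.1 hB.tm)] with w hr ⟨hw, h1, _⟩ ⟨_, b⟩
    refine ⟨hw, fun e he => ?_⟩
    let p : Pt := ⟨algebraMap ℂ Gr w, 0, e, algebraMap_mem_even w, Submodule.zero_mem _, he⟩
    obtain ⟨i1, i2, i3⟩ := invI_of_complex_z (p := p) hw rfl
    have h2 := (hr p rfl).2.2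
    rw [(form p).1, (form p).2.2, b (invI p) (by rw [Pt.body, i1, body_algebraMap]), i1, i2, i3,
      show p.tp = 0 from rfl, smul_zero, zero_mul, zero_mul, sub_zero, smul_mul_assoc] at h2
    rw [← h1]
    exact h2)
  have ev : ∀ (g : CoeffFamily) (φ : ℂ → ℂ), (∀ k w, g k w = coord k 1 * φ w) →
      AnalyticOnNhd ℂ φ Set.univ → ∀ p : Pt, g.eval p.z = hat φ p.z := fun g φ h ha p => by
    rw [show g = scalarFamily φ 1 by funext k w; exact h k w,
      nb_self (scalarFamily_finNear (ha p.body trivial) 1).2 rfl, mul_one]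
  refine eq_id_of_fin hF hi (fun p => ?_) x
  rw [exists_south_expr hi]
  congr 1
  obtain ⟨a, b, c⟩ := form p
  rw [ev gp (fun _ => 1) (fun k w => by rw [hgp, mul_one]) (fun _ _ => analyticAt_const),
    hat_const _ p.z_even, map_one, mul_one] at b
  rw [ev gm (fun _ => 1) (fun k w => by rw [hgm, mul_one]) (fun _ _ => analyticAt_const),
    hat_const _ p.z_even, map_one, mul_one] at c
  rw [ev f (fun w => w) (fun k w => by rw [hf, z0, zero_add]) (fun _ _ => analyticAt_id),
    hat_id p.z_even] at a
  exact Pt.ext a b c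

/-! ### Superconformal equivalence and canonical representatives -/

theorem inseparable_pt_iff {p q : Pt} : Inseparable p q ↔ p.body = q.body := by
  rw [← (Topology.IsInducing.mk rfl : Topology.IsInducing Pt.body).inseparable_iff,
    inseparable_iff_eq]

theorem body_eq_of_inseparable {x y : Sphere} (h : Inseparable x y)
    {φ : OpenPartialHomeomorph Sphere Pt} (hx : x ∈ φ.source) (hy : y ∈ φ.source) :
    (φ x).body = (φ y).body := by
  refine inseparable_pt_iff.1 ?_
  rw [Inseparable, ← φ.map_nhds_eq hx, ← φ.map_nhds_eq hy, h.nhds_eq]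

/-- Having the same body means being topologically indistinguishable; in particular it is
preserved by homeomorphisms. -/
theorem sameBody_iff {x y : Sphere} : SameBody x y ↔ Inseparable x y := by
  constructor
  · rintro ⟨φ, hφ, hx, hy, h⟩
    have h1 := inseparable_pt_iff.2 h
    rw [← φ.left_inv hx, ← φ.left_inv hy]
    rcases hφ with rfl | rfl
    · exact h1.map continuous_fin
    · exact h1.map continuous_northInv
  · intro h
    obtain ⟨φ, hφ, hx⟩ := exists_atlas x
    have hy : y ∈ φ.source := (h.mem_open_iff φ.open_source).1 hx
    exact ⟨φ, hφ, hx, hy, body_eq_of_inseparable h hx hy⟩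

theorem SameBody.of_map (F : Sphere ≃ₜ Sphere) {x y : Sphere} (h : SameBody (F x) (F y)) :
    SameBody x y := by
  rw [sameBody_iff] at h ⊢
  have := h.map F.symm.continuous
  rwa [F.symm_apply_apply, F.symm_apply_apply] at this

theorem sameBody_fin {p q : Pt} (h : p.body = q.body) :
    SameBody (Sphere.fin p) (Sphere.fin q) :=
  ⟨south, Or.inl rfl, south_mem_source p, south_mem_source q, h⟩

/-- A point that has not the same body as the north pole lies in the southern neighborhood. -/
theorem exists_fin {x : Sphere} (h : ¬ SameBody (north.symm 0) x) : ∃ p, x = Sphere.fin p := by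
  cases x with
  | fin p => exact ⟨p, rfl⟩
  | inf q hq =>
    have e : Sphere.inf q hq = northInv q := (dif_pos hq).symm
    exact absurd (sameBody_iff.2 (e ▸ inseparable_northInv (body_zero.trans hq.symm))) h

theorem exists_nbhd_iff {F : Sphere ≃ₜ Sphere} {Ω Ω' : OpenPartialHomeomorph Sphere Pt} {x : Sphere}
    (h : x ∈ Ω.source) (h' : F x ∈ Ω'.source) :
    (∃ W : Set Sphere, IsOpen W ∧ x ∈ W ∧ W ⊆ Ω.source ∧ W ⊆ F ⁻¹' Ω'.source ∧
      ∀ y ∈ W, Ω y = Ω' (F y)) ↔ ∀ᶠ y in 𝓝 x, Ω y = Ω' (F y) := by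
  constructor
  · rintro ⟨W, hW, hx, -, -, e⟩
    filter_upwards [hW.mem_nhds hx] with y hy using e y hy
  · intro e
    obtain ⟨W, h1, h2, h3⟩ := eventually_nhds_iff.1 (e.and ((Ω.open_source.eventually_mem h).and
      ((Ω'.open_source.preimage F.continuous).eventually_mem h')))
    exact ⟨W, h2, h3, fun y hy => (h1 y hy).2.1, fun y hy => (h1 y hy).2.2, fun y hy => (h1 y hy).1⟩

theorem superconformallyEquivalent_iff {n : ℕ} {T T' : Tubed n} :
    SuperconformallyEquivalent n T T' ↔ ∃ F : Sphere ≃ₜ Sphere, IsSCHomeo F ∧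
      ∀ j, F (T.pt j) = T'.pt j ∧ ∀ᶠ x in 𝓝 (T.pt j), T.chart j x = T'.chart j (F x) := by
  constructor
  · rintro ⟨F, h1, h2, h3⟩
    obtain ⟨F, rfl, hF⟩ := exists_isSCHomeo h1 h2
    refine ⟨F, hF, fun j => ?_⟩
    obtain ⟨a, b⟩ := h3 j
    exact ⟨a, (exists_nbhd_iff (T.mem_source j)
      (by rw [show F (T.pt j) = _ from a]; exact T'.mem_source j)).1 b⟩
  · rintro ⟨F, hF, h⟩
    refine ⟨F.toEquiv, hF.isSuperconformalMap, hF.symm.isSuperconformalMap, fun j => ?_⟩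
    obtain ⟨a, b⟩ := h j
    exact ⟨a, (exists_nbhd_iff (T.mem_source j) (by rw [a]; exact T'.mem_source j)).2 b⟩

theorem sameGerms_iff {n : ℕ} {T T' : Tubed n} : SameGerms T T' ↔
    ∀ j, T.pt j = T'.pt j ∧ ∀ᶠ x in 𝓝 (T.pt j), T.chart j x = T'.chart j x := by
  refine forall_congr' fun j => and_congr_right fun e => ?_
  exact exists_nbhd_iff (F := Homeomorph.refl _) (T.mem_source j)
    (by change T.pt j ∈ _; rw [e]; exact T'.mem_source j)

theorem superconformallyEquivalent_equivalence (n : ℕ) :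
    Equivalence (SuperconformallyEquivalent n) where
  refl T := superconformallyEquivalent_iff.2
    ⟨Homeomorph.refl _, IsSCHomeo.refl, fun _ => ⟨rfl, .of_forall fun _ => rfl⟩⟩
  symm h := by
    obtain ⟨F, hF, h⟩ := superconformallyEquivalent_iff.1 h
    refine superconformallyEquivalent_iff.2 ⟨F.symm, hF.symm, fun j => ?_⟩
    obtain ⟨a, b⟩ := h j
    have e := (F.symm_apply_eq.2 a.symm)
    refine ⟨e, ?_⟩
    rw [← e] at b
    filter_upwards [F.symm.continuous.continuousAt.eventually b] with x hx
    rw [hx, F.apply_symm_apply]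
  trans h h' := by
    obtain ⟨F, hF, h⟩ := superconformallyEquivalent_iff.1 h
    obtain ⟨G, hG, h'⟩ := superconformallyEquivalent_iff.1 h'
    refine superconformallyEquivalent_iff.2 ⟨F.trans G, hF.trans hG, fun j => ?_⟩
    obtain ⟨a, b⟩ := h j
    obtain ⟨a', b'⟩ := h' j
    refine ⟨(congrArg G a).trans a', ?_⟩
    rw [← a] at b'
    filter_upwards [b, F.continuous.continuousAt.eventually b'] with x h1 h2
    exact h1.trans h2

theorem SameGerms.superconformallyEquivalent {n : ℕ} {T T' : Tubed n} (h : SameGerms T T') :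
    SuperconformallyEquivalent n T T' :=
  superconformallyEquivalent_iff.2 ⟨Homeomorph.refl _, IsSCHomeo.refl, sameGerms_iff.1 h⟩

theorem isSuperconformalChart_restrOpen {Ω : OpenPartialHomeomorph Sphere Pt}
    (h : IsSuperconformalChart Ω) {U : Set Sphere} (hU : IsOpen U) :
    IsSuperconformalChart (Ω.restrOpen U hU) :=
  isSuperconformalChart_of_compatAt fun _ hx =>
    ⟨Ω, h, hx.1, CompatAt.refl (Ω := Ω) hx.1, CompatAt.refl (Ω := Ω) hx.1⟩

/-- The image of a sphere with tubes under an automorphism, with the local coordinates restricted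
to given neighborhoods of the punctures. -/
theorem exists_move {n : ℕ} (T : Tubed n) {F : Sphere ≃ₜ Sphere} (hF : IsSCHomeo F)
    {U : Fin (n + 1) → Set Sphere} (hU : ∀ j, IsOpen (U j)) (hm : ∀ j, F (T.pt j) ∈ U j)
    (hs : ∀ j, U j ⊆ F.symm ⁻¹' (T.chart j).source) :
    ∃ T' : Tubed n, SuperconformallyEquivalent n T T' ∧ (∀ j, T'.pt j = F (T.pt j)) ∧
      (∀ j, (T'.chart j).source = U j) ∧ ∀ j x, T'.chart j x = T.chart j (F.symm x) := by
  let T' : Tubed n :=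
    { pt := fun j => F (T.pt j)
      distinct := fun j k hjk h => T.distinct j k hjk (h.of_map F)
      chart := fun j => (F.symm.transOpenPartialHomeomorph (T.chart j)).restrOpen (U j) (hU j)
      superconformal := fun j =>
        isSuperconformalChart_restrOpen (hF.symm.pull (T.superconformal j)) (hU j)
      mem_source := fun j => ⟨by
        change F.symm (F (T.pt j)) ∈ (T.chart j).source
        rw [F.symm_apply_apply]; exact T.mem_source j, hm j⟩
      vanish := fun j => by
        change T.chart j (F.symm (F (T.pt j))) = 0
        rw [F.symm_apply_apply]; exact T.vanish j }
  refine ⟨T', superconformallyEquivalent_iff.2 ⟨F, hF, fun j => ⟨rfl, .of_forall fun x => ?_⟩⟩,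
    fun _ => rfl, fun j => Set.inter_eq_right.2 (hs j), fun _ _ => rfl⟩
  change _ = T.chart j (F.symm (F x))
  rw [F.symm_apply_apply]

theorem exists_disc_south {x : Pt} {U : Set Sphere} (hU : IsOpen U) (h : Sphere.fin x ∈ U) :
    ∃ r : ℝ, 0 < r ∧ south.symm '' ball x r ⊆ U := by
  have h1 : ∀ᶠ p in nb x.body, Sphere.fin p ∈ U := by
    rw [nb_eq_nhds]; exact continuous_fin.continuousAt.eventually (hU.mem_nhds h)
  obtain ⟨r, hr, h2⟩ := Metric.eventually_nhds_iff_ball.1 (nb_iff.1 h1)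
  refine ⟨r, hr, ?_⟩
  rintro _ ⟨p, hp, rfl⟩
  exact h2 p.body (by rw [mem_ball_iff_norm]; exact hp) p rfl

theorem exists_disc_north {U : Set Sphere} (hU : IsOpen U) (h : north.symm 0 ∈ U) :
    ∃ r : ℝ, 0 < r ∧ north.symm '' ball 0 r ⊆ U := by
  have h1 : ∀ᶠ p in nb (0 : Pt).body, northInv p ∈ U := by
    rw [nb_eq_nhds]; exact continuous_northInv.continuousAt.eventually (hU.mem_nhds h)
  obtain ⟨r, hr, h2⟩ := Metric.eventually_nhds_iff_ball.1 (nb_iff.1 h1)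
  refine ⟨r, hr, ?_⟩
  rintro _ ⟨p, hp, rfl⟩
  exact h2 p.body (by rw [mem_ball_iff_norm]; exact hp) p rfl

theorem isOpen_ball (x : Pt) (r : ℝ) : IsOpen (ball x r) :=
  isOpen_lt (continuous_norm.comp (continuous_ptBody.sub continuous_const)) continuous_const

theorem mem_ball_self (x : Pt) {r : ℝ} (hr : 0 < r) : x ∈ ball x r := by
  change ‖x.body - x.body‖ < r
  rwa [sub_self, norm_zero]

theorem positions_last {m : ℕ} (x : Fin m → Pt) : positions x (Fin.last m) = 0 :=
  Fin.snoc_last (α := fun _ => Pt) _ _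

theorem positions_castSucc {m : ℕ} (x : Fin m → Pt) (j : Fin m) : positions x j.castSucc = x j :=
  Fin.snoc_castSucc (α := fun _ => Pt) _ _ _

theorem exists_hasSeries_infinity {n : ℕ} (T : Tubed n) (h : T.pt 0 = north.symm 0) :
    ∃ K, HasSeries (inNorth (T.chart 0)) K :=
  exists_hasSeries_inNorth (T.superconformal 0) (h ▸ T.mem_source 0) (h ▸ T.vanish 0)

/-- The canonical form in terms of the superconformal power series at infinity. The conditions on
the local coordinates at the other punctures hold automatically. -/
theorem isCanonical_succ_iff {m : ℕ} {T : Tubed (m + 1)} : IsCanonical T ↔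
    ∃ x : Fin m → Pt, T.pt 0 = north.symm 0 ∧
      (∀ j : Fin (m + 1), T.pt j.succ = Sphere.fin (positions x j)) ∧
      (∃ r : ℝ, 0 < r ∧ (T.chart 0).source = north.symm '' ball 0 r) ∧
      (∀ j : Fin (m + 1), ∃ r : ℝ, 0 < r ∧
        (T.chart j.succ).source = south.symm '' ball (positions x j) r) ∧
      ∃ K, HasSeries (inNorth (T.chart 0)) K ∧ K.ap 0 = 1 ∧ K.am 0 = 1 := by
  constructor
  · rintro ⟨x, r, -, -, hr, h0, hj, s0, sj, hN, -⟩
    obtain ⟨K, hK⟩ := exists_hasSeries_infinity T h0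
    exact ⟨x, h0, hj, ⟨_, hr 0, s0⟩, fun j => ⟨_, hr _, sj j⟩, K, hK,
      (normalizedAtInfinity_iff hK fun p hp => inSouth_eq _ hp).1 hN⟩
  · rintro ⟨x, h0, hj, ⟨r0, hr0, s0⟩, hs, K, hK, hN⟩
    choose r hr sj using hs
    refine ⟨x, Fin.cons r0 r, fun j => ?_, fun j k hjk e => ?_, Fin.cases hr0 hr, h0, hj, s0, sj,
      (normalizedAtInfinity_iff hK fun p hp => inSouth_eq _ hp).2 hN, fun j => ?_⟩
    · rw [isUnit_iff_body (x j).z_even]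
      intro e
      refine T.distinct j.castSucc.succ (Fin.last m).succ (fun h => ?_) ?_
      · exact (Fin.castSucc_lt_last j).ne (Fin.succ_injective _ h)
      · rw [hj, hj, positions_last, positions_castSucc]
        exact sameBody_fin (e.trans body_zero.symm)
    · refine T.distinct j.castSucc.succ k.castSucc.succ (fun h => hjk ?_) ?_
      · exact Fin.castSucc_injective _ (Fin.succ_injective _ h)
      · rw [hj, hj, positions_castSucc, positions_castSucc]
        exact sameBody_fin e
    · obtain ⟨L, hL⟩ := exists_hasSeries_atPoint (x := positions x j) (T.superconformal j.succ)
        (hj j ▸ T.mem_source j.succ) (hj j ▸ T.vanish j.succ)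
      exact vanishesWithInvertibleLimit hL fun p => inSouth_eq_atPoint _ _ p

theorem isCanonical_zero_iff {T : Tubed 0} : IsCanonical T ↔ T.pt 0 = north.symm 0 ∧
      (∃ r : ℝ, 0 < r ∧ (T.chart 0).source = north.symm '' ball 0 r) ∧
      ∃ K, HasSeries (inNorth (T.chart 0)) K ∧ K.ap 0 = 1 ∧ K.am 0 = 1 ∧
        K.ap 1 = -K.am 1 ∧ K.mp 0 = 0 ∧ K.mm 0 = 0 := by
  constructor
  · rintro ⟨h0, s0, hN, hO⟩
    obtain ⟨K, hK⟩ := exists_hasSeries_infinity T h0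
    have := (normalizedAtInfinity_iff hK fun p hp => inSouth_eq _ hp).1 hN
    exact ⟨h0, s0, K, hK, this.1, this.2,
      (oneTubeNormalized_iff hK (fun p hp => inSouth_eq _ hp) this.1 this.2).1 hO⟩
  · rintro ⟨h0, s0, K, hK, hp, hm, hO⟩
    exact ⟨h0, s0, (normalizedAtInfinity_iff hK fun p hp => inSouth_eq _ hp).2 ⟨hp, hm⟩,
      (oneTubeNormalized_iff hK (fun p hp => inSouth_eq _ hp) hp hm).2 hO⟩

/-! ### Normalizing the local coordinate at infinity -/

theorem body_eq_zero {p : Pt} (hz : p.z = 0) : p.body = 0 := by rw [Pt.body, hz, map_zero]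

theorem HasSeries.tp_of_z_eq_zero {H : Pt → Pt} {K : LocalSeries} (h : HasSeries H K) {p : Pt}
    (hz : p.z = 0) (hm : p.tp * p.tm = 0) : (H p).tp = p.tp * K.ap 0 := by
  rw [(h.apply (body_eq_zero hz)).tp_eq (by simp [hz]) (by simp [hz]) hm, hz, mul_zero,
    zero_add]

theorem HasSeries.tm_of_z_eq_zero {H : Pt → Pt} {K : LocalSeries} (h : HasSeries H K) {p : Pt}
    (hz : p.z = 0) (hm : p.tp * p.tm = 0) : (H p).tm = p.tm * K.am 0 := by
  rw [(h.apply (body_eq_zero hz)).tm_eq (by simp [hz]) (by simp [hz]) hm, hz, mul_zero,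
    zero_add]

theorem HasSeries.z_of_z_eq_zero {H : Pt → Pt} {K : LocalSeries} (h : HasSeries H K) {p : Pt}
    (hz : p.z = 0) : (H p).z = 0 := by
  rw [(h.apply (body_eq_zero hz)).z_eq (by simp [hz]) (by simp [hz]) (by simp [hz])
    (by simp [hz])]
  simp [hz]

theorem HasSeries.ap_zero_eq {H : Pt → Pt} {K : LocalSeries} (h : HasSeries H K) {c : Gr}
    (hc : ∀ p : Pt, p.z = 0 → p.tm = 0 → (H p).tp = p.tp * c) : K.ap 0 = c :=
  cancel_odd_eq fun e he => by
    let p : Pt := ⟨0, e, 0, Submodule.zero_mem _, he, Submodule.zero_mem _⟩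
    exact (h.tp_of_z_eq_zero (p := p) rfl (mul_zero _)).symm.trans (hc p rfl rfl)

theorem HasSeries.am_zero_eq {H : Pt → Pt} {K : LocalSeries} (h : HasSeries H K) {c : Gr}
    (hc : ∀ p : Pt, p.z = 0 → p.tp = 0 → (H p).tm = p.tm * c) : K.am 0 = c :=
  cancel_odd_eq fun e he => by
    let p : Pt := ⟨0, 0, e, Submodule.zero_mem _, Submodule.zero_mem _, he⟩
    exact (h.tm_of_z_eq_zero (p := p) rfl (zero_mul _)).symm.trans (hc p rfl rfl)

/-- The values at a nilpotent even argument. -/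
theorem HasSeries.odd_of_cube {H : Pt → Pt} {K : LocalSeries} (h : HasSeries H K) {n : Gr}
    (hn : n ∈ evenPart) (h3 : n ^ 3 = 0) :
    (H (evenPt n hn)).tp = K.mp 0 * n + K.mp 1 * n ^ 2 ∧
      (H (evenPt n hn)).tm = K.mm 0 * n + K.mm 1 * n ^ 2 := by
  obtain ⟨f, gp, gm, sp, sm, hB, -, -, -, tsp, tsm⟩ := h
  have e1 := nb_self hB.tp (p := evenPt n hn) (body_of_pow h3)
  have e2 := nb_self hB.tm (p := evenPt n hn) (body_of_pow h3)
  rw [show (evenPt n hn).tp = 0 from rfl, show (evenPt n hn).tm = 0 from rfl,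
    show (evenPt n hn).z = n from rfl] at e1 e2
  simp only [zero_mul, add_zero, sub_zero] at e1 e2
  rw [e1, e2, tsp.eval_of_cube hn h3, tsm.eval_of_cube hn h3]
  simp [shiftSeq]

theorem HasSeries.z_of_cube {H : Pt → Pt} {K : LocalSeries} (h : HasSeries H K)
    (hp : K.ap 0 = 1) (hm : K.am 0 = 1) {n : Gr} (hn : n ∈ evenPart) (h3 : n ^ 3 = 0) :
    (H (evenPt n hn)).z = n + ((1 : ℂ) / 2) • ((K.am 1 + K.ap 1) * n ^ 2) := by
  rw [(h.apply (p := evenPt n hn) (body_of_pow h3)).z_eq h3 (zero_mul _) (zero_mul _)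
    (by rw [show (evenPt n hn).tp = 0 from rfl, zero_mul, zero_mul]), hp, hm,
    show (evenPt n hn).tp = 0 from rfl, show (evenPt n hn).tm = 0 from rfl]
  simp only [one_mul, mul_one, zero_mul, add_zero]
  rfl

theorem inNorth_pull {F : Sphere ≃ₜ Sphere} {B : Pt → Pt} {Ω : OpenPartialHomeomorph Sphere Pt}
    (h : ∀ᶠ q in nb 0, F.symm (northInv q) = northInv (B q)) {q : Pt} (hq : q.body = 0) :
    inNorth (F.symm.transOpenPartialHomeomorph Ω) q = inNorth Ω (flip (B (flip q))) := by
  have := nb_self h (p := flip q) (by rw [body_flip, hq])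
  change Ω (F.symm (northInv (flip q))) = Ω (northInv (flip (flip (B (flip q)))))
  rw [this, flip_flip]

/-- The local coordinate at infinity can be normalized by a rescaling of the sphere. -/
theorem exists_normalizing_scaling {Ω : OpenPartialHomeomorph Sphere Pt}
    (hΩ : IsSuperconformalChart Ω) (h : north.symm 0 ∈ Ω.source) (h0 : Ω (north.symm 0) = 0) :
    ∃ F : Sphere ≃ₜ Sphere, IsSCHomeo F ∧ F (Sphere.fin 0) = Sphere.fin 0 ∧
      F.symm (north.symm 0) = north.symm 0 ∧
      ∃ K, HasSeries (inNorth (F.symm.transOpenPartialHomeomorph Ω)) K ∧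
        K.ap 0 = 1 ∧ K.am 0 = 1 := by
  obtain ⟨L, hL⟩ := exists_hasSeries_inNorth hΩ h h0
  have hb := inverse_mem_even (L.ap_even 0)
  have ha := inverse_mem_even (L.am_even 0)
  obtain ⟨F, hF, h1, -, h2⟩ := exists_scaling ha hb (inverse_mem_unit L.am_unit)
    (inverse_mem_unit L.ap_unit)
  have hi : F.symm (north.symm 0) = north.symm 0 := by
    have := nb_self h2 (p := 0) body_zero
    rwa [show scale hb ha 0 = 0 by ext1 <;> exact mul_zero _] at this
  obtain ⟨K, hK⟩ := exists_hasSeries_inNorth (hF.symm.pull hΩ)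
    (by change F.symm _ ∈ Ω.source; rwa [hi]) (by change Ω (F.symm _) = 0; rwa [hi])
  refine ⟨F, hF, ?_, hi, K, hK, hK.ap_zero_eq fun p hz hm => ?_, hK.am_zero_eq fun p hz hm => ?_⟩
  · rw [h1]
    congr 1
    ext1 <;> exact mul_zero _
  · rw [inNorth_pull h2 (body_eq_zero hz), hL.tp_of_z_eq_zero]
    · change -(Ring.inverse (L.ap 0) * -p.tp) * L.ap 0 = _
      rw [mul_neg, neg_neg, (even_commute hb _).eq, mul_assoc, Ring.inverse_mul_cancel _ L.ap_unit]
    · change _ * _ * p.z = 0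
      rw [hz, mul_zero]
    · change _ * -(_ * -p.tm) = 0
      rw [hm, neg_zero, mul_zero, neg_zero, mul_zero]
  · rw [inNorth_pull h2 (body_eq_zero hz), hL.tm_of_z_eq_zero]
    · change -(Ring.inverse (L.am 0) * -p.tm) * L.am 0 = _
      rw [mul_neg, neg_neg, (even_commute ha _).eq, mul_assoc, Ring.inverse_mul_cancel _ L.am_unit]
    · change _ * _ * p.z = 0
      rw [hz, mul_zero]
    · change -(_ * -p.tp) * _ = 0
      rw [hm, neg_zero, mul_zero, neg_zero, zero_mul]

theorem shiftNorth_zero (x : Pt) : shiftNorth x 0 = 0 := by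
  ext1
  · exact zero_mul _
  · change (0 + Complex.I • (x.tp * 0)) * _ = 0
    simp
  · change (0 + Complex.I • (x.tm * 0)) * _ = 0
    simp

theorem shiftNorth_evenPt (x : Pt) {n : Gr} (hn : n ∈ evenPart) (h3 : n ^ 3 = 0) :
    (shiftNorth x (evenPt n hn)).z = n + x.z * n ^ 2 ∧
    (shiftNorth x (evenPt n hn)).tp = Complex.I • (x.tp * (n + x.z * n ^ 2)) ∧
    (shiftNorth x (evenPt n hn)).tm = Complex.I • (x.tm * (n + x.z * n ^ 2)) := by
  have hd : shiftDenom x (evenPt n hn) = 1 - x.z * n := by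
    change 1 - x.z * n - Complex.I • (0 * x.tm) - Complex.I • (0 * x.tp) = _
    simp
  have c := (even_commute x.z_even n).eq
  have hi : Ring.inverse (shiftDenom x (evenPt n hn)) = 1 + x.z * n + (x.z * n) ^ 2 := by
    refine inverse_eq_of_mul (shiftDenom_even _ _) ?_
    have h3' : (x.z * n) ^ 3 = 0 := by
      rw [(show Commute x.z n from c).mul_pow, h3, mul_zero]
    rw [hd]
    calc (1 - x.z * n) * (1 + x.z * n + (x.z * n) ^ 2) = 1 - (x.z * n) ^ 3 := by noncomm_ring
      _ = 1 := by rw [h3', sub_zero]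
  have hm : n * (1 + x.z * n + (x.z * n) ^ 2) = n + x.z * n ^ 2 := by
    rw [(show Commute x.z n from c).mul_pow]
    calc n * (1 + x.z * n + x.z ^ 2 * n ^ 2) = n + n * x.z * n + n * x.z ^ 2 * n ^ 2 := by noncomm_ring
      _ = n + x.z * n ^ 2 + x.z ^ 2 * n ^ 3 := by
        rw [← c, (even_commute hn (x.z ^ 2)).eq]; noncomm_ring
      _ = _ := by rw [h3, mul_zero, add_zero]
  refine ⟨?_, ?_, ?_⟩
  · change n * Ring.inverse _ = _
    rw [hi, hm]
  · change (0 + Complex.I • (x.tp * n)) * Ring.inverse _ = _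
    rw [hi, zero_add, smul_mul_assoc, mul_assoc, hm]
  · change (0 + Complex.I • (x.tm * n)) * Ring.inverse _ = _
    rw [hi, zero_add, smul_mul_assoc, mul_assoc, hm]

theorem odd_mul_inverse {e a : Gr} (he : e ∈ oddPart) {c : ℂ} (ha : a ∈ oddPart) :
    e * Ring.inverse (1 + c • (e * a)) = e := by
  have ev : 1 + c • (e * a) ∈ evenPart :=
    Submodule.add_mem _ one_mem_even (Submodule.smul_mem _ _ (odd_mul_odd he ha))
  have u : IsUnit (1 + c • (e * a)) := by
    rw [isUnit_iff_body ev, map_add, map_one, map_smul, map_mul, body_odd he, zero_mul, smul_zero,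
      add_zero]
    exact one_ne_zero
  have h : e * (1 + c • (e * a)) = e := by
    rw [mul_add, mul_one, mul_smul_comm, ← mul_assoc, odd_sq he, zero_mul, smul_zero, add_zero]
  conv_lhs => enter [1]; rw [← h]
  rw [mul_assoc, Ring.mul_inverse_cancel _ u, mul_one]

/-- With one tube, a shift of the sphere removes the remaining freedom in the local coordinate. -/
theorem exists_normalizing_shift {Ω : OpenPartialHomeomorph Sphere Pt}
    (hΩ : IsSuperconformalChart Ω) (h : north.symm 0 ∈ Ω.source) {L : LocalSeries}
    (hL : HasSeries (inNorth Ω) L) (lp : L.ap 0 = 1) (lm : L.am 0 = 1) :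
    ∃ F : Sphere ≃ₜ Sphere, IsSCHomeo F ∧ F.symm (north.symm 0) = north.symm 0 ∧
      ∃ K, HasSeries (inNorth (F.symm.transOpenPartialHomeomorph Ω)) K ∧
        K.ap 0 = 1 ∧ K.am 0 = 1 ∧ K.ap 1 = -K.am 1 ∧ K.mp 0 = 0 ∧ K.mm 0 = 0 := by
  -- The choice of `y` makes the new coefficients `m_{1/2}^±` and `a_1⁺ + a_1⁻` vanish.
  let y : Pt := ⟨-(((1 : ℂ) / 2) • (L.am 1 + L.ap 1)), -(Complex.I • L.mp 0), -(Complex.I • L.mm 0),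
    Submodule.neg_mem _ (Submodule.smul_mem _ _ (Submodule.add_mem _ (L.am_even 1) (L.ap_even 1))),
    Submodule.neg_mem _ (Submodule.smul_mem _ _ (L.mp_odd 0)),
    Submodule.neg_mem _ (Submodule.smul_mem _ _ (L.mm_odd 0))⟩
  obtain ⟨F, hF, -, -, h2⟩ := exists_shift (negPt y)
  rw [negPt_negPt] at h2
  have hi : F.symm (north.symm 0) = north.symm 0 := by
    have := nb_self h2 (p := 0) body_zero
    rwa [shiftNorth_zero] at this
  have h0 : Ω (north.symm 0) = 0 := by
    have := hL.map_zero
    rwa [inNorth, flip_zero] at this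
  obtain ⟨K, hK⟩ := exists_hasSeries_inNorth (hF.symm.pull hΩ)
    (by change F.symm _ ∈ Ω.source; rwa [hi]) (by change Ω (F.symm _) = 0; rwa [hi])
  have kp : K.ap 0 = 1 := hK.ap_zero_eq fun p hz hm => by
    have hd : shiftDenom y (flip p) = 1 + Complex.I • (p.tp * y.tm) := by
      change 1 - y.z * p.z - Complex.I • (-p.tp * y.tm) - Complex.I • (-p.tm * y.tp) = _
      rw [hz, hm]
      simp
    have e1 : (flip (shiftNorth y (flip p))).tp = p.tp := by
      change -((-p.tp + Complex.I • (y.tp * p.z)) * Ring.inverse (shiftDenom y (flip p))) = _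
      rw [hz, mul_zero, smul_zero, add_zero, neg_mul, neg_neg, hd, odd_mul_inverse p.tp_odd y.tm_odd]
    have e2 : (flip (shiftNorth y (flip p))).tm = 0 := by
      change -((-p.tm + Complex.I • (y.tm * p.z)) * _) = _
      rw [hz, hm]
      simp
    rw [inNorth_pull h2 (body_eq_zero hz), hL.tp_of_z_eq_zero, e1, lp]
    · change p.z * _ = 0
      rw [hz, zero_mul]
    · rw [e2, mul_zero]
  have km : K.am 0 = 1 := hK.am_zero_eq fun p hz hm => by
    have hd : shiftDenom y (flip p) = 1 + Complex.I • (p.tm * y.tp) := by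
      change 1 - y.z * p.z - Complex.I • (-p.tp * y.tm) - Complex.I • (-p.tm * y.tp) = _
      rw [hz, hm]
      simp
    have e1 : (flip (shiftNorth y (flip p))).tm = p.tm := by
      change -((-p.tm + Complex.I • (y.tm * p.z)) * Ring.inverse (shiftDenom y (flip p))) = _
      rw [hz, mul_zero, smul_zero, add_zero, neg_mul, neg_neg, hd, odd_mul_inverse p.tm_odd y.tp_odd]
    have e2 : (flip (shiftNorth y (flip p))).tp = 0 := by
      change -((-p.tp + Complex.I • (y.tp * p.z)) * _) = _
      rw [hz, hm]
      simp
    rw [inNorth_pull h2 (body_eq_zero hz), hL.tm_of_z_eq_zero, e1, lm]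
    · change p.z * _ = 0
      rw [hz, zero_mul]
    · rw [e2, zero_mul]
  -- the values at the points `(n, 0, 0)` with `n³ = 0`
  have val : ∀ n (hn : n ∈ evenPart), n ^ 3 = 0 → ∃ p : Pt, p.body = 0 ∧
      p.z = n + y.z * n ^ 2 ∧ p.tp = -(L.mp 0 * (n + y.z * n ^ 2)) ∧
      p.tm = -(L.mm 0 * (n + y.z * n ^ 2)) ∧
      inNorth (F.symm.transOpenPartialHomeomorph Ω) (evenPt n hn) = inNorth Ω p := fun n hn h3 => by
    obtain ⟨a, b, c⟩ := shiftNorth_evenPt y hn h3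
    have hf : flip (evenPt n hn) = evenPt n hn := by
      ext1
      · rfl
      · exact neg_zero
      · exact neg_zero
    have hb : (evenPt n hn).body = 0 := body_of_pow h3
    refine ⟨flip (shiftNorth y (evenPt n hn)), ?_, a, ?_, ?_, by rw [inNorth_pull h2 hb, hf]⟩
    · rw [body_flip, body_shiftNorth_zero y hb]
    · change -(shiftNorth y (evenPt n hn)).tp = _
      rw [b]
      change -(Complex.I • (-(Complex.I • L.mp 0) * _)) = _
      rw [neg_mul, smul_neg, smul_mul_assoc, smul_smul, Complex.I_mul_I, neg_one_smul, neg_neg]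
    · change -(shiftNorth y (evenPt n hn)).tm = _
      rw [c]
      change -(Complex.I • (-(Complex.I • L.mm 0) * _)) = _
      rw [neg_mul, smul_neg, smul_mul_assoc, smul_smul, Complex.I_mul_I, neg_one_smul, neg_neg]
  have first : K.mp 0 = 0 ∧ K.mm 0 = 0 := by
    have key : ∀ n (_ : n ∈ evenPart), n ^ 2 = 0 → K.mp 0 * n = 0 * n ∧ K.mm 0 * n = 0 * n :=
        fun n hn hn2 => by
      have h3 := pow_eq_zero_of_le hn2 (by norm_num : 2 ≤ 3)
      obtain ⟨p, hb, hz, hp, hm, e⟩ := val n hn h3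
      obtain ⟨e1, e2⟩ := hK.odd_of_cube hn h3
      rw [hn2, mul_zero, add_zero] at hz hp hm e1 e2
      have hnn : n * n = 0 := by rw [← pow_two, hn2]
      have hpm : p.tp * p.tm = 0 := by
        rw [hp, hm, neg_mul_neg, mul_assoc, ← mul_assoc n, (even_commute hn (L.mm 0)).eq,
          mul_assoc (L.mm 0), hnn, mul_zero, mul_zero]
      rw [e, (hL.apply hb).tp_eq (by rw [hz, hn2])
        (by rw [hp, hz, neg_mul, mul_assoc, hnn, mul_zero, neg_zero]) hpm, lp, mul_one, hz, hp,
        add_neg_cancel] at e1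
      rw [e, (hL.apply hb).tm_eq (by rw [hz, hn2])
        (by rw [hm, hz, neg_mul, mul_assoc, hnn, mul_zero, neg_zero]) hpm, lm, mul_one, hz, hm,
        add_neg_cancel] at e2
      rw [zero_mul]
      exact ⟨e1.symm, e2.symm⟩
    exact ⟨cancel_linear fun n hn h => (key n hn h).1, cancel_linear fun n hn h => (key n hn h).2⟩
  have second : ((1 : ℂ) / 2) • (K.am 1 + K.ap 1) = 0 := cancel_quadratic fun n hn h3 => by
    obtain ⟨p, hb, hz, hp, hm, e⟩ := val n hn h3
    have e1 := hK.z_of_cube kp km hn h3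
    have h4 := pow_eq_zero_of_le h3 (by norm_num : 3 ≤ 4)
    have hc : Commute y.z n := even_commute y.z_even n
    set v := n + y.z * n ^ 2 with hv
    have v2 : v ^ 2 = n ^ 2 := by
      have : v ^ 2 = n ^ 2 + (y.z * n ^ 3 + n * y.z * n ^ 2 + y.z * n ^ 2 * y.z * n ^ 2) := by
        rw [hv]; noncomm_ring
      rw [this, h3, ← hc.eq, (even_commute (even_mul_even y.z_even (even_pow hn 2)) y.z).eq,
        mul_assoc, mul_assoc, mul_assoc y.z (n ^ 2), ← pow_succ', ← pow_add, h3, h4]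
      simp
    have ve : v ∈ evenPart := hz ▸ p.z_even
    have v3 : v ^ 3 = 0 := by
      rw [pow_succ, v2, hv, mul_add, ← mul_assoc, (even_commute (even_pow hn 2) y.z).eq, mul_assoc,
        ← pow_succ, ← pow_add, h3, h4, mul_zero, add_zero]
    have v3' : v * v ^ 2 = 0 := by rw [← pow_succ', v3]
    rw [e, (hL.apply hb).z_eq (by rw [hz, v3])
      (by rw [hp, hz, neg_mul, mul_assoc, v3', mul_zero, neg_zero])
      (by rw [hm, hz, neg_mul, mul_assoc, v3', mul_zero, neg_zero])
      (by
        rw [hp, hm, hz, neg_mul_neg, mul_assoc, mul_assoc, mul_assoc, ← pow_two,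
          ← mul_assoc v, (even_commute ve _).eq, mul_assoc _ v, v3', mul_zero, mul_zero]),
      lp, lm, one_mul, one_mul, one_mul, mul_one, mul_one, mul_one, hz, hp, hm, v2] at e1
    -- The two products of odd coefficients cancel.
    have e2 : -(L.mp 0 * v) * L.mm 0 * v + -(L.mm 0 * v) * L.mp 0 * v = 0 := by
      rw [neg_mul, neg_mul, neg_mul, neg_mul, mul_assoc (L.mp 0), (even_commute ve _).eq,
        mul_assoc (L.mm 0) v, (even_commute ve (L.mp 0)).eq, ← mul_assoc (L.mp 0),
        ← mul_assoc (L.mm 0), odd_anticomm (L.mp_odd 0) (L.mm_odd 0)]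
      simp
    rw [add_assoc, e2, add_zero, hv, add_assoc, add_right_inj] at e1
    change -(((1 : ℂ) / 2) • (L.am 1 + L.ap 1)) * n ^ 2 + _ = _ at e1
    rw [neg_mul, smul_mul_assoc, neg_add_cancel] at e1
    rw [smul_mul_assoc, ← e1, zero_mul]
  refine ⟨F, hF, hi, K, hK, kp, km, ?_, first.1, first.2⟩
  have := (smul_eq_zero.1 second).resolve_left (by norm_num)
  rw [add_comm] at this
  exact eq_neg_of_add_eq_zero_left this

/-! ### Uniqueness of canonical representatives -/

/-- An automorphism that fixes infinity and is compatible with normalized local coordinates at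
infinity is the identity, if it fixes zero or if the coordinates are normalized to second order. -/
theorem eq_id_of_normalized {F : Sphere ≃ₜ Sphere} (hF : IsSCHomeo F)
    (hi : F (north.symm 0) = north.symm 0) {Ω Ω' : OpenPartialHomeomorph Sphere Pt}
    (e : ∀ᶠ x in 𝓝 (north.symm 0), Ω x = Ω' (F x)) {L L' : LocalSeries}
    (hL : HasSeries (inNorth Ω) L) (hL' : HasSeries (inNorth Ω') L')
    (lp : L.ap 0 = 1) (lm : L.am 0 = 1) (lp' : L'.ap 0 = 1) (lm' : L'.am 0 = 1)
    (h : F (Sphere.fin 0) = Sphere.fin 0 ∨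
      ((L.ap 1 = -L.am 1 ∧ L.mp 0 = 0 ∧ L.mm 0 = 0) ∧
        L'.ap 1 = -L'.am 1 ∧ L'.mp 0 = 0 ∧ L'.mm 0 = 0)) (x : Sphere) : F x = x := by
  obtain ⟨K, hK⟩ := exists_hasSeries (lsc_northExpr hF hi) (northExpr_zero hi)
  have key : ∀ q : Pt, q.body = 0 → inNorth Ω' (northExpr F q) = inNorth Ω q := fun q hq => by
    have i : Inseparable (north.symm 0) (north.symm (flip q)) :=
      inseparable_northInv (by rw [body_flip, hq, body_zero])
    have h1 : Ω (north.symm (flip q)) = Ω' (F (north.symm (flip q))) := by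
      rw [i.nhds_eq] at e
      exact e.self_of_nhds
    have h2 : F (north.symm (flip q)) ∈ north.source := by
      refine ((i.map F.continuous).mem_open_iff north.open_source).1 ?_
      rw [hi]; exact north_mem_source 0
    rw [inNorth, inNorth, h1, northExpr, flip_flip, north.left_inv h2]
  have body0 : ∀ q : Pt, q.body = 0 → (northExpr F q).body = 0 := fun q hq => by
    have := nb_self (lsc_northExpr hF hi).sa.body_eq hq
    have h0 := nb_self (lsc_northExpr hF hi).sa.body_eq body_zero
    rw [this, hq, ← body_zero, ← h0, northExpr_zero hi]
  -- First order coefficients are compared at points with `z = 0`, the others at `(n, 0, 0)` with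
  -- `n` nilpotent.
  have kp : K.ap 0 = 1 := hK.ap_zero_eq fun p hz hm => by
    have e1 : (northExpr F p).tm = 0 := by
      rw [hK.tm_of_z_eq_zero hz (by rw [hm, mul_zero]), hm, zero_mul]
    have := hL'.tp_of_z_eq_zero (p := northExpr F p) (hK.z_of_z_eq_zero hz) (by rw [e1, mul_zero])
    rw [key p (body_eq_zero hz), hL.tp_of_z_eq_zero hz (by rw [hm, mul_zero]), lp, lp', mul_one,
      mul_one] at this
    rw [mul_one, this]
  have km : K.am 0 = 1 := hK.am_zero_eq fun p hz hm => by
    have e1 : (northExpr F p).tp = 0 := by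
      rw [hK.tp_of_z_eq_zero hz (by rw [hm, zero_mul]), hm, zero_mul]
    have := hL'.tm_of_z_eq_zero (p := northExpr F p) (hK.z_of_z_eq_zero hz) (by rw [e1, zero_mul])
    rw [key p (body_eq_zero hz), hL.tm_of_z_eq_zero hz (by rw [hm, zero_mul]), lm, lm', mul_one,
      mul_one] at this
    rw [mul_one, this]
  refine hF.rigid hi hK kp km (h.imp_right ?_) x
  rintro ⟨⟨l1, l2, l3⟩, l1', l2', l3'⟩
  have first : ∀ n (_ : n ∈ evenPart), n ^ 2 = 0 → K.mp 0 * n = 0 * n ∧ K.mm 0 * n = 0 * n :=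
      fun n hn h2 => by
    have h3 := pow_eq_zero_of_le h2 (by norm_num : 2 ≤ 3)
    have hnn : n * n = 0 := by rw [← pow_two, h2]
    have hb : (evenPt n hn).body = 0 := body_of_pow h2
    obtain ⟨e1, e2⟩ := hK.odd_of_cube hn h3
    obtain ⟨e3, e4⟩ := hL.odd_of_cube hn h3
    have e5 := hK.z_of_cube kp km hn h3
    have hpm : (northExpr F (evenPt n hn)).tp * (northExpr F (evenPt n hn)).tm = 0 := by
      rw [e1, e2, h2, mul_zero, add_zero, mul_zero, add_zero, mul_assoc, ← mul_assoc n,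
        (even_commute hn _).eq, mul_assoc, hnn, mul_zero, mul_zero]
    rw [h2, mul_zero, add_zero] at e1 e2 e3 e4
    rw [h2, mul_zero, smul_zero, add_zero] at e5
    have f1 := (hL'.apply (body0 _ hb)).tp_eq (by rw [e5, h2])
      (by rw [e1, e5, mul_assoc, hnn, mul_zero]) hpm
    have f2 := (hL'.apply (body0 _ hb)).tm_eq (by rw [e5, h2])
      (by rw [e2, e5, mul_assoc, hnn, mul_zero]) hpm
    rw [key _ hb, e3, l2, l2', zero_mul, zero_mul, zero_add, lp', mul_one, e1] at f1
    rw [key _ hb, e4, l3, l3', zero_mul, zero_mul, zero_add, lm', mul_one, e2] at f2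
    rw [zero_mul]
    exact ⟨f1.symm, f2.symm⟩
  have mp0 : K.mp 0 = 0 := cancel_linear fun n hn h => (first n hn h).1
  have mm0 : K.mm 0 = 0 := cancel_linear fun n hn h => (first n hn h).2
  have second : ((1 : ℂ) / 2) • (K.am 1 + K.ap 1) = 0 := cancel_quadratic fun n hn h3 => by
    have hb : (evenPt n hn).body = 0 := body_of_pow h3
    obtain ⟨e1, e2⟩ := hK.odd_of_cube hn h3
    have e5 := hK.z_of_cube kp km hn h3
    have e6 := hL.z_of_cube lp lm hn h3
    rw [mp0, zero_mul, zero_add] at e1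
    rw [mm0, zero_mul, zero_add] at e2
    set P := northExpr F (evenPt n hn) with hP
    have hz : n ^ 2 * P.z = 0 := by
      have h4 := pow_eq_zero_of_le h3 (by norm_num : 3 ≤ 4)
      rw [e5, mul_add, ← pow_succ, h3, mul_smul_comm, ← mul_assoc, (even_commute (even_pow hn 2) _).eq,
        mul_assoc, ← pow_add, h4, mul_zero, smul_zero, add_zero]
    have P3 : P.z ^ 3 = 0 := by
      have : P.z ^ 2 = n * P.z := by
        rw [pow_two, e5, add_mul, ← e5, smul_mul_assoc, mul_assoc, hz, mul_zero, smul_zero, add_zero]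
      rw [pow_succ, this, mul_assoc, ← pow_two, this, ← mul_assoc, ← pow_two, hz]
    have f := (hL'.apply (body0 _ hb)).z_eq P3
      (by rw [← hP, e1, pow_two P.z, mul_assoc, ← mul_assoc (n ^ 2), hz, zero_mul, mul_zero])
      (by rw [← hP, e2, pow_two P.z, mul_assoc, ← mul_assoc (n ^ 2), hz, zero_mul, mul_zero])
      (by rw [← hP, e2, mul_assoc, mul_assoc, hz, mul_zero, mul_zero])
    rw [key _ hb, e6, ← hP, lp', lm', l2', l3', one_mul, one_mul, one_mul, mul_one, l1, l1',
      add_neg_cancel, add_neg_cancel, zero_mul, zero_mul, smul_zero, mul_zero, mul_zero, zero_mul,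
      add_zero, add_zero, add_zero, add_zero, e5, left_eq_add] at f
    rw [smul_mul_assoc, f, zero_mul]
  refine ⟨?_, mp0, mm0⟩
  have := (smul_eq_zero.1 second).resolve_left (by norm_num)
  rw [add_comm] at this
  exact eq_neg_of_add_eq_zero_left this

/-- Superconformally equivalent canonical superspheres agree up to the radii of the discs. -/
theorem sameGerms_of_equivalent {n : ℕ} {T T' : Tubed n} (hT : IsCanonical T) (hT' : IsCanonical T')
    (h : SuperconformallyEquivalent n T T') : SameGerms T T' := by
  obtain ⟨F, hF, hj⟩ := superconformallyEquivalent_iff.1 h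
  have hid : ∀ x, F x = x := by
    cases n with
    | zero =>
      obtain ⟨p0, -, L, hL, lp, lm, l⟩ := isCanonical_zero_iff.1 hT
      obtain ⟨p0', -, L', hL', lp', lm', l'⟩ := isCanonical_zero_iff.1 hT'
      obtain ⟨a, b⟩ := hj 0
      rw [p0, p0'] at a
      rw [p0] at b
      exact eq_id_of_normalized hF a b hL hL' lp lm lp' lm' (Or.inr ⟨l, l'⟩)
    | succ m =>
      obtain ⟨x, p0, px, -, -, L, hL, lp, lm⟩ := isCanonical_succ_iff.1 hT
      obtain ⟨x', p0', px', -, -, L', hL', lp', lm'⟩ := isCanonical_succ_iff.1 hT'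
      obtain ⟨a, b⟩ := hj 0
      rw [p0, p0'] at a
      rw [p0] at b
      have c := (hj (Fin.last m).succ).1
      rw [px, px', positions_last, positions_last] at c
      exact eq_id_of_normalized hF a b hL hL' lp lm lp' lm' (Or.inl c)
  refine sameGerms_iff.2 fun j => ?_
  obtain ⟨a, b⟩ := hj j
  rw [hid] at a
  exact ⟨a, b.mono fun x hx => by rw [hx, hid]⟩

/-! ### Existence of canonical representatives -/

theorem exists_to_zero (x : Sphere) : ∃ F : Sphere ≃ₜ Sphere, IsSCHomeo F ∧ F x = Sphere.fin 0 := by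
  have hfin : ∀ p, ∃ F : Sphere ≃ₜ Sphere, IsSCHomeo F ∧ F (Sphere.fin p) = Sphere.fin 0 := fun p => by
    obtain ⟨F, hF, h, -⟩ := exists_shift p
    exact ⟨F, hF, by rw [h, shift_self]⟩
  cases x with
  | fin p => exact hfin p
  | inf q hq =>
    obtain ⟨G, hG, -, h⟩ := exists_inversion
    obtain ⟨F, hF, h'⟩ := hfin (flip q)
    refine ⟨G.trans F, hG.trans hF, ?_⟩
    rw [show Sphere.inf q hq = northInv q from (dif_pos hq).symm]
    change F (G (northInv q)) = _
    rw [h, h']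

theorem exists_to_infinity (x : Sphere) :
    ∃ F : Sphere ≃ₜ Sphere, IsSCHomeo F ∧ F x = north.symm 0 := by
  obtain ⟨F, hF, h⟩ := exists_to_zero x
  obtain ⟨G, hG, h', -⟩ := exists_inversion
  refine ⟨F.trans G, hF.trans hG, ?_⟩
  change G (F x) = _
  rw [h, h']
  rfl

theorem isOpen_disc_south (x : Pt) (r : ℝ) : IsOpen (south.symm '' ball x r) :=
  isOpenMap_fin _ (isOpen_ball x r)

theorem isOpen_disc_north (x : Pt) (r : ℝ) : IsOpen (north.symm '' ball x r) :=
  isOpenMap_northInv _ (isOpen_ball x r)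

theorem exists_canonical_zero (T : Tubed 0) :
    ∃ T' : Tubed 0, IsCanonical T' ∧ SuperconformallyEquivalent 0 T T' := by
  -- Move the puncture to infinity, scale, and shift.
  obtain ⟨F₁, hF₁, h1⟩ := exists_to_infinity (T.pt 0)
  have e1 : F₁.symm (north.symm 0) = T.pt 0 := by rw [← h1, F₁.symm_apply_apply]
  have hΩ₁ := hF₁.symm.pull (T.superconformal 0)
  have m1 : F₁.symm (north.symm 0) ∈ (T.chart 0).source := by rw [e1]; exact T.mem_source 0
  obtain ⟨F₂, hF₂, -, e2, L, hL, lp, lm⟩ := exists_normalizing_scaling hΩ₁ m1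
    (by change T.chart 0 (F₁.symm _) = 0; rw [e1]; exact T.vanish 0)
  have m2 : F₁.symm (F₂.symm (north.symm 0)) ∈ (T.chart 0).source := by rwa [e2]
  obtain ⟨F₃, hF₃, e3, K, hK, kk⟩ := exists_normalizing_shift (hF₂.symm.pull hΩ₁) m2 hL lp lm
  set F := F₁.trans (F₂.trans F₃) with hFdef
  have hF : IsSCHomeo F := hF₁.trans (hF₂.trans hF₃)
  have eF : F.symm (north.symm 0) = T.pt 0 := by
    change F₁.symm (F₂.symm (F₃.symm (north.symm 0))) = _
    rw [e3, e2, e1]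
  have hF0 : F (T.pt 0) = north.symm 0 := by rw [← eF, F.apply_symm_apply]
  obtain ⟨r, hr, hs⟩ := exists_disc_north ((T.chart 0).open_source.preimage F.symm.continuous)
    (by rw [Set.mem_preimage, eF]; exact T.mem_source 0)
  obtain ⟨T', hT', h1, h2, h3⟩ := exists_move T hF (U := fun _ => north.symm '' ball 0 r)
    (fun _ => isOpen_disc_north _ _)
    (Fin.cases (by rw [hF0]; exact Set.mem_image_of_mem _ (mem_ball_self 0 hr)) fun j => j.elim0)
    (Fin.cases hs fun j => j.elim0)
  refine ⟨T', isCanonical_zero_iff.2 ⟨by rw [h1, hF0], ⟨r, hr, h2 0⟩, K, ?_, kk⟩, hT'⟩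
  rwa [show inNorth (T'.chart 0) = inNorth (F₃.symm.transOpenPartialHomeomorph
    (F₂.symm.transOpenPartialHomeomorph (F₁.symm.transOpenPartialHomeomorph (T.chart 0)))) from
    funext fun q => h3 0 _]

theorem exists_canonical_succ {m : ℕ} (T : Tubed (m + 1)) :
    ∃ T' : Tubed (m + 1), IsCanonical T' ∧ SuperconformallyEquivalent (m + 1) T T' := by
  -- Move `p_0` to infinity, then the last puncture to zero by a shift, and scale; the scaling fixes
  -- both points.
  obtain ⟨F₁, hF₁, h1⟩ := exists_to_infinity (T.pt 0)
  obtain ⟨p, hp⟩ := exists_fin (x := F₁ (T.pt (Fin.last m).succ)) fun h =>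
    T.distinct 0 (Fin.last m).succ (Fin.succ_ne_zero _).symm (SameBody.of_map F₁ (h1 ▸ h))
  obtain ⟨F₂, hF₂, h2, -, e2⟩ := exists_shift p
  replace e2 : F₂.symm (north.symm 0) = north.symm 0 := by
    have := nb_self e2 (p := 0) body_zero
    rwa [shiftNorth_zero] at this
  have e1 : F₁.symm (F₂.symm (north.symm 0)) = T.pt 0 := by rw [e2, ← h1, F₁.symm_apply_apply]
  have hΩ := hF₂.symm.pull (hF₁.symm.pull (T.superconformal 0))
  have m1 : F₁.symm (F₂.symm (north.symm 0)) ∈ (T.chart 0).source := by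
    rw [e1]; exact T.mem_source 0
  obtain ⟨F₃, hF₃, h3, e3, K, hK, kk⟩ := exists_normalizing_scaling hΩ m1
    (by change T.chart 0 (F₁.symm (F₂.symm _)) = 0; rw [e1]; exact T.vanish 0)
  set F := F₁.trans (F₂.trans F₃) with hFdef
  have hF : IsSCHomeo F := hF₁.trans (hF₂.trans hF₃)
  have eF : F.symm (north.symm 0) = T.pt 0 := by
    change F₁.symm (F₂.symm (F₃.symm (north.symm 0))) = _
    rw [e3, e1]
  have hF0 : F (T.pt 0) = north.symm 0 := by rw [← eF, F.apply_symm_apply]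
  have hl : F (T.pt (Fin.last m).succ) = Sphere.fin 0 := by
    change F₃ (F₂ (F₁ _)) = _
    rw [hp, h2, shift_self, h3]
  have hfin : ∀ j : Fin (m + 1), ∃ p, F (T.pt j.succ) = Sphere.fin p := fun j =>
    exists_fin fun h => T.distinct 0 j.succ (Fin.succ_ne_zero _).symm
      (SameBody.of_map F (hF0 ▸ h))
  choose P hP using hfin
  let x : Fin m → Pt := fun j => P j.castSucc
  have hx : ∀ j : Fin (m + 1), F (T.pt j.succ) = Sphere.fin (positions x j) := fun j => by
    induction j using Fin.lastCases with
    | last => rw [hl, positions_last]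
    | cast j => rw [hP, positions_castSucc]
  obtain ⟨r0, hr0, hs0⟩ := exists_disc_north ((T.chart 0).open_source.preimage F.symm.continuous)
    (by rw [Set.mem_preimage, eF]; exact T.mem_source 0)
  have hd : ∀ j : Fin (m + 1), ∃ r : ℝ, 0 < r ∧
      south.symm '' ball (positions x j) r ⊆ F.symm ⁻¹' (T.chart j.succ).source := fun j =>
    exists_disc_south ((T.chart j.succ).open_source.preimage F.symm.continuous) (by
      rw [Set.mem_preimage, ← hx, F.symm_apply_apply]; exact T.mem_source _)
  choose r hr hs using hd
  obtain ⟨T', hT', h1, h2, h3⟩ := exists_move T hF (U := Fin.cons (north.symm '' ball 0 r0)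
      fun j => south.symm '' ball (positions x j) (r j))
    (Fin.cases (isOpen_disc_north _ _) fun j => isOpen_disc_south _ _)
    (Fin.cases (by rw [hF0]; exact Set.mem_image_of_mem _ (mem_ball_self 0 hr0)) fun j => by
      rw [hx]; exact Set.mem_image_of_mem _ (mem_ball_self _ (hr j)))
    (Fin.cases hs0 hs)
  refine ⟨T', isCanonical_succ_iff.2 ⟨x, by rw [h1, hF0], fun j => by rw [h1, hx],
    ⟨r0, hr0, h2 0⟩, fun j => ⟨r j, hr j, h2 j.succ⟩, K, ?_, kk⟩, hT'⟩
  rwa [show inNorth (T'.chart 0) = inNorth (F₃.symm.transOpenPartialHomeomorph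
    (F₂.symm.transOpenPartialHomeomorph (F₁.symm.transOpenPartialHomeomorph (T.chart 0)))) from
    funext fun q => h3 0 _]

/-- Every sphere with tubes is superconformally equivalent to a canonical one. -/
theorem exists_canonical {n : ℕ} (T : Tubed n) :
    ∃ T' : Tubed n, IsCanonical T' ∧ SuperconformallyEquivalent n T T' := by
  cases n with
  | zero => exact exists_canonical_zero T
  | succ m => exact exists_canonical_succ T

/-! ### The power series data of canonical superspheres -/

/-- The sign change `flip` of the odd coordinates, as a homeomorphism. -/
def flipHomeo : Pt ≃ₜ Pt where
  toFun := flip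
  invFun := flip
  left_inv := flip_flip
  right_inv := flip_flip
  continuous_toFun := continuous_to_pt.2 (continuous_ptBody.congr fun p => (body_flip p).symm)
  continuous_invFun := continuous_to_pt.2 (continuous_ptBody.congr fun p => (body_flip p).symm)

theorem continuous_shift (x : Pt) : Continuous (shift x) :=
  continuous_to_pt.2 ((continuous_ptBody.sub continuous_const).congr fun p => (body_shift x p).symm)

/-- The shift that moves `x` to zero, as a homeomorphism of superspace. -/
def shiftHomeo (x : Pt) : Pt ≃ₜ Pt where
  toFun := shift x
  invFun := shift (negPt x)
  left_inv := shift_negPt x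
  right_inv := shift_shift_negPt x
  continuous_toFun := continuous_shift x
  continuous_invFun := continuous_shift _

theorem eventually_north_iff {P : Sphere → Prop} :
    (∀ᶠ x in 𝓝 (north.symm 0), P x) ↔ ∀ᶠ q in nb 0, P (north.symm (flip q)) := by
  rw [← north.symm.map_nhds_eq (show (0 : Pt) ∈ north.symm.source from trivial), eventually_map]
  have h := flipHomeo.map_nhds_eq 0
  rw [show flipHomeo 0 = 0 from flip_zero] at h
  conv_lhs => rw [← h]
  rw [eventually_map, ← nb_eq_nhds, body_zero]
  rfl

theorem eventually_fin_iff {P : Sphere → Prop} {x : Pt} :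
    (∀ᶠ y in 𝓝 (Sphere.fin x), P y) ↔ ∀ᶠ p in nb 0, P (Sphere.fin (shift (negPt x) p)) := by
  have h1 := south.symm.map_nhds_eq (x := x) trivial
  have h := (shiftHomeo x).symm.map_nhds_eq 0
  rw [show (shiftHomeo x).symm 0 = x from shift_negPt_zero x] at h
  rw [← h, Filter.map_map] at h1
  rw [show Sphere.fin x = south.symm x from rfl, ← h1, eventually_map, ← nb_eq_nhds, body_zero]
  rfl

theorem HasSeries.congr {H H' : Pt → Pt} {K : LocalSeries} (h : HasSeries H K)
    (e : ∀ᶠ p in nb 0, H' p = H p) : HasSeries H' K :=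
  .of_evalsTo h.converges (h.evalsTo.and e |>.mono fun _ ⟨a, b⟩ => b ▸ a)

theorem HasSeries.unique {H : Pt → Pt} {K K' : LocalSeries} (h : HasSeries H K)
    (h' : HasSeries H K') : K = K' :=
  LocalSeries.unique h.evalsTo h'.evalsTo

theorem HasSeries.eventually_eq {H H' : Pt → Pt} {K : LocalSeries} (h : HasSeries H K)
    (h' : HasSeries H' K) : ∀ᶠ p in nb 0, H p = H' p :=
  (h.evalsTo.and h'.evalsTo).mono fun _ ⟨a, b⟩ => a.unique b

/-- Two local coordinates at infinity have the same germ if and only if they have the same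
series. -/
theorem eventually_eq_north_iff {Ω Ω' : OpenPartialHomeomorph Sphere Pt} {K K' : LocalSeries}
    (h : HasSeries (inNorth Ω) K) (h' : HasSeries (inNorth Ω') K') :
    (∀ᶠ x in 𝓝 (north.symm 0), Ω x = Ω' x) ↔ K = K' := by
  rw [eventually_north_iff]
  constructor
  · exact fun e => h.unique (h'.congr e)
  · rintro rfl
    exact h.eventually_eq h'

theorem eventually_eq_fin_iff {Ω Ω' : OpenPartialHomeomorph Sphere Pt} {K K' : LocalSeries} {x : Pt}
    (h : HasSeries (atPoint Ω x) K) (h' : HasSeries (atPoint Ω' x) K') :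
    (∀ᶠ y in 𝓝 (Sphere.fin x), Ω y = Ω' y) ↔ K = K' := by
  rw [eventually_fin_iff]
  constructor
  · exact fun e => h.unique (h'.congr e)
  · rintro rfl
    exact h.eventually_eq h'

/-- A convergent superconformal power series, composed with a change of the coordinate, is a
superconformal chart defined on a disc. -/
theorem LocalSeries.Converges.exists_chart {K : LocalSeries} (hK : K.Converges)
    {φ : OpenPartialHomeomorph Sphere Pt} (hφ : φ ∈ atlas) (B : Pt ≃ₜ Pt) (hB : ∀ w, LSC B w)
    (hB' : ∀ w, LSC B.symm w) : ∃ Ω H, IsSuperconformalChart Ω ∧ HasSeries H K ∧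
      (∀ p, Ω (φ.symm p) = H (B p)) ∧
      ∃ r : ℝ, 0 < r ∧ Ω.source = φ.symm '' (B ⁻¹' ball 0 r) := by
  obtain ⟨H, hH⟩ := hK.exists_hasSeries
  obtain ⟨e, r, hr, hs, rfl, he⟩ := hH.exists_chart
  have hφt : ∀ p, p ∈ φ.target := fun p => by rw [atlas_target hφ]; trivial
  have hΩ : ∀ p, φ.trans (B.transOpenPartialHomeomorph e) (φ.symm p) = e (B p) := fun p => by
    change e (B (φ (φ.symm p))) = _
    rw [φ.right_inv (hφt p)]
  refine ⟨φ.trans (B.transOpenPartialHomeomorph e), e, ?_, hH, hΩ, r, hr, ?_⟩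
  · refine isSuperconformalChart_of_compatAt fun x hx => ⟨φ, atlas_isSuperconformalChart hφ, hx.1, ?_⟩
    obtain ⟨h1, h2⟩ := he (B (φ x)) hx.2
    rw [← bodyMap_eq (hB _).sa] at h1
    refine ⟨?_, ((h1.comp (hB _)).congr (.of_forall hΩ) : LSC _ _)⟩
    have h3 := (hB' (bodyMap e.symm (e (B (φ x))).body)).comp h2
    refine h3.congr (.of_forall fun q => ?_)
    change φ (φ.symm (B.symm (e.symm q))) = _
    rw [φ.right_inv (hφt _)]
  · rw [← hs]
    ext x
    constructor
    · exact fun hx => ⟨φ x, hx.2, φ.left_inv hx.1⟩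
    · rintro ⟨p, hp, rfl⟩
      refine ⟨φ.map_target (hφt p), ?_⟩
      change B (φ (φ.symm p)) ∈ e.source
      rwa [φ.right_inv (hφt p)]

theorem exists_chart_infinity {K : LocalSeries} (hK : K.Converges) :
    ∃ Ω, IsSuperconformalChart Ω ∧ HasSeries (inNorth Ω) K ∧ Ω (north.symm 0) = 0 ∧
      ∃ r : ℝ, 0 < r ∧ Ω.source = north.symm '' ball 0 r := by
  obtain ⟨Ω, H, hΩ, hH, e, r, hr, hs⟩ :=
    hK.exists_chart (φ := north) (Or.inr rfl) flipHomeo lsc_flip lsc_flip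
  refine ⟨Ω, hΩ, hH.congr (.of_forall fun q => ?_), ?_, r, hr, ?_⟩
  · rw [inNorth, e]
    exact congrArg H (flip_flip q)
  · rw [e, show flipHomeo 0 = 0 from flip_zero, hH.map_zero]
  · rw [hs]
    congr 1

theorem exists_chart_at {K : LocalSeries} (hK : K.Converges) (x : Pt) :
    ∃ Ω, IsSuperconformalChart Ω ∧ HasSeries (atPoint Ω x) K ∧ Ω (Sphere.fin x) = 0 ∧
      ∃ r : ℝ, 0 < r ∧ Ω.source = south.symm '' ball x r := by
  obtain ⟨Ω, H, hΩ, hH, e, r, hr, hs⟩ := hK.exists_chart (φ := south) (Or.inl rfl) (shiftHomeo x)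
    (lsc_shift x) (lsc_shift (negPt x))
  refine ⟨Ω, hΩ, hH.congr (.of_forall fun q => ?_), ?_, r, hr, ?_⟩
  · exact (e _).trans (congrArg H (shift_shift_negPt x q))
  · refine (e x).trans ?_
    rw [show shiftHomeo x x = 0 from shift_self x, hH.map_zero]
  · rw [hs]
    congr 1
    ext p
    change ‖(shift x p).body - (0 : Pt).body‖ < r ↔ ‖p.body - x.body‖ < r
    rw [body_shift, body_zero, sub_zero]

/-- Having given data, in terms of germs of maps instead of convergent expansions. -/
theorem hasData_iff {m : ℕ} {T : Tubed (m + 1)} {d : ModuliData m} : HasData T d ↔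
    T.pt 0 = north.symm 0 ∧ (∀ j : Fin (m + 1), T.pt j.succ = Sphere.fin (positions d.x j)) ∧
      (∃ r : ℝ, 0 < r ∧ (T.chart 0).source = north.symm '' ball 0 r) ∧
      (∀ j : Fin (m + 1), ∃ r : ℝ, 0 < r ∧
        (T.chart j.succ).source = south.symm '' ball (positions d.x j) r) ∧
      HasSeries (inNorth (T.chart 0)) (d.H 0) ∧
      ∀ j : Fin (m + 1), HasSeries (atPoint (T.chart j.succ) (positions d.x j)) (d.H j.succ) := by
  constructor
  · rintro ⟨hc, hp, h0, hj⟩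
    replace hp : ∀ j : Fin (m + 1), T.pt j.succ = Sphere.fin (positions d.x j) := hp
    obtain ⟨x, p0, px, s0, sx, -⟩ := isCanonical_succ_iff.1 hc
    have e : ∀ j, positions x j = positions d.x j := fun j =>
      Sphere.fin.inj ((px j).symm.trans (hp j))
    refine ⟨p0, hp, s0, fun j => e j ▸ sx j, ?_, fun j => ?_⟩
    · exact (expandsAtInfinity_iff (T.superconformal 0) (p0 ▸ T.mem_source 0)
        (d.converges 0)).1 h0
    · exact (expandsAt_iff (hp j ▸ T.mem_source j.succ) (d.converges _)).1 (hj j)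
  · rintro ⟨p0, hp, s0, sx, h0, hj⟩
    exact ⟨isCanonical_succ_iff.2 ⟨d.x, p0, hp, s0, sx, d.H 0, h0, d.normalized_plus,
      d.normalized_minus⟩, hp, (expandsAtInfinity_iff (T.superconformal 0) (p0 ▸ T.mem_source 0)
        (d.converges 0)).2 h0, fun j =>
      (expandsAt_iff (hp j ▸ T.mem_source j.succ) (d.converges _)).2 (hj j)⟩

theorem hasOneTubeData_iff {T : Tubed 0} {d : OneTubeData} : HasOneTubeData T d ↔
    T.pt 0 = north.symm 0 ∧ (∃ r : ℝ, 0 < r ∧ (T.chart 0).source = north.symm '' ball 0 r) ∧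
      HasSeries (inNorth (T.chart 0)) d.K := by
  constructor
  · rintro ⟨hc, h⟩
    obtain ⟨p0, s0, -⟩ := isCanonical_zero_iff.1 hc
    exact ⟨p0, s0, (expandsAtInfinity_iff (T.superconformal 0) (p0 ▸ T.mem_source 0) d.converges).1 h⟩
  · rintro ⟨p0, s0, h⟩
    exact ⟨isCanonical_zero_iff.2 ⟨p0, s0, d.K, h, d.normalized_plus, d.normalized_minus, d.a_one,
      d.mp_zero, d.mm_zero⟩,
      (expandsAtInfinity_iff (T.superconformal 0) (p0 ▸ T.mem_source 0) d.converges).2 h⟩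

theorem exists_hasData {m : ℕ} {T : Tubed (m + 1)} (hT : IsCanonical T) :
    ∃ d : ModuliData m, HasData T d := by
  obtain ⟨x, -, hu, hd, -⟩ := id hT
  obtain ⟨x', p0, px, s0, sx, K, hK, kp, km⟩ := isCanonical_succ_iff.1 hT
  obtain ⟨x, -, hu, hd, -, -, px', -⟩ := hT
  obtain rfl : x = x' := funext fun j => by
    have := Sphere.fin.inj ((px' j.castSucc).symm.trans (px j.castSucc))
    rwa [positions_castSucc, positions_castSucc] at this
  have hL : ∀ j : Fin (m + 1), ∃ L, HasSeries (atPoint (T.chart j.succ) (positions x j)) L :=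
    fun j => exists_hasSeries_atPoint (T.superconformal j.succ) (px j ▸ T.mem_source j.succ)
      (px j ▸ T.vanish j.succ)
  choose L hL using hL
  exact ⟨⟨x, hu, hd, Fin.cons K L, Fin.cases hK.converges fun j => (hL j).converges, kp, km⟩,
    hasData_iff.2 ⟨p0, px, s0, sx, hK, hL⟩⟩

theorem exists_hasOneTubeData {T : Tubed 0} (hT : IsCanonical T) :
    ∃ d : OneTubeData, HasOneTubeData T d := by
  obtain ⟨p0, s0, K, hK, kp, km, k1, k2, k3⟩ := isCanonical_zero_iff.1 hT
  exact ⟨⟨K, hK.converges, kp, km, k1, k2, k3⟩, hasOneTubeData_iff.2 ⟨p0, s0, hK⟩⟩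

theorem not_sameBody_north_fin (p : Pt) : ¬ SameBody (north.symm 0) (Sphere.fin p) := fun h =>
  fin_not_inseparable body_zero (sameBody_iff.1 h).symm

/-- The inverse function theorem turns the given power series into charts on discs. -/
theorem exists_tubed_hasData {m : ℕ} (d : ModuliData m) : ∃ T : Tubed (m + 1), HasData T d := by
  obtain ⟨Ω₀, h0, hs0, z0, r0, hr0, s0⟩ := exists_chart_infinity (d.converges 0)
  choose Ω h hs z r hr s using fun j : Fin (m + 1) =>
    exists_chart_at (d.converges j.succ) (positions d.x j)
  have hpos : ∀ j k : Fin (m + 1), j ≠ k → (positions d.x j).body ≠ (positions d.x k).body := by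
    intro j k
    have hu := fun j => (isUnit_iff_body (d.x j).z_even).1 (d.unit j)
    induction j using Fin.lastCases with
    | last =>
      induction k using Fin.lastCases with
      | last => exact fun h => absurd rfl h
      | cast k =>
        rw [positions_last, positions_castSucc, body_zero]
        exact fun _ => (hu k).symm
    | cast j =>
      induction k using Fin.lastCases with
      | last =>
        rw [positions_last, positions_castSucc, body_zero]
        exact fun _ => hu j
      | cast k =>
        rw [positions_castSucc, positions_castSucc]
        exact fun h => d.distinct j k fun e => h (congrArg _ e)
  let T : Tubed (m + 1) :=
    { pt := Fin.cons (north.symm 0) fun j => Sphere.fin (positions d.x j)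
      distinct := Fin.cases (Fin.cases (fun h => absurd rfl h) fun k _ => not_sameBody_north_fin _)
        fun j => Fin.cases (fun _ e => not_sameBody_north_fin _
          (sameBody_iff.2 (sameBody_iff.1 e).symm)) fun k hjk e => hpos j k
            (fun h => hjk (congrArg _ h)) (body_eq_of_inseparable (sameBody_iff.1 e)
              (south_mem_source _) (south_mem_source _))
      chart := Fin.cons Ω₀ Ω
      superconformal := Fin.cases h0 h
      mem_source := Fin.cases
        (by change _ ∈ Ω₀.source; rw [s0]; exact Set.mem_image_of_mem _ (mem_ball_self 0 hr0))
        fun j => by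
          change _ ∈ (Ω j).source
          rw [s]; exact Set.mem_image_of_mem south.symm (mem_ball_self _ (hr j))
      vanish := Fin.cases z0 z }
  exact ⟨T, hasData_iff.2 ⟨rfl, fun _ => rfl, ⟨r0, hr0, s0⟩, fun j => ⟨r j, hr j, s j⟩, hs0, hs⟩⟩

theorem exists_tubed_hasOneTubeData (d : OneTubeData) : ∃ T : Tubed 0, HasOneTubeData T d := by
  obtain ⟨Ω, h, hs, z, r, hr, s⟩ := exists_chart_infinity d.converges
  let T : Tubed 0 :=
    { pt := fun _ => north.symm 0
      distinct := fun j k hjk => absurd (Subsingleton.elim (α := Fin 1) j k) hjk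
      chart := fun _ => Ω
      superconformal := fun _ => h
      mem_source := fun _ => by rw [s]; exact Set.mem_image_of_mem _ (mem_ball_self 0 hr)
      vanish := fun _ => z }
  exact ⟨T, hasOneTubeData_iff.2 ⟨rfl, ⟨r, hr, s⟩, hs⟩⟩

/-- The data determine a canonical supersphere up to the radii of the discs, and conversely. -/
theorem sameGerms_iff_data {m : ℕ} {T T' : Tubed (m + 1)} {d d' : ModuliData m} (h : HasData T d)
    (h' : HasData T' d') : SameGerms T T' ↔ d = d' := by
  obtain ⟨p0, px, -, -, s0, sx⟩ := hasData_iff.1 h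
  obtain ⟨p0', px', -, -, s0', sx'⟩ := hasData_iff.1 h'
  rw [sameGerms_iff]
  constructor
  · intro hg
    have hx : d.x = d'.x := funext fun j => by
      have := (hg j.castSucc.succ).1
      rw [px, px'] at this
      have := Sphere.fin.inj this
      rwa [positions_castSucc, positions_castSucc] at this
    have h0 := (hg 0).2
    rw [p0] at h0
    refine ModuliData.ext hx (funext (Fin.cases ((eventually_eq_north_iff s0 s0').1 h0) fun j => ?_))
    have hj := (hg j.succ).2
    rw [px] at hj
    exact (eventually_eq_fin_iff (sx j) (hx ▸ sx' j)).1 hj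
  · rintro rfl
    refine Fin.cases ⟨p0.trans p0'.symm, ?_⟩ fun j => ⟨(px j).trans (px' j).symm, ?_⟩
    · rw [p0]
      exact (eventually_eq_north_iff s0 s0').2 rfl
    · rw [px]
      exact (eventually_eq_fin_iff (sx j) (sx' j)).2 rfl

theorem sameGerms_iff_oneTubeData {T T' : Tubed 0} {d d' : OneTubeData} (h : HasOneTubeData T d)
    (h' : HasOneTubeData T' d') : SameGerms T T' ↔ d = d' := by
  obtain ⟨p0, -, s0⟩ := hasOneTubeData_iff.1 h
  obtain ⟨p0', -, s0'⟩ := hasOneTubeData_iff.1 h'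
  rw [sameGerms_iff, OneTubeData.ext_iff, ← eventually_eq_north_iff s0 s0']
  constructor
  · intro hg
    have h0 := (hg 0).2
    rwa [p0] at h0
  · intro e
    exact Fin.cases ⟨p0.trans p0'.symm, by rwa [p0]⟩ fun j => j.elim0

theorem toModuli_eq_iff {n : ℕ} {T T' : Tubed n} :
    T.toModuli = T'.toModuli ↔ SuperconformallyEquivalent n T T' :=
  (superconformallyEquivalent_equivalence n).quot_mk_eq_iff T T'

/-- The correspondence between canonical superspheres and points of the moduli space. -/
theorem exists_canonical_equiv (n : ℕ) : ∃ Ψ : CanonicalSphere n ≃ Moduli n,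
    ∀ T : {T : Tubed n // IsCanonical T},
      Ψ (Quotient.mk (canonicalSetoid n) T) = T.1.toModuli := by
  let ψ : CanonicalSphere n → Moduli n := Quotient.lift (fun T => T.1.toModuli)
    fun _ _ h => toModuli_eq_iff.2 (SameGerms.superconformallyEquivalent h)
  refine ⟨Equiv.ofBijective ψ ⟨?_, ?_⟩, fun _ => rfl⟩
  · rintro ⟨T⟩ ⟨T'⟩ h
    exact Quotient.sound (s := canonicalSetoid n)
      (sameGerms_of_equivalent T.2 T'.2 (toModuli_eq_iff.1 h))
  · rintro ⟨T⟩
    obtain ⟨T', h, h'⟩ := exists_canonical T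
    exact ⟨Quotient.mk (canonicalSetoid n) ⟨T', h⟩, (toModuli_eq_iff.2 h').symm⟩

/-- Data that classify canonical superspheres up to germs parametrize the moduli space. -/
theorem exists_data_equiv {n : ℕ} {D : Type} {R : Tubed n → D → Prop}
    (hc : ∀ {T d}, R T d → IsCanonical T) (hex : ∀ {T}, IsCanonical T → ∃ d, R T d)
    (hreal : ∀ d, ∃ T, R T d) (hs : ∀ {T T' d d'}, R T d → R T' d' → (SameGerms T T' ↔ d = d')) :
    (∀ T, IsCanonical T → ∃! d, R T d) ∧ (∀ d, ∃ T, R T d) ∧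
      ∃ Φ : D ≃ Moduli n, ∀ d T, R T d → Φ d = T.toModuli := by
  refine ⟨fun T hT => ?_, hreal, ?_⟩
  · obtain ⟨d, hd⟩ := hex hT
    exact ⟨d, hd, fun d' hd' => (hs hd' hd).1 ((sameGerms_equivalence n).refl T)⟩
  · choose S hS using hreal
    have key : ∀ d T, R T d → (S d).toModuli = T.toModuli := fun d T h =>
      toModuli_eq_iff.2 ((hs (hS d) h).2 rfl).superconformallyEquivalent
    refine ⟨Equiv.ofBijective (fun d => (S d).toModuli) ⟨fun d d' h => ?_, ?_⟩, key⟩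
    · exact (hs (hS d) (hS d')).1
        (sameGerms_of_equivalent (hc (hS d)) (hc (hS d')) (toModuli_eq_iff.1 h))
    · rintro ⟨T⟩
      obtain ⟨T', h, h'⟩ := exists_canonical T
      obtain ⟨d, hd⟩ := hex h
      exact ⟨d, (key d T' hd).trans (toModuli_eq_iff.2 h').symm⟩

end

end NTwo

theorem theorem5p7 :
    -- superconformal equivalence is an equivalence relation
    (∀ n : ℕ, Equivalence (NTwo.SuperconformallyEquivalent n)) ∧
    -- canonical superspheres with tubes correspond to the points of the moduli space
    (∀ n : ℕ, ∃ Ψ : NTwo.CanonicalSphere n ≃ NTwo.Moduli n,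
      ∀ T : {T : NTwo.Tubed n // NTwo.IsCanonical T},
        Ψ (Quotient.mk (NTwo.canonicalSetoid n) T) = T.1.toModuli) ∧
    -- the moduli space with `1 + (m + 1)` tubes
    (∀ m : ℕ,
      (∀ T : NTwo.Tubed (m + 1), NTwo.IsCanonical T →
        ∃! d : NTwo.ModuliData m, NTwo.HasData T d) ∧
      (∀ d : NTwo.ModuliData m, ∃ T : NTwo.Tubed (m + 1), NTwo.HasData T d) ∧
      ∃ Φ : NTwo.ModuliData m ≃ NTwo.Moduli (m + 1),
        ∀ (d : NTwo.ModuliData m) (T : NTwo.Tubed (m + 1)),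
          NTwo.HasData T d → Φ d = T.toModuli) ∧
    -- the moduli space with one tube
    ((∀ T : NTwo.Tubed 0, NTwo.IsCanonical T →
        ∃! d : NTwo.OneTubeData, NTwo.HasOneTubeData T d) ∧
      (∀ d : NTwo.OneTubeData, ∃ T : NTwo.Tubed 0, NTwo.HasOneTubeData T d) ∧
      ∃ Φ : NTwo.OneTubeData ≃ NTwo.Moduli 0,
        ∀ (d : NTwo.OneTubeData) (T : NTwo.Tubed 0),
          NTwo.HasOneTubeData T d → Φ d = T.toModuli) :=
  ⟨NTwo.superconformallyEquivalent_equivalence, NTwo.exists_canonical_equiv,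
    fun _ => NTwo.exists_data_equiv (R := NTwo.HasData) (fun h => h.1) NTwo.exists_hasData
      NTwo.exists_tubed_hasData NTwo.sameGerms_iff_data,
    NTwo.exists_data_equiv (R := NTwo.HasOneTubeData) (fun h => h.1) NTwo.exists_hasOneTubeData
      NTwo.exists_tubed_hasOneTubeData NTwo.sameGerms_iff_oneTubeData⟩
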